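/- **Setting.** Let $D\ge 3$, let $U\subseteq\mathbb R^D$ be open (a coordinate domain of a $D$-dimensional manifold) and let $g_{ab}=g_{ba}$ (smooth functions, $\det(g_{ab})\neq0$, any signature, in particular Lorentzian), $\vartheta^a$ (smooth, pointwise linearly independent 1-forms) and $\Gamma_a{}^b$ (smooth 1-forms) be an anholonomic metric, a coframe and connection 1-forms on $U$, $a,b=1,\dots,D$. Let $e_a$ be the dual frame, $e_a\rfloor$ the interior product, indices raised and lowered with $g$, $\vartheta_{ab\dots}=\vartheta_a\wedge\vartheta_b\wedge\cdots$, $\mathbf{vol}_g=\sqrt{|\det g_{ab}|}\,\vartheta^1\wedge\dots\wedge\vartheta^D$, $s=\operatorname{sgn}\det(g_{ab})$, and $\star$ the Hodge dual, $\star(\alpha\wedge\vartheta_a)=e_a\rfloor\star\alpha$, $\star1=\mathbf{vol}_g$. Let $\mathrm D$ be the exterior covariant derivative, $\mathrm D\alpha^a{}_b=d\alpha^a{}_b+\Gamma_c{}^a\wedge\alpha^c{}_b-\Gamma_b{}^c\wedge\alpha^a{}_c$, and $$T^a=\mathrm D\vartheta^a,\qquad Q_{ab}=-\mathrm Dg_{ab},\qquad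 R_a{}^b=d\Gamma_a{}^b+\Gamma_c{}^b\wedge\Gamma_a{}^c .$$ *Irreducible parts of torsion and nonmetricity.* $T=e_a\rfloor T^a$, ${}^{(2)}T^a=\frac1{D-1}\vartheta^a\wedge T$, ${}^{(3)}T^a=\frac13e^a\rfloor(T^b\wedge\vartheta_b)$, ${}^{(1)}T^a=T^a-{}^{(2)}T^a-{}^{(3)}T^a$. With $Q=\frac1DQ_c{}^c$, $\Lambda=\vartheta^a\,e^b\rfloor(Q_{ab}-g_{ab}Q)$ and $\overline\Lambda_a=\star[(Q_{ac}-g_{ac}Q)\wedge\vartheta^c-\frac1{D-1}\vartheta_a\wedge\Lambda]$: ${}^{(4)}Q_{ab}=g_{ab}Q$, ${}^{(3)}Q_{ab}=\frac{2D}{(D-1)(D+2)}(\vartheta_{(a}e_{b)}\rfloor\Lambda-\frac1Dg_{ab}\Lambda)$, ${}^{(2)}Q_{ab}=-\frac23s\star(\overline\Lambda_{(a}\wedge\vartheta_{b)})$, ${}^{(1)}Q_{ab}=Q_{ab}-\sum_{I=2}^4{}^{(I)}Q_{ab}$. *Irreducible parts of the curvature.* $W_{ab}=R_{[ab]}$,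 $Z_{ab}=R_{(ab)}$; $X^a=e_b\rfloor W^{ab}$, $X=e_a\rfloor X^a$, $\overline X{}^a=\star(W^{ba}\wedge\vartheta_b)$, $\overline X=e_a\rfloor\overline X{}^a$, $\Psi_a=X_a-\frac1DX\vartheta_a-\frac12e_a\rfloor(\vartheta^b\wedge X_b)$, $\overline\Psi_a=\overline X_a-\frac14\vartheta_a\wedge\overline X-\frac1{D-2}e_a\rfloor(\vartheta^b\wedge\overline X_b)$; ${}^{(2)}W_{ab}=s\star(\vartheta_{[a}\wedge\overline\Psi_{b]})$, ${}^{(3)}W_{ab}=\frac s{12}\star(\overline X\wedge\vartheta_{ab})$, ${}^{(4)}W_{ab}=-\frac2{D-2}\vartheta_{[a}\wedge\Psi_{b]}$, ${}^{(5)}W_{ab}=-\frac1{D-2}\vartheta_{[a}\wedge e_{b]}\rfloor(\vartheta^c\wedge X_c)$, ${}^{(6)}W_{ab}=-\frac1{D(D-1)}X\vartheta_{ab}$, ${}^{(1)}W_{ab}=W_{ab}-\sum_{I=2}^6{}^{(I)}W_{ab}$. Further ${}^{(5)}Z_{ab}=\frac1Dg_{ab}Z_c{}^c$, $Y_a=e^b\rfloor(Z_{ab}-{}^{(5)}Z_{ab})$,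 $\overline Y_a=\star[(Z_{ba}-{}^{(5)}Z_{ba})\wedge\vartheta^b]$, $\Phi_a=Y_a-\frac12e_a\rfloor(\vartheta^b\wedge Y_b)$, $\overline\Phi_a=\overline Y_a-\frac1{D-2}e_a\rfloor(\vartheta^b\wedge\overline Y_b)$; ${}^{(2)}Z_{ab}=\frac s2\star(\vartheta_{(a}\wedge\overline\Phi_{b)})$, ${}^{(3)}Z_{ab}=\frac1{D^2-4}[D\,\vartheta_{(a}\wedge e_{b)}\rfloor(\vartheta^c\wedge Y_c)-2g_{ab}\,\vartheta^c\wedge Y_c]$, ${}^{(4)}Z_{ab}=\frac2D\vartheta_{(a}\wedge\Phi_{b)}$, ${}^{(1)}Z_{ab}=Z_{ab}-\sum_{I=2}^5{}^{(I)}Z_{ab}$. Finally $P=\vartheta^b\wedge(e^a\rfloor R_{ab})$. (Forms of negative degree are $0$.) *Lagrangian.* Let $\kappa,\rho\ne0$ and $\lambda,a_0,\dots,a_3,b_1,\dots,b_5,c_1,c_2,c_3,w_1,\dots,w_6,z_1,\dots,z_5,v_1,\dots,v_5$ be real constants and $L_{\rm MAG}=L_{\rm w}+L_{\rm s}$ with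 $$L_{\rm w}=-\tfrac1{2\kappa}\Big[2\lambda\,\mathbf{vol}_g-a_0R^{ab}\wedge\star\vartheta_{ab}+T^a\wedge\star\sum_{I=1}^3a_I{}^{(I)}T_a+Q_{ab}\wedge\star\sum_{I=1}^4b_I{}^{(I)}Q^{ab}+2b_5({}^{(3)}Q_{ac}\wedge\vartheta^a)\wedge\star({}^{(4)}Q^{bc}\wedge\vartheta_b)-2\sum_{I=1}^3c_I{}^{(I+1)}Q_{ab}\wedge\vartheta^a\wedge\star T^b\Big],$$ $$L_{\rm s}=-\tfrac1{2\rho}R_{ab}\wedge\star\Big[\sum_{I=1}^6w_I{}^{(I)}W^{ab}+v_1\vartheta^a\wedge(e_c\rfloor{}^{(5)}W^{cb})+\sum_{I=1}^5z_I{}^{(I)}Z^{ab}+v_2\vartheta_c\wedge(e^a\rfloor{}^{(2)}Z^{cb})+\sum_{I=3}^5v_I\vartheta^a\wedge(e_c\rfloor{}^{(I)}Z^{cb})\Big],$$ and define $L_{(2)}$ by $L_{\rm MAG}=\frac1{2\kappa}[a_0R^{ab}\wedge\star\vartheta_{ab}-2\lambda\mathbf{vol}_g]+\frac1\kappa L_{(2)}$.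 Let $S_{\rm matt}$ be an arbitrary matter action depending on $g,\vartheta,\Gamma$ and matter fields $\Psi$, and $S=\int L_{\rm MAG}+S_{\rm matt}$. *Variations.* $\delta S/\delta\vartheta^a$ and $\delta S/\delta\Gamma_a{}^b$ are the continuous $(D-1)$-forms with $\delta S=\int\delta\vartheta^a\wedge\frac{\delta S}{\delta\vartheta^a}$, resp. $\delta S=\int\delta\Gamma_a{}^b\wedge\frac{\delta S}{\delta\Gamma_a{}^b}$, for all smooth compactly supported variations of $\vartheta$, resp. $\Gamma$, the other fields being fixed (the actions being evaluated on compact sets that contain the support of the variation). For the matter currents $\Sigma_a=\delta S_{\rm matt}/\delta\vartheta^a$ and $\Delta^a{}_b=\delta S_{\rm matt}/\delta\Gamma_a{}^b$, existence is assumed. *Momenta.* Put $$m^{ab}=\star\Big\{\sum_{I=1}^4b_I{}^{(I)}Q^{ab}-b_5\big[\vartheta^{(a}(e^{b)}\rfloor Q)+\tfrac1Dg^{ab}(\Lambda-Q)\big]+c_1e^{(a}\rfloor T^{b)}-\tfrac{Dc_1-c_2-(D-1)c_3}{D(D-1)}g^{ab}T+\tfrac{c_1-c_2}{D-1}\vartheta^{(a}(e^{b)}\rfloor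 T)\Big\},$$ $$h_a=\star\Big\{\sum_{I=1}^3a_I{}^{(I)}T_a+\vartheta^b\wedge\sum_{I=2}^4c_{I-1}{}^{(I)}Q_{ab}\Big\},$$ $$\begin{aligned}h_{ab}=\star\Big\{&\sum_{I=1}^6w_I{}^{(I)}W_{ab}+\sum_{I=1}^5z_I{}^{(I)}Z_{ab}+\tfrac{v_1}2\big[\vartheta_a\wedge(e_c\rfloor{}^{(5)}W^c{}_b)+\tfrac12\vartheta_{[a}\wedge e_{b]}\rfloor P\big]\\&+\tfrac{v_2}2\big[\vartheta_c\wedge(e_{(a}\rfloor{}^{(2)}W^c{}_{b)})+\vartheta_c\wedge(e_{[a}\rfloor{}^{(2)}Z^c{}_{b]})-2\,{}^{(2)}Z_{ab}\big]\\&+\tfrac{v_3}2\big[\vartheta_a\wedge(e_c\rfloor{}^{(3)}Z^c{}_b)+\tfrac12\vartheta_{(a}\wedge(e_{b)}\rfloor P)-\tfrac1Dg_{ab}P\big]\\&+\tfrac{v_4}2\big[\vartheta_{[a}\wedge(e_{|c|}\rfloor{}^{(4)}Z^c{}_{b]})+\vartheta_{(a}\wedge(e_{|c|}\rfloor{}^{(4)}W^c{}_{b)})+D\,{}^{(4)}Z_{ab}\big]\\&+\tfrac{v_5}2\big[\vartheta_a\wedge(e_c\rfloor{}^{(5)}Z^c{}_b)+\tfrac1Dg_{ab}P\big]\Big\}.\end{aligned}$$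 **Theorem.** (i) The gravitational momenta $M^{ab}=-2\,\partial L_{\rm MAG}/\partial Q_{ab}$, $H_a=-\partial L_{\rm MAG}/\partial T^a$, $H^a{}_b=-\partial L_{\rm MAG}/\partial R_a{}^b$ (partial derivatives of $L_{\rm MAG}(g,\vartheta,Q,T,R)$, the variation standing on the left) are $$M^{ab}=\tfrac2\kappa m^{ab},\qquad H_a=\tfrac1\kappa h_a,\qquad H^a{}_b=-\tfrac1{2\kappa}a_0\star\vartheta^a{}_b+\tfrac1\rho h^a{}_b .$$ (ii) The variations of $S$ with respect to the coframe and the connection exist, are unique, and are given by $$\kappa\frac{\delta S}{\delta\vartheta^a}=\frac{a_0}2R^{bc}\wedge\star\vartheta_{bca}-\lambda\star\vartheta_a+q_a-\mathrm Dh_a+\kappa\Sigma_a,$$ $$\kappa\frac{\delta S}{\delta\Gamma_a{}^b}=\frac{a_0}2\Big(T^c\wedge\star\vartheta^a{}_{bc}+Q^{ac}\wedge\star\vartheta_{cb}-\tfrac12Q_c{}^c\wedge\star\vartheta^a{}_b\Big)-\vartheta^a\wedge h_b-2m^a{}_b-\frac\kappa\rho\mathrm Dh^a{}_b+\kappa\Delta^a{}_b,$$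 where $q_a$ is the $(D-1)$-form $$q_a=e_a\rfloor L_{(2)}+(e_a\rfloor T^b)\wedge h_b+(e_a\rfloor Q_{bc})\,m^{bc}+\frac\kappa\rho(e_a\rfloor R_b{}^c)\wedge h^b{}_c .$$ -/

import Mathlib

noncomputable section

namespace MAG

/-! ### Exterior algebra of the coordinate space `ℝ^D` -/

/-- Points of the coordinate domain, with coordinates `x^μ`. -/
abbrev Pt (D : ℕ) := Fin D → ℝ

/-- Covectors: `ω` stands for `∑ μ, ω μ dx^μ`. -/
abbrev Cov (D : ℕ) := Fin D → ℝ

/-- Exterior forms at a point, of all degrees at once; the product `*` is the exterior product.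
Forms of "negative degree" and of degree larger than `D` are zero, as they have to be. -/
abbrev Form (D : ℕ) := ExteriorAlgebra ℝ (Cov D)

variable {D : ℕ}

/-- A covector seen as a 1-form. -/
def form1 (ω : Cov D) : Form D := ExteriorAlgebra.ι ℝ ω

/-- A real number seen as a 0-form. -/
def form0 (r : ℝ) : Form D := algebraMap ℝ (Form D) r

/-- `α` is a `p`-form. -/
def IsForm (p : ℕ) (α : Form D) : Prop := α ∈ ExteriorAlgebra.exteriorPower ℝ p (Cov D)

/-- The basis `dx^{μ₁} ∧ ⋯ ∧ dx^{μ_p}`, `μ₁ < ⋯ < μ_p`, of the exterior algebra, indexed by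
the sets `{μ₁, …, μ_p}`. -/
def dxBasis : Module.Basis (Finset (Fin D)) ℝ (Form D) :=
  (Pi.basisFun ℝ (Fin D)).ExteriorAlgebra

/-- The coefficient of `α` in the coordinate basis. -/
def coeff (I : Finset (Fin D)) (α : Form D) : ℝ := dxBasis.repr α I

/-- The coefficient `f` of the top-degree part `f dx^1 ∧ ⋯ ∧ dx^D`. -/
def top (α : Form D) : ℝ := coeff Finset.univ α

/-- A vector `v = ∑ μ, v μ ∂_μ` as a linear form on covectors. -/
def vec (v : Fin D → ℝ) : Module.Dual ℝ (Cov D) := ∑ μ, v μ • LinearMap.proj μ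

/-- The interior product of a form with a vector. -/
def interior (v : Module.Dual ℝ (Cov D)) (α : Form D) : Form D :=
  CliffordAlgebra.contractLeft v α

/-! ### Fields of forms -/

/-- A field of forms is continuous on `U`. -/
def ContForm (U : Set (Pt D)) (α : Pt D → Form D) : Prop :=
  ∀ I, ContinuousOn (fun x => coeff I (α x)) U

/-- The coefficientwise partial derivative `∂_μ α`. -/
def pderiv (μ : Fin D) (α : Pt D → Form D) (x : Pt D) : Form D :=
  ∑ I, (fderiv ℝ (fun y => coeff I (α y)) x (Pi.single μ 1)) • dxBasis I

/-- The exterior derivative `dα = ∑ μ, dx^μ ∧ ∂_μ α`. -/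
def extd (α : Pt D → Form D) (x : Pt D) : Form D :=
  ∑ μ, form1 (Pi.single μ 1) * pderiv μ α x

/-- The integral over `K` of (the top-degree part of) a field of forms. -/
def integral (K : Set (Pt D)) (α : Pt D → Form D) : ℝ := ∫ x in K, top (α x)

/-! ### Algebra with a metric and a coframe, at one point -/

/-- The values at one point of the anholonomic metric `g_{ab}` and of the coframe
`ϑ^a = ∑ μ, θ a μ dx^μ`. -/
structure Frame (D : ℕ) where
  g : Matrix (Fin D) (Fin D) ℝ
  θ : Matrix (Fin D) (Fin D) ℝ

namespace Frame

variable (F : Frame D)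

/-- The inverse metric `g^{ab}`. -/
def gi : Matrix (Fin D) (Fin D) ℝ := F.g⁻¹

/-- The sign of the determinant of the metric. -/
def sgn : ℝ := SignType.sign F.g.det

/-- The coframe `ϑ^a`. -/
def cof (a : Fin D) : Form D := form1 (F.θ a)

/-- `ϑ_a = g_{ab} ϑ^b`. -/
def cofL (a : Fin D) : Form D := ∑ b, F.g a b • F.cof b

/-- The frame `e_a` dual to the coframe: `ϑ^b(e_a) = δ^b_a`. -/
def e (a : Fin D) : Module.Dual ℝ (Cov D) := vec (fun μ => F.θ⁻¹ μ a)

/-- The interior product `e_a ⌟ α`. -/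
def ip (a : Fin D) (α : Form D) : Form D := interior (F.e a) α

/-- The interior product `e^a ⌟ α`, where `e^a = g^{ab} e_b`. -/
def ipU (a : Fin D) (α : Form D) : Form D := ∑ b, F.gi a b • F.ip b α

/-- The metric volume form `√|det g_{ab}| ϑ^1 ∧ ⋯ ∧ ϑ^D`. -/
def vol : Form D := √|F.g.det| • (List.ofFn fun a => F.cof a).prod

/-- The vector metrically equivalent to a covector: `ω^♯ = g^{ab} ω(e_a) e_b`. -/
def sharp : Cov D →ₗ[ℝ] Module.Dual ℝ (Cov D) :=
  ∑ a, ∑ b, F.gi a b • (F.e a).smulRight (F.e b)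

/-- The algebra homomorphism `ω₁ ∧ ⋯ ∧ ω_p ↦ (ω₁^♯ ⌟) ∘ ⋯ ∘ (ω_p^♯ ⌟)`. -/
def contraction : Form D →ₐ[ℝ] Module.End ℝ (Form D) :=
  ExteriorAlgebra.lift ℝ ⟨CliffordAlgebra.contractLeft ∘ₗ F.sharp, fun m =>
    LinearMap.ext fun x => CliffordAlgebra.contractLeft_contractLeft (F.sharp m) x⟩

/-- The Hodge dual. It is the linear map with
`⋆(ω₁ ∧ ⋯ ∧ ω_p) = ω_p^♯ ⌟ (⋯ ⌟ (ω₁^♯ ⌟ vol))`, i.e. in components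
`⋆α = 1/(p!(D-p)!) α^{a₁…a_p} ℰ_{a₁…a_D} ϑ^{a_{p+1}} ∧ ⋯ ∧ ϑ^{a_D}`. -/
def star (α : Form D) : Form D := F.contraction (CliffordAlgebra.reverse α) F.vol

theorem star_one : F.star 1 = F.vol := by
  simp [star]

theorem star_mul_form1 (α : Form D) (ω : Cov D) :
    F.star (α * form1 ω) = interior (F.sharp ω) (F.star α) := by
  have h : F.contraction (ExteriorAlgebra.ι ℝ ω) = CliffordAlgebra.contractLeft (F.sharp ω) := by
    simp [contraction]
  have h' : CliffordAlgebra.reverse (α * ExteriorAlgebra.ι ℝ ω)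
      = ExteriorAlgebra.ι ℝ ω * CliffordAlgebra.reverse α := by
    simp [ExteriorAlgebra.ι, CliffordAlgebra.reverse.map_mul]
  simp only [star, form1, interior, h', map_mul, h, Module.End.mul_apply]

/-- Lowering the index of `A^a`. -/
def low1 (A : Fin D → Form D) (a : Fin D) : Form D := ∑ b, F.g a b • A b

/-- Raising the first index of `A_{ab}`: the result is `A^a{}_b`. -/
def up1 (A : Fin D → Fin D → Form D) (a b : Fin D) : Form D := ∑ c, F.gi a c • A c b

/-- Raising both indices of `A_{ab}`. -/
def up2 (A : Fin D → Fin D → Form D) (a b : Fin D) : Form D :=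
  ∑ c, ∑ d, (F.gi a c * F.gi b d) • A c d

/-- Lowering the second index: from `A_a{}^b` to `A_{ab}`, or from `A^{ab}` to `A^a{}_b`. -/
def low2 (A : Fin D → Fin D → Form D) (a b : Fin D) : Form D := ∑ c, F.g c b • A a c

/-- The trace `A_c{}^c` of `A_{ab}`. -/
def trace (A : Fin D → Fin D → Form D) : Form D := ∑ a, ∑ b, F.gi a b • A a b

end Frame

/-- `A_{(ab)}` -/
def symm (A : Fin D → Fin D → Form D) (a b : Fin D) : Form D := (1 / 2 : ℝ) • (A a b + A b a)

/-- `A_{[ab]}` -/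
def asymm (A : Fin D → Fin D → Form D) (a b : Fin D) : Form D := (1 / 2 : ℝ) • (A a b - A b a)

/-- The values at one point of the metric, the coframe, the nonmetricity 1-forms `Q_{ab}`, the
torsion 2-forms `T^a` and the curvature 2-forms `R_a{}^b` (here `R a b`): the arguments of a
gravitational Lagrangian. -/
structure Geom (D : ℕ) extends Frame D where
  Q : Fin D → Fin D → Form D
  T : Fin D → Form D
  R : Fin D → Fin D → Form D

namespace Geom

variable (G : Geom D)

/-! #### Torsion -/

/-- The trace 1-form `T = e_a ⌟ T^a`. -/
def trT : Form D := ∑ a, G.ip a (G.T a)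

def T2 (a : Fin D) : Form D := (1 / ((D : ℝ) - 1)) • (G.cof a * G.trT)

def T3 (a : Fin D) : Form D := (1 / 3 : ℝ) • G.ipU a (∑ b, G.T b * G.cofL b)

def T1 (a : Fin D) : Form D := G.T a - G.T2 a - G.T3 a

/-! #### Nonmetricity -/

/-- `Q = (1/D) Q_c{}^c`. -/
def trQ : Form D := (1 / (D : ℝ)) • G.trace G.Q

/-- `Q_{ab} - g_{ab} Q`. -/
def Qfree (a b : Fin D) : Form D := G.Q a b - G.g a b • G.trQ

/-- `Λ = ϑ^a e^b ⌟ (Q_{ab} - g_{ab} Q)`. -/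
def Lam : Form D := ∑ a, ∑ b, G.cof a * G.ipU b (G.Qfree a b)

/-- The `(D-2)`-form `Λ̄_a`. -/
def Lambar (a : Fin D) : Form D :=
  G.star ((∑ c, G.Qfree a c * G.cof c) - (1 / ((D : ℝ) - 1)) • (G.cofL a * G.Lam))

def Q4 (a b : Fin D) : Form D := G.g a b • G.trQ

def Q3 (a b : Fin D) : Form D :=
  (2 * (D : ℝ) / (((D : ℝ) - 1) * ((D : ℝ) + 2))) •
    (symm (fun a b => G.cofL a * G.ip b G.Lam) a b - (1 / (D : ℝ)) • G.g a b • G.Lam)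

def Q2 (a b : Fin D) : Form D :=
  (-(2 / 3) * G.sgn) • G.star (symm (fun a b => G.Lambar a * G.cofL b) a b)

def Q1 (a b : Fin D) : Form D := G.Q a b - G.Q2 a b - G.Q3 a b - G.Q4 a b

/-! #### Curvature -/

/-- `R_{ab} = R_a{}^c g_{cb}`. -/
def Rlow : Fin D → Fin D → Form D := G.low2 G.R

/-- `W_{ab} = R_{[ab]}`. -/
def W : Fin D → Fin D → Form D := asymm G.Rlow

/-- `Z_{ab} = R_{(ab)}`. -/
def Z : Fin D → Fin D → Form D := symm G.Rlow

/-- `X^a = e_b ⌟ W^{ab}`. -/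
def XU (a : Fin D) : Form D := ∑ b, G.ip b (G.up2 G.W a b)

/-- `X_a`. -/
def XL : Fin D → Form D := G.low1 G.XU

/-- `X = e_a ⌟ X^a`. -/
def X : Form D := ∑ a, G.ip a (G.XU a)

/-- `X̄^a = ⋆(W^{ba} ∧ ϑ_b)`. -/
def XbarU (a : Fin D) : Form D := G.star (∑ b, G.up2 G.W b a * G.cofL b)

/-- `X̄_a`. -/
def XbarL : Fin D → Form D := G.low1 G.XbarU

/-- `X̄ = e_a ⌟ X̄^a`. -/
def Xbar : Form D := ∑ a, G.ip a (G.XbarU a)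

/-- `Ψ_a`. -/
def Psi (a : Fin D) : Form D :=
  G.XL a - (1 / (D : ℝ)) • (G.X * G.cofL a)
    - (1 / 2 : ℝ) • G.ip a (∑ b, G.cof b * G.XL b)

/-- `Ψ̄_a`. -/
def Psibar (a : Fin D) : Form D :=
  G.XbarL a - (1 / 4 : ℝ) • (G.cofL a * G.Xbar)
    - (1 / ((D : ℝ) - 2)) • G.ip a (∑ b, G.cof b * G.XbarL b)

def W2 (a b : Fin D) : Form D :=
  G.sgn • G.star (asymm (fun a b => G.cofL a * G.Psibar b) a b)

def W3 (a b : Fin D) : Form D :=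
  (G.sgn * (1 / 12)) • G.star (G.Xbar * (G.cofL a * G.cofL b))

def W4 (a b : Fin D) : Form D :=
  (-(2 / ((D : ℝ) - 2))) • asymm (fun a b => G.cofL a * G.Psi b) a b

def W5 (a b : Fin D) : Form D :=
  (-(1 / ((D : ℝ) - 2))) •
    asymm (fun a b => G.cofL a * G.ip b (∑ c, G.cof c * G.XL c)) a b

def W6 (a b : Fin D) : Form D :=
  (-(1 / ((D : ℝ) * ((D : ℝ) - 1)))) • (G.X * (G.cofL a * G.cofL b))

def W1 (a b : Fin D) : Form D :=
  G.W a b - (G.W2 a b + G.W3 a b + G.W4 a b + G.W5 a b + G.W6 a b)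

def Z5 (a b : Fin D) : Form D := (1 / (D : ℝ)) • G.g a b • G.trace G.Z

/-- `Y_a = e^b ⌟ (Z_{ab} - Z5_{ab})`. -/
def Y (a : Fin D) : Form D := ∑ b, G.ipU b (G.Z a b - G.Z5 a b)

/-- `Ȳ_a = ⋆((Z_{ba} - Z5_{ba}) ∧ ϑ^b)`. -/
def Ybar (a : Fin D) : Form D := G.star (∑ b, (G.Z b a - G.Z5 b a) * G.cof b)

/-- `Φ_a`. -/
def Phi (a : Fin D) : Form D := G.Y a - (1 / 2 : ℝ) • G.ip a (∑ b, G.cof b * G.Y b)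

/-- `Φ̄_a`. -/
def Phibar (a : Fin D) : Form D :=
  G.Ybar a - (1 / ((D : ℝ) - 2)) • G.ip a (∑ b, G.cof b * G.Ybar b)

def Z2 (a b : Fin D) : Form D :=
  ((1 / 2) * G.sgn) • G.star (symm (fun a b => G.cofL a * G.Phibar b) a b)

def Z3 (a b : Fin D) : Form D :=
  (1 / ((D : ℝ) ^ 2 - 4)) •
    ((D : ℝ) • symm (fun a b => G.cofL a * G.ip b (∑ c, G.cof c * G.Y c)) a b
      - (2 : ℝ) • G.g a b • (∑ c, G.cof c * G.Y c))

def Z4 (a b : Fin D) : Form D :=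
  (2 / (D : ℝ)) • symm (fun a b => G.cofL a * G.Phi b) a b

def Z1 (a b : Fin D) : Form D :=
  G.Z a b - (G.Z2 a b + G.Z3 a b + G.Z4 a b + G.Z5 a b)

/-- `P = ϑ^b ∧ (e^a ⌟ R_{ab})`. -/
def P : Form D := ∑ a, ∑ b, G.cof b * G.ipU a (G.Rlow a b)

/-- `ϑ_a ∧ (e_c ⌟ A^c{}_b)`. -/
def thetaTrace (A : Fin D → Fin D → Form D) (a b : Fin D) : Form D :=
  G.cofL a * ∑ c, G.ipU c (A c b)

/-- `ϑ_c ∧ (e_a ⌟ A^c{}_b)`. -/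
def thetaInt (A : Fin D → Fin D → Form D) (a b : Fin D) : Form D :=
  ∑ c, G.cof c * G.ip a (A c b)

/-- `ϑ_a ∧ (e_b ⌟ P)`. -/
def thetaP (a b : Fin D) : Form D := G.cofL a * G.ip b G.P

end Geom

/-! ### The quadratic Lagrangian and its momenta -/

/-- The parameters of the Lagrangian (`lam` is the cosmological one). -/
structure Params where
  (κ ρ lam : ℝ)
  (a0 a1 a2 a3 : ℝ)
  (b1 b2 b3 b4 b5 : ℝ)
  (c1 c2 c3 : ℝ)
  (w1 w2 w3 w4 w5 w6 : ℝ)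
  (z1 z2 z3 z4 z5 : ℝ)
  (v1 v2 v3 v4 v5 : ℝ)

namespace Params

variable (p : Params) (G : Geom D)

/-- `∑ a_I T(I)^a`. -/
def sumT (a : Fin D) : Form D := p.a1 • G.T1 a + p.a2 • G.T2 a + p.a3 • G.T3 a

/-- `∑ b_I Q(I)_{ab}`. -/
def sumQ (a b : Fin D) : Form D :=
  p.b1 • G.Q1 a b + p.b2 • G.Q2 a b + p.b3 • G.Q3 a b + p.b4 • G.Q4 a b

/-- `∑ c_I Q(I+1)_{ab}`. -/
def sumC (a b : Fin D) : Form D := p.c1 • G.Q2 a b + p.c2 • G.Q3 a b + p.c3 • G.Q4 a b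

/-- `∑ w_I W(I)_{ab} + ∑ z_I Z(I)_{ab}`. -/
def sumWZ (a b : Fin D) : Form D :=
  (p.w1 • G.W1 a b + p.w2 • G.W2 a b + p.w3 • G.W3 a b + p.w4 • G.W4 a b + p.w5 • G.W5 a b
    + p.w6 • G.W6 a b)
  + (p.z1 • G.Z1 a b + p.z2 • G.Z2 a b + p.z3 • G.Z3 a b + p.z4 • G.Z4 a b + p.z5 • G.Z5 a b)

/-- The Einstein-Hilbert term `R^{ab} ∧ ⋆(ϑ_a ∧ ϑ_b)`. -/
def LEH : Form D := ∑ a, ∑ b, G.up2 G.Rlow a b * G.star (G.cofL a * G.cofL b)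

/-- The weak gravity part. -/
def Lw : Form D :=
  (-(1 / (2 * p.κ))) •
    ((2 * p.lam) • G.vol - p.a0 • LEH G
      + (∑ a, G.T a * G.star (G.low1 (p.sumT G) a))
      + (∑ a, ∑ b, G.Q a b * G.star (G.up2 (p.sumQ G) a b))
      + (2 * p.b5) •
        (∑ c, (∑ a, G.Q3 a c * G.cof a) * G.star (∑ b, G.up2 G.Q4 b c * G.cofL b))
      - (2 : ℝ) • (∑ a, ∑ b, p.sumC G a b * G.cof a * G.star (G.T b)))

/-- The bracket in the strong gravity part, with its two indices lowered. -/
def strongBracket (a b : Fin D) : Form D :=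
  p.sumWZ G a b + p.v1 • G.thetaTrace G.W5 a b + p.v2 • G.thetaInt G.Z2 a b
    + p.v3 • G.thetaTrace G.Z3 a b + p.v4 • G.thetaTrace G.Z4 a b + p.v5 • G.thetaTrace G.Z5 a b

/-- The strong gravity part. -/
def Ls : Form D :=
  (-(1 / (2 * p.ρ))) • ∑ a, ∑ b, G.Rlow a b * G.star (G.up2 (p.strongBracket G) a b)

/-- The even-parity quadratic MAG Lagrangian. -/
def LMAG : Form D := p.Lw G + p.Ls G

/-- The part `L_(2)`, given by `L_MAG = 1/(2κ) [a_0 R^{ab} ∧ ⋆ϑ_{ab} - 2λ vol] + (1/κ) L_(2)`. -/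
def L2 : Form D :=
  p.κ • (p.LMAG G - (1 / (2 * p.κ)) • (p.a0 • LEH G - (2 * p.lam) • G.vol))

/-- The momentum `m^{ab}`. -/
def m (a b : Fin D) : Form D :=
  G.star (G.up2 (p.sumQ G) a b
    - p.b5 • (symm (fun a b => G.cof a * G.ipU b G.trQ) a b
        + (1 / (D : ℝ)) • G.gi a b • (G.Lam - G.trQ))
    + p.c1 • symm (fun a b => G.ipU a (G.T b)) a b
    - (((D : ℝ) * p.c1 - p.c2 - ((D : ℝ) - 1) * p.c3) / ((D : ℝ) * ((D : ℝ) - 1))) •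
        G.gi a b • G.trT
    + ((p.c1 - p.c2) / ((D : ℝ) - 1)) • symm (fun a b => G.cof a * G.ipU b G.trT) a b)

/-- The momentum `h_a`. -/
def h1 (a : Fin D) : Form D :=
  G.star (G.low1 (p.sumT G) a + ∑ b, G.cof b * p.sumC G a b)

/-- The momentum `h_{ab}`. -/
def h2L (a b : Fin D) : Form D :=
  G.star (p.sumWZ G a b
    + (p.v1 / 2) • (G.thetaTrace G.W5 a b + (1 / 2 : ℝ) • asymm G.thetaP a b)
    + (p.v2 / 2) • (symm (G.thetaInt G.W2) a b + asymm (G.thetaInt G.Z2) a b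
        - (2 : ℝ) • G.Z2 a b)
    + (p.v3 / 2) • (G.thetaTrace G.Z3 a b + (1 / 2 : ℝ) • symm G.thetaP a b
        - (1 / (D : ℝ)) • G.g a b • G.P)
    + (p.v4 / 2) • (asymm (G.thetaTrace G.Z4) a b + symm (G.thetaTrace G.W4) a b
        + (D : ℝ) • G.Z4 a b)
    + (p.v5 / 2) • (G.thetaTrace G.Z5 a b + (1 / (D : ℝ)) • G.g a b • G.P))

/-- The momentum `h^a{}_b`. -/
def h2 : Fin D → Fin D → Form D := G.up1 (p.h2L G)

/-- The `(D-1)`-form `q_a`. -/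
def q (a : Fin D) : Form D :=
  G.ip a (p.L2 G) + (∑ b, G.ip a (G.T b) * p.h1 G b)
    + (∑ b, ∑ c, G.ip a (G.Q b c) * p.m G b c)
    + (p.κ / p.ρ) • (∑ b, ∑ c, G.ip a (G.R b c) * p.h2 G b c)

end Params

/-- `M^{ab} = -2 ∂L/∂Q_{ab}`, `H_a = -∂L/∂T^a` and `H^a{}_b = -∂L/∂R_a{}^b` at `G`, where the
partial derivatives of a top-form valued Lagrangian `L` are the forms with
`δL = δQ_{ab} ∧ ∂L/∂Q_{ab}` (with `M^{ab}` symmetric), `δL = δT^a ∧ ∂L/∂T^a` and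
`δL = δR_a{}^b ∧ ∂L/∂R_a{}^b`, for variations of one argument with all others fixed. -/
structure HasMomenta (L : Geom D → Form D) (G : Geom D) (M : Fin D → Fin D → Form D)
    (H : Fin D → Form D) (HH : Fin D → Fin D → Form D) : Prop where
  degM : ∀ a b, IsForm (D - 1) (M a b)
  symmM : ∀ a b, M a b = M b a
  degH : ∀ a, IsForm (D - 2) (H a)
  degHH : ∀ a b, IsForm (D - 2) (HH a b)
  derivQ : ∀ δQ : Fin D → Fin D → Form D, (∀ a b, IsForm 1 (δQ a b)) →
    (∀ a b, δQ a b = δQ b a) →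
    HasDerivAt (fun t : ℝ => top (L { G with Q := G.Q + t • δQ }))
      (top (∑ a, ∑ b, δQ a b * (-(1 / 2 : ℝ)) • M a b)) 0
  derivT : ∀ δT : Fin D → Form D, (∀ a, IsForm 2 (δT a)) →
    HasDerivAt (fun t : ℝ => top (L { G with T := G.T + t • δT }))
      (top (∑ a, δT a * -H a)) 0
  derivR : ∀ δR : Fin D → Fin D → Form D, (∀ a b, IsForm 2 (δR a b)) →
    HasDerivAt (fun t : ℝ => top (L { G with R := G.R + t • δR }))
      (top (∑ a, ∑ b, δR a b * -HH a b)) 0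

/-! ### Field configurations -/

/-- The basic fields: metric `g_{ab}`, coframe `ϑ^a` and connection 1-forms `Γ_a{}^b`
(here `Γ a b`). -/
structure Config (D : ℕ) where
  g : Pt D → Matrix (Fin D) (Fin D) ℝ
  θ : Fin D → Pt D → Cov D
  Γ : Fin D → Fin D → Pt D → Cov D

namespace Config

variable (c : Config D)

/-- On `U` the fields are smooth, the metric is symmetric and nondegenerate, and the 1-forms
`ϑ^a` are linearly independent. -/
structure IsRegularOn (U : Set (Pt D)) : Prop where
  smooth_g : ∀ a b, ContDiffOn ℝ (⊤ : ℕ∞) (fun x => c.g x a b) U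
  smooth_θ : ∀ a, ContDiffOn ℝ (⊤ : ℕ∞) (c.θ a) U
  smooth_Γ : ∀ a b, ContDiffOn ℝ (⊤ : ℕ∞) (c.Γ a b) U
  symm_g : ∀ x ∈ U, (c.g x).IsSymm
  nondeg_g : ∀ x ∈ U, (c.g x).det ≠ 0
  coframe : ∀ x ∈ U, LinearIndependent ℝ (fun a => c.θ a x)

/-- The connection 1-form `Γ_a{}^b` as a form. -/
def conn (a b : Fin D) (x : Pt D) : Form D := form1 (c.Γ a b x)

/-- `Dα^a`. -/
def DU (α : Fin D → Pt D → Form D) (a : Fin D) (x : Pt D) : Form D :=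
  extd (α a) x + ∑ d, c.conn d a x * α d x

/-- `Dα_a`. -/
def DL (α : Fin D → Pt D → Form D) (a : Fin D) (x : Pt D) : Form D :=
  extd (α a) x - ∑ d, c.conn a d x * α d x

/-- `Dα_{ab}`. -/
def DLL (α : Fin D → Fin D → Pt D → Form D) (a b : Fin D) (x : Pt D) : Form D :=
  extd (α a b) x - (∑ d, c.conn a d x * α d b x) - ∑ d, c.conn b d x * α a d x

/-- `Dα^a{}_b`. -/
def DUL (α : Fin D → Fin D → Pt D → Form D) (a b : Fin D) (x : Pt D) : Form D :=
  extd (α a b) x + (∑ d, c.conn d a x * α d b x) - ∑ d, c.conn b d x * α a d x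

/-- The torsion `T^a = Dϑ^a`. -/
def torsion (a : Fin D) (x : Pt D) : Form D := c.DU (fun a x => form1 (c.θ a x)) a x

/-- The nonmetricity `Q_{ab} = -Dg_{ab}`. -/
def nonmetricity (a b : Fin D) (x : Pt D) : Form D :=
  -c.DLL (fun a b x => form0 (c.g x a b)) a b x

/-- The curvature `R_a{}^b = dΓ_a{}^b + Γ_c{}^b ∧ Γ_a{}^c`. -/
def curvature (a b : Fin D) (x : Pt D) : Form D :=
  extd (c.conn a b) x + ∑ d, c.conn d b x * c.conn a d x

/-- The geometric data at a point. -/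
def geom (x : Pt D) : Geom D where
  g := c.g x
  θ := fun a => c.θ a x
  Q := fun a b => c.nonmetricity a b x
  T := fun a => c.torsion a x
  R := fun a b => c.curvature a b x

end Config

/-! ### Actions and variational derivatives -/

/-- An action: for each region and each field configuration a number. Since an action need not
converge on the whole domain, it is evaluated on compact regions. -/
abbrev Action (D : ℕ) := Set (Pt D) → Config D → ℝ

/-- The gravitational action `∫_K L_MAG`. -/
def gravAction (p : Params) : Action D := fun K c => integral K fun x => p.LMAG (c.geom x)

/-- `δS/δϑ^a = X_a` on `U` at the configuration `c`: the `X_a` are continuous fields of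
`(D-1)`-forms and, for all smooth variations `δϑ^a` with support in a compact `K ⊆ U`, at fixed
metric and connection, the action on `K` varies by `δS = ∫_K δϑ^a ∧ X_a`. -/
structure HasCoframeVariation (U : Set (Pt D)) (S : Action D) (c : Config D)
    (X : Fin D → Pt D → Form D) : Prop where
  cont : ∀ a, ContForm U (X a)
  deg : ∀ a, ∀ x ∈ U, IsForm (D - 1) (X a x)
  deriv : ∀ K, IsCompact K → K ⊆ U → ∀ δθ : Fin D → Pt D → Cov D,
    (∀ a, ContDiff ℝ (⊤ : ℕ∞) (δθ a)) → (∀ a, tsupport (δθ a) ⊆ K) →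
    HasDerivAt (fun t : ℝ => S K { c with θ := c.θ + t • δθ })
      (integral K fun x => ∑ a, form1 (δθ a x) * X a x) 0

/-- `δS/δΓ_a{}^b = X^a{}_b` on `U` at the configuration `c`: the `X^a{}_b` (here `X a b`) are
continuous fields of `(D-1)`-forms and, for all smooth variations `δΓ_a{}^b` with support in a
compact `K ⊆ U`, at fixed metric and coframe, the action on `K` varies by
`δS = ∫_K δΓ_a{}^b ∧ X^a{}_b`. -/
structure HasConnectionVariation (U : Set (Pt D)) (S : Action D) (c : Config D)
    (X : Fin D → Fin D → Pt D → Form D) : Prop where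
  cont : ∀ a b, ContForm U (X a b)
  deg : ∀ a b, ∀ x ∈ U, IsForm (D - 1) (X a b x)
  deriv : ∀ K, IsCompact K → K ⊆ U → ∀ δΓ : Fin D → Fin D → Pt D → Cov D,
    (∀ a b, ContDiff ℝ (⊤ : ℕ∞) (δΓ a b)) → (∀ a b, tsupport (δΓ a b) ⊆ K) →
    HasDerivAt (fun t : ℝ => S K { c with Γ := c.Γ + t • δΓ })
      (integral K fun x => ∑ a, ∑ b, form1 (δΓ a b x) * X a b x) 0

/-! ### The right-hand sides of the field equations -/

/-- The gravitational part of `κ δS/δϑ^a`. -/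
def coframeRHS (p : Params) (c : Config D) (a : Fin D) (x : Pt D) : Form D :=
  (p.a0 / 2) • (∑ b, ∑ d, (c.geom x).up2 (c.geom x).Rlow b d *
      (c.geom x).star ((c.geom x).cofL b * (c.geom x).cofL d * (c.geom x).cofL a))
    - p.lam • (c.geom x).star ((c.geom x).cofL a)
    + p.q (c.geom x) a
    - c.DL (fun a x => p.h1 (c.geom x) a) a x

/-- The gravitational part of `κ δS/δΓ_a{}^b`. -/
def connectionRHS (p : Params) (c : Config D) (a b : Fin D) (x : Pt D) : Form D :=
  (p.a0 / 2) •
      ((∑ d, (c.geom x).T d *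
          (c.geom x).star ((c.geom x).cof a * (c.geom x).cofL b * (c.geom x).cofL d))
        + (∑ d, (c.geom x).up2 (c.geom x).Q a d *
            (c.geom x).star ((c.geom x).cofL d * (c.geom x).cofL b))
        - (1 / 2 : ℝ) • ((c.geom x).trace (c.geom x).Q *
            (c.geom x).star ((c.geom x).cof a * (c.geom x).cofL b)))
    - (c.geom x).cof a * p.h1 (c.geom x) b
    - (2 : ℝ) • (c.geom x).low2 (p.m (c.geom x)) a b
    - (p.κ / p.ρ) • c.DUL (fun a b x => p.h2 (c.geom x) a b) a b x

end MAG

end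

/-! ### Exterior algebra at one point: grade involution, contraction, derivations and degree. -/

noncomputable section

namespace MAG

variable {D : ℕ}

/-! ### The exterior algebra -/

section Exterior

/-! The Lagrangian is an algebraic function of `g`, `ϑ`, `Q`, `T` and `R`. Both variations result
from explicit partial derivatives with respect to `Q`, `T`, `R`, a naturality identity that supplies
the partial derivative with respect to `ϑ`, and integration by parts.

Momenta. For a fixed frame, `α ∧ ⋆β` is a symmetric pairing in which exterior multiplication by a
covector is adjoint to contraction with the equivalent vector (`Regular.pair_comm`,
`Regular.pair_form1_mul_left`). The index operations on covector- and tensor-valued forms therefore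
come in adjoint pairs, and once the Hodge stars in their definitions are cancelled, the irreducible
parts are self-adjoint operators applied to `Q`, `T` or `R` (with `T` and `R` taken with lowered
indices). The Lagrangian becomes a constant plus linear and bilinear terms (`Params.top_LMAG`). A
bilinear term `B(x,x)` has derivative `B(x,y) + B(y,x)`. For the projections both halves agree. The
operators multiplied by `v_1, …, v_5` are not self-adjoint, and the second half is what produces the
terms of `h_{ab}` with `P`, `²W` and `⁴W` (`Params.pT_strongOp`). In the same way, transposing the
mixed terms in `Q` and `T` and in `Λ` and the trace of `Q` gives the `c_I` and `b_5` terms of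
`m^{ab}` (`Params.opC_sy_wedA`, `Params.hasDerivAt_Q`).

Coframe. The coframe enters through the dual frame, the volume form, the star and all the
projections, so a direct differentiation is avoided. Instead, `L` is natural: a linear isomorphism
of the cotangent space applied to `ϑ`, `Q`, `T` and `R` at once, with `g_{ab}` fixed, acts on `L` by
the induced map of forms. Differentiating along `id + tΔ` with `Δϑ^a = δϑ^a`, the total change of
`L` is `δϑ^a ∧ (e_a ⌟ L)`, and `Q`, `T`, `R` change by the same derivation. Subtracting the changes
due to them, which the momenta give, leaves `∂L/∂ϑ^a` (`Concomitant.hasDerivAt`). That the changes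
add up is differentiability of `L`; smoothness, naturality and degree are carried together through
all the constructions by `Concomitant`.

Variations. At fixed `Γ` a coframe variation acts directly and through `δT = Dδϑ`; a connection
variation acts through `δQ`, `δT = δΓ ∧ ϑ` and `δR = DδΓ`. Stokes' theorem moves `D` onto the
momenta (`Concomitant.hasCoframeVariation`, `Concomitant.hasConnectionVariation`). The
Einstein–Hilbert part of the curvature momentum cancels one half of `e_a ⌟ (R ∧ ⋆ϑϑ)` in the coframe
equation (`Params.smul_coframeDerivative`), and its covariant derivative is computed in
`Config.DUL_star_cof_mul_cofL` for the connection equation. Uniqueness is the fundamental lemma of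
the calculus of variations, `eq_of_integral_form1_mul_eq`. -/

theorem form_left_induction {P : Form D → Prop} (h0 : ∀ r : ℝ, P (form0 r))
    (ha : ∀ α β, P α → P β → P (α + β)) (hm : ∀ ω α, P α → P (form1 ω * α)) (α : Form D) : P α :=
  CliffordAlgebra.left_induction _ h0 ha (fun x m hx => hm m x hx) α

theorem form_right_induction {P : Form D → Prop} (h0 : ∀ r : ℝ, P (form0 r))
    (ha : ∀ α β, P α → P β → P (α + β)) (hm : ∀ ω α, P α → P (α * form1 ω)) (α : Form D) : P α :=
  CliffordAlgebra.right_induction _ h0 ha (fun m x hx => hm m x hx) α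

theorem form0_eq_smul (r : ℝ) : (form0 r : Form D) = r • 1 := Algebra.algebraMap_eq_smul_one r

@[simp] theorem form1_add (ω η : Cov D) : form1 (ω + η) = form1 ω + form1 η := map_add _ _ _
@[simp] theorem form1_smul (r : ℝ) (ω : Cov D) : form1 (r • ω) = r • form1 ω := map_smul _ _ _
@[simp] theorem form1_neg (ω : Cov D) : form1 (-ω) = -form1 ω := map_neg _ _
@[simp] theorem form1_zero : form1 (0 : Cov D) = 0 := map_zero _
theorem form1_sum {ι : Type*} (s : Finset ι) (f : ι → Cov D) :
    form1 (∑ i ∈ s, f i) = ∑ i ∈ s, form1 (f i) := map_sum _ _ _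

/-- The differential `dx^μ` of a coordinate. -/
def dx (μ : Fin D) : Form D := form1 (Pi.single μ 1)

theorem form1_eq_sum (ω : Cov D) : form1 ω = ∑ μ, ω μ • dx μ := by
  conv_lhs => rw [← (Pi.basisFun ℝ (Fin D)).sum_repr ω]
  simp [form1_sum, dx]

theorem form1_mul_form1 (ω η : Cov D) : form1 ω * form1 η = -(form1 η * form1 ω) :=
  eq_neg_of_add_eq_zero_left (ExteriorAlgebra.ι_add_mul_swap ω η)

theorem form1_mul_form1_mul (ω η : Cov D) (α : Form D) :
    form1 ω * (form1 η * α) = -(form1 η * (form1 ω * α)) := by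
  rw [← mul_assoc, form1_mul_form1, neg_mul, mul_assoc]

/-- The grade involution `α ↦ (-1)^p α`. -/
def inv (α : Form D) : Form D := CliffordAlgebra.involute α

@[simp] theorem inv_add (α β : Form D) : inv (α + β) = inv α + inv β := map_add _ _ _
@[simp] theorem inv_sub (α β : Form D) : inv (α - β) = inv α - inv β := map_sub _ _ _
@[simp] theorem inv_neg (α : Form D) : inv (-α) = -inv α := map_neg _ _
@[simp] theorem inv_smul (r : ℝ) (α : Form D) : inv (r • α) = r • inv α := map_smul _ _ _
@[simp] theorem inv_mul (α β : Form D) : inv (α * β) = inv α * inv β := map_mul _ _ _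
@[simp] theorem inv_zero : inv (0 : Form D) = 0 := map_zero _
@[simp] theorem inv_one : inv (1 : Form D) = 1 := map_one _
theorem inv_sum {ι : Type*} (s : Finset ι) (f : ι → Form D) :
    inv (∑ i ∈ s, f i) = ∑ i ∈ s, inv (f i) := map_sum _ _ _

@[simp] theorem inv_form1 (ω : Cov D) : inv (form1 ω) = -form1 ω := CliffordAlgebra.involute_ι ω

@[simp] theorem inv_inv (α : Form D) : inv (inv α) = α := CliffordAlgebra.involute_involute α

@[simp] theorem inv_form0 (r : ℝ) : inv (form0 r : Form D) = form0 r := AlgHom.commutes _ r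

/-- Graded commutativity without a homogeneity hypothesis: the sign `(-1)^p` is carried by the
involution, which lets later inductions run over arbitrary forms. -/
theorem form1_mul_comm (ω : Cov D) (α : Form D) : form1 ω * α = inv α * form1 ω := by
  induction α using form_left_induction with
  | h0 r => rw [inv_form0]; exact Algebra.commutes' r _ |>.symm
  | ha α β hα hβ => simp only [mul_add, hα, hβ, inv_add, add_mul]
  | hm η α h => rw [form1_mul_form1_mul, h]; simp [mul_assoc]

theorem mul_form1_comm (ω : Cov D) (α : Form D) : α * form1 ω = form1 ω * inv α := by
  rw [form1_mul_comm, inv_inv]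

variable (v : Module.Dual ℝ (Cov D))

@[simp] theorem interior_add (α β : Form D) :
    interior v (α + β) = interior v α + interior v β := map_add _ _ _
@[simp] theorem interior_sub (α β : Form D) :
    interior v (α - β) = interior v α - interior v β := map_sub _ _ _
@[simp] theorem interior_smul (r : ℝ) (α : Form D) :
    interior v (r • α) = r • interior v α := map_smul _ _ _
@[simp] theorem interior_neg (α : Form D) : interior v (-α) = -interior v α := map_neg _ _
@[simp] theorem interior_zero : interior v (0 : Form D) = 0 := map_zero _
theorem interior_sum {ι : Type*} (s : Finset ι) (f : ι → Form D) :
    interior v (∑ i ∈ s, f i) = ∑ i ∈ s, interior v (f i) := map_sum _ _ _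

theorem interior_vec_smul (r : ℝ) (α : Form D) : interior (r • v) α = r • interior v α := by
  simp [interior]
theorem interior_vec_sum {ι : Type*} (s : Finset ι) (f : ι → Module.Dual ℝ (Cov D)) (α : Form D) :
    interior (∑ i ∈ s, f i) α = ∑ i ∈ s, interior (f i) α := by
  simp [interior]

@[simp] theorem interior_form0 (r : ℝ) : interior v (form0 r) = 0 :=
  CliffordAlgebra.contractLeft_algebraMap _ v r

@[simp] theorem interior_one : interior v (1 : Form D) = 0 := CliffordAlgebra.contractLeft_one _ v

theorem interior_form1_mul (ω : Cov D) (α : Form D) :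
    interior v (form1 ω * α) = v ω • α - form1 ω * interior v α :=
  CliffordAlgebra.contractLeft_ι_mul v ω α

@[simp] theorem interior_form1 (ω : Cov D) : interior v (form1 ω) = v ω • 1 := by
  rw [← mul_one (form1 ω), interior_form1_mul]; simp

theorem interior_comm (w : Module.Dual ℝ (Cov D)) (α : Form D) :
    interior v (interior w α) = -interior w (interior v α) :=
  CliffordAlgebra.contractLeft_comm v w α

theorem interior_inv (α : Form D) : interior v (inv α) = -inv (interior v α) := by
  induction α using form_left_induction with
  | h0 r => simp
  | ha α β hα hβ => simp only [inv_add, interior_add, hα, hβ, neg_add]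
  | hm η α h =>
    simp only [inv_mul, inv_form1, neg_mul, interior_neg, interior_form1_mul, inv_sub,
      inv_smul] at h ⊢
    rw [h]; simp

theorem interior_mul (α β : Form D) :
    interior v (α * β) = interior v α * β + inv α * interior v β := by
  induction α using form_left_induction with
  | h0 r => simp [form0_eq_smul]
  | ha α γ hα hβ => simp only [inv_add, interior_add, hα, hβ, add_mul]; abel
  | hm η α h =>
    rw [mul_assoc, interior_form1_mul, h, interior_form1_mul]
    simp only [inv_mul, inv_form1, neg_mul, sub_mul, smul_mul_assoc, mul_assoc, mul_add]
    abel

theorem interior_mul_form1 (α : Form D) (ω : Cov D) :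
    interior v (α * form1 ω) = interior v α * form1 ω + v ω • inv α := by
  rw [interior_mul]; simp

/-! #### Contraction with a frame and the degree -/

/-- The vector `∂_μ`, as a linear form on covectors. -/
def pd (μ : Fin D) : Module.Dual ℝ (Cov D) := LinearMap.proj μ

@[simp] theorem pd_apply (μ : Fin D) (ω : Cov D) : pd μ ω = ω μ := rfl

/-- The derivation of the exterior algebra which extends a linear map of covectors. -/
def derivation (A : Cov D →ₗ[ℝ] Cov D) (α : Form D) : Form D :=
  ∑ μ, form1 (A (Pi.single μ 1)) * interior (pd μ) α

variable (A : Cov D →ₗ[ℝ] Cov D)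

theorem sum_apply_single (ω : Cov D) : ∑ μ, ω μ • A (Pi.single μ 1) = A ω := by
  conv_rhs => rw [← (Pi.basisFun ℝ (Fin D)).sum_repr ω]
  simp

@[simp] theorem derivation_add (α β : Form D) :
    derivation A (α + β) = derivation A α + derivation A β := by
  simp [derivation, mul_add, Finset.sum_add_distrib]
@[simp] theorem derivation_smul (r : ℝ) (α : Form D) :
    derivation A (r • α) = r • derivation A α := by
  simp [derivation, Finset.smul_sum]
@[simp] theorem derivation_zero : derivation A (0 : Form D) = 0 := by simp [derivation]
theorem derivation_sum {ι : Type*} (s : Finset ι) (f : ι → Form D) :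
    derivation A (∑ i ∈ s, f i) = ∑ i ∈ s, derivation A (f i) :=
  map_sum ({ toFun := derivation A, map_add' := derivation_add A, map_zero' := derivation_zero A }
    : Form D →+ Form D) f s
@[simp] theorem derivation_form0 (r : ℝ) : derivation A (form0 r) = 0 := by simp [derivation]
@[simp] theorem derivation_one : derivation A (1 : Form D) = 0 := by simp [derivation]

/-- Two signs cancel: contraction passes `ω` with a minus, and so does the 1-form in front of it.
The remaining terms `ω μ • A (dx^μ)` add up to `A ω`. This is why the Leibniz rule below is
ungraded. -/
theorem derivation_form1_mul (ω : Cov D) (α : Form D) :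
    derivation A (form1 ω * α) = form1 (A ω) * α + form1 ω * derivation A α := by
  rw [← sum_apply_single A ω]
  simp only [derivation, interior_form1_mul, mul_sub, Finset.sum_sub_distrib, Finset.mul_sum,
    form1_sum, Finset.sum_mul, pd_apply, mul_smul_comm, form1_smul, smul_mul_assoc]
  simp only [form1_mul_form1_mul _ ω, Finset.sum_neg_distrib, sub_neg_eq_add]

theorem derivation_mul (α β : Form D) :
    derivation A (α * β) = derivation A α * β + α * derivation A β := by
  induction α using form_left_induction with
  | h0 r => simp [form0_eq_smul]
  | ha α γ hα hβ => simp only [derivation_add, hα, hβ, add_mul]; abel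
  | hm η α h =>
    rw [mul_assoc, derivation_form1_mul, h, derivation_form1_mul]
    simp only [add_mul, mul_assoc, mul_add]
    abel

@[simp] theorem derivation_form1 (ω : Cov D) : derivation A (form1 ω) = form1 (A ω) := by
  rw [← mul_one (form1 ω), derivation_form1_mul]; simp

/-- The Euler operator, which multiplies a `p`-form by `p`. -/
def euler (α : Form D) : Form D := derivation LinearMap.id α

@[simp] theorem euler_add (α β : Form D) : euler (α + β) = euler α + euler β := derivation_add _ _ _
@[simp] theorem euler_smul (r : ℝ) (α : Form D) : euler (r • α) = r • euler α :=
  derivation_smul _ _ _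
@[simp] theorem euler_form0 (r : ℝ) : euler (form0 r : Form D) = 0 := derivation_form0 _ _
@[simp] theorem euler_form1 (ω : Cov D) : euler (form1 ω) = form1 ω := derivation_form1 _ _
theorem euler_mul (α β : Form D) : euler (α * β) = euler α * β + α * euler β :=
  derivation_mul _ _ _

/-- A form of degree `r`. For convenience the degree is a real number. -/
def Deg (r : ℝ) (α : Form D) : Prop := euler α = r • α

theorem euler_interior (α : Form D) :
    euler (interior v α) = interior v (euler α) - interior v α := by
  induction α using form_left_induction with
  | h0 r => simp [euler]
  | ha α γ hα hβ => simp only [euler, derivation_add, interior_add] at *; rw [hα, hβ]; abel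
  | hm η α h =>
    simp only [euler, interior_form1_mul, derivation_form1_mul, sub_eq_add_neg, derivation_add,
      derivation_smul, interior_add] at *
    rw [← neg_mul, ← form1_neg, derivation_form1_mul, h]
    simp [mul_add]
    abel

theorem Deg.zero (r : ℝ) : Deg r (0 : Form D) := by simp [Deg, euler]
theorem Deg.form0 (r : ℝ) : Deg 0 (form0 r : Form D) := by simp [Deg, euler]
theorem Deg.one : Deg 0 (1 : Form D) := by simp [Deg, euler]
theorem Deg.form1 (ω : Cov D) : Deg 1 (form1 ω) := by simp [Deg, euler]
theorem Deg.add {r : ℝ} {α β : Form D} (h : Deg r α) (h' : Deg r β) : Deg r (α + β) := by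
  simp only [Deg, euler, derivation_add, smul_add] at *; rw [h, h']
theorem Deg.smul {r : ℝ} {α : Form D} (s : ℝ) (h : Deg r α) : Deg r (s • α) := by
  simp only [Deg, euler, derivation_smul] at *; rw [h, smul_comm]
theorem Deg.neg {r : ℝ} {α : Form D} (h : Deg r α) : Deg r (-α) := by
  simpa using h.smul (-1)
theorem Deg.sub {r : ℝ} {α β : Form D} (h : Deg r α) (h' : Deg r β) : Deg r (α - β) := by
  simpa [sub_eq_add_neg] using h.add h'.neg
theorem Deg.sum {ι : Type*} {s : Finset ι} {r : ℝ} {f : ι → Form D} (h : ∀ i, Deg r (f i)) :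
    Deg r (∑ i ∈ s, f i) := by
  have h' : ∀ i, derivation LinearMap.id (f i) = r • f i := h
  simp [Deg, euler, derivation_sum, h', Finset.smul_sum]
theorem Deg.mul {r s : ℝ} {α β : Form D} (h : Deg r α) (h' : Deg s β) : Deg (r + s) (α * β) := by
  simp only [Deg, euler, derivation_mul] at *; rw [h, h']; simp [add_smul]
theorem Deg.interior {r : ℝ} {α : Form D} (h : Deg r α) : Deg (r - 1) (interior v α) := by
  simp only [Deg, euler_interior] at *; rw [h]; simp [sub_smul]
theorem Deg.cast {r s : ℝ} {α : Form D} (h : Deg r α) (e : r = s) : Deg s α := e ▸ h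

theorem deg_ofFn_prod {n : ℕ} (f : Fin n → Cov D) :
    Deg n (List.ofFn fun i => form1 (f i)).prod := by
  induction n with
  | zero => simpa using Deg.one
  | succ n ih => simpa [add_comm] using (Deg.form1 (f 0)).mul (ih fun i => f i.succ)

theorem inv_ofFn_prod {n : ℕ} (f : Fin n → Cov D) :
    inv (List.ofFn fun i => form1 (f i)).prod
      = (-1 : ℝ) ^ n • (List.ofFn fun i => form1 (f i)).prod := by
  induction n with
  | zero => simp
  | succ n ih =>
    have := ih fun i => f i.succ
    simp only [List.ofFn_succ, List.prod_cons, inv_mul, inv_form1] at *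
    rw [this]; simp [pow_succ]

theorem dxBasis_eq (I : Finset (Fin D)) : ∃ f : Fin I.card → Cov D,
    dxBasis I = (List.ofFn fun i => form1 (f i)).prod :=
  ⟨_, by rw [dxBasis, ExteriorAlgebra.basis_apply]; exact ExteriorAlgebra.ιMulti_apply _⟩

theorem deg_dxBasis (I : Finset (Fin D)) : Deg I.card (dxBasis I) := by
  obtain ⟨f, hf⟩ := dxBasis_eq I; rw [hf]; exact deg_ofFn_prod f

theorem sum_coeff (α : Form D) : ∑ I, coeff I α • dxBasis I = α := dxBasis.sum_repr α

@[simp] theorem coeff_add (I : Finset (Fin D)) (α β : Form D) :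
    coeff I (α + β) = coeff I α + coeff I β := by simp [coeff]
@[simp] theorem coeff_sub (I : Finset (Fin D)) (α β : Form D) :
    coeff I (α - β) = coeff I α - coeff I β := by simp [coeff]
@[simp] theorem coeff_neg (I : Finset (Fin D)) (α : Form D) :
    coeff I (-α) = -coeff I α := by simp [coeff]
@[simp] theorem coeff_smul (I : Finset (Fin D)) (r : ℝ) (α : Form D) :
    coeff I (r • α) = r * coeff I α := by simp [coeff]
@[simp] theorem coeff_zero (I : Finset (Fin D)) : coeff I (0 : Form D) = 0 := by simp [coeff]
theorem coeff_sum {ι : Type*} (I : Finset (Fin D)) (s : Finset ι) (f : ι → Form D) :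
    coeff I (∑ i ∈ s, f i) = ∑ i ∈ s, coeff I (f i) := by simp [coeff]
theorem coeff_dxBasis (I J : Finset (Fin D)) :
    coeff I (dxBasis J) = if J = I then 1 else 0 := by
  simp [coeff, Finsupp.single_apply]

@[simp] theorem top_add (α β : Form D) : top (α + β) = top α + top β := coeff_add _ _ _
@[simp] theorem top_sub (α β : Form D) : top (α - β) = top α - top β := coeff_sub _ _ _
@[simp] theorem top_neg (α : Form D) : top (-α) = -top α := coeff_neg _ _
@[simp] theorem top_smul (r : ℝ) (α : Form D) : top (r • α) = r * top α := coeff_smul _ _ _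
@[simp] theorem top_zero : top (0 : Form D) = 0 := coeff_zero _
theorem top_sum {ι : Type*} (s : Finset ι) (f : ι → Form D) :
    top (∑ i ∈ s, f i) = ∑ i ∈ s, top (f i) := coeff_sum _ _ _

/-- Monomials diagonalise the Euler operator, the eigenvalue being the number of factors. Degree
thus becomes an eigenvalue equation, which passes through products, contractions and the Hodge dual
by algebra alone. -/
theorem coeff_euler (I : Finset (Fin D)) (α : Form D) : coeff I (euler α) = I.card * coeff I α := by
  conv_lhs => rw [← sum_coeff α]
  have : ∀ J : Finset (Fin D), derivation LinearMap.id (dxBasis J) = (J.card : ℝ) • dxBasis J :=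
    deg_dxBasis
  simp [euler, derivation_sum, this, coeff_sum, coeff_dxBasis, mul_comm]

theorem Deg.coeff_eq_zero {r : ℝ} {α : Form D} (h : Deg r α) {I : Finset (Fin D)}
    (hI : (I.card : ℝ) ≠ r) : coeff I α = 0 := by
  have h1 := coeff_euler I α
  rw [show euler α = r • α from h, coeff_smul] at h1
  have : ((I.card : ℝ) - r) * coeff I α = 0 := by linarith
  exact (mul_eq_zero.1 this).resolve_left (sub_ne_zero.2 hI)

theorem dxBasis_isForm (I : Finset (Fin D)) : IsForm I.card (dxBasis I) := by
  rw [IsForm, ← ExteriorAlgebra.ιMulti_span_fixedDegree, dxBasis, ExteriorAlgebra.basis_apply]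
  exact Submodule.subset_span ⟨_, rfl⟩

/-- Products of `p` 1-forms are eigenvectors with eigenvalue `p`; conversely an eigenvector has no
coefficient at a monomial with a different number of factors. -/
theorem isForm_iff_deg {p : ℕ} {α : Form D} : IsForm p α ↔ Deg p α := by
  constructor
  · intro h
    rw [IsForm, ← ExteriorAlgebra.ιMulti_span_fixedDegree] at h
    induction h using Submodule.span_induction with
    | mem x hx =>
      obtain ⟨f, rfl⟩ := hx
      rw [ExteriorAlgebra.ιMulti_apply]; exact deg_ofFn_prod f
    | zero => exact Deg.zero _
    | add x y _ _ hx hy => exact hx.add hy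
    | smul a x _ hx => exact hx.smul a
  · intro h
    rw [← sum_coeff α]
    refine Submodule.sum_mem _ fun I _ => ?_
    by_cases hI : I.card = p
    · exact Submodule.smul_mem _ _ (hI ▸ dxBasis_isForm I)
    · rw [h.coeff_eq_zero (by exact_mod_cast hI), zero_smul]; exact Submodule.zero_mem _

theorem Deg.inv_eq {p : ℕ} {α : Form D} (h : Deg p α) : inv α = (-1 : ℝ) ^ p • α := by
  rw [← sum_coeff α]
  simp only [inv_sum, inv_smul, Finset.smul_sum]
  refine Finset.sum_congr rfl fun I _ => ?_
  by_cases hI : I.card = p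
  · obtain ⟨f, hf⟩ := dxBasis_eq I
    have := inv_ofFn_prod f
    rw [← hf, hI] at this
    rw [this, smul_comm]
  · rw [h.coeff_eq_zero (by exact_mod_cast hI)]; simp

-- Contraction leaves nothing in degree `D`. Applied to a product, this is the algebraic integration
-- by parts from which adjointness for the Hodge pairing follows.
@[simp] theorem top_interior (α : Form D) : top (interior v α) = 0 := by
  rw [← sum_coeff α, interior_sum, top_sum]
  refine Finset.sum_eq_zero fun I _ => ?_
  rw [interior_smul, top_smul, top, ((deg_dxBasis I).interior v).coeff_eq_zero, mul_zero]
  have : I.card ≤ D := by simpa using Finset.card_le_univ I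
  have : (I.card : ℝ) ≤ D := by exact_mod_cast this
  simp only [Finset.card_univ, Fintype.card_fin]
  intro h; linarith

theorem Deg.eq_zero_of_gt {r : ℝ} {α : Form D} (h : Deg r α) (hr : (D : ℝ) < r) : α = 0 := by
  rw [← sum_coeff α]
  refine Finset.sum_eq_zero fun I _ => ?_
  have : I.card ≤ D := by simpa using Finset.card_le_univ I
  have : (I.card : ℝ) ≤ D := by exact_mod_cast this
  rw [h.coeff_eq_zero (by intro h; linarith), zero_smul]

theorem top_inv (α : Form D) : top (inv α) = (-1 : ℝ) ^ D * top α := by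
  rw [← sum_coeff α]
  simp only [inv_sum, inv_smul, top_sum, top_smul, Finset.mul_sum]
  refine Finset.sum_congr rfl fun I _ => ?_
  have h1 := (deg_dxBasis I).inv_eq
  rw [h1, top_smul, top, coeff_dxBasis]
  split_ifs with h
  · subst h; simp [mul_comm]
  · simp

theorem Deg.smul_eq_top {α : Form D} (h : Deg D α) : α = top α • dxBasis Finset.univ := by
  conv_lhs => rw [← sum_coeff α]
  rw [Finset.sum_eq_single Finset.univ]
  · rfl
  · intro I _ hI
    rw [h.coeff_eq_zero, zero_smul]
    intro hc
    apply hI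
    rw [← Finset.card_eq_iff_eq_univ]
    simpa using hc
  · simp

end Exterior

end MAG
end

/-! ### Hodge duality and the symmetric pairing it defines. -/

noncomputable section

namespace MAG

variable {D : ℕ}

/-! ### The Hodge dual -/

namespace Frame

/-- A symmetric nondegenerate metric together with a coframe. -/
structure Regular (F : Frame D) : Prop where
  symm : F.g.IsSymm
  det_g : F.g.det ≠ 0
  det_θ : F.θ.det ≠ 0

variable (F : Frame D)

@[simp] theorem star_add (α β : Form D) : F.star (α + β) = F.star α + F.star β := by simp [star]
@[simp] theorem star_sub (α β : Form D) : F.star (α - β) = F.star α - F.star β := by simp [star]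
@[simp] theorem star_neg (α : Form D) : F.star (-α) = -F.star α := by simp [star]
@[simp] theorem star_smul (r : ℝ) (α : Form D) : F.star (r • α) = r • F.star α := by simp [star]
@[simp] theorem star_zero : F.star 0 = 0 := by simp [star]
theorem star_sum {ι : Type*} (s : Finset ι) (f : ι → Form D) :
    F.star (∑ i ∈ s, f i) = ∑ i ∈ s, F.star (f i) := by simp [star]

theorem star_form0 (r : ℝ) : F.star (form0 r) = r • F.vol := by
  rw [form0_eq_smul, star_smul, star_one]

theorem deg_vol : Deg D F.vol := (deg_ofFn_prod _).smul _

variable {F}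

theorem Regular.isUnit_g (h : F.Regular) : IsUnit F.g.det := isUnit_iff_ne_zero.2 h.det_g
theorem Regular.isUnit_θ (h : F.Regular) : IsUnit F.θ.det := isUnit_iff_ne_zero.2 h.det_θ

theorem Regular.g_comm (h : F.Regular) (a b : Fin D) : F.g a b = F.g b a := h.symm.apply b a

theorem Regular.gi_comm (h : F.Regular) (a b : Fin D) : F.gi a b = F.gi b a := by
  have : F.gi.IsSymm := by rw [gi, Matrix.IsSymm, Matrix.transpose_nonsing_inv, h.symm.eq]
  exact this.apply b a

theorem Regular.gi_mul_g (h : F.Regular) (a b : Fin D) :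
    ∑ c, F.gi a c * F.g c b = if a = b then 1 else 0 := by
  have := congrFun₂ (Matrix.nonsing_inv_mul F.g h.isUnit_g) a b
  rwa [Matrix.mul_apply, Matrix.one_apply] at this

theorem Regular.g_mul_gi (h : F.Regular) (a b : Fin D) :
    ∑ c, F.g a c * F.gi c b = if a = b then 1 else 0 := by
  have := congrFun₂ (Matrix.mul_nonsing_inv F.g h.isUnit_g) a b
  rwa [Matrix.mul_apply, Matrix.one_apply] at this

theorem e_apply (a : Fin D) (ω : Cov D) : F.e a ω = ∑ μ, F.θ⁻¹ μ a * ω μ := by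
  simp [e, vec, LinearMap.sum_apply]

theorem Regular.e_θ (h : F.Regular) (a b : Fin D) : F.e a (F.θ b) = if a = b then 1 else 0 := by
  have := congrFun₂ (Matrix.mul_nonsing_inv F.θ h.isUnit_θ) b a
  rw [Matrix.mul_apply, Matrix.one_apply] at this
  rw [e_apply]
  simp only [mul_comm (F.θ⁻¹ _ _)]
  rw [this]; simp only [eq_comm]

theorem e_eq_sum (a : Fin D) : F.e a = ∑ μ, F.θ⁻¹ μ a • pd μ := rfl

theorem sharp_apply (ω : Cov D) : F.sharp ω = ∑ a, ∑ b, (F.gi a b * F.e a ω) • F.e b := by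
  simp [sharp, LinearMap.sum_apply, smul_smul]

theorem Regular.sharp_comm (h : F.Regular) (ω η : Cov D) : F.sharp ω η = F.sharp η ω := by
  simp only [sharp_apply, LinearMap.sum_apply, LinearMap.smul_apply, smul_eq_mul]
  rw [Finset.sum_comm]
  refine Finset.sum_congr rfl fun a _ => Finset.sum_congr rfl fun b _ => ?_
  rw [h.gi_comm]; ring

theorem Regular.sharp_θ (h : F.Regular) (c : Fin D) : F.sharp (F.θ c) = ∑ b, F.gi c b • F.e b := by
  simp [sharp_apply, h.e_θ]

/-- The covector `ϑ_a`. -/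
def θL (F : Frame D) (a : Fin D) : Cov D := ∑ b, F.g a b • F.θ b

theorem cofL_eq (a : Fin D) : F.cofL a = form1 (F.θL a) := by
  simp [cofL, θL, form1_sum, cof]

theorem Regular.sharp_θL (h : F.Regular) (a : Fin D) : F.sharp (F.θL a) = F.e a := by
  simp only [θL, map_sum, map_smul, h.sharp_θ, Finset.smul_sum, smul_smul]
  rw [Finset.sum_comm]
  simp [← Finset.sum_smul, h.g_mul_gi]

/-- Induction on factors split off on the right. The base case is `ω ∧ vol = 0`, by degree. In the
inductive step the formula for `α` is contracted with `η^♯`; symmetry of the metric exchanges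
`ω^♯(η)` and `η^♯(ω)`. -/
theorem Regular.form1_mul_star (h : F.Regular) (ω : Cov D) (α : Form D) :
    form1 ω * F.star α = -F.star (interior (F.sharp ω) (inv α)) := by
  induction α using form_right_induction with
  | h0 r =>
    have : form1 ω * F.vol = 0 :=
      ((Deg.form1 ω).mul F.deg_vol).eq_zero_of_gt (by linarith)
    simp [star_form0, this]
  | ha α γ hα hβ => simp only [mul_add, star_add, hα, hβ, inv_add, interior_add, neg_add]
  | hm η α ih =>
    have h1 := interior_form1_mul (F.sharp η) ω (F.star α)
    rw [ih] at h1
    have h2 : form1 ω * interior (F.sharp η) (F.star α) = F.sharp η ω • F.star α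
        - interior (F.sharp η) (-F.star (interior (F.sharp ω) (inv α))) := by rw [h1]; abel
    rw [star_mul_form1, h2]
    simp only [inv_mul, inv_form1, mul_neg, interior_neg, interior_mul_form1, star_neg, star_add,
      star_mul_form1, star_smul, inv_inv]
    rw [h.sharp_comm]
    simp [add_comm]

theorem euler_star (α : Form D) : euler (F.star α) = (D : ℝ) • F.star α - F.star (euler α) := by
  induction α using form_right_induction with
  | h0 r =>
    have : euler F.vol = (D : ℝ) • F.vol := F.deg_vol
    rw [star_form0, euler_smul, this, euler_form0, star_zero, sub_zero, smul_comm]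
  | ha α γ hα hβ => simp only [star_add, euler_add]; rw [hα, hβ]; module
  | hm η α ih =>
    rw [star_mul_form1, euler_interior, ih, euler_mul]
    simp only [interior_sub, interior_smul, euler_form1, star_add, star_mul_form1]
    module

end Frame

theorem Deg.star {r : ℝ} {α : Form D} (F : Frame D) (h : Deg r α) : Deg (D - r) (F.star α) := by
  have := F.euler_star α
  rw [show euler α = r • α from h] at this
  rw [Deg, this, F.star_smul, sub_smul]

namespace Frame

variable {F : Frame D}

/-- The coframe as a basis of the covectors. -/
def Regular.basis (h : F.Regular) : Module.Basis (Fin D) ℝ (Cov D) :=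
  (Pi.basisFun ℝ (Fin D)).map
    (LinearEquiv.ofIsUnitDet (f := F.θ.vecMulLinear) (v := Pi.basisFun ℝ (Fin D))
      (v' := Pi.basisFun ℝ (Fin D)) (by
        have : LinearMap.toMatrix (Pi.basisFun ℝ (Fin D)) (Pi.basisFun ℝ (Fin D))
            F.θ.vecMulLinear = F.θ.transpose := by
          ext a b; simp
        rw [this, Matrix.det_transpose]; exact h.isUnit_θ))

@[simp] theorem Regular.basis_apply (h : F.Regular) (a : Fin D) : h.basis a = F.θ a := by
  ext; simp [Regular.basis]

/-- The reversed list lets `w 0` act first. It strips the leading factor and annihilates the others,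
so the contractions consume the product one factor at a time without a sign. -/
theorem contract_prod {n : ℕ} (w : Fin n → Module.Dual ℝ (Cov D)) (ω : Fin n → Cov D)
    (hw : ∀ i j, w i (ω j) = if i = j then 1 else 0) :
    ((List.ofFn fun i => (CliffordAlgebra.contractLeft (w i) : Module.End ℝ (Form D))).reverse.prod)
      (List.ofFn fun i => form1 (ω i)).prod = 1 := by
  induction n with
  | zero => simp
  | succ n ih =>
    have h0 : ∀ m (v : Module.Dual ℝ (Cov D)) (η : Fin m → Cov D), (∀ i, v (η i) = 0) →
        interior v (List.ofFn fun i => form1 (η i)).prod = 0 := by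
      intro m
      induction m with
      | zero => intro v η _; simp
      | succ m ihm =>
        intro v η hv
        rw [List.ofFn_succ, List.prod_cons, interior_form1_mul, hv 0,
          ihm v _ (fun i => hv i.succ)]
        simp
    rw [List.ofFn_succ, List.reverse_cons, List.prod_append, List.ofFn_succ, List.prod_cons]
    simp only [List.prod_cons, List.prod_nil, mul_one, Module.End.mul_apply]
    have h1 : (CliffordAlgebra.contractLeft (w 0)) (form1 (ω 0) *
        (List.ofFn fun i : Fin n => form1 (ω i.succ)).prod)
        = (List.ofFn fun i : Fin n => form1 (ω i.succ)).prod := by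
      refine (interior_form1_mul (w 0) (ω 0) _).trans ?_
      rw [h0 n (w 0) _ (fun i => by rw [hw, if_neg (Fin.succ_ne_zero i).symm]), hw]
      simp
    rw [h1]
    exact ih _ _ fun i j => by rw [hw]; simp

/-- On a `D`-dimensional space every alternating map in `D` arguments is a multiple of the
determinant relative to the basis `ϑ^a`, and the determinant of `(ϑ_a)` relative to it is `det g`.
This is applied to each coefficient of the exterior product. -/
theorem Regular.prod_cofL (h : F.Regular) :
    (List.ofFn fun a => form1 (F.θL a)).prod
      = F.g.det • (List.ofFn fun a => form1 (F.θ a)).prod := by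
  refine dxBasis.repr.injective (Finsupp.ext fun I => ?_)
  have h1 := AlternatingMap.eq_smul_basis_det h.basis
    ((dxBasis.coord I).compAlternatingMap (ExteriorAlgebra.ιMulti ℝ D))
  have h2 := congrArg (fun f => f F.θL) h1
  have h3 : h.basis.det F.θL = F.g.det := by
    rw [Module.Basis.det_apply, ← Matrix.det_transpose]
    congr 1
    ext a b
    rw [Matrix.transpose_apply, Module.Basis.toMatrix_apply, θL, map_sum]
    simp only [← h.basis_apply, map_smul, Module.Basis.repr_self]
    simp [Finsupp.single_apply]
  simp only [AlternatingMap.smul_apply, h3, LinearMap.compAlternatingMap_apply,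
    ExteriorAlgebra.ιMulti_apply, h.basis_apply] at h2
  rw [map_smul, Finsupp.smul_apply, smul_eq_mul, mul_comm]
  exact h2

theorem star_ofFn_prod {n : ℕ} (ω : Fin n → Cov D) :
    F.star (List.ofFn fun i => form1 (ω i)).prod
      = (List.ofFn fun i => (CliffordAlgebra.contractLeft (F.sharp (ω i)) :
          Module.End ℝ (Form D))).reverse.prod F.vol := by
  have h : ∀ (l : List (Cov D)) (α : Form D), F.star (α * (l.map form1).prod)
      = (l.map fun ω => (CliffordAlgebra.contractLeft (F.sharp ω) :
          Module.End ℝ (Form D))).reverse.prod (F.star α) := by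
    intro l
    induction l with
    | nil => simp
    | cons ω l ih =>
      intro α
      rw [List.map_cons, List.prod_cons, ← mul_assoc, ih, star_mul_form1]
      simp [Module.End.mul_apply, interior]
  simpa [List.map_ofFn, Function.comp_def, star_one] using h (List.ofFn ω) 1

/-- The vectors equivalent to `ϑ_a` are the `e_a`, which are dual to the factors of `vol`, so `⋆(ϑ_1
∧ ⋯ ∧ ϑ_D) = √|det g|`. Lowering the indices costs a factor `det g`, and `|det g| / det g` is the
sign. -/
theorem Regular.star_vol (h : F.Regular) : F.star F.vol = F.sgn • 1 := by
  have h1 : F.star (List.ofFn fun a => form1 (F.θL a)).prod = √|F.g.det| • 1 := by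
    rw [star_ofFn_prod]
    simp only [h.sharp_θL, vol, map_smul]
    exact congrArg _ (contract_prod F.e F.θ fun i j => h.e_θ i j)
  rw [h.prod_cofL, star_smul] at h1
  have h2 : F.star F.vol = (F.g.det⁻¹ * |F.g.det|) • 1 := by
    rw [vol, star_smul]
    have h3 := congrArg (fun α => (√|F.g.det| * F.g.det⁻¹) • α) h1
    simp only [smul_smul, mul_assoc, inv_mul_cancel₀ h.det_g, mul_one] at h3
    rw [show (fun a => F.cof a) = fun a => form1 (F.θ a) from rfl, h3]
    congr 1
    rw [mul_left_comm, Real.mul_self_sqrt (abs_nonneg _)]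
  rw [h2, sgn]
  congr 1
  rcases lt_or_gt_of_ne h.det_g with hg | hg
  · rw [abs_of_neg hg, sign_neg hg]; have := h.det_g; simp; field_simp
  · rw [abs_of_pos hg, sign_pos hg]; have := h.det_g; simp; field_simp

/-- The Hodge dual is an involution up to a sign. -/
theorem Regular.star_interior (h : F.Regular) (ω : Cov D) (α : Form D) :
    F.star (interior (F.sharp ω) α) = -(form1 ω * F.star (inv α)) := by
  rw [h.form1_mul_star, inv_inv, neg_neg]

theorem star_inv (α : Form D) : F.star (inv α) = (-1 : ℝ) ^ D • inv (F.star α) := by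
  have h : ∀ β : Form D, Deg D β → inv β = (-1 : ℝ) ^ D • β := fun β hβ => hβ.inv_eq
  induction α using form_right_induction with
  | h0 r =>
    rw [inv_form0, star_form0, inv_smul, h _ F.deg_vol]
    rw [smul_comm, smul_smul ((-1) ^ D), ← mul_pow]; simp
  | ha α γ hα hβ => simp only [star_add, inv_add, smul_add, hα, hβ]
  | hm η α ih =>
    simp only [inv_mul, inv_form1, mul_neg, star_neg, star_mul_form1, ih, interior_smul,
      interior_inv, smul_neg, neg_neg]

/-- The familiar sign `s (-1)^{p(D-p)}` is `s (-1)^p` for even `D` and `s` for odd `D`, which allows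
a formulation without homogeneity. In the inductive step the outer star turns the contraction back
into a multiplication by `η`. -/
theorem Regular.star_star (h : F.Regular) (α : Form D) :
    F.star (F.star α) = F.sgn • (if Even D then inv α else α) := by
  induction α using form_right_induction with
  | h0 r => rw [star_form0, star_smul, h.star_vol, inv_form0, ite_self, form0_eq_smul, smul_comm]
  | ha α γ hα hβ => simp only [star_add, inv_add, hα, hβ]; split_ifs <;> simp
  | hm η α ih =>
    rw [star_mul_form1, h.star_interior]
    have h1 : F.star (inv (F.star α)) = (-1 : ℝ) ^ D • inv (F.star (F.star α)) := star_inv _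
    rw [h1, ih]
    split_ifs with hD
    · rw [hD.neg_one_pow]; simp [mul_form1_comm]
    · rw [(Nat.not_even_iff_odd.1 hD).neg_one_pow]; simp [mul_form1_comm]

/-! ### The Hodge pairing -/

/-- The Hodge pairing `α ∧ ⋆β`, as a number. -/
def pair (F : Frame D) (α β : Form D) : ℝ := top (α * F.star β)

@[simp] theorem pair_add_left (α β γ : Form D) :
    F.pair (α + β) γ = F.pair α γ + F.pair β γ := by simp [pair, add_mul]
@[simp] theorem pair_zero_left (γ : Form D) : F.pair 0 γ = 0 := by simp [pair]
@[simp] theorem pair_smul_left (r : ℝ) (α γ : Form D) : F.pair (r • α) γ = r * F.pair α γ := by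
  simp [pair]
theorem pair_sum_left {ι : Type*} (s : Finset ι) (f : ι → Form D) (γ : Form D) :
    F.pair (∑ i ∈ s, f i) γ = ∑ i ∈ s, F.pair (f i) γ := by simp [pair, Finset.sum_mul, top_sum]
@[simp] theorem pair_add_right (α β γ : Form D) :
    F.pair γ (α + β) = F.pair γ α + F.pair γ β := by simp [pair, mul_add]
@[simp] theorem pair_neg_right (α γ : Form D) : F.pair γ (-α) = -F.pair γ α := by simp [pair]
@[simp] theorem pair_zero_right (γ : Form D) : F.pair γ 0 = 0 := by simp [pair]
@[simp] theorem pair_smul_right (r : ℝ) (α γ : Form D) : F.pair γ (r • α) = r * F.pair γ α := by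
  simp [pair]
theorem pair_sum_right {ι : Type*} (s : Finset ι) (f : ι → Form D) (γ : Form D) :
    F.pair γ (∑ i ∈ s, f i) = ∑ i ∈ s, F.pair γ (f i) := by
  simp [pair, Finset.mul_sum, top_sum, star_sum]

theorem Regular.pair_mul_form1_left (h : F.Regular) (ω : Cov D) (α β : Form D) :
    F.pair (α * form1 ω) β = -F.pair α (interior (F.sharp ω) (inv β)) := by
  rw [pair, mul_assoc, h.form1_mul_star]; simp [pair]

/-- The contraction of `inv β ∧ ⋆α` has no top-degree part, so by the graded Leibniz rule the
contraction can be moved from one factor to the other. -/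
theorem pair_mul_form1_right (ω : Cov D) (α β : Form D) :
    F.pair β (α * form1 ω) = -F.pair (interior (F.sharp ω) (inv β)) α := by
  have h1 := top_interior (F.sharp ω) (inv β * F.star α)
  rw [interior_mul, inv_inv, top_add] at h1
  rw [pair, star_mul_form1, pair]; linarith

/-- Removing a 1-form from the left or from the right argument gives the same recursion, so
induction reduces symmetry to 0-forms. The shape of the metric never enters, only its symmetry. -/
theorem Regular.pair_comm (h : F.Regular) (α β : Form D) : F.pair α β = F.pair β α := by
  induction α using form_right_induction generalizing β with
  | h0 r =>
    induction β using form_right_induction with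
    | h0 s => simp only [form0_eq_smul, pair_smul_left, pair_smul_right]; ring
    | ha α γ hα hβ => simp only [pair_add_left, pair_add_right, hα, hβ]
    | hm η α ih => rw [pair_mul_form1_right, h.pair_mul_form1_left]; simp
  | ha α γ hα hβ => simp only [pair_add_left, pair_add_right, hα, hβ]
  | hm η α ih => rw [pair_mul_form1_right, h.pair_mul_form1_left, ih]

theorem pair_inv (α β : Form D) : F.pair (inv α) (inv β) = F.pair α β := by
  have h1 := top_inv (α * F.star β)
  rw [inv_mul] at h1
  rw [pair, star_inv, mul_smul_comm, top_smul, h1, ← mul_assoc, ← mul_pow]; simp [pair]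

/-- The basic adjunction; every adjoint pair of tensor operations below is this one with indices
attached. -/
theorem Regular.pair_form1_mul_left (h : F.Regular) (ω : Cov D) (α β : Form D) :
    F.pair (form1 ω * α) β = F.pair α (interior (F.sharp ω) β) := by
  rw [form1_mul_comm, h.pair_mul_form1_left, ← pair_inv, inv_inv, interior_inv]; simp

end Frame
end MAG
end

/-! ### Index calculus with the frame and the coframe. -/

noncomputable section

namespace MAG

variable {D : ℕ}

/-- Covector-valued forms. -/
abbrev VForm (D : ℕ) := Fin D → Form D

/-- Forms with two indices. -/
abbrev TForm (D : ℕ) := Fin D → Fin D → Form D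

theorem eq_zero_of_eq_neg {α : Form D} (h : α = -α) : α = 0 := by
  have h1 : (2 : ℝ) • α = 0 := by rw [two_smul]; nth_rewrite 1 [h]; simp
  simpa using h1

/-! ### Interior and exterior products with the frame -/

namespace Frame

variable (F : Frame D)

@[simp] theorem ip_add (a : Fin D) (α β : Form D) : F.ip a (α + β) = F.ip a α + F.ip a β :=
  interior_add _ _ _
@[simp] theorem ip_sub (a : Fin D) (α β : Form D) : F.ip a (α - β) = F.ip a α - F.ip a β :=
  interior_sub _ _ _
@[simp] theorem ip_neg (a : Fin D) (α : Form D) : F.ip a (-α) = -F.ip a α := interior_neg _ _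
@[simp] theorem ip_zero (a : Fin D) : F.ip a 0 = 0 := interior_zero _
@[simp] theorem ip_smul (a : Fin D) (r : ℝ) (α : Form D) : F.ip a (r • α) = r • F.ip a α :=
  interior_smul _ _ _
theorem ip_sum {ι : Type*} (a : Fin D) (s : Finset ι) (f : ι → Form D) :
    F.ip a (∑ i ∈ s, f i) = ∑ i ∈ s, F.ip a (f i) := interior_sum _ _ _

/-- The vector `e^a`. -/
def eU (a : Fin D) : Module.Dual ℝ (Cov D) := ∑ b, F.gi a b • F.e b

theorem ipU_eq (a : Fin D) (α : Form D) : F.ipU a α = interior (F.eU a) α := by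
  simp [ipU, eU, interior_vec_sum, interior_vec_smul, ip]

@[simp] theorem ipU_add (a : Fin D) (α β : Form D) : F.ipU a (α + β) = F.ipU a α + F.ipU a β := by
  simp [ipU_eq]
@[simp] theorem ipU_neg (a : Fin D) (α : Form D) : F.ipU a (-α) = -F.ipU a α := by simp [ipU_eq]
@[simp] theorem ipU_smul (a : Fin D) (r : ℝ) (α : Form D) : F.ipU a (r • α) = r • F.ipU a α := by
  simp [ipU_eq]
theorem ipU_sum {ι : Type*} (a : Fin D) (s : Finset ι) (f : ι → Form D) :
    F.ipU a (∑ i ∈ s, f i) = ∑ i ∈ s, F.ipU a (f i) := by simp only [ipU_eq, interior_sum]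

theorem ip_ip_comm (a b : Fin D) (α : Form D) : F.ip a (F.ip b α) = -F.ip b (F.ip a α) :=
  interior_comm _ _ _
theorem ipU_ip_comm (a b : Fin D) (α : Form D) : F.ipU a (F.ip b α) = -F.ip b (F.ipU a α) := by
  simp only [ipU_eq]; exact interior_comm _ _ _
theorem ipU_ipU_comm (a b : Fin D) (α : Form D) : F.ipU a (F.ipU b α) = -F.ipU b (F.ipU a α) := by
  simp only [ipU_eq]; exact interior_comm _ _ _

theorem cof_mul_cofL_mul (a b : Fin D) (α : Form D) :
    F.cof a * (F.cofL b * α) = -(F.cofL b * (F.cof a * α)) := by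
  rw [cofL_eq]; exact form1_mul_form1_mul _ _ _
theorem cof_mul_cof_mul (a b : Fin D) (α : Form D) :
    F.cof a * (F.cof b * α) = -(F.cof b * (F.cof a * α)) := form1_mul_form1_mul _ _ _
theorem cofL_mul_cofL_mul (a b : Fin D) (α : Form D) :
    F.cofL a * (F.cofL b * α) = -(F.cofL b * (F.cofL a * α)) := by
  simp only [cofL_eq]; exact form1_mul_form1_mul _ _ _

theorem deg_cof (a : Fin D) : Deg 1 (F.cof a) := Deg.form1 _
theorem deg_cofL (a : Fin D) : Deg 1 (F.cofL a) := by rw [cofL_eq]; exact Deg.form1 _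

variable {F}

/-- Raising the index of a covector-valued form. -/
def upV (F : Frame D) (V : VForm D) (a : Fin D) : Form D := ∑ b, F.gi a b • V b

theorem Regular.ip_cof_mul (h : F.Regular) (a b : Fin D) (α : Form D) :
    F.ip a (F.cof b * α) = (if a = b then α else 0) - F.cof b * F.ip a α := by
  rw [ip, cof, interior_form1_mul, h.e_θ]; simp [ite_smul, ip]

theorem Regular.ipU_cof_mul (h : F.Regular) (a b : Fin D) (α : Form D) :
    F.ipU a (F.cof b * α) = F.gi a b • α - F.cof b * F.ipU a α := by
  simp [ipU, h.ip_cof_mul, smul_sub, Finset.sum_sub_distrib, Finset.mul_sum]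

theorem Regular.ip_cofL_mul (h : F.Regular) (a b : Fin D) (α : Form D) :
    F.ip a (F.cofL b * α) = F.g a b • α - F.cofL b * F.ip a α := by
  simp [cofL, Finset.sum_mul, ip_sum, h.ip_cof_mul, smul_sub, h.g_comm b a]

theorem Regular.ipU_cofL_mul (h : F.Regular) (a b : Fin D) (α : Form D) :
    F.ipU a (F.cofL b * α) = (if a = b then α else 0) - F.cofL b * F.ipU a α := by
  simp only [ipU, h.ip_cofL_mul, smul_sub, Finset.sum_sub_distrib, Finset.mul_sum, smul_smul,
    mul_smul_comm, ← Finset.sum_smul, h.gi_mul_g, ite_smul, one_smul, zero_smul]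

theorem Regular.cof_mul_ip (h : F.Regular) (a b : Fin D) (α : Form D) :
    F.cof b * F.ip a α = (if a = b then α else 0) - F.ip a (F.cof b * α) := by
  rw [h.ip_cof_mul]; abel

theorem Regular.upV_cofL (h : F.Regular) (a : Fin D) : F.upV F.cofL a = F.cof a := by
  simp only [upV, cofL, Finset.smul_sum, smul_smul]
  rw [Finset.sum_comm]
  simp [← Finset.sum_smul, h.gi_mul_g]

theorem Regular.low1_upV (h : F.Regular) (V : VForm D) : F.low1 (F.upV V) = V := by
  funext a
  simp only [upV, low1, Finset.smul_sum, smul_smul]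
  rw [Finset.sum_comm]
  simp [← Finset.sum_smul, h.g_mul_gi]

theorem Regular.upV_low1 (h : F.Regular) (V : VForm D) : F.upV (F.low1 V) = V := by
  funext a
  simp only [upV, low1, Finset.smul_sum, smul_smul]
  rw [Finset.sum_comm]
  simp [← Finset.sum_smul, h.gi_mul_g]

theorem Regular.ip_eq_sum (h : F.Regular) (a : Fin D) (α : Form D) :
    F.ip a α = ∑ b, F.g a b • F.ipU b α :=
  (congrFun (h.low1_upV (fun b => F.ip b α)) a).symm

/-- Contraction over an upper and a lower index. -/
theorem Regular.sum_upV_left (h : F.Regular) (B : Form D → Form D → Form D)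
    (hadd : ∀ x y z, B (x + y) z = B x z + B y z) (hadd' : ∀ x y z, B x (y + z) = B x y + B x z)
    (hs : ∀ (r : ℝ) x y, B (r • x) y = r • B x y) (hs' : ∀ (r : ℝ) x y, B x (r • y) = r • B x y)
    (V U : VForm D) : ∑ a, B (F.upV V a) (U a) = ∑ a, B (V a) (F.upV U a) := by
  have hB : ∀ x y, B x y = LinearMap.mk₂ ℝ B hadd hs hadd' hs' x y := fun _ _ => rfl
  simp only [hB, upV, map_sum, map_smul, LinearMap.sum_apply, LinearMap.smul_apply]
  rw [Finset.sum_comm]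
  refine Finset.sum_congr rfl fun a _ => Finset.sum_congr rfl fun b _ => ?_
  rw [h.gi_comm]

theorem Regular.sum_cof_mul (h : F.Regular) (V : VForm D) :
    ∑ a, F.cof a * V a = ∑ a, F.cofL a * F.upV V a := by
  have := h.sum_upV_left (fun x y => x * y) (fun _ _ _ => add_mul _ _ _) (fun _ _ _ => mul_add _ _ _)
    (fun _ _ _ => smul_mul_assoc _ _ _) (fun _ _ _ => mul_smul_comm _ _ _) F.cofL V
  simpa only [h.upV_cofL] using this

theorem Regular.sum_mul_cofL (h : F.Regular) (V : VForm D) :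
    ∑ a, F.upV V a * F.cofL a = ∑ a, V a * F.cof a := by
  have := h.sum_upV_left (fun x y => x * y) (fun _ _ _ => add_mul _ _ _) (fun _ _ _ => mul_add _ _ _)
    (fun _ _ _ => smul_mul_assoc _ _ _) (fun _ _ _ => mul_smul_comm _ _ _) V F.cofL
  simpa only [h.upV_cofL] using this

theorem Regular.sum_ip_upV (h : F.Regular) (V : VForm D) :
    ∑ a, F.ip a (F.upV V a) = ∑ a, F.ipU a (V a) := by
  simp only [upV, ipU, ip_sum, ip_smul]
  rw [Finset.sum_comm]
  refine Finset.sum_congr rfl fun a _ => Finset.sum_congr rfl fun b _ => ?_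
  rw [h.gi_comm]

/-- Replacing a dual pair of coordinate bases by the frame and the coframe. -/
theorem Regular.sum_frame (h : F.Regular) (f : Cov D →ₗ[ℝ] Form D) (α : Form D) :
    ∑ a, f (F.θ a) * F.ip a α = ∑ μ, f (Pi.single μ 1) * interior (pd μ) α := by
  have h1 : ∀ a, f (F.θ a) = ∑ μ, F.θ a μ • f (Pi.single μ 1) := by
    intro a
    conv_lhs => rw [← (Pi.basisFun ℝ (Fin D)).sum_repr (F.θ a)]
    simp
  simp only [h1, ip, e_eq_sum, interior_vec_sum, interior_vec_smul, Finset.sum_mul, Finset.mul_sum,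
    smul_mul_smul_comm]
  rw [Finset.sum_comm]
  refine Finset.sum_congr rfl fun μ _ => ?_
  rw [Finset.sum_comm]
  have h2 : ∀ ν, ∑ a, F.θ a ν * F.θ⁻¹ μ a = if μ = ν then 1 else 0 := by
    intro ν
    have := congrFun₂ (Matrix.nonsing_inv_mul F.θ h.isUnit_θ) μ ν
    rw [Matrix.mul_apply, Matrix.one_apply] at this
    rw [← this]; exact Finset.sum_congr rfl fun _ _ => mul_comm _ _
  refine (Finset.sum_congr rfl fun ν _ => Finset.sum_smul.symm.trans
    (congrArg (· • (f (Pi.single ν 1) * interior (pd μ) α)) (h2 ν))).trans ?_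
  simp

/-- Frame and coframe are dual bases, so the sum may be taken in the coordinate bases, where it is
the Euler operator by definition. -/
theorem Regular.sum_cof_mul_ip (h : F.Regular) (α : Form D) :
    ∑ a, F.cof a * F.ip a α = euler α :=
  h.sum_frame (ExteriorAlgebra.ι ℝ) α

theorem Regular.sum_cofL_mul_ipU (h : F.Regular) (α : Form D) :
    ∑ a, F.cofL a * F.ipU a α = euler α := by
  rw [← h.sum_cof_mul_ip, h.sum_cof_mul]; rfl

/-- The symmetric inverse metric is contracted with two anticommuting interior products. -/
theorem Regular.sum_ipU_ip (h : F.Regular) (α : Form D) : ∑ a, F.ipU a (F.ip a α) = 0 := by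
  have h1 : ∑ a, F.ipU a (F.ip a α) = -∑ a, F.ipU a (F.ip a α) := by
    conv_lhs => simp only [ipU_ip_comm, Finset.sum_neg_distrib]
    congr 1
    exact h.sum_ip_upV (fun a => F.ip a α)
  exact eq_zero_of_eq_neg h1

theorem Regular.sum_cof_mul_cofL_mul (h : F.Regular) (α : Form D) :
    ∑ a, F.cof a * (F.cofL a * α) = 0 := by
  have h1 : ∑ a, F.cof a * (F.cofL a * α) = -∑ a, F.cof a * (F.cofL a * α) := by
    conv_lhs => simp only [cof_mul_cofL_mul, Finset.sum_neg_distrib]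
    congr 1
    rw [h.sum_cof_mul]
    refine Finset.sum_congr rfl fun a _ => ?_
    congr 1
    rw [← h.upV_cofL a]; simp [upV, Finset.sum_mul]
  exact eq_zero_of_eq_neg h1

/-! ### The Hodge dual and the frame -/

theorem Regular.sharp_eq_eU (h : F.Regular) (a : Fin D) : F.sharp (F.θ a) = F.eU a := h.sharp_θ a

theorem Regular.star_mul_cofL (h : F.Regular) (a : Fin D) (α : Form D) :
    F.star (α * F.cofL a) = F.ip a (F.star α) := by
  rw [cofL_eq, star_mul_form1, h.sharp_θL]; rfl

theorem Regular.star_mul_cof (h : F.Regular) (a : Fin D) (α : Form D) :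
    F.star (α * F.cof a) = F.ipU a (F.star α) := by
  rw [cof, star_mul_form1, h.sharp_eq_eU, ipU_eq]

theorem Regular.cofL_mul_star (h : F.Regular) (a : Fin D) (α : Form D) :
    F.cofL a * F.star α = -F.star (F.ip a (inv α)) := by
  rw [cofL_eq, h.form1_mul_star, h.sharp_θL]; rfl

theorem Regular.cof_mul_star (h : F.Regular) (a : Fin D) (α : Form D) :
    F.cof a * F.star α = -F.star (F.ipU a (inv α)) := by
  rw [cof, h.form1_mul_star, h.sharp_eq_eU, ipU_eq]

theorem Regular.pair_cof_left (h : F.Regular) (a : Fin D) (α β : Form D) :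
    F.pair (F.cof a * α) β = F.pair α (F.ipU a β) := by
  rw [cof, h.pair_form1_mul_left, h.sharp_eq_eU, ipU_eq]
theorem Regular.pair_cof_right (h : F.Regular) (a : Fin D) (α β : Form D) :
    F.pair α (F.cof a * β) = F.pair (F.ipU a α) β := by
  rw [h.pair_comm, h.pair_cof_left, h.pair_comm]

end Frame

theorem Deg.mul_form1_comm {α : Form D} (h : Deg 2 α) (ω : Cov D) :
    α * MAG.form1 ω = MAG.form1 ω * α := by
  rw [MAG.mul_form1_comm, Deg.inv_eq (p := 2) (by exact_mod_cast h)]; simp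

end MAG
end

/-! ### Operators on forms with one or two indices, and their adjoints. -/

noncomputable section

namespace MAG

variable {D : ℕ}

/-- Covector-valued forms of degree `r`. -/
def VDeg (r : ℝ) (V : VForm D) : Prop := ∀ a, Deg r (V a)

/-- Tensor-valued forms of degree `r`. -/
def TDeg (r : ℝ) (A : TForm D) : Prop := ∀ a b, Deg r (A a b)

namespace Frame

/-! ### Tensor operations -/

variable (F : Frame D)

/-- The transpose `A_{ba}`. -/
def tp : TForm D →ₗ[ℝ] TForm D where
  toFun A a b := A b a
  map_add' _ _ := rfl
  map_smul' _ _ := rfl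

/-- The symmetrization. -/
def sy : TForm D →ₗ[ℝ] TForm D := (1 / 2 : ℝ) • (LinearMap.id + tp)

/-- The antisymmetrization. -/
def asy : TForm D →ₗ[ℝ] TForm D := (1 / 2 : ℝ) • (LinearMap.id - tp)

/-- The trace `A_c{}^c`. -/
def tr : TForm D →ₗ[ℝ] Form D where
  toFun A := F.trace A
  map_add' A B := by simp [trace, Finset.sum_add_distrib]
  map_smul' r A := by simp [trace, Finset.smul_sum, smul_comm r]

/-- The tensor `g_{ab} ω`. -/
def trA : Form D →ₗ[ℝ] TForm D where
  toFun ω a b := F.g a b • ω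
  map_add' _ _ := by ext; simp
  map_smul' r _ := by ext; simp [smul_comm r]

/-- The contraction `e^a ⌟ A_{ab}`. -/
def con : TForm D →ₗ[ℝ] VForm D where
  toFun A b := ∑ a, F.ipU a (A a b)
  map_add' _ _ := by ext; simp [Finset.sum_add_distrib]
  map_smul' r _ := by ext; simp [Finset.smul_sum]

/-- The tensor `ϑ_a ∧ V_b`. -/
def conA : VForm D →ₗ[ℝ] TForm D where
  toFun V a b := F.cofL a * V b
  map_add' _ _ := by ext; simp [mul_add]
  map_smul' r _ := by ext; simp

/-- The contraction `ϑ^a ∧ A_{ab}`. -/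
def wed : TForm D →ₗ[ℝ] VForm D where
  toFun A b := ∑ a, F.cof a * A a b
  map_add' _ _ := by ext; simp [mul_add, Finset.sum_add_distrib]
  map_smul' r _ := by ext; simp [Finset.smul_sum]

/-- The tensor `e_a ⌟ V_b`. -/
def wedA : VForm D →ₗ[ℝ] TForm D where
  toFun V a b := F.ip a (V b)
  map_add' _ _ := by ext; simp
  map_smul' r _ := by ext; simp

/-- The contraction `e^a ⌟ V_a`. -/
def div : VForm D →ₗ[ℝ] Form D where
  toFun V := ∑ a, F.ipU a (V a)
  map_add' _ _ := by simp [Finset.sum_add_distrib]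
  map_smul' r _ := by simp [Finset.smul_sum]

/-- The covector-valued form `ϑ_a ∧ ω`. -/
def divA : Form D →ₗ[ℝ] VForm D where
  toFun ω a := F.cofL a * ω
  map_add' _ _ := by ext; simp [mul_add]
  map_smul' r _ := by ext; simp

/-- The contraction `ϑ^a ∧ V_a`. -/
def wdg : VForm D →ₗ[ℝ] Form D where
  toFun V := ∑ a, F.cof a * V a
  map_add' _ _ := by simp [mul_add, Finset.sum_add_distrib]
  map_smul' r _ := by simp [Finset.smul_sum]

/-- The covector-valued form `e_a ⌟ ω`. -/
def wdgA : Form D →ₗ[ℝ] VForm D where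
  toFun ω a := F.ip a ω
  map_add' _ _ := by ext; simp
  map_smul' r _ := by ext; simp

/-- The trace-free part. -/
def fr : TForm D →ₗ[ℝ] TForm D := LinearMap.id - (1 / (D : ℝ)) • F.trA ∘ₗ F.tr

theorem tp_apply (A : TForm D) (a b : Fin D) : tp A a b = A b a := rfl
theorem sy_eq (A : TForm D) : sy A = (1 / 2 : ℝ) • (A + tp A) := rfl
theorem asy_eq (A : TForm D) : asy A = (1 / 2 : ℝ) • (A - tp A) := rfl
theorem sy_apply (A : TForm D) (a b : Fin D) : sy A a b = (1 / 2 : ℝ) • (A a b + A b a) := rfl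
theorem asy_apply (A : TForm D) (a b : Fin D) : asy A a b = (1 / 2 : ℝ) • (A a b - A b a) := rfl
theorem symm_eq_sy (A : TForm D) : MAG.symm A = sy A := rfl
theorem tr_apply (A : TForm D) : F.tr A = F.trace A := rfl
theorem trA_apply (ω : Form D) (a b : Fin D) : F.trA ω a b = F.g a b • ω := rfl
theorem con_apply (A : TForm D) (b : Fin D) : F.con A b = ∑ a, F.ipU a (A a b) := rfl
theorem conA_apply (V : VForm D) (a b : Fin D) : F.conA V a b = F.cofL a * V b := rfl
theorem wed_apply (A : TForm D) (b : Fin D) : F.wed A b = ∑ a, F.cof a * A a b := rfl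
theorem wedA_apply (V : VForm D) (a b : Fin D) : F.wedA V a b = F.ip a (V b) := rfl
theorem div_apply (V : VForm D) : F.div V = ∑ a, F.ipU a (V a) := rfl
theorem divA_apply (ω : Form D) (a : Fin D) : F.divA ω a = F.cofL a * ω := rfl
theorem wdg_apply (V : VForm D) : F.wdg V = ∑ a, F.cof a * V a := rfl
theorem wdgA_apply (ω : Form D) (a : Fin D) : F.wdgA ω a = F.ip a ω := rfl
theorem fr_eq (A : TForm D) : F.fr A = A - (1 / (D : ℝ)) • F.trA (F.tr A) := rfl

theorem tp_tp (A : TForm D) : tp (tp A) = A := rfl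
theorem tp_sy (A : TForm D) : tp (sy A) = sy A := by
  ext a b; simp only [tp_apply, sy_apply, add_comm]
theorem tp_asy (A : TForm D) : tp (asy A) = -asy A := by
  ext a b; simp only [tp_apply, asy_apply, Pi.neg_apply]; module
theorem sy_of_tp {A : TForm D} (h : tp A = A) : sy A = A := by rw [sy_eq, h]; module
theorem asy_of_tp {A : TForm D} (h : tp A = -A) : asy A = A := by rw [asy_eq, h]; module
theorem sy_add_asy (A : TForm D) : sy A + asy A = A := by rw [sy_eq, asy_eq]; module

variable {F}

/-! #### Relations between the operations -/

/-- Moving `e^a` past `ϑ_a` gives `D` from the Kronecker delta, and the remaining `ϑ_a ∧ e^a ⌟` is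
the Euler operator, which gives the degree. With the indices of `ϑ_a ∧ V_b` exchanged the delta
selects a single term instead. These two mechanisms produce all the `D`-dependent constants. -/
theorem Regular.con_conA (h : F.Regular) {r : ℝ} {V : VForm D} (hV : VDeg r V) :
    F.con (F.conA V) = ((D : ℝ) - r) • V := by
  ext b : 1
  have : euler (V b) = r • V b := hV b
  simp only [con_apply, conA_apply, Pi.smul_apply]
  simp [h.ipU_cofL_mul, Finset.sum_sub_distrib, h.sum_cofL_mul_ipU, this, sub_smul, Nat.cast_smul_eq_nsmul]

theorem Regular.con_tp_conA (h : F.Regular) (V : VForm D) :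
    F.con (tp (F.conA V)) = V - F.divA (F.div V) := by
  ext b : 1
  simp [con_apply, conA_apply, tp_apply, divA_apply, div_apply, h.ipU_cofL_mul,
    Finset.sum_sub_distrib]

theorem Regular.con_sy_conA (h : F.Regular) {r : ℝ} {V : VForm D} (hV : VDeg r V) :
    F.con (sy (F.conA V)) = (1 / 2 : ℝ) • (((D : ℝ) - r + 1) • V - F.divA (F.div V)) := by
  rw [sy_eq, map_smul, map_add, h.con_conA hV, h.con_tp_conA]; module

theorem Regular.con_asy_conA (h : F.Regular) {r : ℝ} {V : VForm D} (hV : VDeg r V) :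
    F.con (asy (F.conA V)) = (1 / 2 : ℝ) • (((D : ℝ) - r - 1) • V + F.divA (F.div V)) := by
  rw [asy_eq, map_smul, map_sub, h.con_conA hV, h.con_tp_conA]; module

theorem Regular.div_divA (h : F.Regular) {r : ℝ} {ω : Form D} (hω : Deg r ω) :
    F.div (F.divA ω) = ((D : ℝ) - r) • ω := by
  have : euler ω = r • ω := hω
  simp [div_apply, divA_apply, h.ipU_cofL_mul, Finset.sum_sub_distrib, h.sum_cofL_mul_ipU, this,
    sub_smul, Nat.cast_smul_eq_nsmul]

theorem Regular.div_wdgA (h : F.Regular) (ω : Form D) : F.div (F.wdgA ω) = 0 := h.sum_ipU_ip ω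

theorem Regular.wdg_wdgA (h : F.Regular) {r : ℝ} {ω : Form D} (hω : Deg r ω) :
    F.wdg (F.wdgA ω) = r • ω := (h.sum_cof_mul_ip ω).trans hω

theorem Regular.wdg_divA (h : F.Regular) (ω : Form D) : F.wdg (F.divA ω) = 0 :=
  h.sum_cof_mul_cofL_mul ω

theorem Regular.tr_eq_sum (h : F.Regular) (A : TForm D) :
    F.tr A = ∑ b, F.upV (fun a => A a b) b := by
  simp only [tr_apply, trace, upV]
  rw [Finset.sum_comm]
  simp only [h.gi_comm]

theorem Regular.tr_conA (h : F.Regular) (V : VForm D) : F.tr (F.conA V) = F.wdg V := by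
  rw [h.tr_eq_sum]
  refine Finset.sum_congr rfl fun b _ => ?_
  rw [← h.upV_cofL]; simp [upV, conA_apply, Finset.sum_mul]

theorem Regular.tr_wedA (h : F.Regular) (V : VForm D) : F.tr (F.wedA V) = F.div V := by
  rw [h.tr_eq_sum]; rfl

theorem Regular.tr_tp (h : F.Regular) (A : TForm D) : F.tr (tp A) = F.tr A := by
  simp only [tr_apply, trace, tp_apply]
  rw [Finset.sum_comm]
  simp only [h.gi_comm]

theorem Regular.tr_sy (h : F.Regular) (A : TForm D) : F.tr (sy A) = F.tr A := by
  rw [sy_eq, map_smul, map_add, h.tr_tp]; module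

theorem Regular.tr_trA (h : F.Regular) (ω : Form D) : F.tr (F.trA ω) = (D : ℝ) • ω := by
  simp only [tr_apply, trace, trA_apply, smul_smul, ← Finset.sum_smul]
  congr 1
  rw [Finset.sum_congr rfl fun a _ => Finset.sum_congr rfl fun b _ => by rw [h.g_comm a b]]
  simp [h.gi_mul_g]

theorem Regular.tp_trA (h : F.Regular) (ω : Form D) : tp (F.trA ω) = F.trA ω := by
  ext a b : 2; rw [tp_apply, trA_apply, h.g_comm]; rfl

theorem Regular.sy_trA (h : F.Regular) (ω : Form D) : sy (F.trA ω) = F.trA ω :=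
  sy_of_tp (h.tp_trA ω)

theorem Regular.tp_fr (h : F.Regular) (A : TForm D) : tp (F.fr A) = F.fr (tp A) := by
  rw [fr_eq, fr_eq, h.tr_tp, map_sub, map_smul, h.tp_trA]

theorem Regular.sy_fr (h : F.Regular) (A : TForm D) : sy (F.fr A) = F.fr (sy A) := by
  rw [sy_eq, sy_eq, h.tp_fr, ← map_add, map_smul]

theorem Regular.tr_fr (h : F.Regular) (hD : (D : ℝ) ≠ 0) (A : TForm D) : F.tr (F.fr A) = 0 := by
  rw [fr_eq, map_sub, map_smul, h.tr_trA, smul_smul]; simp [hD]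

theorem fr_of_tr {A : TForm D} (hA : F.tr A = 0) : F.fr A = A := by rw [fr_eq, hA]; simp

theorem Regular.con_trA (h : F.Regular) (ω : Form D) : F.con (F.trA ω) = F.wdgA ω := by
  ext b : 1
  rw [wdgA_apply, h.ip_eq_sum]
  simp [con_apply, trA_apply, h.g_comm b]

theorem Regular.wed_trA (h : F.Regular) (ω : Form D) : F.wed (F.trA ω) = F.divA ω := by
  ext b : 1
  simp [wed_apply, trA_apply, divA_apply, cofL, Finset.sum_mul, h.g_comm b]

theorem Regular.con_wedA (h : F.Regular) (V : VForm D) : F.con (F.wedA V) = 0 := by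
  ext b : 1; exact h.sum_ipU_ip (V b)

theorem Regular.wed_wedA (h : F.Regular) {r : ℝ} {V : VForm D} (hV : VDeg r V) :
    F.wed (F.wedA V) = r • V := by
  ext b : 1; exact (h.sum_cof_mul_ip (V b)).trans (hV b)

theorem Regular.wed_tp_wedA (h : F.Regular) (V : VForm D) :
    F.wed (tp (F.wedA V)) = V - F.wdgA (F.wdg V) := by
  ext b : 1
  simp [wed_apply, wedA_apply, tp_apply, wdgA_apply, wdg_apply, h.ip_cof_mul]

theorem con_tp_wedA (V : VForm D) : F.con (tp (F.wedA V)) = -F.wdgA (F.div V) := by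
  ext b : 1
  simp [con_apply, wedA_apply, tp_apply, wdgA_apply, div_apply, ipU_ip_comm]

theorem Regular.wed_conA (h : F.Regular) (V : VForm D) : F.wed (F.conA V) = 0 := by
  ext b : 1; exact h.sum_cof_mul_cofL_mul (V b)

theorem wed_tp_conA (V : VForm D) : F.wed (tp (F.conA V)) = -F.divA (F.wdg V) := by
  ext b : 1
  simp [wed_apply, conA_apply, tp_apply, divA_apply, wdg_apply, cof_mul_cofL_mul]

theorem Regular.tp_wedA_divA (h : F.Regular) (ω : Form D) :
    tp (F.wedA (F.divA ω)) = F.trA ω - F.conA (F.wdgA ω) := by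
  ext a b : 2
  simp [tp_apply, wedA_apply, divA_apply, trA_apply, conA_apply, wdgA_apply, h.ip_cofL_mul,
    h.g_comm b a]

theorem sy_tp (A : TForm D) : sy (tp A) = sy A := by rw [sy_eq, sy_eq, tp_tp, add_comm]

theorem Regular.sy_wedA_divA (h : F.Regular) (ω : Form D) :
    sy (F.wedA (F.divA ω)) = F.trA ω - sy (F.conA (F.wdgA ω)) := by
  rw [← sy_tp, h.tp_wedA_divA, map_sub, h.sy_trA]

/-- A symmetric tensor meets two anticommuting contractions. -/
theorem div_con_of_symm {A : TForm D} (hA : tp A = A) :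
    F.div (F.con A) = 0 := by
  refine eq_zero_of_eq_neg ?_
  have hA' : ∀ a b, A b a = A a b := fun a b => congrFun₂ hA a b
  simp only [div_apply, con_apply, ipU_sum, ← Finset.sum_neg_distrib]
  rw [Finset.sum_comm]
  refine Finset.sum_congr rfl fun a _ => Finset.sum_congr rfl fun b _ => ?_
  rw [ipU_ipU_comm, hA' a b]

theorem Regular.div_wed (h : F.Regular) (A : TForm D) :
    F.div (F.wed A) = F.tr A - F.wdg (F.con (tp A)) := by
  simp only [div_apply, wed_apply, wdg_apply, con_apply, ipU_sum, h.ipU_cof_mul,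
    Finset.sum_sub_distrib, tp_apply, Finset.mul_sum]
  rw [h.tr_eq_sum, Finset.sum_comm (f := fun x y => F.cof y * F.ipU x (A y x))]
  rfl

/-- Expresses the `v_2` term through the operations `wed` and `wedA`, whose adjoints are known. -/
theorem Regular.tInt_eq (h : F.Regular) (A : TForm D) :
    (fun a b => ∑ c, F.cof c * F.ip a (A c b)) = A - F.wedA (F.wed A) := by
  ext a b : 2
  simp [wedA_apply, wed_apply, ip_sum, h.ip_cof_mul]

end Frame

section Degrees

variable {F : Frame D} {r : ℝ}

theorem Deg.ipU {α : Form D} (h : Deg r α) (a : Fin D) : Deg (r - 1) (F.ipU a α) := by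
  rw [F.ipU_eq]; exact h.interior _
theorem VDeg.wed {A : TForm D} (hA : TDeg r A) : VDeg (r + 1) (F.wed A) := by
  intro b; rw [F.wed_apply, add_comm]; exact Deg.sum fun a => (F.deg_cof a).mul (hA a b)
theorem VDeg.con {A : TForm D} (hA : TDeg r A) : VDeg (r - 1) (F.con A) := by
  intro b; rw [F.con_apply]; exact Deg.sum fun a => (hA a b).ipU a
theorem Deg.tr {A : TForm D} (hA : TDeg r A) : Deg r (F.tr A) := by
  rw [F.tr_apply]; exact Deg.sum fun a => Deg.sum fun b => (hA a b).smul _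
theorem Deg.div {V : VForm D} (hV : VDeg r V) : Deg (r - 1) (F.div V) := by
  rw [F.div_apply]; exact Deg.sum fun a => (hV a).ipU a
theorem Deg.wdg {V : VForm D} (hV : VDeg r V) : Deg (r + 1) (F.wdg V) := by
  rw [F.wdg_apply, add_comm]; exact Deg.sum fun a => (F.deg_cof a).mul (hV a)
theorem VDeg.wdgA {ω : Form D} (hω : Deg r ω) : VDeg (r - 1) (F.wdgA ω) := by
  intro a; rw [F.wdgA_apply]; exact hω.interior _
theorem VDeg.divA {ω : Form D} (hω : Deg r ω) : VDeg (r + 1) (F.divA ω) := by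
  intro a; rw [F.divA_apply, add_comm]; exact (F.deg_cofL a).mul hω
theorem VDeg.add {V U : VForm D} (hV : VDeg r V) (hU : VDeg r U) : VDeg r (V + U) :=
  fun a => Deg.add (hV a) (hU a)
theorem VDeg.sub {V U : VForm D} (hV : VDeg r V) (hU : VDeg r U) : VDeg r (V - U) :=
  fun a => Deg.sub (hV a) (hU a)
theorem VDeg.smul {V : VForm D} (s : ℝ) (hV : VDeg r V) : VDeg r (s • V) :=
  fun a => Deg.smul s (hV a)
theorem VDeg.cast {s : ℝ} {V : VForm D} (hV : VDeg r V) (e : r = s) : VDeg s V := e ▸ hV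
theorem TDeg.sy {A : TForm D} (hA : TDeg r A) : TDeg r (Frame.sy A) := by
  intro a b; rw [Frame.sy_apply]; exact Deg.smul _ (Deg.add (hA a b) (hA b a))
theorem TDeg.asy {A : TForm D} (hA : TDeg r A) : TDeg r (Frame.asy A) := by
  intro a b; rw [Frame.asy_apply]; exact Deg.smul _ (Deg.sub (hA a b) (hA b a))
theorem TDeg.fr {A : TForm D} (hA : TDeg r A) : TDeg r (F.fr A) := by
  intro a b; rw [F.fr_eq]
  exact Deg.sub (hA a b) (Deg.smul _ (Deg.smul _ (Deg.tr hA)))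

end Degrees

namespace Frame

variable {F : Frame D}

/-! #### Pairings of tensors -/

/-- The pairing `V_a ∧ ⋆U^a`. -/
def pV (F : Frame D) : VForm D →ₗ[ℝ] VForm D →ₗ[ℝ] ℝ :=
  LinearMap.mk₂ ℝ (fun V U => ∑ a, F.pair (V a) (F.upV U a))
    (by intros; simp [Finset.sum_add_distrib]) (by intros; simp [Finset.mul_sum])
    (by intros; simp [upV, Finset.sum_add_distrib])
    (by intros; simp [upV, Finset.mul_sum, pair_sum_right, mul_left_comm])

/-- The pairing `A_{ab} ∧ ⋆B^{ab}`. -/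
def pT (F : Frame D) : TForm D →ₗ[ℝ] TForm D →ₗ[ℝ] ℝ :=
  LinearMap.mk₂ ℝ (fun A B => ∑ a, ∑ b, F.pair (A a b) (F.up2 B a b))
    (by intros; simp [Finset.sum_add_distrib]) (by intros; simp [Finset.mul_sum])
    (by intros; simp [up2, Finset.sum_add_distrib])
    (by intros; simp [up2, Finset.mul_sum, pair_sum_right, mul_left_comm])

theorem pV_apply (V U : VForm D) : F.pV V U = ∑ a, F.pair (V a) (F.upV U a) := rfl
theorem pT_apply (A B : TForm D) : F.pT A B = ∑ a, ∑ b, F.pair (A a b) (F.up2 B a b) := rfl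

theorem Regular.pV_comm (h : F.Regular) (V U : VForm D) : F.pV V U = F.pV U V := by
  simp only [pV_apply, upV, pair_sum_right, pair_smul_right]
  rw [Finset.sum_comm]
  refine Finset.sum_congr rfl fun a _ => Finset.sum_congr rfl fun b _ => ?_
  rw [h.gi_comm, h.pair_comm]

theorem Regular.pT_comm (h : F.Regular) (A B : TForm D) : F.pT A B = F.pT B A := by
  have key : ∀ A B : TForm D, F.pT A B = ∑ x : Fin D × Fin D, ∑ y : Fin D × Fin D,
      F.gi x.1 y.1 * F.gi x.2 y.2 * F.pair (A x.1 x.2) (B y.1 y.2) := by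
    intro A B
    simp only [pT_apply, up2, pair_sum_right, pair_smul_right, Fintype.sum_prod_type]
  rw [key, key, Finset.sum_comm]
  refine Finset.sum_congr rfl fun x _ => Finset.sum_congr rfl fun y _ => ?_
  rw [h.gi_comm x.1, h.gi_comm x.2, h.pair_comm]

theorem Regular.up2_conA (h : F.Regular) (V : VForm D) (a b : Fin D) :
    F.up2 (F.conA V) a b = F.cof a * F.upV V b := by
  rw [← h.upV_cofL]
  simp only [up2, upV, conA_apply, Finset.sum_mul, Finset.mul_sum, smul_mul_smul_comm]
  rw [Finset.sum_comm]

theorem up2_wedA (V : VForm D) (a b : Fin D) :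
    F.up2 (F.wedA V) a b = F.ipU a (F.upV V b) := by
  simp [up2, upV, wedA_apply, ipU, Finset.smul_sum, smul_smul, ip_sum]

theorem Regular.up2_trA (h : F.Regular) (ω : Form D) (a b : Fin D) :
    F.up2 (F.trA ω) a b = F.gi a b • ω := by
  simp only [up2, trA_apply, smul_smul, ← Finset.sum_smul]
  congr 1
  have : ∀ c, ∑ d, F.gi a c * F.gi b d * F.g c d = F.gi a c * if b = c then 1 else 0 := by
    intro c
    rw [← h.gi_mul_g b c, Finset.mul_sum]
    refine Finset.sum_congr rfl fun d _ => ?_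
    rw [h.g_comm c d]; ring
  simp [this]

/-- In this and the next four results, multiplication by `ϑ` on one side of the pairing is traded
for contraction on the other, or the metric is moved across. The adjoint pairs are `conA`/`con`,
`wedA`/`wed`, `trA`/`tr`, `divA`/`div` and `wdgA`/`wdg`. -/
theorem Regular.pT_conA (h : F.Regular) (A : TForm D) (V : VForm D) :
    F.pT A (F.conA V) = F.pV (F.con A) V := by
  simp only [pT_apply, h.up2_conA, h.pair_cof_right, pV_apply, con_apply, pair_sum_left]
  exact Finset.sum_comm

theorem Regular.pT_wedA (h : F.Regular) (A : TForm D) (V : VForm D) :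
    F.pT A (F.wedA V) = F.pV (F.wed A) V := by
  simp only [pT_apply, up2_wedA, ← h.pair_cof_left, pV_apply, wed_apply, pair_sum_left]
  exact Finset.sum_comm

theorem Regular.pT_trA (h : F.Regular) (A : TForm D) (ω : Form D) :
    F.pT A (F.trA ω) = F.pair (F.tr A) ω := by
  simp [pT_apply, h.up2_trA, tr_apply, trace, pair_sum_left]

theorem Regular.pV_divA (h : F.Regular) (V : VForm D) (ω : Form D) :
    F.pV V (F.divA ω) = F.pair (F.div V) ω := by
  have : ∀ a, F.upV (F.divA ω) a = F.cof a * ω := by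
    intro a; rw [← h.upV_cofL]; simp [upV, divA_apply, Finset.sum_mul]
  simp [pV_apply, this, h.pair_cof_right, div_apply, pair_sum_left]

theorem Regular.pV_wdgA (h : F.Regular) (V : VForm D) (ω : Form D) :
    F.pV V (F.wdgA ω) = F.pair (F.wdg V) ω := by
  have : ∀ a, F.upV (F.wdgA ω) a = F.ipU a ω := fun a => rfl
  simp [pV_apply, this, h.pair_cof_left, wdg_apply, pair_sum_left]

theorem pT_tp (A B : TForm D) : F.pT A (tp B) = F.pT (tp A) B := by
  simp only [pT_apply, tp_apply]
  rw [Finset.sum_comm]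
  refine Finset.sum_congr rfl fun a _ => Finset.sum_congr rfl fun b _ => ?_
  simp only [up2, tp_apply]
  rw [Finset.sum_comm]
  simp only [mul_comm]

theorem pT_sy (A B : TForm D) : F.pT A (sy B) = F.pT (sy A) B := by
  simp [sy_eq, pT_tp]

theorem pT_asy (A B : TForm D) : F.pT A (asy B) = F.pT (asy A) B := by
  simp [asy_eq, pT_tp]

theorem Regular.pT_fr (h : F.Regular) (A B : TForm D) : F.pT A (F.fr B) = F.pT (F.fr A) B := by
  simp only [fr_eq, map_sub, map_smul, LinearMap.sub_apply, LinearMap.smul_apply, h.pT_trA]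
  rw [h.pT_comm (F.trA _), h.pT_trA, h.pair_comm]

end Frame
end MAG
end

/-! ### Self-adjoint operators behind the irreducible decompositions. -/

noncomputable section

namespace MAG

variable {D : ℕ}

namespace Frame

/-! ### The irreducible projections as operators -/

variable (F : Frame D)

/-- The symmetric trace-free part. -/
def frs : TForm D →ₗ[ℝ] TForm D := F.fr ∘ₗ sy

/-- `ϑ^a ∧ (e^b ⌟ A_{ab})` for the symmetric trace-free part. -/
def lamOp : TForm D →ₗ[ℝ] Form D := F.wdg ∘ₗ F.con ∘ₗ F.frs

/-- The adjoint of `lamOp`. -/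
def lamAdj : Form D →ₗ[ℝ] TForm D := F.frs ∘ₗ F.conA ∘ₗ F.wdgA

/-- `ϑ^b ∧ A_{ab}` for the symmetric trace-free part. -/
def zetaOp : TForm D →ₗ[ℝ] VForm D := F.wed ∘ₗ F.frs

def opQ4 : TForm D →ₗ[ℝ] TForm D := (1 / (D : ℝ)) • F.trA ∘ₗ F.tr

def opQ3 : TForm D →ₗ[ℝ] TForm D :=
  (2 * (D : ℝ) / (((D : ℝ) - 1) * ((D : ℝ) + 2))) • F.lamAdj ∘ₗ F.lamOp

/-- The second term is the trace-free remnant of `ϑ_a ∧ Λ` in `Λ̄_a`: up to a pure trace, the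
symmetrised contraction of `ϑ_a ∧ Λ` is minus the tensor `ϑ_{(a} ∧ e_{b)} ⌟ Λ`. -/
def opQ2 : TForm D →ₗ[ℝ] TForm D :=
  (2 / 3 : ℝ) • F.frs ∘ₗ F.wedA ∘ₗ F.zetaOp - (2 / (3 * ((D : ℝ) - 1))) • F.lamAdj ∘ₗ F.lamOp

def opQ1 : TForm D →ₗ[ℝ] TForm D := LinearMap.id - F.opQ2 - F.opQ3 - F.opQ4

def opT2 : VForm D →ₗ[ℝ] VForm D := (1 / ((D : ℝ) - 1)) • F.divA ∘ₗ F.div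

def opT3 : VForm D →ₗ[ℝ] VForm D := (1 / 3 : ℝ) • F.wdgA ∘ₗ F.wdg

def opT1 : VForm D →ₗ[ℝ] VForm D := LinearMap.id - F.opT2 - F.opT3

/-- The projection onto covector-valued 3-forms with vanishing traces. -/
def psiProj : VForm D →ₗ[ℝ] VForm D :=
  LinearMap.id - (1 / 4 : ℝ) • F.wdgA ∘ₗ F.wdg - (1 / ((D : ℝ) - 2)) • F.divA ∘ₗ F.div

def phibarProj : VForm D →ₗ[ℝ] VForm D :=
  LinearMap.id - (1 / ((D : ℝ) - 2)) • F.divA ∘ₗ F.div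

def psi4Proj : VForm D →ₗ[ℝ] VForm D :=
  LinearMap.id - (1 / (D : ℝ)) • F.divA ∘ₗ F.div - (1 / 2 : ℝ) • F.wdgA ∘ₗ F.wdg

def phi4Proj : VForm D →ₗ[ℝ] VForm D := LinearMap.id - (1 / 2 : ℝ) • F.wdgA ∘ₗ F.wdg

/-- The stars in the definition of `²W` are absent here, because a pair of stars around an exterior
product with `ϑ_a` is a contraction up to sign. What remains is a projection between adjoint
operations, so that self-adjointness is formal. -/
def opW2 : TForm D →ₗ[ℝ] TForm D := asy ∘ₗ F.wedA ∘ₗ F.psiProj ∘ₗ F.wed ∘ₗ asy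

def opW3 : TForm D →ₗ[ℝ] TForm D :=
  (1 / 12 : ℝ) • asy ∘ₗ F.wedA ∘ₗ F.wdgA ∘ₗ F.wdg ∘ₗ F.wed ∘ₗ asy

def opW4 : TForm D →ₗ[ℝ] TForm D :=
  (2 / ((D : ℝ) - 2)) • asy ∘ₗ F.conA ∘ₗ F.psi4Proj ∘ₗ F.con ∘ₗ asy

def opW5 : TForm D →ₗ[ℝ] TForm D :=
  (1 / ((D : ℝ) - 2)) • asy ∘ₗ F.conA ∘ₗ F.wdgA ∘ₗ F.wdg ∘ₗ F.con ∘ₗ asy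

def opW6 : TForm D →ₗ[ℝ] TForm D :=
  (1 / ((D : ℝ) * ((D : ℝ) - 1))) • asy ∘ₗ F.conA ∘ₗ F.divA ∘ₗ F.div ∘ₗ F.con ∘ₗ asy

def opW1 : TForm D →ₗ[ℝ] TForm D := asy - (F.opW2 + F.opW3 + F.opW4 + F.opW5 + F.opW6)

def opZ5 : TForm D →ₗ[ℝ] TForm D := (1 / (D : ℝ)) • F.trA ∘ₗ F.tr

def opZ2 : TForm D →ₗ[ℝ] TForm D :=
  (1 / 2 : ℝ) • F.frs ∘ₗ F.wedA ∘ₗ F.phibarProj ∘ₗ F.zetaOp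

def opZ3 : TForm D →ₗ[ℝ] TForm D := ((D : ℝ) / ((D : ℝ) ^ 2 - 4)) • F.lamAdj ∘ₗ F.lamOp

def opZ4 : TForm D →ₗ[ℝ] TForm D :=
  (2 / (D : ℝ)) • F.frs ∘ₗ F.conA ∘ₗ F.phi4Proj ∘ₗ F.con ∘ₗ F.frs

def opZ1 : TForm D →ₗ[ℝ] TForm D := sy - (F.opZ2 + F.opZ3 + F.opZ4 + F.opZ5)

variable {F}

section SelfAdjoint

theorem frs_apply (A : TForm D) : F.frs A = F.fr (sy A) := rfl

theorem Regular.pT_frs (h : F.Regular) (A B : TForm D) : F.pT A (F.frs B) = F.pT (F.frs A) B := by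
  rw [frs_apply, h.pT_fr, pT_sy, frs_apply, h.sy_fr]

theorem Regular.pair_lamOp_right (h : F.Regular) (A : TForm D) (ω : Form D) :
    F.pair ω (F.lamOp A) = F.pT (F.lamAdj ω) A := by
  rw [h.pT_comm]
  simp only [lamAdj, lamOp, LinearMap.comp_apply, h.pT_frs, h.pT_conA, h.pV_wdgA]
  rw [h.pair_comm]

theorem Regular.pV_wed_right (h : F.Regular) (V : VForm D) (A : TForm D) :
    F.pV V (F.wed A) = F.pT (F.wedA V) A := by rw [h.pV_comm, ← h.pT_wedA, h.pT_comm]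
theorem Regular.pV_con_right (h : F.Regular) (V : VForm D) (A : TForm D) :
    F.pV V (F.con A) = F.pT (F.conA V) A := by rw [h.pV_comm, ← h.pT_conA, h.pT_comm]
theorem Regular.pair_tr_right (h : F.Regular) (ω : Form D) (A : TForm D) :
    F.pair ω (F.tr A) = F.pT (F.trA ω) A := by rw [h.pair_comm, ← h.pT_trA, h.pT_comm]
theorem Regular.pair_div_right (h : F.Regular) (ω : Form D) (V : VForm D) :
    F.pair ω (F.div V) = F.pV (F.divA ω) V := by rw [h.pair_comm, ← h.pV_divA, h.pV_comm]
theorem Regular.pair_wdg_right (h : F.Regular) (ω : Form D) (V : VForm D) :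
    F.pair ω (F.wdg V) = F.pV (F.wdgA ω) V := by rw [h.pair_comm, ← h.pV_wdgA, h.pV_comm]

/-- Self-adjointness with respect to the pairing of tensors. -/
def SelfAdj (F : Frame D) (K : TForm D →ₗ[ℝ] TForm D) : Prop :=
  ∀ A B, F.pT A (K B) = F.pT (K A) B

/-- Self-adjointness with respect to the pairing of covector-valued forms. -/
def SelfAdjV (F : Frame D) (K : VForm D →ₗ[ℝ] VForm D) : Prop :=
  ∀ A B, F.pV A (K B) = F.pV (K A) B

variable {K L : TForm D →ₗ[ℝ] TForm D} {K' L' : VForm D →ₗ[ℝ] VForm D}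

theorem SelfAdj.add (hK : F.SelfAdj K) (hL : F.SelfAdj L) : F.SelfAdj (K + L) :=
  fun A B => by simp [hK A B, hL A B]
theorem SelfAdj.sub (hK : F.SelfAdj K) (hL : F.SelfAdj L) : F.SelfAdj (K - L) :=
  fun A B => by simp [hK A B, hL A B]
theorem SelfAdj.smul (r : ℝ) (hK : F.SelfAdj K) : F.SelfAdj (r • K) :=
  fun A B => by simp [hK A B]
theorem SelfAdj.id : F.SelfAdj LinearMap.id := fun _ _ => rfl
theorem SelfAdjV.add (hK : F.SelfAdjV K') (hL : F.SelfAdjV L') : F.SelfAdjV (K' + L') :=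
  fun A B => by simp [hK A B, hL A B]
theorem SelfAdjV.sub (hK : F.SelfAdjV K') (hL : F.SelfAdjV L') : F.SelfAdjV (K' - L') :=
  fun A B => by simp [hK A B, hL A B]
theorem SelfAdjV.smul (r : ℝ) (hK : F.SelfAdjV K') : F.SelfAdjV (r • K') :=
  fun A B => by simp [hK A B]
theorem SelfAdjV.id : F.SelfAdjV LinearMap.id := fun _ _ => rfl

theorem Regular.selfAdjV_div (h : F.Regular) : F.SelfAdjV (F.divA ∘ₗ F.div) := fun A B => by
  simp only [LinearMap.comp_apply, h.pV_divA, h.pair_div_right]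
theorem Regular.selfAdjV_wdg (h : F.Regular) : F.SelfAdjV (F.wdgA ∘ₗ F.wdg) := fun A B => by
  simp only [LinearMap.comp_apply, h.pV_wdgA, h.pair_wdg_right]
theorem selfAdj_sy : F.SelfAdj sy := pT_sy
theorem selfAdj_asy : F.SelfAdj asy := pT_asy
theorem Regular.selfAdj_tr (h : F.Regular) : F.SelfAdj (F.trA ∘ₗ F.tr) := fun A B => by
  simp only [LinearMap.comp_apply, h.pT_trA, h.pair_tr_right]
theorem Regular.selfAdj_lam (h : F.Regular) : F.SelfAdj (F.lamAdj ∘ₗ F.lamOp) := fun A B => by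
  rw [h.pT_comm]; simp only [LinearMap.comp_apply, ← h.pair_lamOp_right]; rw [h.pair_comm]
theorem Regular.selfAdj_wed (h : F.Regular) (hK : F.SelfAdjV K') :
    F.SelfAdj (F.wedA ∘ₗ K' ∘ₗ F.wed) := fun A B => by
  simp only [LinearMap.comp_apply, h.pT_wedA, ← h.pV_wed_right, hK _ _]
theorem Regular.selfAdj_con (h : F.Regular) (hK : F.SelfAdjV K') :
    F.SelfAdj (F.conA ∘ₗ K' ∘ₗ F.con) := fun A B => by
  simp only [LinearMap.comp_apply, h.pT_conA, ← h.pV_con_right, hK _ _]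
-- The operators of `²W` to `⁶W`, of `²Z` and `⁴Z`, and the leading term of `²Q` have this sandwich
-- form, with `asy` or `frs` outside; the remaining parts are combinations of trace operators and
-- differences.
theorem SelfAdj.conj (hK : F.SelfAdj K) (hL : F.SelfAdj L) : F.SelfAdj (L ∘ₗ K ∘ₗ L) :=
  fun A B => by simp only [LinearMap.comp_apply, hL A, hK _ _, hL _ B]

theorem Regular.selfAdj_opQ4 (h : F.Regular) : F.SelfAdj F.opQ4 := h.selfAdj_tr.smul _
theorem Regular.selfAdj_opQ3 (h : F.Regular) : F.SelfAdj F.opQ3 := h.selfAdj_lam.smul _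
theorem Regular.selfAdj_opQ2 (h : F.Regular) : F.SelfAdj F.opQ2 :=
  ((SelfAdj.conj (h.selfAdj_wed SelfAdjV.id) h.pT_frs).smul _).sub (h.selfAdj_lam.smul _)
theorem Regular.selfAdj_opQ1 (h : F.Regular) : F.SelfAdj F.opQ1 :=
  ((SelfAdj.id.sub h.selfAdj_opQ2).sub h.selfAdj_opQ3).sub h.selfAdj_opQ4
theorem Regular.selfAdj_opT2 (h : F.Regular) : F.SelfAdjV F.opT2 := h.selfAdjV_div.smul _
theorem Regular.selfAdj_opT3 (h : F.Regular) : F.SelfAdjV F.opT3 := h.selfAdjV_wdg.smul _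
theorem Regular.selfAdj_opT1 (h : F.Regular) : F.SelfAdjV F.opT1 :=
  (SelfAdjV.id.sub h.selfAdj_opT2).sub h.selfAdj_opT3
theorem Regular.selfAdj_psiProj (h : F.Regular) : F.SelfAdjV F.psiProj :=
  (SelfAdjV.id.sub (h.selfAdjV_wdg.smul _)).sub (h.selfAdjV_div.smul _)
theorem Regular.selfAdj_phibarProj (h : F.Regular) : F.SelfAdjV F.phibarProj :=
  SelfAdjV.id.sub (h.selfAdjV_div.smul _)
theorem Regular.selfAdj_psi4Proj (h : F.Regular) : F.SelfAdjV F.psi4Proj :=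
  (SelfAdjV.id.sub (h.selfAdjV_div.smul _)).sub (h.selfAdjV_wdg.smul _)
theorem Regular.selfAdj_phi4Proj (h : F.Regular) : F.SelfAdjV F.phi4Proj :=
  SelfAdjV.id.sub (h.selfAdjV_wdg.smul _)
theorem Regular.selfAdj_opW2 (h : F.Regular) : F.SelfAdj F.opW2 :=
  (h.selfAdj_wed h.selfAdj_psiProj).conj selfAdj_asy
theorem Regular.selfAdj_opW3 (h : F.Regular) : F.SelfAdj F.opW3 :=
  ((h.selfAdj_wed h.selfAdjV_wdg).conj selfAdj_asy).smul _
theorem Regular.selfAdj_opW4 (h : F.Regular) : F.SelfAdj F.opW4 :=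
  ((h.selfAdj_con h.selfAdj_psi4Proj).conj selfAdj_asy).smul _
theorem Regular.selfAdj_opW5 (h : F.Regular) : F.SelfAdj F.opW5 :=
  ((h.selfAdj_con h.selfAdjV_wdg).conj selfAdj_asy).smul _
theorem Regular.selfAdj_opW6 (h : F.Regular) : F.SelfAdj F.opW6 :=
  ((h.selfAdj_con h.selfAdjV_div).conj selfAdj_asy).smul _
theorem Regular.selfAdj_opW1 (h : F.Regular) : F.SelfAdj F.opW1 :=
  selfAdj_asy.sub ((((h.selfAdj_opW2.add h.selfAdj_opW3).add h.selfAdj_opW4).add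
    h.selfAdj_opW5).add h.selfAdj_opW6)
theorem Regular.selfAdj_opZ5 (h : F.Regular) : F.SelfAdj F.opZ5 := h.selfAdj_tr.smul _
theorem Regular.selfAdj_opZ3 (h : F.Regular) : F.SelfAdj F.opZ3 := h.selfAdj_lam.smul _
theorem Regular.selfAdj_opZ2 (h : F.Regular) : F.SelfAdj F.opZ2 :=
  ((h.selfAdj_wed h.selfAdj_phibarProj).conj h.pT_frs).smul _
theorem Regular.selfAdj_opZ4 (h : F.Regular) : F.SelfAdj F.opZ4 :=
  ((h.selfAdj_con h.selfAdj_phi4Proj).conj h.pT_frs).smul _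
theorem Regular.selfAdj_opZ1 (h : F.Regular) : F.SelfAdj F.opZ1 :=
  selfAdj_sy.sub (((h.selfAdj_opZ2.add h.selfAdj_opZ3).add h.selfAdj_opZ4).add h.selfAdj_opZ5)

end SelfAdjoint

/-! ### Auxiliary formulas -/

/-- The trace of `ϑ_a ∧ (e_b ⌟ ω)` is the Euler operator, that is `r ω`, and the second term removes
exactly this trace. -/
theorem Regular.frs_conA_wdgA (h : F.Regular) {r : ℝ} {ω : Form D} (hω : Deg r ω) :
    F.lamAdj ω = sy (F.conA (F.wdgA ω)) - (r / D) • F.trA ω := by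
  rw [lamAdj, LinearMap.comp_apply, LinearMap.comp_apply, frs_apply, fr_eq, h.tr_sy, h.tr_conA,
    h.wdg_wdgA hω, map_smul, smul_smul]
  congr 2; ring

theorem up2_eq (A : TForm D) (a b : Fin D) :
    F.up2 A a b = F.upV (fun c => F.upV (A c) b) a := by
  simp [up2, upV, Finset.smul_sum, smul_smul]

theorem up2_eq' (A : TForm D) (a b : Fin D) :
    F.up2 A a b = F.upV (fun d => F.upV (fun c => A c d) a) b := by
  simp only [up2, upV, Finset.smul_sum, smul_smul]
  rw [Finset.sum_comm]
  simp only [mul_comm]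

theorem Regular.star_star_of_even (h : F.Regular) {p : ℕ} (hp : Even p) {α : Form D}
    (hα : Deg p α) : F.star (F.star α) = F.sgn • α := by
  rw [h.star_star, hα.inv_eq, hp.neg_one_pow]; simp

theorem Regular.sgn_mul_sgn (h : F.Regular) : F.sgn * F.sgn = 1 := by
  rw [sgn]
  rcases lt_or_gt_of_ne h.det_g with hg | hg
  · simp [sign_neg hg]
  · simp [sign_pos hg]

/-- The first star turns multiplication by `ϑ_a` into contraction, and the second star is then
undone on the resulting 2-form; being of even degree, it contributes only the sign of the metric.
The barred quantities in `²W` and `²Z` are removed in this way. -/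
theorem Regular.star_cofL_mul_star (h : F.Regular) (a : Fin D) {α : Form D} (hα : Deg 3 α) :
    F.star (F.cofL a * F.star α) = F.sgn • F.ip a α := by
  rw [h.cofL_mul_star, Deg.inv_eq (p := 3) (by exact_mod_cast hα)]
  rw [ip_smul, star_smul, star_neg, star_smul]
  rw [h.star_star_of_even (p := 2) even_two (by
    have := hα.interior (F.e a); norm_num at this; exact_mod_cast this)]
  module

/-! ### Trace conditions -/

section Traces

variable {A : TForm D}

theorem Regular.tp_frs (h : F.Regular) (A : TForm D) : tp (F.frs A) = F.frs A := by
  rw [frs_apply, h.tp_fr, tp_sy]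

theorem asy_asy (A : TForm D) : asy (asy A) = asy A := asy_of_tp (tp_asy A)

theorem deg_omega (hA : TDeg 2 A) : VDeg 3 (F.wed (asy A)) :=
  (VDeg.wed (TDeg.asy hA)).cast (by norm_num)

theorem deg_psi (hA : TDeg 2 A) : VDeg 3 (F.psiProj (F.wed (asy A))) :=
  ((deg_omega hA).sub (VDeg.smul _ ((VDeg.wdgA (Deg.wdg (deg_omega hA))).cast (by ring)))).sub
    (VDeg.smul _ ((VDeg.divA (Deg.div (deg_omega hA))).cast (by ring)))

theorem deg_zeta (hA : TDeg 2 A) : VDeg 3 (F.zetaOp A) :=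
  (VDeg.wed (TDeg.fr (TDeg.sy hA))).cast (by norm_num)

theorem deg_phi (hA : TDeg 2 A) : VDeg 3 (F.phibarProj (F.zetaOp A)) :=
  (deg_zeta hA).sub (VDeg.smul _ ((VDeg.divA (Deg.div (deg_zeta hA))).cast (by ring)))

theorem deg_con_asy (hA : TDeg 2 A) : VDeg 1 (F.con (asy A)) :=
  (VDeg.con (TDeg.asy hA)).cast (by norm_num)

theorem deg_con_frs (hA : TDeg 2 A) : VDeg 1 (F.con (F.frs A)) :=
  (VDeg.con (TDeg.fr (TDeg.sy hA))).cast (by norm_num)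

theorem deg_psi4 (hA : TDeg 2 A) : VDeg 1 (F.psi4Proj (F.con (asy A))) :=
  ((deg_con_asy hA).sub (VDeg.smul _ ((VDeg.divA (Deg.div (deg_con_asy hA))).cast (by ring)))).sub
    (VDeg.smul _ ((VDeg.wdgA (Deg.wdg (deg_con_asy hA))).cast (by ring)))

theorem deg_phi4 (hA : TDeg 2 A) : VDeg 1 (F.phi4Proj (F.con (F.frs A))) :=
  (deg_con_frs hA).sub (VDeg.smul _ ((VDeg.wdgA (Deg.wdg (deg_con_frs hA))).cast (by ring)))

/-- The coefficient `1/(D-2)` is the inverse of the eigenvalue of `div ∘ divA` on 2-forms. The other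
trace conditions follow the same pattern: each coefficient in a projection inverts one of the
constants `D - r` or `r`, while mixed compositions such as `div ∘ wdgA` vanish. -/
theorem Regular.div_phi (h : F.Regular) (hD : 3 ≤ D) (hA : TDeg 2 A) :
    F.div (F.phibarProj (F.zetaOp A)) = 0 := by
  have hD' : (3 : ℝ) ≤ D := by exact_mod_cast hD
  have hD2 : (D : ℝ) - 2 ≠ 0 := by intro h; linarith
  simp only [phibarProj, LinearMap.sub_apply, LinearMap.smul_apply, LinearMap.comp_apply,
    LinearMap.id_apply, map_sub, map_smul]
  rw [h.div_divA ((Deg.div (deg_zeta hA)).cast (s := 2) (by norm_num)), smul_smul,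
    one_div_mul_cancel hD2]
  simp

theorem Regular.div_psi (h : F.Regular) (hD : 3 ≤ D) (hA : TDeg 2 A) :
    F.div (F.psiProj (F.wed (asy A))) = 0 := by
  have hD' : (3 : ℝ) ≤ D := by exact_mod_cast hD
  have hD2 : (D : ℝ) - 2 ≠ 0 := by intro h; linarith
  simp only [psiProj, LinearMap.sub_apply, LinearMap.smul_apply, LinearMap.comp_apply,
    LinearMap.id_apply, map_sub, map_smul, h.div_wdgA]
  rw [h.div_divA ((Deg.div (deg_omega hA)).cast (s := 2) (by norm_num)), smul_smul,
    one_div_mul_cancel hD2]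
  simp

theorem Regular.wdg_psi (h : F.Regular) (hA : TDeg 2 A) :
    F.wdg (F.psiProj (F.wed (asy A))) = 0 := by
  simp only [psiProj, LinearMap.sub_apply, LinearMap.smul_apply, LinearMap.comp_apply,
    LinearMap.id_apply, map_sub, map_smul, h.wdg_divA]
  rw [h.wdg_wdgA ((Deg.wdg (deg_omega hA)).cast (s := 4) (by norm_num))]
  module

theorem wdg_wed_of_symm (hA : tp A = A) : F.wdg (F.wed A) = 0 := by
  refine eq_zero_of_eq_neg ?_
  have hA' : ∀ a b, A b a = A a b := fun a b => congrFun₂ hA a b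
  simp only [wdg_apply, wed_apply, Finset.mul_sum, ← Finset.sum_neg_distrib]
  rw [Finset.sum_comm]
  refine Finset.sum_congr rfl fun a _ => Finset.sum_congr rfl fun b _ => ?_
  rw [cof_mul_cof_mul, hA' a b]

theorem Regular.wdg_phi (h : F.Regular) (A : TForm D) :
    F.wdg (F.phibarProj (F.zetaOp A)) = 0 := by
  have h1 : F.wdg (F.zetaOp A) = 0 := wdg_wed_of_symm (h.tp_frs A)
  simp only [phibarProj, LinearMap.sub_apply, LinearMap.smul_apply, LinearMap.comp_apply,
    LinearMap.id_apply, map_sub, map_smul, h1, h.wdg_divA]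
  simp

theorem Regular.wdg_phi4 (h : F.Regular) (hA : TDeg 2 A) :
    F.wdg (F.phi4Proj (F.con (F.frs A))) = 0 := by
  simp only [phi4Proj, LinearMap.sub_apply, LinearMap.smul_apply, LinearMap.comp_apply,
    LinearMap.id_apply, map_sub, map_smul]
  rw [h.wdg_wdgA ((Deg.wdg (deg_con_frs hA)).cast (s := 2) (by norm_num))]
  module

/-- Unlike in the antisymmetric case no trace has to be subtracted, since the double contraction of
a symmetric tensor already vanishes. -/
theorem Regular.div_phi4 (h : F.Regular) (A : TForm D) :
    F.div (F.phi4Proj (F.con (F.frs A))) = 0 := by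
  simp only [phi4Proj, LinearMap.sub_apply, LinearMap.smul_apply, LinearMap.comp_apply,
    LinearMap.id_apply, map_sub, map_smul, h.div_wdgA, div_con_of_symm (h.tp_frs A)]
  simp

theorem Regular.wdg_psi4 (h : F.Regular) (hA : TDeg 2 A) :
    F.wdg (F.psi4Proj (F.con (asy A))) = 0 := by
  simp only [psi4Proj, LinearMap.sub_apply, LinearMap.smul_apply, LinearMap.comp_apply,
    LinearMap.id_apply, map_sub, map_smul, h.wdg_divA]
  rw [h.wdg_wdgA ((Deg.wdg (deg_con_asy hA)).cast (s := 2) (by norm_num))]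
  module

theorem Regular.div_psi4 (h : F.Regular) (hD : 3 ≤ D) (hA : TDeg 2 A) :
    F.div (F.psi4Proj (F.con (asy A))) = 0 := by
  have hD0 : (D : ℝ) ≠ 0 := by positivity
  simp only [psi4Proj, LinearMap.sub_apply, LinearMap.smul_apply, LinearMap.comp_apply,
    LinearMap.id_apply, map_sub, map_smul, h.div_wdgA]
  rw [h.div_divA ((Deg.div (deg_con_asy hA)).cast (s := 0) (by norm_num)), smul_smul, sub_zero,
    one_div, inv_mul_cancel₀ hD0]
  simp

end Traces

end Frame
end MAG
end

/-! ### Identification of the irreducible parts with the operators. -/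

noncomputable section

namespace MAG

variable {D : ℕ}

theorem Deg.mul_form1_even {p : ℕ} {α : Form D} (h : Deg p α) (hp : Even p) (ω : Cov D) :
    α * MAG.form1 ω = MAG.form1 ω * α := by
  rw [MAG.mul_form1_comm, h.inv_eq, hp.neg_one_pow, one_smul]

theorem Deg.mul_form1_odd {p : ℕ} {α : Form D} (h : Deg p α) (hp : Odd p) (ω : Cov D) :
    α * MAG.form1 ω = -(MAG.form1 ω * α) := by
  rw [MAG.mul_form1_comm, h.inv_eq, hp.neg_one_pow]; simp

namespace Geom

/-- The data are those of a geometry: `Q_{ab}` are symmetric 1-forms, `T^a` and `R_a{}^b` are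
2-forms. -/
structure Regular (G : Geom D) : Prop extends G.toFrame.Regular where
  tpQ : Frame.tp G.Q = G.Q
  degQ : TDeg 1 G.Q
  degT : VDeg 2 G.T
  degR : TDeg 2 G.R

open _root_.MAG.Frame

variable {G : Geom D}

theorem Regular.degRlow (h : G.Regular) : TDeg 2 G.Rlow := by
  intro a b
  rw [Geom.Rlow, Frame.low2]
  exact Deg.sum fun c => Deg.smul _ (h.degR a c)

/-- The torsion with lowered index. -/
def TL (G : Geom D) : VForm D := G.low1 G.T

theorem Regular.degTL (h : G.Regular) : VDeg 2 G.TL := by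
  intro a
  rw [Geom.TL, Frame.low1]
  exact Deg.sum fun b => Deg.smul _ (h.degT b)

theorem Regular.T_eq (h : G.Regular) : G.T = G.upV G.TL := (h.upV_low1 G.T).symm

theorem Regular.trT_eq (h : G.Regular) : G.trT = G.div G.TL := by
  rw [trT, h.T_eq, h.sum_ip_upV, div_apply]

theorem low1_smul (F : Frame D) (r : ℝ) (V : VForm D) : F.low1 (r • V) = r • F.low1 V := by
  ext a : 1; simp [low1, Finset.smul_sum, smul_comm r]
theorem low1_sub (F : Frame D) (V U : VForm D) : F.low1 (V - U) = F.low1 V - F.low1 U := by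
  ext a : 1; simp [low1, smul_sub]
theorem low1_add (F : Frame D) (V U : VForm D) : F.low1 (V + U) = F.low1 V + F.low1 U := by
  ext a : 1; simp [low1, Finset.sum_add_distrib]

theorem Regular.low1_T2 (h : G.Regular) : G.low1 G.T2 = G.opT2 G.TL := by
  have : G.T2 = (1 / ((D : ℝ) - 1)) • G.upV (G.divA (G.div G.TL)) := by
    ext a : 1
    rw [T2, h.trT_eq, Pi.smul_apply]; congr 1
    rw [← h.upV_cofL]; simp [upV, divA_apply, Finset.sum_mul]
  rw [this, low1_smul, h.low1_upV]; rfl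

theorem Regular.low1_T3 (h : G.Regular) : G.low1 G.T3 = G.opT3 G.TL := by
  have h1 : ∑ b, G.T b * G.cofL b = G.wdg G.TL := by
    rw [h.T_eq, h.sum_mul_cofL, wdg_apply]
    exact Finset.sum_congr rfl fun a _ => Deg.mul_form1_even (p := 2) (h.degTL a) even_two _
  have : G.T3 = (1 / 3 : ℝ) • G.upV (G.wdgA (G.wdg G.TL)) := by
    ext a : 1
    rw [T3, h1]; rfl
  rw [this, low1_smul, h.low1_upV]; rfl

theorem Regular.low1_T1 (h : G.Regular) : G.low1 G.T1 = G.opT1 G.TL := by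
  have : G.T1 = G.T - G.T2 - G.T3 := rfl
  rw [this, low1_sub, low1_sub, h.low1_T2, h.low1_T3]; rfl

theorem Regular.low1_sumT (h : G.Regular) (p : Params) :
    G.low1 (p.sumT G) = p.a1 • G.opT1 G.TL + p.a2 • G.opT2 G.TL + p.a3 • G.opT3 G.TL := by
  have : p.sumT G = p.a1 • G.T1 + p.a2 • G.T2 + p.a3 • G.T3 := rfl
  rw [this, low1_add, low1_add, low1_smul, low1_smul, low1_smul, h.low1_T1, h.low1_T2, h.low1_T3]

/-! #### Nonmetricity -/

theorem trQ_eq : G.trQ = (1 / (D : ℝ)) • G.tr G.Q := rfl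

theorem Qfree_eq : G.Qfree = G.fr G.Q := by
  ext a b : 2
  rw [Qfree, fr_eq, trQ_eq, smul_comm]; rfl

theorem Q4_eq : G.Q4 = G.opQ4 G.Q := by
  ext a b : 2
  rw [Q4, trQ_eq, smul_comm]; rfl

theorem Regular.frs_Q (h : G.Regular) : G.frs G.Q = G.fr G.Q := by rw [frs_apply, sy_of_tp h.tpQ]

theorem Regular.Lam_eq (h : G.Regular) : G.Lam = G.lamOp G.Q := by
  rw [Lam, lamOp, LinearMap.comp_apply, LinearMap.comp_apply, h.frs_Q, wdg_apply]
  refine Finset.sum_congr rfl fun a _ => ?_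
  rw [con_apply, Finset.mul_sum]
  refine Finset.sum_congr rfl fun b _ => ?_
  rw [Qfree_eq, ← tp_apply (G.fr G.Q), h.tp_fr, h.tpQ]

theorem Regular.degLam (h : G.Regular) : Deg 1 (G.lamOp G.Q) :=
  (Deg.wdg (VDeg.con (TDeg.fr (TDeg.sy h.degQ)))).cast (by ring)

theorem Regular.Q3_eq (h : G.Regular) : G.Q3 = G.opQ3 G.Q := by
  have h1 : G.Q3 = (2 * (D : ℝ) / (((D : ℝ) - 1) * ((D : ℝ) + 2))) •
      (sy (G.conA (G.wdgA (G.lamOp G.Q))) - (1 / (D : ℝ)) • G.trA (G.lamOp G.Q)) := by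
    ext a b : 2
    rw [Q3, h.Lam_eq]; rfl
  rw [h1, opQ3, LinearMap.smul_apply, LinearMap.comp_apply, h.frs_conA_wdgA h.degLam]

/-- The overall minus comes from moving `ϑ^c` to the left of the 1-form `Q_{ac}`. -/
theorem Regular.Lambar_eq (h : G.Regular) (a : Fin D) : G.Lambar a =
    -G.star ((G.zetaOp G.Q + (1 / ((D : ℝ) - 1)) • G.divA (G.lamOp G.Q)) a) := by
  rw [Lambar, ← star_neg]
  congr 1
  rw [h.Lam_eq, Pi.add_apply, neg_add, sub_eq_add_neg]
  congr 1
  rw [zetaOp, LinearMap.comp_apply, h.frs_Q, wed_apply, ← Finset.sum_neg_distrib]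
  refine Finset.sum_congr rfl fun c _ => ?_
  rw [Qfree_eq, ← tp_apply (G.fr G.Q), h.tp_fr, h.tpQ]
  exact Deg.mul_form1_odd (p := 1) (by simpa using TDeg.fr h.degQ c a) odd_one _

theorem Regular.Q2_eq (h : G.Regular) (hD : 3 ≤ D) : G.Q2 = G.opQ2 G.Q := by
  have hD' : (3 : ℝ) ≤ D := by exact_mod_cast hD
  have hD0 : (D : ℝ) ≠ 0 := by positivity
  have hD1 : (D : ℝ) - 1 ≠ 0 := by intro h; linarith
  set Λ := G.lamOp G.Q with hΛ
  set ζ := G.zetaOp G.Q with hζ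
  have dζ : VDeg 2 ζ := (VDeg.wed (TDeg.fr (TDeg.sy h.degQ))).cast (by ring)
  -- The trace of the trace-free part drops out of `div_wed`, and only the double contraction `Λ`
  -- remains.
  have hdiv : G.div ζ = -Λ := by
    rw [hζ, zetaOp, LinearMap.comp_apply, h.div_wed, frs_apply, h.tr_fr hD0, h.tp_fr, tp_sy]
    rw [hΛ]; simp [lamOp, frs_apply]
  have h1 : G.Q2 = (2 / 3 : ℝ) • sy (G.wedA (ζ + (1 / ((D : ℝ) - 1)) • G.divA Λ)) := by
    -- The outer star meets the one inside `Λ̄`, and a double dual of a 2-form is left. This gives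
    -- one factor `s`, which later multiplies the `s` in the definition to one.
    have h3 : ∀ a b, G.star (G.Lambar a * G.cofL b)
        = -(G.sgn • G.ip b ((ζ + (1 / ((D : ℝ) - 1)) • G.divA Λ) a)) := by
      intro a b
      have d2 : VDeg 2 (ζ + (1 / ((D : ℝ) - 1)) • G.divA Λ) :=
        dζ.add (VDeg.smul _ ((VDeg.divA h.degLam).cast (by ring)))
      rw [h.star_mul_cofL, h.Lambar_eq, star_neg,
        h.star_star_of_even (p := 2) even_two (by exact_mod_cast d2 a), ip_neg, ip_smul]
    ext a b : 2
    rw [Q2, MAG.symm, Frame.star_smul, Frame.star_add, h3, h3]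
    simp only [Pi.smul_apply, sy_apply, wedA_apply]
    have := h.sgn_mul_sgn
    match_scalars <;> linear_combination (1 / 3) * this
  have h2 : G.opQ2 G.Q = (2 / 3 : ℝ) • G.fr (sy (G.wedA ζ))
      - (2 / (3 * ((D : ℝ) - 1))) • G.lamAdj Λ := rfl
  -- On one side the pure trace comes from the contraction of `ϑ_a ∧ Λ`; on the other it comes from
  -- the projections `fr` and `lamAdj`. The two agree because `1/(D-1) = (1/D)(1 + 1/(D-1))`.
  rw [h1, h2, h.frs_conA_wdgA h.degLam, map_add, map_add, map_smul, map_smul, h.sy_wedA_divA,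
    fr_eq, h.tr_sy, h.tr_wedA, hdiv, map_neg]
  have e1 : (2 : ℝ) / (3 * ((D : ℝ) - 1)) = 2 / 3 * (1 / ((D : ℝ) - 1)) := by field_simp
  rw [e1]
  match_scalars <;> field_simp
  ring

theorem Regular.Q1_eq (h : G.Regular) (hD : 3 ≤ D) : G.Q1 = G.opQ1 G.Q := by
  have : G.Q1 = G.Q - G.Q2 - G.Q3 - G.Q4 := rfl
  rw [this, h.Q2_eq hD, h.Q3_eq, Q4_eq]; rfl

/-! #### Curvature -/

theorem W_eq : G.W = asy G.Rlow := rfl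
theorem Z_eq : G.Z = sy G.Rlow := rfl

theorem Regular.degW (h : G.Regular) : TDeg 2 (asy G.Rlow) := TDeg.asy h.degRlow

/-- `X^a` contracts the second index of `W^{ab}` and `con` the first, so antisymmetry supplies the
sign. -/
theorem Regular.XU_eq (h : G.Regular) : G.XU = G.upV (-G.con (asy G.Rlow)) := by
  have h1 : -G.con (asy G.Rlow) = G.con (tp (asy G.Rlow)) := by rw [tp_asy, map_neg]
  ext a : 1
  rw [XU, W_eq, h1]
  simp only [up2_eq']
  rw [h.sum_ip_upV]
  simp only [upV, con_apply, tp_apply, ipU_sum, ipU_smul, Finset.smul_sum]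
  exact Finset.sum_comm

theorem Regular.XL_eq (h : G.Regular) : G.XL = -G.con (asy G.Rlow) := by
  rw [XL, h.XU_eq, h.low1_upV]

theorem Regular.X_eq (h : G.Regular) : G.X = -G.div (G.con (asy G.Rlow)) := by
  rw [X, h.XU_eq, h.sum_ip_upV, ← div_apply, map_neg]

theorem Regular.XbarU_eq (h : G.Regular) :
    G.XbarU = G.upV (fun a => G.star (G.wed (asy G.Rlow) a)) := by
  ext a : 1
  rw [XbarU, W_eq]
  simp only [up2_eq]
  rw [h.sum_mul_cofL (fun c => G.upV (asy G.Rlow c) a)]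
  have h1 : ∀ c d, asy G.Rlow c d * G.cof c = G.cof c * asy G.Rlow c d := fun c d =>
    Deg.mul_form1_even (p := 2) (by exact_mod_cast h.degW c d) even_two _
  simp only [upV, wed_apply, Frame.star_sum, Frame.star_smul, Finset.smul_sum, Finset.sum_mul,
    smul_mul_assoc, h1]
  exact Finset.sum_comm

theorem Regular.XbarL_eq (h : G.Regular) : G.XbarL = fun a => G.star (G.wed (asy G.Rlow) a) := by
  rw [XbarL, h.XbarU_eq, h.low1_upV]

theorem Regular.Xbar_eq (h : G.Regular) : G.Xbar = -G.star (G.wdg (G.wed (asy G.Rlow))) := by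
  rw [Xbar, h.XbarU_eq, h.sum_ip_upV, wdg_apply, Frame.star_sum, ← Finset.sum_neg_distrib]
  refine Finset.sum_congr rfl fun a _ => ?_
  rw [← h.star_mul_cof, ← Frame.star_neg]
  congr 1
  exact Deg.mul_form1_odd (p := 3) (by exact_mod_cast (deg_omega h.degRlow) a) (by decide) _

/-- Duality exchanges multiplication and contraction: `ϑ^b ∧ ⋆V_b` is `⋆` of the divergence, and
`e_a ⌟ ⋆` is `⋆` of a product with `ϑ_a`. A trace subtraction for `⋆V` thus becomes the
complementary subtraction for `V`. -/
theorem ip_sum_cof_mul_star (h : G.Regular) {V : VForm D} (hV : VDeg 3 V) (a : Fin D) :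
    G.ip a (∑ b, G.cof b * G.star (V b)) = G.star (G.divA (G.div V) a) := by
  have h1 : ∑ b, G.cof b * G.star (V b) = G.star (G.div V) := by
    rw [div_apply, Frame.star_sum]
    refine Finset.sum_congr rfl fun b _ => ?_
    rw [h.cof_mul_star, Deg.inv_eq (p := 3) (by exact_mod_cast hV b)]
    simp [pow_succ]
  have h2 : Deg ((2 : ℕ) : ℝ) (G.div V) := (Deg.div hV).cast (by norm_num)
  rw [h1, ← h.star_mul_cofL, divA_apply, cofL_eq, h2.mul_form1_even even_two]

/-- Under duality the coefficients `1/4` and `1/(D-2)` belong to `wdgA ∘ wdg` and `divA ∘ div` on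
covector-valued 3-forms, where `4` and `D-2` are the corresponding eigenvalues on 4-forms and
2-forms. -/
theorem Regular.Psibar_eq (h : G.Regular) (a : Fin D) :
    G.Psibar a = G.star (G.psiProj (G.wed (asy G.Rlow)) a) := by
  have h4 : Deg ((4 : ℕ) : ℝ) (G.wdg (G.wed (asy G.Rlow))) :=
    (Deg.wdg (deg_omega h.degRlow)).cast (by norm_num)
  rw [Psibar, h.XbarL_eq, ip_sum_cof_mul_star h (deg_omega h.degRlow), h.Xbar_eq, mul_neg, h.cofL_mul_star,
    h4.inv_eq, show ((-1 : ℝ) ^ 4) = 1 by norm_num, one_smul, neg_neg]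
  rw [← Frame.star_smul, ← Frame.star_smul, ← Frame.star_sub, ← Frame.star_sub]
  congr 1

theorem Regular.W2_eq (h : G.Regular) : G.W2 = G.opW2 G.Rlow := by
  ext a b : 2
  rw [W2, MAG.asymm, Frame.star_smul, Frame.star_sub, h.Psibar_eq, h.Psibar_eq,
    h.star_cofL_mul_star a (deg_psi h.degRlow b), h.star_cofL_mul_star b (deg_psi h.degRlow a)]
  have := h.sgn_mul_sgn
  simp only [opW2, LinearMap.comp_apply, asy_apply (G.wedA _), wedA_apply]
  match_scalars
  · linear_combination (1 / 2) * this
  · linear_combination (-1 / 2) * this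

theorem Regular.W3_eq (h : G.Regular) : G.W3 = G.opW3 G.Rlow := by
  have h4 : Deg ((4 : ℕ) : ℝ) (G.wdg (G.wed (asy G.Rlow))) :=
    (Deg.wdg (deg_omega h.degRlow)).cast (by norm_num)
  -- Two contractions anticommute, so the outer antisymmetrisation, kept only for formal
  -- self-adjointness, does nothing.
  have h5 : asy (G.wedA (G.wdgA (G.wdg (G.wed (asy G.Rlow)))))
      = G.wedA (G.wdgA (G.wdg (G.wed (asy G.Rlow)))) := by
    refine asy_of_tp ?_
    ext a b : 2
    exact ip_ip_comm _ _ _ _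
  ext a b : 2
  simp only [opW3, LinearMap.smul_apply, LinearMap.comp_apply, h5]
  rw [W3, ← mul_assoc, h.star_mul_cofL, h.star_mul_cofL, h.Xbar_eq, Frame.star_neg,
    h.star_star_of_even (by decide) h4, ip_neg, ip_smul, ip_neg, ip_smul, ip_ip_comm]
  simp only [Pi.smul_apply, wedA_apply, wdgA_apply]
  have := h.sgn_mul_sgn
  match_scalars; linear_combination (1 / 12) * this

theorem Regular.X_mul_cofL (h : G.Regular) (a : Fin D) :
    G.X * G.cofL a = -(G.cofL a * G.div (G.con (asy G.Rlow))) := by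
  have h0 : Deg ((0 : ℕ) : ℝ) (G.div (G.con (asy G.Rlow))) :=
    (Deg.div (deg_con_asy h.degRlow)).cast (by norm_num)
  rw [h.X_eq, neg_mul, cofL_eq, h0.mul_form1_even (by decide)]

theorem Regular.Psi_eq (h : G.Regular) : G.Psi = -G.psi4Proj (G.con (asy G.Rlow)) := by
  ext a : 1
  have : ∑ b, G.cof b * G.XL b = -G.wdg (G.con (asy G.Rlow)) := by
    rw [h.XL_eq, ← wdg_apply, map_neg]
  rw [Psi, this, h.X_mul_cofL, h.XL_eq]
  simp only [psi4Proj, LinearMap.sub_apply, LinearMap.smul_apply, LinearMap.comp_apply,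
    LinearMap.id_apply, Pi.neg_apply, Pi.sub_apply, Pi.smul_apply, divA_apply, wdgA_apply, ip_neg]
  module

theorem Regular.W4_eq (h : G.Regular) : G.W4 = G.opW4 G.Rlow := by
  have : G.W4 = (-(2 / ((D : ℝ) - 2))) • asy (G.conA G.Psi) := rfl
  rw [this, h.Psi_eq, map_neg, map_neg]
  simp only [opW4, LinearMap.smul_apply, LinearMap.comp_apply]
  module

theorem Regular.W5_eq (h : G.Regular) : G.W5 = G.opW5 G.Rlow := by
  have : G.W5 = (-(1 / ((D : ℝ) - 2))) • asy (G.conA (G.wdgA (G.wdg G.XL))) := rfl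
  rw [this, h.XL_eq, map_neg, map_neg, map_neg, map_neg]
  simp only [opW5, LinearMap.smul_apply, LinearMap.comp_apply]
  module

theorem Regular.W6_eq (h : G.Regular) : G.W6 = G.opW6 G.Rlow := by
  have h0 : Deg ((0 : ℕ) : ℝ) (G.div (G.con (asy G.Rlow))) :=
    (Deg.div (deg_con_asy h.degRlow)).cast (by norm_num)
  -- Here `ϑ_a ∧ ϑ_b` is antisymmetric by itself, and the outer `asy` is again redundant.
  have h5 : asy (G.conA (G.divA (G.div (G.con (asy G.Rlow)))))
      = G.conA (G.divA (G.div (G.con (asy G.Rlow)))) := by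
    refine asy_of_tp ?_
    ext a b : 2
    exact cofL_mul_cofL_mul _ _ _ _
  ext a b : 2
  simp only [opW6, LinearMap.smul_apply, LinearMap.comp_apply, h5]
  rw [W6, ← mul_assoc, h.X_mul_cofL, Pi.smul_apply, Pi.smul_apply, conA_apply, divA_apply,
    neg_mul, mul_assoc, cofL_eq, cofL_eq, h0.mul_form1_even (by decide)]
  module

theorem Regular.W1_eq (h : G.Regular) : G.W1 = G.opW1 G.Rlow := by
  have : G.W1 = G.W - (G.W2 + G.W3 + G.W4 + G.W5 + G.W6) := rfl
  rw [this, h.W2_eq, h.W3_eq, h.W4_eq, h.W5_eq, h.W6_eq]; rfl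

theorem Regular.Z5_eq (h : G.Regular) : G.Z5 = G.opZ5 G.Rlow := by
  have : G.Z5 = (1 / (D : ℝ)) • G.trA (G.tr (sy G.Rlow)) := rfl
  rw [this, h.tr_sy]; rfl

theorem Regular.Zfree_eq (h : G.Regular) (a b : Fin D) : G.Z a b - G.Z5 a b = G.frs G.Rlow a b := by
  rw [h.Z5_eq, Z_eq, frs_apply, fr_eq, h.tr_sy]; rfl

theorem Regular.Y_eq (h : G.Regular) : G.Y = G.con (G.frs G.Rlow) := by
  ext a : 1
  simp only [Y, h.Zfree_eq, con_apply]
  refine Finset.sum_congr rfl fun b _ => ?_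
  rw [← tp_apply (G.frs G.Rlow), h.tp_frs]

theorem Regular.degZf (h : G.Regular) : TDeg 2 (G.frs G.Rlow) := TDeg.fr (TDeg.sy h.degRlow)

theorem Regular.Ybar_eq (h : G.Regular) : G.Ybar = fun a => G.star (G.zetaOp G.Rlow a) := by
  ext a : 1
  simp only [Ybar, h.Zfree_eq, zetaOp, LinearMap.comp_apply, wed_apply]
  congr 1
  exact Finset.sum_congr rfl fun b _ =>
    Deg.mul_form1_even (p := 2) (by exact_mod_cast h.degZf b a) even_two _

theorem Regular.Phi_eq (h : G.Regular) : G.Phi = G.phi4Proj (G.con (G.frs G.Rlow)) := by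
  ext a : 1
  rw [Phi, h.Y_eq]; rfl

theorem Regular.Phibar_eq (h : G.Regular) (a : Fin D) :
    G.Phibar a = G.star (G.phibarProj (G.zetaOp G.Rlow) a) := by
  rw [Phibar, h.Ybar_eq, ip_sum_cof_mul_star h (deg_zeta h.degRlow), ← Frame.star_smul, ← Frame.star_sub]
  rfl

theorem Regular.Z2_eq_sy (h : G.Regular) :
    G.Z2 = (1 / 2 : ℝ) • sy (G.wedA (G.phibarProj (G.zetaOp G.Rlow))) := by
  ext a b : 2
  rw [Z2, MAG.symm, Frame.star_smul, Frame.star_add, h.Phibar_eq, h.Phibar_eq,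
    h.star_cofL_mul_star a (deg_phi h.degRlow b), h.star_cofL_mul_star b (deg_phi h.degRlow a)]
  have := h.sgn_mul_sgn
  simp only [Pi.smul_apply, sy_apply, wedA_apply]
  match_scalars <;> linear_combination (1 / 4) * this

/-- The operator includes a trace-free projection that the definition does not have; it is harmless
since the divergence of `φ` vanishes. -/
theorem Regular.Z2_eq (h : G.Regular) (hD : 3 ≤ D) : G.Z2 = G.opZ2 G.Rlow := by
  rw [h.Z2_eq_sy]
  simp only [opZ2, LinearMap.smul_apply, LinearMap.comp_apply]
  rw [frs_apply, fr_of_tr]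
  rw [h.tr_sy, h.tr_wedA, h.div_phi hD h.degRlow]

theorem Regular.degUps (h : G.Regular) : Deg 2 (G.lamOp G.Rlow) :=
  (Deg.wdg (VDeg.con h.degZf)).cast (by ring)

theorem Regular.Z3_eq (h : G.Regular) (hD : 3 ≤ D) : G.Z3 = G.opZ3 G.Rlow := by
  have hD0 : (D : ℝ) ≠ 0 := by positivity
  have : G.Z3 = (1 / ((D : ℝ) ^ 2 - 4)) • ((D : ℝ) • sy (G.conA (G.wdgA (G.wdg G.Y)))
      - (2 : ℝ) • G.trA (G.wdg G.Y)) := rfl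
  have e : G.wdg G.Y = G.lamOp G.Rlow := by rw [h.Y_eq]; rfl
  rw [this, e, opZ3, LinearMap.smul_apply, LinearMap.comp_apply, h.frs_conA_wdgA h.degUps]
  match_scalars <;> field_simp

theorem Regular.Z4_eq (h : G.Regular) : G.Z4 = G.opZ4 G.Rlow := by
  have : G.Z4 = (2 / (D : ℝ)) • sy (G.conA G.Phi) := rfl
  rw [this, h.Phi_eq]
  simp only [opZ4, LinearMap.smul_apply, LinearMap.comp_apply]
  rw [frs_apply (G.conA _), fr_of_tr]
  rw [h.tr_sy, h.tr_conA, h.wdg_phi4 h.degRlow]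

theorem Regular.Z1_eq (h : G.Regular) (hD : 3 ≤ D) : G.Z1 = G.opZ1 G.Rlow := by
  have : G.Z1 = G.Z - (G.Z2 + G.Z3 + G.Z4 + G.Z5) := rfl
  rw [this, h.Z2_eq hD, h.Z3_eq hD, h.Z4_eq, h.Z5_eq]; rfl

end Geom
end MAG
end

/-! ### Strong gravity: transposing the non-symmetric terms. -/

noncomputable section

namespace MAG

variable {D : ℕ}

namespace Frame

variable (F : Frame D)

/-! ### The adjoints of the trace terms -/

/-- The tensor `ϑ^c ∧ (e_a ⌟ A_{cb})`. -/
def tInt : TForm D →ₗ[ℝ] TForm D := LinearMap.id - F.wedA ∘ₗ F.wed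

variable {F} {A B : TForm D}

theorem tInt_apply (A : TForm D) : F.tInt A = A - F.wedA (F.wed A) := rfl

/-- Contraction recovers, up to a number, the covector-valued form from which an irreducible part is
built. Here the number is `(D-2)/2` divided by `D-2`; for `³Z` it is again `1/2`, and for `⁴Z` and
`⁴W` it is `1`. -/
theorem Regular.con_opW5 (h : F.Regular) (hD : 3 ≤ D) (hB : TDeg 2 B) :
    F.con (F.opW5 B) = (1 / 2 : ℝ) • F.wdgA (F.wdg (F.con (asy B))) := by
  have hD' : (3 : ℝ) ≤ D := by exact_mod_cast hD
  have hD2 : (D : ℝ) - 2 ≠ 0 := by intro h; linarith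
  have d : VDeg 1 (F.wdgA (F.wdg (F.con (asy B)))) :=
    (VDeg.wdgA (Deg.wdg (deg_con_asy hB))).cast (by ring)
  simp only [opW5, LinearMap.smul_apply, LinearMap.comp_apply, map_smul, h.con_asy_conA d,
    h.div_wdgA, map_zero, add_zero, smul_smul]
  congr 1
  field_simp
  ring

theorem Regular.con_opZ3 (h : F.Regular) (hD : 3 ≤ D) (hB : TDeg 2 B) :
    F.con (F.opZ3 B) = (1 / 2 : ℝ) • F.wdgA (F.lamOp B) := by
  have hD' : (3 : ℝ) ≤ D := by exact_mod_cast hD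
  have hD2 : (D : ℝ) ^ 2 - 4 ≠ 0 := by intro h; nlinarith
  have hD0 : (D : ℝ) ≠ 0 := by positivity
  have d2 : Deg 2 (F.lamOp B) := (Deg.wdg (deg_con_frs hB)).cast (by norm_num)
  have d : VDeg 1 (F.wdgA (F.lamOp B)) := (VDeg.wdgA d2).cast (by norm_num)
  simp only [opZ3, LinearMap.smul_apply, LinearMap.comp_apply, map_smul, map_sub,
    h.frs_conA_wdgA d2, h.con_sy_conA d, h.con_trA, h.div_wdgA, map_zero, sub_zero, smul_smul,
    ← sub_smul]
  congr 1
  field_simp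
  ring

theorem Regular.opZ4_eq (h : F.Regular) (hB : TDeg 2 B) :
    F.opZ4 B = (2 / (D : ℝ)) • sy (F.conA (F.phi4Proj (F.con (F.frs B)))) := by
  simp only [opZ4, LinearMap.smul_apply, LinearMap.comp_apply]
  rw [frs_apply (F.conA _), fr_of_tr]
  rw [h.tr_sy, h.tr_conA, h.wdg_phi4 hB]

theorem Regular.con_opZ4 (h : F.Regular) (hD : 3 ≤ D) (hB : TDeg 2 B) :
    F.con (F.opZ4 B) = F.phi4Proj (F.con (F.frs B)) := by
  have hD0 : (D : ℝ) ≠ 0 := by positivity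
  rw [h.opZ4_eq hB, map_smul, h.con_sy_conA (deg_phi4 hB), h.div_phi4, map_zero]
  match_scalars
  field_simp
  ring

theorem Regular.con_opW4 (h : F.Regular) (hD : 3 ≤ D) (hB : TDeg 2 B) :
    F.con (F.opW4 B) = F.psi4Proj (F.con (asy B)) := by
  have hD' : (3 : ℝ) ≤ D := by exact_mod_cast hD
  have hD2 : (D : ℝ) - 2 ≠ 0 := by intro h; linarith
  simp only [opW4, LinearMap.smul_apply, LinearMap.comp_apply, map_smul]
  rw [h.con_asy_conA (deg_psi4 hB), h.div_psi4 hD hB, map_zero]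
  match_scalars
  field_simp
  ring

theorem Regular.con_opZ5 (h : F.Regular) (B : TForm D) :
    F.con (F.opZ5 B) = (1 / (D : ℝ)) • F.wdgA (F.tr B) := by
  simp only [opZ5, LinearMap.smul_apply, LinearMap.comp_apply, map_smul, h.con_trA]

theorem Regular.pT_con_opW5 (h : F.Regular) (hD : 3 ≤ D) (A : TForm D) (hB : TDeg 2 B) :
    F.pT A (F.conA (F.con (F.opW5 B)))
      = 1 / 2 * F.pT B (asy (F.conA (F.wdgA (F.wdg (F.con A))))) := by
  rw [h.con_opW5 hD hB]
  simp only [map_smul, smul_eq_mul, h.pT_conA, h.pV_wdgA, pT_asy]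
  rw [h.pair_comm]

theorem Regular.pT_con_opZ3 (h : F.Regular) (hD : 3 ≤ D) (hA : TDeg 2 A) (hB : TDeg 2 B) :
    F.pT A (F.conA (F.con (F.opZ3 B))) = F.pT B ((1 / 2 : ℝ) • sy (F.conA (F.wdgA (F.wdg (F.con A))))
        - (1 / (D : ℝ)) • F.trA (F.wdg (F.con A))) := by
  have d2 : Deg 2 (F.wdg (F.con A)) := (Deg.wdg (VDeg.con hA)).cast (by norm_num)
  rw [h.con_opZ3 hD hB]
  simp only [map_smul, smul_eq_mul, h.pT_conA, h.pV_wdgA, h.pair_lamOp_right]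
  rw [h.frs_conA_wdgA d2, h.pT_comm]
  simp only [map_smul, map_sub, smul_eq_mul]
  ring

theorem Regular.pT_con_opZ5 (h : F.Regular) (A B : TForm D) :
    F.pT A (F.conA (F.con (F.opZ5 B))) = F.pT B ((1 / (D : ℝ)) • F.trA (F.wdg (F.con A))) := by
  rw [h.con_opZ5]
  simp only [map_smul, smul_eq_mul, h.pT_conA, h.pV_wdgA, h.pT_trA]
  rw [h.pair_comm]

theorem Regular.frs_conA (h : F.Regular) {V : VForm D} (hV : F.wdg V = 0) :
    F.frs (F.conA V) = sy (F.conA V) := by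
  rw [frs_apply, fr_of_tr]; rw [h.tr_sy, h.tr_conA, hV]

theorem Regular.frs_wedA (h : F.Regular) {V : VForm D} (hV : F.div V = 0) :
    F.frs (F.wedA V) = sy (F.wedA V) := by
  rw [frs_apply, fr_of_tr]; rw [h.tr_sy, h.tr_wedA, hV]

theorem eq_frs_add (A : TForm D) :
    A = F.frs A + (1 / (D : ℝ)) • F.trA (F.tr (sy A)) + asy A := by
  rw [frs_apply, fr_eq]
  nth_rewrite 1 [← sy_add_asy A]
  module

/-- `Φ` satisfies `wdg Φ = 0` and `div Φ = 0`, hence is orthogonal to all `wdgA` and `divA` terms.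
Pairing with it sees only the fully projected contractions of the symmetric and of the antisymmetric
part of `A`. The antisymmetric one is how `⁴W` enters the derivative of a term containing only `⁴Z`.
-/
theorem Regular.pT_con_opZ4 (h : F.Regular) (hD : 3 ≤ D) (hA : TDeg 2 A) (hB : TDeg 2 B) :
    F.pT A (F.conA (F.con (F.opZ4 B)))
      = F.pT B (sy (F.conA (F.phi4Proj (F.con (F.frs A))))
        + sy (F.conA (F.psi4Proj (F.con (asy A))))) := by
  rw [h.con_opZ4 hD hB, h.pT_conA]
  set Φ := F.phi4Proj (F.con (F.frs B)) with hΦ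
  have hw : F.wdg Φ = 0 := h.wdg_phi4 hB
  have hd : F.div Φ = 0 := h.div_phi4 B
  have p1 : ∀ ω, F.pV (F.wdgA ω) Φ = 0 := fun ω => by rw [h.pV_comm, h.pV_wdgA, hw]; simp
  have p2 : ∀ ω, F.pV (F.divA ω) Φ = 0 := fun ω => by rw [h.pV_comm, h.pV_divA, hd]; simp
  have e1 : F.pV (F.con A) Φ = F.pV (F.con (F.frs A)) Φ + F.pV (F.con (asy A)) Φ := by
    conv_lhs => rw [eq_frs_add (F := F) A]
    simp only [map_add, map_smul, LinearMap.add_apply, LinearMap.smul_apply, h.con_trA, p1]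
    simp
  have e2 : F.pV (F.con (F.frs A)) Φ = F.pV (F.phi4Proj (F.con (F.frs A))) Φ := by
    simp [phi4Proj, p1]
  have e3 : F.pV (F.con (asy A)) Φ = F.pV (F.psi4Proj (F.con (asy A))) Φ := by
    simp [psi4Proj, p1, p2]
  -- For such `V` the tensor `ϑ_{(a} ∧ V_{b)}` is trace-free, so the projections defining `Φ` can be
  -- transferred to `V`, where they are trivial.
  have e4 : ∀ V, F.wdg V = 0 → F.pV V Φ = F.pT B (sy (F.conA V)) := by
    intro V hV
    rw [← h.frs_conA hV, h.pT_frs, h.pT_conA, h.pV_comm, hΦ, phi4Proj]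
    simp only [LinearMap.sub_apply, LinearMap.smul_apply, LinearMap.comp_apply,
      LinearMap.id_apply]
    rw [h.pV_comm, map_sub, map_smul, h.pV_wdgA, hV, h.pV_comm]
    simp
  rw [e1, e2, e3, e4 _ (h.wdg_phi4 hA), e4 _ (h.wdg_psi4 hA), map_add]

theorem Regular.opZ2_eq (h : F.Regular) (hD : 3 ≤ D) (hA : TDeg 2 A) :
    F.opZ2 A = (1 / 2 : ℝ) • sy (F.wedA (F.phibarProj (F.zetaOp A))) := by
  simp only [opZ2, LinearMap.smul_apply, LinearMap.comp_apply]
  rw [h.frs_wedA (h.div_phi hD hA)]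

/-- By the Euler operator `wed ∘ wedA` is multiplication by `3`, and with transposed indices by `1`
because `wdg φ = 0`. The symmetrised tensor alone does not reproduce itself, which generates an
antisymmetric piece. -/
theorem Regular.tInt_opZ2 (h : F.Regular) (hD : 3 ≤ D) (hA : TDeg 2 A) :
    F.tInt (F.opZ2 A) = -(1 / 2 : ℝ) • sy (F.wedA (F.phibarProj (F.zetaOp A)))
      - asy (F.wedA (F.phibarProj (F.zetaOp A))) := by
  rw [h.opZ2_eq hD hA, tInt_apply, sy_eq, asy_eq]
  simp only [map_smul, map_add, h.wed_wedA (deg_phi hA), h.wed_tp_wedA, h.wdg_phi, map_zero,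
    sub_zero]
  module

theorem Regular.tInt_opW2 (h : F.Regular) (hA : TDeg 2 A) :
    F.tInt (F.opW2 A) = -sy (F.wedA (F.psiProj (F.wed (asy A)))) := by
  rw [tInt_apply]
  simp only [opW2, LinearMap.comp_apply]
  rw [sy_eq, asy_eq (F.wedA _)]
  simp only [map_smul, map_sub, h.wed_wedA (deg_psi hA), h.wed_tp_wedA, h.wdg_psi hA, map_zero,
    sub_zero]
  module

/-- The covector-valued 3-form `φ` of `²Z` is free of both traces, so it pairs only with the
trace-free 3-forms of the symmetric and the antisymmetric part of `A`. The latter is the one of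
`²W`. -/
theorem Regular.pT_tInt_opZ2 (h : F.Regular) (hD : 3 ≤ D) (hA : TDeg 2 A) (hB : TDeg 2 B) :
    F.pT A (F.tInt (F.opZ2 B))
      = F.pT B (-(1 / 2 : ℝ) • sy (F.wedA (F.phibarProj (F.zetaOp A)))
        - sy (F.wedA (F.psiProj (F.wed (asy A))))) := by
  rw [h.tInt_opZ2 hD hB]
  simp only [map_sub, map_smul, pT_sy A, pT_asy A, h.pT_wedA]
  set φ := F.phibarProj (F.zetaOp B) with hφ
  have hw : F.wdg φ = 0 := h.wdg_phi B
  have hd : F.div φ = 0 := h.div_phi hD hB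
  have p1 : ∀ ω, F.pV (F.wdgA ω) φ = 0 := fun ω => by rw [h.pV_comm, h.pV_wdgA, hw]; simp
  have p2 : ∀ ω, F.pV (F.divA ω) φ = 0 := fun ω => by rw [h.pV_comm, h.pV_divA, hd]; simp
  have e1 : F.pV (F.wed (sy A)) φ = F.pV (F.phibarProj (F.zetaOp A)) φ := by
    have : sy A = F.frs A + (1 / (D : ℝ)) • F.trA (F.tr (sy A)) := by
      rw [frs_apply, fr_eq]; module
    rw [this]
    simp [phibarProj, p2, h.wed_trA, zetaOp]
  have e2 : F.pV (F.wed (asy A)) φ = F.pV (F.psiProj (F.wed (asy A))) φ := by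
    simp [psiProj, p1, p2]
  have e4 : ∀ V, F.div V = 0 → F.pV V φ = F.pT B (sy (F.wedA V)) := by
    intro V hV
    rw [← h.frs_wedA hV, h.pT_frs, h.pT_wedA, hφ, phibarProj]
    simp only [LinearMap.sub_apply, LinearMap.smul_apply, LinearMap.comp_apply,
      LinearMap.id_apply]
    rw [map_sub, map_smul, h.pV_divA, hV, h.pV_comm]
    simp [zetaOp]
  rw [e1, e2, e4 _ (h.div_phi hD hA), e4 _ (h.div_psi hD hA)]

end Frame

open _root_.MAG.Frame in
theorem Geom.Regular.P_eq {G : Geom D} : G.P = G.wdg (G.con G.Rlow) := by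
  rw [Geom.P, Finset.sum_comm, wdg_apply]
  simp only [con_apply, Finset.mul_sum]

namespace Params

open _root_.MAG.Frame

variable (p : Params)

/-- The operator of the strong gravity part. -/
def strongOp (F : Frame D) : TForm D →ₗ[ℝ] TForm D :=
  (p.w1 • F.opW1 + p.w2 • F.opW2 + p.w3 • F.opW3 + p.w4 • F.opW4 + p.w5 • F.opW5 + p.w6 • F.opW6)
    + (p.z1 • F.opZ1 + p.z2 • F.opZ2 + p.z3 • F.opZ3 + p.z4 • F.opZ4 + p.z5 • F.opZ5)
    + p.v1 • F.conA ∘ₗ F.con ∘ₗ F.opW5 + p.v2 • F.tInt ∘ₗ F.opZ2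
    + p.v3 • F.conA ∘ₗ F.con ∘ₗ F.opZ3 + p.v4 • F.conA ∘ₗ F.con ∘ₗ F.opZ4
    + p.v5 • F.conA ∘ₗ F.con ∘ₗ F.opZ5

variable {G : Geom D}

theorem sumWZ_eq (h : G.Regular) (hD : 3 ≤ D) : p.sumWZ G = (p.w1 • G.opW1 + p.w2 • G.opW2
    + p.w3 • G.opW3 + p.w4 • G.opW4 + p.w5 • G.opW5 + p.w6 • G.opW6
    + (p.z1 • G.opZ1 + p.z2 • G.opZ2 + p.z3 • G.opZ3 + p.z4 • G.opZ4 + p.z5 • G.opZ5)) G.Rlow := by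
  have : p.sumWZ G = (p.w1 • G.W1 + p.w2 • G.W2 + p.w3 • G.W3 + p.w4 • G.W4 + p.w5 • G.W5
    + p.w6 • G.W6)
    + (p.z1 • G.Z1 + p.z2 • G.Z2 + p.z3 • G.Z3 + p.z4 • G.Z4 + p.z5 • G.Z5) := rfl
  rw [this, h.W1_eq, h.W2_eq, h.W3_eq, h.W4_eq, h.W5_eq, h.W6_eq, h.Z1_eq hD, h.Z2_eq hD,
    h.Z3_eq hD, h.Z4_eq, h.Z5_eq]
  rfl

theorem strongBracket_eq (h : G.Regular) (hD : 3 ≤ D) :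
    p.strongBracket G = p.strongOp G.toFrame G.Rlow := by
  have e2 : G.thetaInt G.Z2 = G.tInt G.Z2 := h.tInt_eq G.Z2
  have : p.strongBracket G = p.sumWZ G + p.v1 • G.conA (G.con G.W5) + p.v2 • G.thetaInt G.Z2
      + p.v3 • G.conA (G.con G.Z3) + p.v4 • G.conA (G.con G.Z4) + p.v5 • G.conA (G.con G.Z5) := rfl
  rw [this, p.sumWZ_eq h hD, e2, h.W5_eq, h.Z2_eq hD, h.Z3_eq hD, h.Z4_eq, h.Z5_eq]
  rfl

/-- The bracket of the momentum `h_{ab}`. -/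
def strongMomentum (G : Geom D) : TForm D := fun a b =>
  p.sumWZ G a b
    + (p.v1 / 2) • (G.thetaTrace G.W5 a b + (1 / 2 : ℝ) • asymm G.thetaP a b)
    + (p.v2 / 2) • (symm (G.thetaInt G.W2) a b + asymm (G.thetaInt G.Z2) a b
        - (2 : ℝ) • G.Z2 a b)
    + (p.v3 / 2) • (G.thetaTrace G.Z3 a b + (1 / 2 : ℝ) • symm G.thetaP a b
        - (1 / (D : ℝ)) • G.g a b • G.P)
    + (p.v4 / 2) • (asymm (G.thetaTrace G.Z4) a b + symm (G.thetaTrace G.W4) a b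
        + (D : ℝ) • G.Z4 a b)
    + (p.v5 / 2) • (G.thetaTrace G.Z5 a b + (1 / (D : ℝ)) • G.g a b • G.P)

theorem strongMomentum_eq (h : G.Regular) (hD : 3 ≤ D) : p.strongMomentum G =
    p.sumWZ G
    + (p.v1 / 2) • (G.conA (G.con (G.opW5 G.Rlow))
      + (1 / 2 : ℝ) • asy (G.conA (G.wdgA (G.wdg (G.con G.Rlow)))))
    + (p.v2 / 2) • (sy (G.tInt (G.opW2 G.Rlow)) + asy (G.tInt (G.opZ2 G.Rlow))
        - (2 : ℝ) • G.opZ2 G.Rlow)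
    + (p.v3 / 2) • (G.conA (G.con (G.opZ3 G.Rlow))
      + (1 / 2 : ℝ) • sy (G.conA (G.wdgA (G.wdg (G.con G.Rlow))))
        - (1 / (D : ℝ)) • G.trA (G.wdg (G.con G.Rlow)))
    + (p.v4 / 2) • (asy (G.conA (G.con (G.opZ4 G.Rlow))) + sy (G.conA (G.con (G.opW4 G.Rlow)))
        + (D : ℝ) • G.opZ4 G.Rlow)
    + (p.v5 / 2) • (G.conA (G.con (G.opZ5 G.Rlow))
      + (1 / (D : ℝ)) • G.trA (G.wdg (G.con G.Rlow))) := by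
  rw [← h.Z2_eq hD, ← h.W2_eq, ← h.W5_eq, ← h.Z3_eq hD, ← h.Z4_eq, ← h.W4_eq, ← h.Z5_eq,
    ← Geom.Regular.P_eq, ← (show G.thetaInt G.Z2 = G.tInt G.Z2 from h.tInt_eq G.Z2),
    ← (show G.thetaInt G.W2 = G.tInt G.W2 from h.tInt_eq G.W2)]
  rfl

theorem sy_sy (A : TForm D) : sy (sy A) = sy A := sy_of_tp (tp_sy A)
theorem asy_sy (A : TForm D) : asy (sy A) = 0 := by rw [asy_eq, tp_sy]; simp

/-- With `K` the operator of the Lagrangian, the momentum is `½(K + K†)` applied to the curvature.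
The projections contribute with their full coefficients, and each `v_I` bracket is the operator plus
its transpose. -/
theorem pT_strongOp (h : G.Regular) (hD : 3 ≤ D) {B : TForm D} (hB : TDeg 2 B) :
    G.pT G.Rlow (p.strongOp G.toFrame B) + G.pT B (p.strongOp G.toFrame G.Rlow)
      = 2 * G.pT B (p.strongMomentum G) := by
  have hA := h.degRlow
  -- The printed `v_2` bracket is split as operator plus transpose: the antisymmetric part of the
  -- operator is already present, and `-2 · ²Z` supplies the symmetric parts of both.
  have e2 : sy (G.tInt (G.opW2 G.Rlow)) + asy (G.tInt (G.opZ2 G.Rlow)) - (2 : ℝ) • G.opZ2 G.Rlow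
      = G.tInt (G.opZ2 G.Rlow) + (-(1 / 2 : ℝ) • sy (G.wedA (G.phibarProj (G.zetaOp G.Rlow)))
        - sy (G.wedA (G.psiProj (G.wed (asy G.Rlow))))) := by
    rw [h.tInt_opZ2 hD hA, h.tInt_opW2 hA, h.opZ2_eq hD hA]
    simp only [map_neg, map_sub, map_smul, sy_sy, asy_sy, asy_asy]
    module
  -- The same for `v_4`. As `D · ⁴Z` is twice the symmetrised `ϑ_a ∧ Φ_b`, one copy completes the
  -- operator and the other is the symmetric part of the transpose.
  have e4 : asy (G.conA (G.con (G.opZ4 G.Rlow))) + sy (G.conA (G.con (G.opW4 G.Rlow)))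
        + (D : ℝ) • G.opZ4 G.Rlow = G.conA (G.con (G.opZ4 G.Rlow)) +
        (sy (G.conA (G.phi4Proj (G.con (G.frs G.Rlow))))
        + sy (G.conA (G.psi4Proj (G.con (asy G.Rlow))))) := by
    have hD0 : (D : ℝ) ≠ 0 := by positivity
    rw [h.con_opZ4 hD hA, h.con_opW4 hD hA, h.opZ4_eq hA, smul_smul, mul_div_cancel₀ _ hD0]
    have key : ∀ S T A P : TForm D, S + T = A → T + P + (2 : ℝ) • S = A + (S + P) := by
      rintro S T A P rfl
      module
    exact key _ _ _ _ (sy_add_asy _)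
  rw [p.strongMomentum_eq h hD, e2, e4, p.sumWZ_eq h hD]
  simp only [strongOp, LinearMap.add_apply, LinearMap.smul_apply, LinearMap.comp_apply, map_add,
    map_smul, smul_eq_mul, h.selfAdj_opW1 G.Rlow B, h.selfAdj_opW2 G.Rlow B,
    h.selfAdj_opW3 G.Rlow B, h.selfAdj_opW4 G.Rlow B, h.selfAdj_opW5 G.Rlow B,
    h.selfAdj_opW6 G.Rlow B, h.selfAdj_opZ1 G.Rlow B, h.selfAdj_opZ2 G.Rlow B,
    h.selfAdj_opZ3 G.Rlow B, h.selfAdj_opZ4 G.Rlow B, h.selfAdj_opZ5 G.Rlow B,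
    h.pT_con_opW5 hD G.Rlow hB, h.pT_con_opZ3 hD hA hB, h.pT_con_opZ4 hD hA hB,
    h.pT_con_opZ5 G.Rlow B, h.pT_tInt_opZ2 hD hA hB, h.pT_comm _ B, map_sub]
  ring

end Params
end MAG
end

/-! ### Weak gravity: action of the projections on the symmetrised torsion, and the Lagrangian as a
sum of pairings. -/

noncomputable section

namespace MAG

variable {D : ℕ}

section Degrees

variable {F : Frame D} {r : ℝ} {A B : TForm D}

theorem TDeg.add (hA : TDeg r A) (hB : TDeg r B) : TDeg r (A + B) := fun a b => (hA a b).add (hB a b)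

theorem TDeg.sub (hA : TDeg r A) (hB : TDeg r B) : TDeg r (A - B) := fun a b => (hA a b).sub (hB a b)

theorem TDeg.smul (s : ℝ) (hA : TDeg r A) : TDeg r (s • A) := fun a b => (hA a b).smul s

theorem TDeg.conA {V : VForm D} (hV : VDeg r V) : TDeg (r + 1) (F.conA V) := by
  intro a b
  rw [Frame.conA_apply, add_comm]
  exact (Frame.deg_cofL (F := F) a).mul (hV b)

theorem TDeg.wedA {V : VForm D} (hV : VDeg r V) : TDeg (r - 1) (F.wedA V) := by
  intro a b
  rw [Frame.wedA_apply]
  exact (hV b).interior _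

theorem TDeg.trA {ω : Form D} (hω : Deg r ω) : TDeg r (F.trA ω) := by
  intro a b
  rw [Frame.trA_apply]
  exact hω.smul _

theorem TDeg.frs (hA : TDeg r A) : TDeg r (F.frs A) := TDeg.fr (TDeg.sy hA)

theorem Deg.lamOp (hA : TDeg r A) : Deg r (F.lamOp A) := by
  have := Deg.wdg (F := F) (VDeg.con (F := F) (TDeg.frs (F := F) hA))
  rwa [sub_add_cancel] at this

theorem TDeg.lamAdj {ω : Form D} (hω : Deg r ω) : TDeg r (F.lamAdj ω) := by
  have := TDeg.conA (F := F) (VDeg.wdgA (F := F) hω)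
  rw [sub_add_cancel] at this
  exact TDeg.frs this

theorem TDeg.opQ2 (hA : TDeg r A) : TDeg r (F.opQ2 A) := by
  have h1 : VDeg (r + 1) (F.zetaOp A) := VDeg.wed (TDeg.frs hA)
  have h2 := TDeg.wedA (F := F) h1
  rw [add_sub_cancel_right] at h2
  have h3 : TDeg r (F.frs (F.wedA (F.zetaOp A))) := TDeg.frs h2
  have h4 : TDeg r (F.lamAdj (F.lamOp A)) := TDeg.lamAdj (Deg.lamOp hA)
  exact (h3.smul _).sub (h4.smul _)

theorem TDeg.opQ3 (hA : TDeg r A) : TDeg r (F.opQ3 A) := by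
  have h4 : TDeg r (F.lamAdj (F.lamOp A)) := TDeg.lamAdj (Deg.lamOp hA)
  exact h4.smul _

theorem TDeg.opQ4 (hA : TDeg r A) : TDeg r (F.opQ4 A) := by
  have h4 : TDeg r (F.trA (F.tr A)) := TDeg.trA (Deg.tr hA)
  exact h4.smul _

end Degrees

namespace Frame

variable {F : Frame D} {A B : TForm D}

theorem up2_add (A B : TForm D) : F.up2 (A + B) = F.up2 A + F.up2 B := by
  ext a b : 2; simp [up2, Finset.sum_add_distrib]

theorem up2_smul (r : ℝ) (A : TForm D) : F.up2 (r • A) = r • F.up2 A := by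
  ext a b : 2; simp [up2, Finset.smul_sum, smul_comm r]

theorem up2_sub (A B : TForm D) : F.up2 (A - B) = F.up2 A - F.up2 B := by
  ext a b : 2; simp [up2, smul_sub]

theorem up2_tp (A : TForm D) : F.up2 (tp A) = tp (F.up2 A) := by
  ext a b : 2
  simp only [up2, tp_apply]
  rw [Finset.sum_comm]
  simp only [mul_comm]

theorem up2_sy (A : TForm D) : F.up2 (sy A) = sy (F.up2 A) := by
  rw [sy_eq, sy_eq, up2_smul, up2_add, up2_tp]

theorem Regular.pV_low1 (h : F.Regular) (V U : VForm D) :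
    F.pV (F.low1 V) U = ∑ a, F.pair (V a) (U a) := by
  rw [h.pV_comm, pV_apply, h.upV_low1]
  exact Finset.sum_congr rfl fun a _ => h.pair_comm _ _

/-- Pairing after lowering the second index. -/
theorem Regular.pT_low2 (h : F.Regular) (A K : TForm D) :
    F.pT (F.low2 A) K = ∑ a, ∑ b, F.pair (A a b) (F.up1 K a b) := by
  rw [pT_apply]
  refine Finset.sum_congr rfl fun a _ => ?_
  refine Eq.trans ?_ (h.pV_low1 (A a) (F.up1 K a))
  rw [pV_apply]
  refine Finset.sum_congr rfl fun b _ => ?_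
  congr 1
  · simp only [low1, low2]
    exact Finset.sum_congr rfl fun c _ => by rw [h.g_comm]
  · rw [up2_eq']; rfl

theorem Regular.opQ4_sy_wedA (h : F.Regular) (V : VForm D) :
    F.opQ4 (sy (F.wedA V)) = (1 / (D : ℝ)) • F.trA (F.div V) := by
  rw [opQ4, LinearMap.smul_apply, LinearMap.comp_apply, h.tr_sy, h.tr_wedA]

/-- Contraction kills `e_a ⌟ V_b`, and its transpose gives `-e_b ⌟ div V`; together with the
subtracted trace this leaves a multiple of the divergence. For torsion the divergence is the trace
1-form `T`. -/
theorem Regular.lamOp_sy_wedA (h : F.Regular) (hD : 3 ≤ D) {V : VForm D} (hV : VDeg 2 V) :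
    F.lamOp (sy (F.wedA V)) = -(((D : ℝ) + 2) / (2 * D)) • F.div V := by
  have hD0 : (D : ℝ) ≠ 0 := by positivity
  have d : Deg 1 (F.div V) := by simpa [show (2 : ℝ) - 1 = 1 by norm_num] using Deg.div (F := F) hV
  have e : F.con (sy (F.wedA V)) = -(1 / 2 : ℝ) • F.wdgA (F.div V) := by
    rw [sy_eq, map_smul, map_add, h.con_wedA, con_tp_wedA]; module
  simp only [lamOp, LinearMap.comp_apply, frs_apply, sy_of_tp (tp_sy _), fr_eq, map_sub, map_smul,
    h.tr_sy, h.tr_wedA, h.con_trA, e, h.wdg_wdgA d]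
  match_scalars
  field_simp
  ring

theorem Regular.opQ3_sy_wedA (h : F.Regular) (hD : 3 ≤ D) {V : VForm D} (hV : VDeg 2 V) :
    F.opQ3 (sy (F.wedA V)) = -(1 / ((D : ℝ) - 1)) •
      (sy (F.conA (F.wdgA (F.div V))) - (1 / (D : ℝ)) • F.trA (F.div V)) := by
  have hD' : (3 : ℝ) ≤ D := by exact_mod_cast hD
  have hD0 : (D : ℝ) ≠ 0 := by positivity
  have hD1 : (D : ℝ) - 1 ≠ 0 := by intro h; linarith
  have hD2 : (D : ℝ) + 2 ≠ 0 := by positivity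
  have d : Deg 1 (F.div V) := by simpa [show (2 : ℝ) - 1 = 1 by norm_num] using Deg.div (F := F) hV
  rw [opQ3, LinearMap.smul_apply, LinearMap.comp_apply, h.lamOp_sy_wedA hD hV, map_smul,
    h.frs_conA_wdgA d, smul_smul]
  congr 1
  field_simp

theorem Regular.opQ2_sy_wedA (h : F.Regular) (hD : 3 ≤ D) {V : VForm D} (hV : VDeg 2 V) :
    F.opQ2 (sy (F.wedA V)) = sy (F.wedA V) + (1 / ((D : ℝ) - 1)) •
      (sy (F.conA (F.wdgA (F.div V))) - F.trA (F.div V)) := by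
  have hD' : (3 : ℝ) ≤ D := by exact_mod_cast hD
  have hD0 : (D : ℝ) ≠ 0 := by positivity
  have hD1 : (D : ℝ) - 1 ≠ 0 := by intro h; linarith
  have hD2 : (D : ℝ) + 2 ≠ 0 := by positivity
  have d : Deg 1 (F.div V) := by simpa [show (2 : ℝ) - 1 = 1 by norm_num] using Deg.div (F := F) hV
  have e1 : F.zetaOp (sy (F.wedA V))
      = (3 / 2 : ℝ) • V - (1 / 2 : ℝ) • F.wdgA (F.wdg V) - (1 / (D : ℝ)) • F.divA (F.div V) := by
    rw [zetaOp, LinearMap.comp_apply, frs_apply, sy_of_tp (tp_sy _), fr_eq, map_sub, map_smul,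
      h.tr_sy, h.tr_wedA, h.wed_trA, sy_eq, map_smul, map_add, h.wed_wedA hV, h.wed_tp_wedA]
    module
  -- The axial contribution is antisymmetric in its two contractions and drops out of the
  -- symmetrisation.
  have e2 : ∀ ω, sy (F.wedA (F.wdgA ω)) = 0 := by
    intro ω
    have : tp (F.wedA (F.wdgA ω)) = -F.wedA (F.wdgA ω) := by
      ext a b : 2
      simp [tp_apply, wedA_apply, wdgA_apply, F.ip_ip_comm b a]
    rw [sy_eq, this]; module
  have e3 : F.wedA (F.zetaOp (sy (F.wedA V))) = (3 / 2 : ℝ) • F.wedA V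
      - (1 / 2 : ℝ) • F.wedA (F.wdgA (F.wdg V)) - (1 / (D : ℝ)) • F.wedA (F.divA (F.div V)) := by
    rw [e1]; simp
  have e4 : sy (F.wedA (F.zetaOp (sy (F.wedA V)))) = (3 / 2 : ℝ) • sy (F.wedA V)
      - (1 / (D : ℝ)) • (F.trA (F.div V) - sy (F.conA (F.wdgA (F.div V)))) := by
    rw [e3, map_sub, map_sub, map_smul, map_smul, map_smul, e2, h.sy_wedA_divA]; module
  have e5 : F.frs (F.wedA (F.zetaOp (sy (F.wedA V)))) = (3 / 2 : ℝ) • sy (F.wedA V)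
      - (1 / (D : ℝ)) • (F.trA (F.div V) - sy (F.conA (F.wdgA (F.div V))))
      - (1 / (D : ℝ)) • F.trA ((3 / 2 : ℝ) • F.div V - (1 / (D : ℝ)) •
        ((D : ℝ) • F.div V - F.div V)) := by
    rw [frs_apply, e4, fr_eq]
    congr 3
    rw [map_sub, map_smul, map_smul, map_sub, h.tr_sy, h.tr_sy, h.tr_wedA, h.tr_trA, h.tr_conA,
      h.wdg_wdgA d, one_smul]
  have e6 : F.lamAdj (F.lamOp (sy (F.wedA V))) = -(((D : ℝ) + 2) / (2 * D)) •
      (sy (F.conA (F.wdgA (F.div V))) - (1 / (D : ℝ)) • F.trA (F.div V)) := by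
    rw [h.lamOp_sy_wedA hD hV, map_smul, h.frs_conA_wdgA d]
  rw [opQ2, LinearMap.sub_apply, LinearMap.smul_apply, LinearMap.smul_apply, LinearMap.comp_apply,
    LinearMap.comp_apply, LinearMap.comp_apply, e5, e6]
  simp only [map_sub, map_smul]
  match_scalars <;> field_simp <;> ring

theorem Regular.wed_opQ3 (h : F.Regular) (hD : 3 ≤ D) (hA : TDeg 1 A) :
    F.wed (F.opQ3 A) = -(1 / ((D : ℝ) - 1)) • F.divA (F.lamOp A) := by
  have hD' : (3 : ℝ) ≤ D := by exact_mod_cast hD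
  have hD0 : (D : ℝ) ≠ 0 := by positivity
  have hD1 : (D : ℝ) - 1 ≠ 0 := by intro h; linarith
  have hD2 : (D : ℝ) + 2 ≠ 0 := by positivity
  have d : Deg 1 (F.lamOp A) := Deg.lamOp hA
  rw [opQ3, LinearMap.smul_apply, LinearMap.comp_apply, h.frs_conA_wdgA d, map_smul, map_sub,
    sy_eq, map_smul, map_smul, map_add, h.wed_conA, wed_tp_conA, h.wdg_wdgA d, h.wed_trA, one_smul]
  match_scalars
  field_simp
  ring

theorem Regular.wed_opQ4 (h : F.Regular) (A : TForm D) :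
    F.wed (F.opQ4 A) = (1 / (D : ℝ)) • F.divA (F.tr A) := by
  rw [opQ4, LinearMap.smul_apply, LinearMap.comp_apply, map_smul, h.wed_trA]

/-- Both `ϑ^a ∧ ³Q_{ab}` and `ϑ^a ∧ ⁴Q_{ab}` are multiples of `ϑ_b ∧` a 1-form, so the `b_5` term is
the pairing of the two trace 1-forms; the eigenvalue `D-1` of `div ∘ divA` cancels. -/
theorem Regular.pV_wed_opQ3_opQ4 (h : F.Regular) (hD : 3 ≤ D) (hA : TDeg 1 A) (B : TForm D) :
    F.pV (F.wed (F.opQ3 A)) (F.wed (F.opQ4 B))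
      = -(1 / (D : ℝ)) * F.pair (F.lamOp A) (F.tr B) := by
  have hD' : (3 : ℝ) ≤ D := by exact_mod_cast hD
  have hD0 : (D : ℝ) ≠ 0 := by positivity
  have hD1 : (D : ℝ) - 1 ≠ 0 := by intro h; linarith
  have d : Deg 1 (F.lamOp A) := Deg.lamOp hA
  rw [h.wed_opQ3 hD hA, h.wed_opQ4]
  simp only [map_smul, LinearMap.smul_apply, smul_eq_mul, h.pV_divA, h.div_divA d,
    pair_smul_left]
  field_simp

end Frame

namespace Params

open _root_.MAG.Frame

variable (p : Params)

/-- `∑ a_I T(I)` as an operator on torsion with lowered index. -/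
def opT (F : Frame D) : VForm D →ₗ[ℝ] VForm D := p.a1 • F.opT1 + p.a2 • F.opT2 + p.a3 • F.opT3

def opQ (F : Frame D) : TForm D →ₗ[ℝ] TForm D :=
  p.b1 • F.opQ1 + p.b2 • F.opQ2 + p.b3 • F.opQ3 + p.b4 • F.opQ4

def opC (F : Frame D) : TForm D →ₗ[ℝ] TForm D := p.c1 • F.opQ2 + p.c2 • F.opQ3 + p.c3 • F.opQ4

variable {G : Geom D}

theorem selfAdj_opT (h : G.toFrame.Regular) : G.SelfAdjV (p.opT G.toFrame) :=
  ((h.selfAdj_opT1.smul _).add (h.selfAdj_opT2.smul _)).add (h.selfAdj_opT3.smul _)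

theorem selfAdj_opQ (h : G.toFrame.Regular) : G.SelfAdj (p.opQ G.toFrame) :=
  (((h.selfAdj_opQ1.smul _).add (h.selfAdj_opQ2.smul _)).add (h.selfAdj_opQ3.smul _)).add
    (h.selfAdj_opQ4.smul _)

theorem selfAdj_opC (h : G.toFrame.Regular) : G.SelfAdj (p.opC G.toFrame) :=
  ((h.selfAdj_opQ2.smul _).add (h.selfAdj_opQ3.smul _)).add (h.selfAdj_opQ4.smul _)

theorem low1_sumT_eq (h : G.Regular) : G.low1 (p.sumT G) = p.opT G.toFrame G.TL := h.low1_sumT p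

theorem sumQ_eq (h : G.Regular) (hD : 3 ≤ D) : p.sumQ G = p.opQ G.toFrame G.Q := by
  have : p.sumQ G = p.b1 • G.Q1 + p.b2 • G.Q2 + p.b3 • G.Q3 + p.b4 • G.Q4 := rfl
  rw [this, h.Q1_eq hD, h.Q2_eq hD, h.Q3_eq, Geom.Q4_eq]; rfl

theorem sumC_eq (h : G.Regular) (hD : 3 ≤ D) : p.sumC G = p.opC G.toFrame G.Q := by
  have : p.sumC G = p.c1 • G.Q2 + p.c2 • G.Q3 + p.c3 • G.Q4 := rfl
  rw [this, h.Q2_eq hD, h.Q3_eq, Geom.Q4_eq]; rfl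

theorem degOpC {F : Frame D} {r : ℝ} {A : TForm D} (hA : TDeg r A) : TDeg r (p.opC F A) :=
  ((hA.opQ2.smul _).add (hA.opQ3.smul _)).add (hA.opQ4.smul _)

theorem tp_opC (h : G.toFrame.Regular) (A : TForm D) :
    tp (p.opC G.toFrame A) = p.opC G.toFrame A := by
  simp only [opC, opQ2, opQ3, opQ4, lamAdj, LinearMap.add_apply, LinearMap.smul_apply,
    LinearMap.sub_apply, LinearMap.comp_apply, map_add, map_sub, map_smul, h.tp_frs, h.tp_trA]

/-- By self-adjointness the derivative of the mixed term in `Q` and `T` is the same operator applied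
to the symmetrised `e_a ⌟ T_b`. Its expansion gives the three `c`-terms of `m^{ab}`, including their
rational coefficients. -/
theorem opC_sy_wedA (h : G.toFrame.Regular) (hD : 3 ≤ D) {V : VForm D} (hV : VDeg 2 V) :
    p.opC G.toFrame (sy (G.wedA V)) = p.c1 • sy (G.wedA V)
      - (((D : ℝ) * p.c1 - p.c2 - ((D : ℝ) - 1) * p.c3) / ((D : ℝ) * ((D : ℝ) - 1))) •
        G.trA (G.div V)
      + ((p.c1 - p.c2) / ((D : ℝ) - 1)) • sy (G.conA (G.wdgA (G.div V))) := by
  have hD' : (3 : ℝ) ≤ D := by exact_mod_cast hD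
  have hD0 : (D : ℝ) ≠ 0 := by positivity
  have hD1 : (D : ℝ) - 1 ≠ 0 := by intro h; linarith
  simp only [opC, LinearMap.add_apply, LinearMap.smul_apply, h.opQ2_sy_wedA hD hV,
    h.opQ3_sy_wedA hD hV, h.opQ4_sy_wedA]
  match_scalars <;> field_simp <;> ring

/-! ### The Lagrangian in terms of pairings -/

theorem top_LEH (h : G.toFrame.Regular) : top (LEH G) = G.pT G.Rlow (G.conA G.cofL) := by
  rw [h.pT_comm, LEH]
  simp only [top_sum, pT_apply]
  exact Finset.sum_congr rfl fun a _ => Finset.sum_congr rfl fun b _ => h.pair_comm _ _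

theorem top_Ls (h : G.Regular) (hD : 3 ≤ D) :
    top (p.Ls G) = -(1 / (2 * p.ρ)) * G.pT G.Rlow (p.strongOp G.toFrame G.Rlow) := by
  rw [Ls, ← p.strongBracket_eq h hD, top_smul]
  simp only [top_sum]
  rfl

theorem top_Lw (h : G.Regular) (hD : 3 ≤ D) :
    top (p.Lw G) = -(1 / (2 * p.κ)) * (2 * p.lam * top G.vol - p.a0 * G.pT G.Rlow (G.conA G.cofL)
      + G.pV G.TL (p.opT G.toFrame G.TL) + G.pT G.Q (p.opQ G.toFrame G.Q)
      - 2 * p.b5 / D * G.pair (G.lamOp G.Q) (G.tr G.Q)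
      + 2 * G.pV (G.wed (p.opC G.toFrame G.Q)) G.TL) := by
  have e1 : top (∑ a, G.T a * G.star (G.low1 (p.sumT G) a)) = G.pV G.TL (p.opT G.toFrame G.TL) := by
    rw [p.low1_sumT_eq h, Geom.TL, h.pV_low1, top_sum]; rfl
  have e2 : top (∑ a, ∑ b, G.Q a b * G.star (G.up2 (p.sumQ G) a b))
      = G.pT G.Q (p.opQ G.toFrame G.Q) := by
    rw [p.sumQ_eq h hD]; simp only [top_sum]; rfl
  have dQ := h.degQ
  -- Each of the two factors has `ϑ` on the right of a 1-form; reordering costs a sign in each, and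
  -- the two cancel.
  have e3 : top (∑ c, (∑ a, G.Q3 a c * G.cof a) * G.star (∑ b, G.up2 G.Q4 b c * G.cofL b))
      = -(1 / (D : ℝ)) * G.pair (G.lamOp G.Q) (G.tr G.Q) := by
    rw [← h.pV_wed_opQ3_opQ4 hD dQ G.Q, top_sum, pV_apply]
    have d3 : TDeg 1 (G.opQ3 G.Q) := dQ.opQ3
    have d4 : TDeg 1 (G.opQ4 G.Q) := dQ.opQ4
    refine Finset.sum_congr rfl fun c _ => ?_
    have f1 : ∑ a, G.Q3 a c * G.cof a = -G.wed (G.opQ3 G.Q) c := by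
      rw [h.Q3_eq, wed_apply, ← Finset.sum_neg_distrib]
      exact Finset.sum_congr rfl fun a _ =>
        Deg.mul_form1_odd (p := 1) (by simpa using d3 a c) odd_one _
    have f2 : ∑ b, G.up2 G.Q4 b c * G.cofL b = -G.upV (G.wed (G.opQ4 G.Q)) c := by
      have : ∀ b, G.up2 G.Q4 b c = G.upV (fun a => G.upV (G.opQ4 G.Q a) c) b := fun b => by
        rw [up2_eq, Geom.Q4_eq]
      simp only [this]
      rw [h.sum_mul_cofL]
      simp only [upV, wed_apply, Finset.sum_mul, Finset.smul_sum, ← Finset.sum_neg_distrib]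
      rw [Finset.sum_comm]
      refine Finset.sum_congr rfl fun b _ => Finset.sum_congr rfl fun a _ => ?_
      rw [smul_mul_assoc, ← smul_neg]
      congr 1
      exact Deg.mul_form1_odd (p := 1) (by simpa using d4 a b) odd_one _
    rw [f1, f2, Frame.star_neg, neg_mul_neg]
    rfl
  -- Only one such reordering occurs here, which turns the prefactor `-2` of the `c_I` terms into
  -- `+2`.
  have e4 : top (∑ a, ∑ b, p.sumC G a b * G.cof a * G.star (G.T b))
      = -G.pV (G.wed (p.opC G.toFrame G.Q)) G.TL := by
    rw [p.sumC_eq h hD, pV_apply, Finset.sum_comm, top_sum, ← Finset.sum_neg_distrib]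
    refine Finset.sum_congr rfl fun b _ => ?_
    rw [← Finset.sum_mul, ← h.T_eq]
    have f1 : ∑ a, p.opC G.toFrame G.Q a b * G.cof a = -G.wed (p.opC G.toFrame G.Q) b := by
      rw [wed_apply, ← Finset.sum_neg_distrib]
      exact Finset.sum_congr rfl fun a _ =>
        Deg.mul_form1_odd (p := 1) (by simpa using p.degOpC dQ a b) odd_one _
    rw [f1, neg_mul, top_neg]
    rfl
  rw [Lw, top_smul, top_sub, top_add, top_add, top_add, top_sub, top_smul, top_smul, top_smul,
    top_smul, top_LEH h.toRegular, e1, e2, e3, e4]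
  ring

end Params
end MAG
end

/-! ### Derivatives of the Lagrangian with respect to nonmetricity, torsion and curvature. -/

noncomputable section

namespace MAG

variable {D : ℕ}

open _root_.MAG.Frame

/-! ### The momenta -/

theorem hasDerivAt_quadratic {V : Type*} [AddCommGroup V] [Module ℝ V] (B : V →ₗ[ℝ] V →ₗ[ℝ] ℝ)
    (x y : V) : HasDerivAt (fun t : ℝ => B (x + t • y) (x + t • y)) (B x y + B y x) 0 := by
  have e : (fun t : ℝ => B (x + t • y) (x + t • y))
      = fun t => B x x + t * (B x y + B y x) + t ^ 2 * B y y := by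
    ext t
    simp only [map_add, map_smul, LinearMap.add_apply, LinearMap.smul_apply, smul_eq_mul]
    ring
  rw [e]
  have h1 := (hasDerivAt_id (0 : ℝ)).mul_const (B x y + B y x)
  have h2 := ((hasDerivAt_id (0 : ℝ)).pow 2).mul_const (B y y)
  exact ((h1.const_add (B x x)).add h2).congr_deriv (by simp)

theorem hasDerivAt_affine {V : Type*} [AddCommGroup V] [Module ℝ V] (f : V →ₗ[ℝ] ℝ)
    (x y : V) : HasDerivAt (fun t : ℝ => f (x + t • y)) (f y) 0 := by
  have e : (fun t : ℝ => f (x + t • y)) = fun t => f x + t * f y := by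
    ext t; simp
  rw [e]
  simpa using ((hasDerivAt_id (0 : ℝ)).mul_const (f y)).const_add (f x)

variable {G : Geom D}

theorem Geom.Regular.withQ (h : G.Regular) {Q : TForm D} (hQ : TDeg 1 Q) (hs : tp Q = Q) :
    ({ G with Q := Q } : Geom D).Regular :=
  ⟨h.toRegular, hs, hQ, h.degT, h.degR⟩

theorem Geom.Regular.withT (h : G.Regular) {T : VForm D} (hT : VDeg 2 T) :
    ({ G with T := T } : Geom D).Regular :=
  ⟨h.toRegular, h.tpQ, h.degQ, hT, h.degR⟩

theorem Geom.Regular.withR (h : G.Regular) {R : TForm D} (hR : TDeg 2 R) :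
    ({ G with R := R } : Geom D).Regular :=
  ⟨h.toRegular, h.tpQ, h.degQ, h.degT, hR⟩

namespace Frame

/-- The pairing of forms as a bilinear map. -/
def pairL (F : Frame D) : Form D →ₗ[ℝ] Form D →ₗ[ℝ] ℝ :=
  LinearMap.mk₂ ℝ F.pair (by simp) (by simp) (by simp) (by simp)

theorem pairL_apply (F : Frame D) (α β : Form D) : F.pairL α β = F.pair α β := rfl

end Frame

namespace Params

variable (p : Params)

/-- The Lagrangian as a function of the fields with lowered indices. -/
def lagr (F : Frame D) (Q : TForm D) (T : VForm D) (R : TForm D) : ℝ :=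
  -(1 / (2 * p.κ)) * (2 * p.lam * top F.vol - p.a0 * F.pT R (F.conA F.cofL)
      + F.pV T (p.opT F T) + F.pT Q (p.opQ F Q) - 2 * p.b5 / D * F.pair (F.lamOp Q) (F.tr Q)
      + 2 * F.pV (F.wed (p.opC F Q)) T)
    + -(1 / (2 * p.ρ)) * F.pT R (p.strongOp F R)

theorem top_LMAG (h : G.Regular) (hD : 3 ≤ D) :
    top (p.LMAG G) = p.lagr G.toFrame G.Q G.TL G.Rlow := by
  rw [LMAG, top_add, p.top_Lw h hD, p.top_Ls h hD, lagr]

/-- The argument of the Hodge dual in `m^{ab}`, with lowered indices. -/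
def nonmetricityMomentum (G : Geom D) : TForm D :=
  p.opQ G.toFrame G.Q - p.b5 • (sy (G.conA (G.wdgA G.trQ)) + (1 / (D : ℝ)) • G.trA (G.Lam - G.trQ))
    + p.opC G.toFrame (sy (G.wedA G.TL))

theorem m_eq (h : G.Regular) (hD : 3 ≤ D) (a b : Fin D) :
    p.m G a b = G.star (G.up2 (p.nonmetricityMomentum G) a b) := by
  have e1 : ∀ ω, symm (fun a b => G.cof a * G.ipU b ω) = G.up2 (sy (G.conA (G.wdgA ω))) := by
    intro ω
    rw [up2_sy, symm_eq_sy]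
    congr 1
    ext a b : 2
    rw [h.up2_conA]; rfl
  have e2 : symm (fun a b => G.ipU a (G.T b)) = G.up2 (sy (G.wedA G.TL)) := by
    rw [up2_sy, symm_eq_sy]
    congr 1
    ext a b : 2
    rw [up2_wedA, ← h.T_eq]
  have e3 : ∀ ω a b, G.gi a b • ω = G.up2 (G.trA ω) a b := fun ω a b => (h.up2_trA ω a b).symm
  rw [m, nonmetricityMomentum, p.opC_sy_wedA h.toRegular hD h.degTL, p.sumQ_eq h hD, e1, e1, e2,
    e3, e3, ← h.trT_eq]
  simp only [up2_add, up2_sub, up2_smul, Pi.add_apply, Pi.sub_apply, Pi.smul_apply]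
  congr 1
  abel

theorem h1_eq (h : G.Regular) (hD : 3 ≤ D) (a : Fin D) :
    p.h1 G a = G.star ((p.opT G.toFrame G.TL + G.wed (p.opC G.toFrame G.Q)) a) := by
  rw [h1, p.low1_sumT_eq h, p.sumC_eq h hD, Pi.add_apply, wed_apply]
  congr 2
  refine Finset.sum_congr rfl fun b _ => ?_
  exact congrArg _ (congrFun₂ (p.tp_opC h.toRegular G.Q) b a)

theorem h2L_eq (a b : Fin D) : p.h2L G a b = G.star (p.strongMomentum G a b) := rfl

theorem h2_eq (a b : Fin D) : p.h2 G a b = G.star (G.up1 (p.strongMomentum G) a b) := by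
  simp only [h2, up1, Frame.star_sum, Frame.star_smul, h2L_eq]

theorem hasDerivAt_Q (h : G.Regular) (hD : 3 ≤ D) {B : TForm D} (hB : TDeg 1 B) (hs : tp B = B) :
    HasDerivAt (fun t : ℝ => top (p.LMAG { G with Q := G.Q + t • B }))
      (-(1 / p.κ) * G.pT B (p.nonmetricityMomentum G)) 0 := by
  set F := G.toFrame with hF
  have hr := h.toRegular
  have e : (fun t : ℝ => top (p.LMAG { G with Q := G.Q + t • B })) = fun t =>
      p.lagr F (G.Q + t • B) G.TL G.Rlow := by
    ext t
    exact p.top_LMAG (h.withQ (h.degQ.add (hB.smul t)) (by rw [map_add, map_smul, h.tpQ, hs])) hD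
  have d1 := hasDerivAt_quadratic (F.pT.compl₂ (p.opQ F)) G.Q B
  have d2 := hasDerivAt_quadratic (F.pairL.compl₁₂ F.lamOp F.tr) G.Q B
  have d3 := hasDerivAt_affine (F.pV.flip G.TL ∘ₗ F.wed ∘ₗ p.opC F) G.Q B
  have f1 : F.pT G.Q (p.opQ F B) = F.pT B (p.opQ F G.Q) := by
    rw [p.selfAdj_opQ hr, hr.pT_comm]
  -- Polarisation of the `b_5` term. Transposing `lamOp` produces a trace-free tensor, and its
  -- subtracted trace combines with `trA Λ` to the printed `Λ - Q`; the factor `D` is that in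
  -- `Q_c{}^c = D Q`.
  have f2 : F.pair (F.lamOp G.Q) (F.tr B) + F.pair (F.lamOp B) (F.tr G.Q) = (D : ℝ) *
      F.pT B (sy (F.conA (F.wdgA G.trQ)) + (1 / (D : ℝ)) • F.trA (G.Lam - G.trQ)) := by
    have hD0 : (D : ℝ) ≠ 0 := by positivity
    have dt : Deg 1 (F.tr G.Q) := Deg.tr h.degQ
    rw [hr.pair_comm (F.lamOp B), hr.pair_lamOp_right, hr.frs_conA_wdgA dt, hr.pair_tr_right,
      hr.pT_comm _ B, hr.pT_comm _ B, Geom.trQ_eq, h.Lam_eq, ← hF]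
    simp only [map_add, map_sub, map_smul, smul_eq_mul]
    field_simp
    ring
  -- The image of `opC` is symmetric, so `e_a ⌟ T_b` may be symmetrised before the operator is moved
  -- onto it.
  have f3 : F.pV (F.wed (p.opC F B)) G.TL = F.pT B (p.opC F (sy (F.wedA G.TL))) := by
    rw [p.selfAdj_opC hr, pT_sy, sy_of_tp (p.tp_opC hr B), hr.pT_wedA]
  simp only [LinearMap.compl₂_apply, LinearMap.compl₁₂_apply, LinearMap.comp_apply,
    LinearMap.flip_apply, pairL_apply] at d1 d2 d3
  rw [e]
  simp only [lagr]
  have k := ((((d1.const_add (2 * p.lam * top F.vol - p.a0 * F.pT G.Rlow (F.conA F.cofL)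
    + F.pV G.TL (p.opT F G.TL))).sub (d2.const_mul (2 * p.b5 / (D : ℝ)))).add
    (d3.const_mul 2)).const_mul (-(1 / (2 * p.κ)))).add_const
    (-(1 / (2 * p.ρ)) * F.pT G.Rlow (p.strongOp F G.Rlow))
  refine HasDerivAt.congr_deriv (k.congr_of_eventuallyEq (.of_forall fun t => ?_)) ?_
  · simp only [Pi.add_apply, Pi.sub_apply]
  have hD0 : (D : ℝ) ≠ 0 := by positivity
  rw [f1, f2, f3, nonmetricityMomentum]
  simp only [map_add, map_sub, map_smul, smul_eq_mul]
  field_simp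
  ring

theorem hasDerivAt_T (h : G.Regular) (hD : 3 ≤ D) {V : VForm D} (hV : VDeg 2 V) :
    HasDerivAt (fun t : ℝ => top (p.LMAG { G with T := G.T + t • V }))
      (-(1 / p.κ) * G.pV (G.low1 V) (p.opT G.toFrame G.TL + G.wed (p.opC G.toFrame G.Q))) 0 := by
  set F := G.toFrame with hF
  have hr := h.toRegular
  have e : (fun t : ℝ => top (p.LMAG { G with T := G.T + t • V })) = fun t =>
      p.lagr F G.Q (G.TL + t • F.low1 V) G.Rlow := by
    ext t
    have := p.top_LMAG (h.withT (h.degT.add (hV.smul t))) hD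
    rw [this, Geom.TL, Geom.TL, Geom.low1_add, Geom.low1_smul]
    rfl
  have d1 := hasDerivAt_quadratic (F.pV.compl₂ (p.opT F)) G.TL (F.low1 V)
  have d3 := hasDerivAt_affine (F.pV (F.wed (p.opC F G.Q))) G.TL (F.low1 V)
  have f1 : F.pV G.TL (p.opT F (F.low1 V)) = F.pV (F.low1 V) (p.opT F G.TL) := by
    rw [p.selfAdj_opT hr, hr.pV_comm]
  simp only [LinearMap.compl₂_apply] at d1
  rw [e]
  simp only [lagr]
  refine ((((((d1.const_add _).add_const _).sub_const _).add (d3.const_mul 2)).const_mul _).add_const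
    _).congr_deriv ?_
  rw [f1, map_add, hr.pV_comm (F.wed _)]
  field_simp
  ring

theorem hasDerivAt_R (h : G.Regular) (hD : 3 ≤ D) {B : TForm D} (hB : TDeg 2 B) :
    HasDerivAt (fun t : ℝ => top (p.LMAG { G with R := G.R + t • B }))
      (1 / (2 * p.κ) * p.a0 * G.pT (G.low2 B) (G.conA G.cofL)
        - 1 / p.ρ * G.pT (G.low2 B) (p.strongMomentum G)) 0 := by
  set F := G.toFrame with hF
  have hr := h.toRegular
  have dB : TDeg 2 (F.low2 B) := by
    intro a b
    rw [Frame.low2]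
    exact Deg.sum fun c => Deg.smul _ (hB a c)
  have e : (fun t : ℝ => top (p.LMAG { G with R := G.R + t • B })) = fun t =>
      p.lagr F G.Q G.TL (G.Rlow + t • F.low2 B) := by
    ext t
    have := p.top_LMAG (h.withR (h.degR.add (hB.smul t))) hD
    have e2 : ({ G with R := G.R + t • B } : Geom D).Rlow = G.Rlow + t • F.low2 B := by
      ext a b : 2
      simp [Geom.Rlow, Frame.low2, Finset.sum_add_distrib, Finset.smul_sum, smul_comm t, hF]
    rw [this, e2]
    rfl
  have d1 := hasDerivAt_quadratic (F.pT.compl₂ (p.strongOp F)) G.Rlow (F.low2 B)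
  have d3 := hasDerivAt_affine (F.pT.flip (F.conA F.cofL)) G.Rlow (F.low2 B)
  simp only [LinearMap.compl₂_apply, LinearMap.flip_apply] at d1 d3
  rw [e]
  simp only [lagr]
  have z := p.pT_strongOp h hD dB
  rw [← hF] at z
  have d1 := d1.congr_deriv z
  have k := (((((((d3.const_mul p.a0).const_sub (2 * p.lam * top F.vol)).add_const
    (F.pV G.TL (p.opT F G.TL))).add_const (F.pT G.Q (p.opQ F G.Q))).sub_const
    (2 * p.b5 / D * F.pair (F.lamOp G.Q) (F.tr G.Q))).add_const
    (2 * F.pV (F.wed (p.opC F G.Q)) G.TL)).const_mul (-(1 / (2 * p.κ)))).add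
    (d1.const_mul (-(1 / (2 * p.ρ))))
  refine HasDerivAt.congr_deriv (k.congr_of_eventuallyEq (.of_forall fun t => ?_)) ?_
  · simp only [Pi.add_apply]
  field_simp
  ring

/-- Symmetry singles out `M^{ab}`: derivatives along symmetric `δQ_{ab}` do not see an antisymmetric
part. -/
theorem tp_nonmetricityMomentum (h : G.Regular) :
    tp (p.nonmetricityMomentum G) = p.nonmetricityMomentum G := by
  have e : ∀ A : TForm D, tp A = A → tp (p.opQ G.toFrame A) = p.opQ G.toFrame A := by
    intro A hA
    have hr := h.toRegular
    simp only [opQ, opQ1, opQ2, opQ3, opQ4, lamAdj, LinearMap.add_apply, LinearMap.smul_apply,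
      LinearMap.sub_apply, LinearMap.comp_apply, map_add, map_sub, map_smul, hr.tp_frs, hr.tp_trA,
      LinearMap.id_apply, hA]
  rw [nonmetricityMomentum, map_add, map_sub, map_smul, map_add, map_smul, tp_sy,
    h.tp_trA, p.tp_opC h.toRegular, e _ h.tpQ]

/-- The degrees are hypotheses here, to be supplied by the calculus of natural constructions. What
remains is to read the tensor pairings as sums of exterior products with starred, index-raised
momenta. -/
theorem hasMomenta (h : G.Regular) (hD : 3 ≤ D) (hm : TDeg (D - 1) (p.m G))
    (hh1 : VDeg (D - 2) (p.h1 G)) (hh2 : TDeg (D - 2) (p.h2 G)) : HasMomenta p.LMAG G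
    (fun a b => (2 / p.κ) • p.m G a b) (fun a => (1 / p.κ) • p.h1 G a)
    (fun a b => (-(1 / (2 * p.κ)) * p.a0) • G.star (G.cof a * G.cofL b)
      + (1 / p.ρ) • p.h2 G a b) where
  degM a b := by
    -- The natural-number difference `D - 1` agrees with the real degree since `D ≥ 3`.
    rw [isForm_iff_deg, Nat.cast_sub (by lia)]
    simpa using (hm a b).smul (2 / p.κ)
  symmM a b := by
    have e : tp (G.up2 (p.nonmetricityMomentum G)) = G.up2 (p.nonmetricityMomentum G) := by
      rw [← up2_tp, p.tp_nonmetricityMomentum h]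
    rw [p.m_eq h hD, p.m_eq h hD, ← congrFun₂ e a b]
    rfl
  degH a := by
    rw [isForm_iff_deg, Nat.cast_sub (by lia)]
    simpa using (hh1 a).smul (1 / p.κ)
  degHH a b := by
    rw [isForm_iff_deg, Nat.cast_sub (by lia)]
    have d1 : Deg 2 (G.cof a * G.cofL b) :=
      ((deg_cof (F := G.toFrame) a).mul (deg_cofL (F := G.toFrame) b)).cast (by norm_num)
    simpa using ((d1.star G.toFrame).smul (-(1 / (2 * p.κ)) * p.a0)).add
      ((hh2 a b).smul (1 / p.ρ))
  derivQ B hB hs := by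
    have hB' : TDeg 1 B := fun a b => by simpa using isForm_iff_deg.1 (hB a b)
    refine (p.hasDerivAt_Q h hD hB' (funext₂ fun a b => hs b a)).congr_deriv ?_
    simp only [top_sum, p.m_eq h hD, pT_apply, Finset.mul_sum, mul_smul_comm, top_smul]
    refine Finset.sum_congr rfl fun a _ => Finset.sum_congr rfl fun b _ => ?_
    rw [Frame.pair]
    ring
  derivT V hV := by
    have hV' : VDeg 2 V := fun a => by simpa using isForm_iff_deg.1 (hV a)
    refine (p.hasDerivAt_T h hD hV').congr_deriv ?_
    rw [h.pV_low1]
    simp only [top_sum, p.h1_eq h hD, Finset.mul_sum, mul_smul_comm, top_smul, mul_neg, top_neg]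
    refine Finset.sum_congr rfl fun a _ => ?_
    rw [Frame.pair]
    ring
  derivR B hB := by
    have hB' : TDeg 2 B := fun a b => by simpa using isForm_iff_deg.1 (hB a b)
    refine (p.hasDerivAt_R h hD hB').congr_deriv ?_
    have e1 : ∀ a b, G.up1 (G.conA G.cofL) a b = G.cof a * G.cofL b := by
      intro a b
      rw [← h.upV_cofL]; simp [up1, upV, conA_apply, Finset.sum_mul]
    rw [h.pT_low2, h.pT_low2]
    simp only [top_sum, p.h2_eq, Finset.mul_sum, mul_smul_comm, top_smul, mul_neg, top_neg,
      mul_add, top_add, ← Finset.sum_sub_distrib, e1]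
    refine Finset.sum_congr rfl fun a _ => Finset.sum_congr rfl fun b _ => ?_
    simp only [Frame.pair]
    ring

end Params
end MAG
end

/-! ### Smooth dependence on parameters, and behaviour under linear maps of the cotangent space. -/

noncomputable section

namespace MAG

variable {D : ℕ}

/-! ### Smooth families of forms -/

section SmoothForm

variable {E : Type} [NormedAddCommGroup E] [NormedSpace ℝ E] {s : Set E}

/-- The coefficients of a family of forms are smooth. -/
def SmoothForm (s : Set E) (α : E → Form D) : Prop :=
  ∀ I, ContDiffOn ℝ (⊤ : ℕ∞) (fun x => coeff I (α x)) s

variable {α β : E → Form D} {f : E → ℝ}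

theorem SmoothForm.const (α : Form D) : SmoothForm s fun _ => α := fun _ => contDiffOn_const

theorem SmoothForm.add (hα : SmoothForm s α) (hβ : SmoothForm s β) :
    SmoothForm s fun x => α x + β x := fun I => by
  simpa only [coeff_add] using (hα I).add (hβ I)

theorem SmoothForm.sub (hα : SmoothForm s α) (hβ : SmoothForm s β) :
    SmoothForm s fun x => α x - β x := fun I => by
  simpa only [coeff_sub] using (hα I).sub (hβ I)

theorem SmoothForm.neg (hα : SmoothForm s α) : SmoothForm s fun x => -α x := fun I => by
  simpa only [coeff_neg] using (hα I).neg

theorem SmoothForm.smul (hf : ContDiffOn ℝ (⊤ : ℕ∞) f s) (hα : SmoothForm s α) :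
    SmoothForm s fun x => f x • α x := fun I => by
  simpa only [coeff_smul] using hf.mul (hα I)

theorem SmoothForm.sum {ι : Type*} {t : Finset ι} {α : ι → E → Form D}
    (hα : ∀ i, SmoothForm s (α i)) : SmoothForm s fun x => ∑ i ∈ t, α i x := fun I => by
  simp only [coeff_sum]
  exact ContDiffOn.sum fun i _ => hα i I

theorem SmoothForm.congr (hα : SmoothForm s α) (h : ∀ x ∈ s, β x = α x) : SmoothForm s β :=
  fun I => (hα I).congr fun x hx => by rw [h x hx]

theorem SmoothForm.map (L : Form D →ₗ[ℝ] Form D) (hα : SmoothForm s α) :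
    SmoothForm s fun x => L (α x) := by
  have : (fun x => L (α x)) = fun x => ∑ I, coeff I (α x) • L (dxBasis I) := by
    ext1 x
    conv_lhs => rw [← sum_coeff (α x)]
    simp
  rw [this]
  exact .sum fun I => .smul (hα I) (.const _)

theorem SmoothForm.mul (hα : SmoothForm s α) (hβ : SmoothForm s β) :
    SmoothForm s fun x => α x * β x := by
  have : (fun x => α x * β x) = fun x => ∑ I, coeff I (α x) • (dxBasis I * β x) := by
    ext1 x
    conv_lhs => rw [← sum_coeff (α x)]
    simp [Finset.sum_mul]
  rw [this]
  exact .sum fun I => .smul (hα I) (hβ.map (LinearMap.mulLeft ℝ (dxBasis I)))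

theorem SmoothForm.form1 {ω : E → Cov D} (hω : ∀ μ, ContDiffOn ℝ (⊤ : ℕ∞) (fun x => ω x μ) s) :
    SmoothForm s fun x => form1 (ω x) := by
  simp only [form1_eq_sum]
  exact .sum fun μ => .smul (hω μ) (.const _)

theorem SmoothForm.interior {v : E → Fin D → ℝ} (hv : ∀ μ, ContDiffOn ℝ (⊤ : ℕ∞) (fun x => v x μ) s)
    (hα : SmoothForm s α) : SmoothForm s fun x => interior (∑ μ, v x μ • pd μ) (α x) := by
  simp only [interior_vec_sum, interior_vec_smul]
  exact .sum fun μ => .smul (hv μ) (hα.map (CliffordAlgebra.contractLeft (pd μ)))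

theorem contDiffOn_det {n : Type*} [Fintype n] [DecidableEq n] {A : E → Matrix n n ℝ}
    (hA : ∀ a b, ContDiffOn ℝ (⊤ : ℕ∞) (fun x => A x a b) s) :
    ContDiffOn ℝ (⊤ : ℕ∞) (fun x => (A x).det) s := by
  simp only [Matrix.det_apply']
  exact ContDiffOn.sum fun σ _ => contDiffOn_const.mul (contDiffOn_prod fun i _ => hA _ _)

/-- By Cramer's rule the entries are polynomials divided by the determinant. -/
theorem contDiffOn_matrix_inv {n : Type*} [Fintype n] [DecidableEq n] {A : E → Matrix n n ℝ}
    (hA : ∀ a b, ContDiffOn ℝ (⊤ : ℕ∞) (fun x => A x a b) s) (h0 : ∀ x ∈ s, (A x).det ≠ 0)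
    (a b : n) : ContDiffOn ℝ (⊤ : ℕ∞) (fun x => (A x)⁻¹ a b) s := by
  simp only [Matrix.inv_def, Matrix.smul_apply, smul_eq_mul, Ring.inverse_eq_inv,
    Matrix.adjugate_apply]
  refine ((contDiffOn_det hA).inv h0).mul (contDiffOn_det fun i j => ?_)
  by_cases hi : i = b
  · subst hi; simpa using contDiffOn_const
  · simpa [Matrix.updateRow_ne hi] using hA i j

/-- A smooth family of metrics and coframes. -/
structure SmoothFrame (s : Set E) (F : E → Frame D) : Prop where
  smooth_g : ∀ a b, ContDiffOn ℝ (⊤ : ℕ∞) (fun x => (F x).g a b) s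
  smooth_θ : ∀ a μ, ContDiffOn ℝ (⊤ : ℕ∞) (fun x => (F x).θ a μ) s
  regular : ∀ x ∈ s, (F x).Regular

variable {F : E → Frame D}

namespace SmoothFrame

theorem smooth_gi (h : SmoothFrame s F) (a b : Fin D) :
    ContDiffOn ℝ (⊤ : ℕ∞) (fun x => (F x).gi a b) s :=
  contDiffOn_matrix_inv h.smooth_g (fun x hx => (h.regular x hx).det_g) a b

theorem smooth_e (h : SmoothFrame s F) (a μ : Fin D) :
    ContDiffOn ℝ (⊤ : ℕ∞) (fun x => (F x).θ⁻¹ μ a) s :=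
  contDiffOn_matrix_inv h.smooth_θ (fun x hx => (h.regular x hx).det_θ) μ a

theorem smooth_abs_det (h : SmoothFrame s F) :
    ContDiffOn ℝ (⊤ : ℕ∞) (fun x => |(F x).g.det|) s :=
  (contDiffOn_det h.smooth_g).abs fun x hx => (h.regular x hx).det_g

/-- On nondegenerate metrics the sign is `det g / |det g|`, and the absolute value is smooth away
from zero. -/
theorem smooth_sgn (h : SmoothFrame s F) : ContDiffOn ℝ (⊤ : ℕ∞) (fun x => (F x).sgn) s := by
  have h1 : ContDiffOn ℝ (⊤ : ℕ∞) (fun x => (F x).g.det * |(F x).g.det|⁻¹) s :=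
    (contDiffOn_det h.smooth_g).mul
      (h.smooth_abs_det.inv fun x hx => abs_ne_zero.2 (h.regular x hx).det_g)
  refine h1.congr fun x hx => ?_
  have h0 := (h.regular x hx).det_g
  rw [Frame.sgn, eq_mul_inv_iff_mul_eq₀ (abs_ne_zero.2 h0), sign_mul_abs]

theorem cof (h : SmoothFrame s F) (a : Fin D) : SmoothForm s fun x => (F x).cof a :=
  .form1 (h.smooth_θ a)

theorem ip (h : SmoothFrame s F) (hα : SmoothForm s α) (a : Fin D) :
    SmoothForm s fun x => (F x).ip a (α x) :=
  .interior (h.smooth_e a) hα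

theorem vol (h : SmoothFrame s F) : SmoothForm s fun x => (F x).vol := by
  have h1 : ∀ n (w : Fin n → E → Form D), (∀ i, SmoothForm s (w i)) →
      SmoothForm s fun x => (List.ofFn fun i => w i x).prod := by
    intro n
    induction n with
    | zero => intro w _; simpa using SmoothForm.const _
    | succ n ih =>
      intro w hw
      simp only [List.ofFn_succ, List.prod_cons]
      exact (hw 0).mul (ih (fun i => w i.succ) fun i => hw i.succ)
  exact .smul (h.smooth_abs_det.sqrt fun x hx => abs_ne_zero.2 (h.regular x hx).det_g)
    (h1 D _ h.cof)

/-- For a constant form, each factor split off on the right becomes a contraction whose coefficients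
are entries of the inverse metric and of the dual frame. A variable form is a combination of
constant monomials. -/
theorem star_const (h : SmoothFrame s F) (α : Form D) : SmoothForm s fun x => (F x).star α := by
  induction α using form_right_induction with
  | h0 r => simpa only [Frame.star_form0] using SmoothForm.smul contDiffOn_const h.vol
  | ha α β hα hβ => simpa only [Frame.star_add] using hα.add hβ
  | hm ω α hα =>
    simp only [Frame.star_mul_form1, Frame.sharp_apply, interior_vec_sum, interior_vec_smul,
      Frame.e_apply]
    refine .sum fun a => .sum fun b => .smul ((h.smooth_gi a b).mul ?_) (h.ip hα b)
    exact ContDiffOn.sum fun μ _ => (h.smooth_e a μ).mul contDiffOn_const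

theorem star (h : SmoothFrame s F) (hα : SmoothForm s α) :
    SmoothForm s fun x => (F x).star (α x) := by
  have : (fun x => (F x).star (α x)) = fun x => ∑ I, coeff I (α x) • (F x).star (dxBasis I) := by
    ext1 x
    conv_lhs => rw [← sum_coeff (α x)]
    simp only [Frame.star_sum, Frame.star_smul]
  rw [this]
  exact .sum fun I => .smul (hα I) (h.star_const _)

end SmoothFrame

/-- A smooth family of geometries. -/
structure SmoothGeom (s : Set E) (X : E → Geom D) : Prop extends
    SmoothFrame s fun x => (X x).toFrame where
  smooth_Q : ∀ a b, SmoothForm s fun x => (X x).Q a b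
  smooth_T : ∀ a, SmoothForm s fun x => (X x).T a
  smooth_R : ∀ a b, SmoothForm s fun x => (X x).R a b
  geom_regular : ∀ x ∈ s, (X x).Regular

end SmoothForm

/-! ### Linear maps of the cotangent space -/

section Map

/-- The action of a linear map of the covectors on forms. -/
def mapForm (A : Cov D →ₗ[ℝ] Cov D) (α : Form D) : Form D := ExteriorAlgebra.map A α

@[simp] theorem mapForm_form1 (A : Cov D →ₗ[ℝ] Cov D) (ω : Cov D) :
    mapForm A (form1 ω) = form1 (A ω) := ExteriorAlgebra.map_apply_ι A ω
@[simp] theorem mapForm_zero (A : Cov D →ₗ[ℝ] Cov D) : mapForm A (0 : Form D) = 0 := map_zero _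
@[simp] theorem mapForm_add (A : Cov D →ₗ[ℝ] Cov D) (α β : Form D) :
    mapForm A (α + β) = mapForm A α + mapForm A β := map_add _ _ _
@[simp] theorem mapForm_sub (A : Cov D →ₗ[ℝ] Cov D) (α β : Form D) :
    mapForm A (α - β) = mapForm A α - mapForm A β := map_sub _ _ _
@[simp] theorem mapForm_mul (A : Cov D →ₗ[ℝ] Cov D) (α β : Form D) :
    mapForm A (α * β) = mapForm A α * mapForm A β := map_mul _ _ _
@[simp] theorem mapForm_smul (A : Cov D →ₗ[ℝ] Cov D) (r : ℝ) (α : Form D) :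
    mapForm A (r • α) = r • mapForm A α := map_smul _ _ _
@[simp] theorem mapForm_form0 (A : Cov D →ₗ[ℝ] Cov D) (r : ℝ) :
    mapForm A (form0 r) = form0 r := AlgHom.commutes _ r
theorem mapForm_sum (A : Cov D →ₗ[ℝ] Cov D) {ι : Type*} (s : Finset ι) (f : ι → Form D) :
    mapForm A (∑ i ∈ s, f i) = ∑ i ∈ s, mapForm A (f i) := map_sum _ _ _

theorem interior_mapForm (A : Cov D →ₗ[ℝ] Cov D) (v : Module.Dual ℝ (Cov D)) (α : Form D) :
    interior v (mapForm A α) = mapForm A (interior (v ∘ₗ A) α) := by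
  induction α using form_left_induction with
  | h0 r => simp
  | ha α β hα hβ => simp only [mapForm_add, interior_add, hα, hβ]
  | hm ω α h => simp [interior_form1_mul, h]

theorem Deg.mapForm {r : ℝ} {α : Form D} (h : Deg r α) (A : Cov D →ₗ[ℝ] Cov D) :
    Deg r (mapForm A α) := by
  rw [← sum_coeff α, mapForm_sum]
  refine Deg.sum fun I => ?_
  rw [mapForm_smul]
  by_cases hI : (I.card : ℝ) = r
  · obtain ⟨f, hf⟩ := dxBasis_eq I
    subst hI
    refine Deg.smul _ ?_
    rw [hf, MAG.mapForm, map_list_prod, List.map_ofFn]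
    rw [show (⇑(ExteriorAlgebra.map A) ∘ fun i => MAG.form1 (f i)) = fun i => MAG.form1 (A (f i))
      from funext fun i => mapForm_form1 A (f i)]
    exact deg_ofFn_prod _
  · rw [h.coeff_eq_zero hI, zero_smul]; exact Deg.zero _

namespace Frame

variable {F : Frame D}

/-- The transformed coframe. -/
def map (A : Cov D →ₗ[ℝ] Cov D) (F : Frame D) : Frame D where
  g := F.g
  θ := fun a => A (F.θ a)

theorem Regular.map (h : F.Regular) (A : Cov D ≃ₗ[ℝ] Cov D) : (F.map A.toLinearMap).Regular where
  symm := h.symm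
  det_g := h.det_g
  det_θ := by
    have h1 : LinearIndependent ℝ F.θ.row :=
      Matrix.linearIndependent_rows_iff_isUnit.2 ((Matrix.isUnit_iff_isUnit_det _).2 h.isUnit_θ)
    have h2 : LinearIndependent ℝ (F.map A.toLinearMap).θ.row :=
      h1.map' A.toLinearMap (LinearMap.ker_eq_bot.2 A.injective)
    exact ((Matrix.isUnit_iff_isUnit_det _).1
      (Matrix.linearIndependent_rows_iff_isUnit.1 h2)).ne_zero

/-- The dual frame transforms contragrediently; it suffices to evaluate on the basis `ϑ^b`. -/
theorem Regular.e_map (h : F.Regular) (A : Cov D ≃ₗ[ℝ] Cov D) (a : Fin D) :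
    (F.map A.toLinearMap).e a ∘ₗ A.toLinearMap = F.e a := by
  refine h.basis.ext fun b => ?_
  rw [h.basis_apply, h.e_θ, LinearMap.comp_apply]
  exact (h.map A).e_θ a b

theorem Regular.ip_map (h : F.Regular) (A : Cov D ≃ₗ[ℝ] Cov D) (a : Fin D) (α : Form D) :
    (F.map A.toLinearMap).ip a (mapForm A.toLinearMap α) = mapForm A.toLinearMap (F.ip a α) := by
  rw [ip, interior_mapForm, h.e_map]; rfl

theorem cof_map (A : Cov D →ₗ[ℝ] Cov D) (a : Fin D) : (F.map A).cof a = mapForm A (F.cof a) :=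
  (mapForm_form1 _ _).symm

theorem vol_map (A : Cov D →ₗ[ℝ] Cov D) : (F.map A).vol = mapForm A F.vol := by
  rw [vol, vol, mapForm_smul, mapForm, map_list_prod, List.map_ofFn]
  congr 3
  ext a
  exact cof_map A a

/-- The star is determined by the volume form and contractions with the frame, both of which are
transported along with the coframe. Invertibility is needed because the dual frame involves an
inverse. -/
theorem Regular.star_map (h : F.Regular) (A : Cov D ≃ₗ[ℝ] Cov D) (α : Form D) :
    (F.map A.toLinearMap).star (mapForm A.toLinearMap α) = mapForm A.toLinearMap (F.star α) := by
  induction α using form_right_induction with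
  | h0 r => rw [mapForm_form0, star_form0, star_form0, vol_map, mapForm_smul]
  | ha α β hα hβ => simp only [mapForm_add, star_add, hα, hβ]
  | hm ω α ih =>
    have e : ∀ a, (F.map A.toLinearMap).e a (A ω) = F.e a ω := fun a => by
      rw [← h.e_map A a]; rfl
    rw [mapForm_mul, mapForm_form1, star_mul_form1, star_mul_form1, ih]
    simp only [sharp_apply, interior_vec_sum, interior_vec_smul, mapForm_sum, mapForm_smul]
    refine Finset.sum_congr rfl fun a _ => Finset.sum_congr rfl fun b _ => ?_
    exact congrArg₂ _ (congrArg _ (e a)) (h.ip_map A b _)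

end Frame

/-- The transformed geometry. -/
def Geom.map (A : Cov D →ₗ[ℝ] Cov D) (G : Geom D) : Geom D where
  toFrame := G.toFrame.map A
  Q := fun a b => mapForm A (G.Q a b)
  T := fun a => mapForm A (G.T a)
  R := fun a b => mapForm A (G.R a b)

theorem Geom.Regular.map {G : Geom D} (h : G.Regular) (A : Cov D ≃ₗ[ℝ] Cov D) :
    (G.map A.toLinearMap).Regular where
  toRegular := h.toRegular.map A
  tpQ := funext₂ fun a b => congrArg (mapForm _) (congrFun₂ h.tpQ a b)
  degQ a b := (h.degQ a b).mapForm _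
  degT a := (h.degT a).mapForm _
  degR a b := (h.degR a b).mapForm _

end Map

end MAG
end

/-! ### Naturality, degree and smoothness of every ingredient of the Lagrangian. -/

noncomputable section

namespace MAG

variable {D : ℕ}

/-! ### Natural constructions -/

/-- A form constructed naturally and smoothly from the geometry, of degree `r`. -/
structure Concomitant (r : ℝ) (Φ : Geom D → Form D) : Prop where
  natural : ∀ G, G.Regular → ∀ A : Cov D ≃ₗ[ℝ] Cov D,
    Φ (G.map A.toLinearMap) = mapForm A.toLinearMap (Φ G)
  deg : ∀ G, G.Regular → Deg r (Φ G)
  smooth : ∀ {E : Type} [NormedAddCommGroup E] [NormedSpace ℝ E] {s : Set E} {X : E → Geom D},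
    SmoothGeom s X → SmoothForm s fun x => Φ (X x)

namespace Concomitant

variable {r s : ℝ} {Φ Ψ : Geom D → Form D}

/-- Degrees of composites come out unsimplified, for instance `D - (1 + (D - 3))`; the default
argument lets `ring` normalise them wherever the target degree is known. -/
theorem cast (h : Concomitant r Φ) (e : r = s := by ring) : Concomitant s Φ := e ▸ h

theorem add (h : Concomitant r Φ) (h' : Concomitant r Ψ) : Concomitant r fun G => Φ G + Ψ G where
  natural G hG A := by rw [h.natural G hG, h'.natural G hG, mapForm_add]
  deg G hG := (h.deg G hG).add (h'.deg G hG)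
  smooth hX := (h.smooth hX).add (h'.smooth hX)

theorem sub (h : Concomitant r Φ) (h' : Concomitant r Ψ) : Concomitant r fun G => Φ G - Ψ G where
  natural G hG A := by rw [h.natural G hG, h'.natural G hG, mapForm_sub]
  deg G hG := (h.deg G hG).sub (h'.deg G hG)
  smooth hX := (h.smooth hX).sub (h'.smooth hX)

theorem smul (c : ℝ) (h : Concomitant r Φ) : Concomitant r fun G => c • Φ G where
  natural G hG A := by rw [h.natural G hG, mapForm_smul]
  deg G hG := (h.deg G hG).smul c
  smooth hX := .smul contDiffOn_const (h.smooth hX)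

theorem g_smul (h : Concomitant r Φ) (a b : Fin D) : Concomitant r fun G => G.g a b • Φ G where
  natural G hG A := by rw [h.natural G hG, mapForm_smul]; rfl
  deg G hG := (h.deg G hG).smul _
  smooth hX := .smul (hX.smooth_g a b) (h.smooth hX)

theorem gi_smul (h : Concomitant r Φ) (a b : Fin D) : Concomitant r fun G => G.gi a b • Φ G where
  natural G hG A := by rw [h.natural G hG, mapForm_smul]; rfl
  deg G hG := (h.deg G hG).smul _
  smooth hX := .smul (hX.smooth_gi a b) (h.smooth hX)

theorem sgn_smul (h : Concomitant r Φ) : Concomitant r fun G => G.sgn • Φ G where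
  natural G hG A := by rw [h.natural G hG, mapForm_smul]; rfl
  deg G hG := (h.deg G hG).smul _
  smooth hX := .smul hX.smooth_sgn (h.smooth hX)

theorem sum {ι : Type*} {t : Finset ι} {Φ : ι → Geom D → Form D}
    (h : ∀ i, Concomitant r (Φ i)) : Concomitant r fun G => ∑ i ∈ t, Φ i G where
  natural G hG A := by
    rw [mapForm_sum]
    exact Finset.sum_congr rfl fun i _ => (h i).natural G hG A
  deg G hG := Deg.sum fun i => (h i).deg G hG
  smooth hX := .sum fun i => (h i).smooth hX

theorem mul (h : Concomitant r Φ) (h' : Concomitant s Ψ) :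
    Concomitant (r + s) fun G => Φ G * Ψ G where
  natural G hG A := by rw [h.natural G hG, h'.natural G hG, mapForm_mul]
  deg G hG := (h.deg G hG).mul (h'.deg G hG)
  smooth hX := (h.smooth hX).mul (h'.smooth hX)

theorem ip (h : Concomitant r Φ) (a : Fin D) : Concomitant (r - 1) fun G => G.ip a (Φ G) where
  natural G hG A := by rw [h.natural G hG]; exact hG.ip_map A a _
  deg G hG := (h.deg G hG).interior _
  smooth hX := hX.ip (h.smooth hX) a

theorem ipU (h : Concomitant r Φ) (a : Fin D) : Concomitant (r - 1) fun G => G.ipU a (Φ G) :=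
  sum fun b => (h.ip b).gi_smul a b

theorem star (h : Concomitant r Φ) : Concomitant (D - r) fun G => G.star (Φ G) where
  natural G hG A := by rw [h.natural G hG]; exact hG.star_map A _
  deg G hG := (h.deg G hG).star _
  smooth hX := hX.star (h.smooth hX)

theorem vol : Concomitant D fun G : Geom D => G.vol where
  natural G _ _ := G.vol_map _
  deg G _ := G.deg_vol
  smooth hX := hX.vol

theorem cof (a : Fin D) : Concomitant 1 fun G : Geom D => G.cof a where
  natural G _ _ := G.cof_map _ a
  deg G _ := Frame.deg_cof (F := G.toFrame) a
  smooth hX := hX.cof a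

theorem cofL (a : Fin D) : Concomitant 1 fun G : Geom D => G.cofL a :=
  sum fun b => (cof b).g_smul a b

theorem Q (a b : Fin D) : Concomitant 1 fun G : Geom D => G.Q a b where
  natural _ _ _ := rfl
  deg _ hG := hG.degQ a b
  smooth hX := hX.smooth_Q a b

theorem T (a : Fin D) : Concomitant 2 fun G : Geom D => G.T a where
  natural _ _ _ := rfl
  deg _ hG := hG.degT a
  smooth hX := hX.smooth_T a

theorem R (a b : Fin D) : Concomitant 2 fun G : Geom D => G.R a b where
  natural _ _ _ := rfl
  deg _ hG := hG.degR a b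
  smooth hX := hX.smooth_R a b

section Families

variable {V : Geom D → Fin D → Form D} {A : Geom D → Fin D → Fin D → Form D}

theorem low1 (h : ∀ a, Concomitant r fun G => V G a) (a : Fin D) :
    Concomitant r fun G => G.low1 (V G) a := sum fun b => (h b).g_smul a b

theorem low2 (h : ∀ a b, Concomitant r fun G => A G a b) (a b : Fin D) :
    Concomitant r fun G => G.low2 (A G) a b := sum fun c => (h a c).g_smul c b

theorem up1 (h : ∀ a b, Concomitant r fun G => A G a b) (a b : Fin D) :
    Concomitant r fun G => G.up1 (A G) a b := sum fun c => (h c b).gi_smul a c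

theorem up2 (h : ∀ a b, Concomitant r fun G => A G a b) (a b : Fin D) :
    Concomitant r fun G => G.up2 (A G) a b := by
  simp only [Frame.up2, mul_smul]
  exact sum fun c => sum fun d => ((h c d).gi_smul b d).gi_smul a c

theorem trace (h : ∀ a b, Concomitant r fun G => A G a b) :
    Concomitant r fun G => G.trace (A G) := sum fun a => sum fun b => (h a b).gi_smul a b

theorem symm (h : ∀ a b, Concomitant r fun G => A G a b) (a b : Fin D) :
    Concomitant r fun G => symm (A G) a b := ((h a b).add (h b a)).smul _

theorem asymm (h : ∀ a b, Concomitant r fun G => A G a b) (a b : Fin D) :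
    Concomitant r fun G => asymm (A G) a b := ((h a b).sub (h b a)).smul _

end Families

/-! #### Torsion and nonmetricity -/

theorem trT : Concomitant 1 fun G : Geom D => G.trT :=
  sum fun a => ((T a).ip a).cast

theorem T2 (a : Fin D) : Concomitant 2 fun G : Geom D => G.T2 a :=
  (((cof a).mul trT).smul _).cast

theorem T3 (a : Fin D) : Concomitant 2 fun G : Geom D => G.T3 a :=
  (((sum fun b => (T b).mul (cofL b)).ipU a).smul _).cast

theorem T1 (a : Fin D) : Concomitant 2 fun G : Geom D => G.T1 a := ((T a).sub (T2 a)).sub (T3 a)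

theorem trQ : Concomitant 1 fun G : Geom D => G.trQ := (trace Q).smul _

theorem Qfree (a b : Fin D) : Concomitant 1 fun G : Geom D => G.Qfree a b :=
  (Q a b).sub (trQ.g_smul a b)

theorem Lam : Concomitant 1 fun G : Geom D => G.Lam :=
  sum fun a => sum fun b => ((cof a).mul ((Qfree a b).ipU b)).cast

theorem Lambar (a : Fin D) : Concomitant (D - 2) fun G : Geom D => G.Lambar a :=
  ((sum fun c => (Qfree a c).mul (cof c)).sub (((cofL a).mul Lam).smul _)).star.cast

theorem Q4 (a b : Fin D) : Concomitant 1 fun G : Geom D => G.Q4 a b := trQ.g_smul a b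

theorem Q3 (a b : Fin D) : Concomitant 1 fun G : Geom D => G.Q3 a b :=
  ((symm (fun a b => ((cofL a).mul (Lam.ip b)).cast) a b).sub ((Lam.g_smul a b).smul _)).smul _

theorem Q2 (a b : Fin D) : Concomitant 1 fun G : Geom D => G.Q2 a b := by
  -- The scalar is separated into a constant and the sign, because the latter depends on the
  -- geometry.
  have h : Concomitant 1 fun G : Geom D => (-(2 / 3) : ℝ) • G.sgn •
      G.star (MAG.symm (fun a b => G.Lambar a * G.cofL b) a b) :=
    ((symm (fun a b => (Lambar a).mul (cofL b)) a b).star.sgn_smul.smul _).cast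
  simpa only [Geom.Q2, mul_smul] using h

theorem Q1 (a b : Fin D) : Concomitant 1 fun G : Geom D => G.Q1 a b :=
  (((Q a b).sub (Q2 a b)).sub (Q3 a b)).sub (Q4 a b)

/-! #### Curvature -/

theorem Rlow (a b : Fin D) : Concomitant 2 fun G : Geom D => G.Rlow a b := low2 R a b

theorem W (a b : Fin D) : Concomitant 2 fun G : Geom D => G.W a b := asymm Rlow a b

theorem Z (a b : Fin D) : Concomitant 2 fun G : Geom D => G.Z a b := symm Rlow a b

theorem XU (a : Fin D) : Concomitant 1 fun G : Geom D => G.XU a :=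
  sum fun b => ((up2 W a b).ip b).cast

theorem XL (a : Fin D) : Concomitant 1 fun G : Geom D => G.XL a := low1 XU a

theorem X : Concomitant 0 fun G : Geom D => G.X := sum fun a => ((XU a).ip a).cast

theorem XbarU (a : Fin D) : Concomitant (D - 3) fun G : Geom D => G.XbarU a :=
  (sum fun b => (up2 W b a).mul (cofL b)).star.cast

theorem XbarL (a : Fin D) : Concomitant (D - 3) fun G : Geom D => G.XbarL a := low1 XbarU a

/-- For `D = 3` the degree is `-1`, and the eigenvalue equation then says that the form vanishes.
Real-valued degrees make a separate case unnecessary. -/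
theorem Xbar : Concomitant (D - 4) fun G : Geom D => G.Xbar :=
  sum fun a => ((XbarU a).ip a).cast

theorem Psi (a : Fin D) : Concomitant 1 fun G : Geom D => G.Psi a :=
  ((XL a).sub ((X.mul (cofL a)).smul _).cast).sub
    (((sum fun b => (cof b).mul (XL b)).ip a).smul _).cast

theorem Psibar (a : Fin D) : Concomitant (D - 3) fun G : Geom D => G.Psibar a :=
  ((XbarL a).sub (((cofL a).mul Xbar).smul _).cast).sub
    (((sum fun b => (cof b).mul (XbarL b)).ip a).smul _).cast

theorem W2 (a b : Fin D) : Concomitant 2 fun G : Geom D => G.W2 a b :=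
  (asymm (fun a b => (cofL a).mul (Psibar b)) a b).star.sgn_smul.cast

theorem W3 (a b : Fin D) : Concomitant 2 fun G : Geom D => G.W3 a b := by
  have h : Concomitant 2 fun G : Geom D => G.sgn • (1 / 12 : ℝ) •
      G.star (G.Xbar * (G.cofL a * G.cofL b)) :=
    ((Xbar.mul ((cofL a).mul (cofL b))).star.smul _).sgn_smul.cast
  simpa only [Geom.W3, mul_smul] using h

theorem W4 (a b : Fin D) : Concomitant 2 fun G : Geom D => G.W4 a b :=
  ((asymm (fun a b => (cofL a).mul (Psi b)) a b).smul _).cast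

theorem W5 (a b : Fin D) : Concomitant 2 fun G : Geom D => G.W5 a b :=
  ((asymm (fun a b => (cofL a).mul ((sum fun c => (cof c).mul (XL c)).ip b)) a b).smul _).cast

theorem W6 (a b : Fin D) : Concomitant 2 fun G : Geom D => G.W6 a b :=
  ((X.mul ((cofL a).mul (cofL b))).smul _).cast

theorem W1 (a b : Fin D) : Concomitant 2 fun G : Geom D => G.W1 a b :=
  (W a b).sub (((((W2 a b).add (W3 a b)).add (W4 a b)).add (W5 a b)).add (W6 a b))

theorem Z5 (a b : Fin D) : Concomitant 2 fun G : Geom D => G.Z5 a b :=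
  ((trace Z).g_smul a b).smul _

theorem Y (a : Fin D) : Concomitant 1 fun G : Geom D => G.Y a :=
  sum fun b => (((Z a b).sub (Z5 a b)).ipU b).cast

theorem Ybar (a : Fin D) : Concomitant (D - 3) fun G : Geom D => G.Ybar a :=
  (sum fun b => ((Z b a).sub (Z5 b a)).mul (cof b)).star.cast

theorem Phi (a : Fin D) : Concomitant 1 fun G : Geom D => G.Phi a :=
  (Y a).sub (((sum fun b => (cof b).mul (Y b)).ip a).smul _).cast

theorem Phibar (a : Fin D) : Concomitant (D - 3) fun G : Geom D => G.Phibar a :=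
  (Ybar a).sub (((sum fun b => (cof b).mul (Ybar b)).ip a).smul _).cast

theorem Z2 (a b : Fin D) : Concomitant 2 fun G : Geom D => G.Z2 a b := by
  have h : Concomitant 2 fun G : Geom D => (1 / 2 : ℝ) • G.sgn •
      G.star (MAG.symm (fun a b => G.cofL a * G.Phibar b) a b) :=
    ((symm (fun a b => (cofL a).mul (Phibar b)) a b).star.sgn_smul.smul _).cast
  simpa only [Geom.Z2, mul_smul] using h

theorem cof_mul_Y : Concomitant 2 fun G : Geom D => ∑ c, G.cof c * G.Y c :=
  (sum fun c => (cof c).mul (Y c)).cast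

theorem Z3 (a b : Fin D) : Concomitant 2 fun G : Geom D => G.Z3 a b :=
  (((symm (fun a b => ((cofL a).mul (cof_mul_Y.ip b)).cast) a b).smul _).sub
    ((cof_mul_Y.g_smul a b).smul _)).smul _

theorem Z4 (a b : Fin D) : Concomitant 2 fun G : Geom D => G.Z4 a b :=
  ((symm (fun a b => (cofL a).mul (Phi b)) a b).smul _).cast

theorem Z1 (a b : Fin D) : Concomitant 2 fun G : Geom D => G.Z1 a b :=
  (Z a b).sub ((((Z2 a b).add (Z3 a b)).add (Z4 a b)).add (Z5 a b))

theorem P : Concomitant 2 fun G : Geom D => G.P :=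
  sum fun a => sum fun b => ((cof b).mul ((Rlow a b).ipU a)).cast

section Trace

variable {A : Geom D → Fin D → Fin D → Form D}

theorem thetaTrace (h : ∀ a b, Concomitant 2 fun G => A G a b) (a b : Fin D) :
    Concomitant 2 fun G => G.thetaTrace (A G) a b :=
  ((cofL a).mul (sum fun c => (h c b).ipU c)).cast

theorem thetaInt (h : ∀ a b, Concomitant 2 fun G => A G a b) (a b : Fin D) :
    Concomitant 2 fun G => G.thetaInt (A G) a b :=
  sum fun c => ((cof c).mul ((h c b).ip a)).cast

theorem thetaP (a b : Fin D) : Concomitant 2 fun G : Geom D => G.thetaP a b :=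
  ((cofL a).mul (P.ip b)).cast

end Trace

/-! #### The Lagrangian and the momenta -/

variable (p : Params)

theorem sumT (a : Fin D) : Concomitant 2 fun G : Geom D => p.sumT G a :=
  (((T1 a).smul _).add ((T2 a).smul _)).add ((T3 a).smul _)

theorem sumQ (a b : Fin D) : Concomitant 1 fun G : Geom D => p.sumQ G a b :=
  ((((Q1 a b).smul _).add ((Q2 a b).smul _)).add ((Q3 a b).smul _)).add ((Q4 a b).smul _)

theorem sumC (a b : Fin D) : Concomitant 1 fun G : Geom D => p.sumC G a b :=
  (((Q2 a b).smul _).add ((Q3 a b).smul _)).add ((Q4 a b).smul _)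

theorem sumWZ (a b : Fin D) : Concomitant 2 fun G : Geom D => p.sumWZ G a b :=
  ((((((((W1 a b).smul _).add ((W2 a b).smul _)).add ((W3 a b).smul _)).add
    ((W4 a b).smul _)).add ((W5 a b).smul _)).add ((W6 a b).smul _))).add
  ((((((Z1 a b).smul _).add ((Z2 a b).smul _)).add ((Z3 a b).smul _)).add
    ((Z4 a b).smul _)).add ((Z5 a b).smul _))

theorem LEH : Concomitant D fun G : Geom D => Params.LEH G :=
  sum fun a => sum fun b => ((up2 Rlow a b).mul ((cofL a).mul (cofL b)).star).cast

theorem Lw : Concomitant D fun G : Geom D => p.Lw G :=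
  ((((((vol.smul _).sub (LEH.smul _)).add
    (sum fun a => ((T a).mul (low1 (sumT p) a).star).cast)).add
    (sum fun a => sum fun b => ((Q a b).mul (up2 (sumQ p) a b).star).cast)).add
    ((sum fun c => ((sum fun a => (Q3 a c).mul (cof a)).mul
      (sum fun b => (up2 Q4 b c).mul (cofL b)).star).cast).smul _)).sub
    ((sum fun a => sum fun b => (((sumC p a b).mul (cof a)).mul (T b).star).cast).smul _)).smul _

theorem strongBracket (a b : Fin D) : Concomitant 2 fun G : Geom D => p.strongBracket G a b :=
  ((((((sumWZ p a b).add ((thetaTrace W5 a b).smul _)).add ((thetaInt Z2 a b).smul _)).add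
    ((thetaTrace Z3 a b).smul _)).add ((thetaTrace Z4 a b).smul _)).add
    ((thetaTrace Z5 a b).smul _))

theorem Ls : Concomitant D fun G : Geom D => p.Ls G :=
  (sum fun a => sum fun b => ((Rlow a b).mul (up2 (strongBracket p) a b).star).cast).smul _

theorem LMAG : Concomitant D fun G : Geom D => p.LMAG G := (Lw p).add (Ls p)

theorem m (a b : Fin D) : Concomitant (D - 1) fun G : Geom D => p.m G a b :=
  (((((up2 (sumQ p) a b).sub
    (((symm (fun a b => ((cof a).mul (trQ.ipU b)).cast) a b).add
      (((Lam.sub trQ).gi_smul a b).smul _)).smul _)).add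
    ((symm (fun a b => ((T b).ipU a).cast) a b).smul _)).sub ((trT.gi_smul a b).smul _)).add
    ((symm (fun a b => ((cof a).mul (trT.ipU b)).cast) a b).smul _)).star

theorem h1 (a : Fin D) : Concomitant (D - 2) fun G : Geom D => p.h1 G a :=
  ((low1 (sumT p) a).add (sum fun b => ((cof b).mul (sumC p a b)).cast)).star

theorem h2L (a b : Fin D) : Concomitant (D - 2) fun G : Geom D => p.h2L G a b :=
  ((((((sumWZ p a b).add
    (((thetaTrace W5 a b).add ((asymm thetaP a b).smul _)).smul _)).add
    ((((symm (thetaInt W2) a b).add (asymm (thetaInt Z2) a b)).sub ((Z2 a b).smul _)).smul _)).add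
    ((((thetaTrace Z3 a b).add ((symm thetaP a b).smul _)).sub
      ((P.g_smul a b).smul _)).smul _)).add
    ((((asymm (thetaTrace Z4) a b).add (symm (thetaTrace W4) a b)).add
      ((Z4 a b).smul _)).smul _)).add
    (((thetaTrace Z5 a b).add ((P.g_smul a b).smul _)).smul _)).star

theorem h2 (a b : Fin D) : Concomitant (D - 2) fun G : Geom D => p.h2 G a b := up1 (h2L p) a b

end Concomitant

end MAG
end

/-! ### The partial derivative with respect to the coframe, from naturality. -/

noncomputable section

namespace MAG

variable {D : ℕ}

open Filter Topology

/-! ### Derivatives along curves -/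

/-- Coefficientwise derivative of a curve of forms. -/
def HasDerivForm (α : ℝ → Form D) (α' : Form D) (t : ℝ) : Prop :=
  ∀ I, HasDerivAt (fun t => coeff I (α t)) (coeff I α') t

namespace HasDerivForm

variable {α β : ℝ → Form D} {α' β' : Form D} {t : ℝ}

theorem const (α : Form D) (t : ℝ) : HasDerivForm (fun _ => α) 0 t := fun I => by
  simpa using hasDerivAt_const t (coeff I α)

theorem add (hα : HasDerivForm α α' t) (hβ : HasDerivForm β β' t) :
    HasDerivForm (fun t => α t + β t) (α' + β') t := fun I => by
  simpa only [coeff_add] using (hα I).fun_add (hβ I)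

theorem smul_const {f : ℝ → ℝ} {f' : ℝ} (hf : HasDerivAt f f' t) (α : Form D) :
    HasDerivForm (fun t => f t • α) (f' • α) t := fun I => by
  simpa only [coeff_smul] using hf.mul_const (coeff I α)

theorem smul {f : ℝ → ℝ} {f' : ℝ} (hf : HasDerivAt f f' t) (hα : HasDerivForm α α' t) :
    HasDerivForm (fun t => f t • α t) (f' • α t + f t • α') t := fun I => by
  simpa only [coeff_smul, coeff_add] using hf.fun_mul (hα I)

theorem sum {ι : Type*} {s : Finset ι} {α : ι → ℝ → Form D} {α' : ι → Form D}
    (h : ∀ i, HasDerivForm (α i) (α' i) t) :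
    HasDerivForm (fun t => ∑ i ∈ s, α i t) (∑ i ∈ s, α' i) t := fun I => by
  simpa only [coeff_sum] using HasDerivAt.fun_sum fun i (_ : i ∈ s) => h i I

theorem map (L : Form D →ₗ[ℝ] Form D) (h : HasDerivForm α α' t) :
    HasDerivForm (fun t => L (α t)) (L α') t := by
  have e : ∀ β, L β = ∑ I, coeff I β • L (dxBasis I) := fun β => by
    conv_lhs => rw [← sum_coeff β]
    simp
  rw [e α']
  simp only [e (α _)]
  exact sum fun I => smul_const (h I) _

theorem mul (hα : HasDerivForm α α' t) (hβ : HasDerivForm β β' t) :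
    HasDerivForm (fun t => α t * β t) (α' * β t + α t * β') t := by
  have e : ∀ γ η : Form D, γ * η = ∑ I, coeff I γ • (dxBasis I * η) := fun γ η => by
    conv_lhs => rw [← sum_coeff γ]
    simp [Finset.sum_mul]
  rw [e α', e (α t) β', ← Finset.sum_add_distrib]
  simp only [e (α _)]
  exact sum fun I => smul (hα I) (hβ.map (LinearMap.mulLeft ℝ (dxBasis I)))

theorem top (h : HasDerivForm α α' t) : HasDerivAt (fun t => top (α t)) (MAG.top α') t := h _

theorem congr_deriv (h : HasDerivForm α α' t) (e : α' = β') : HasDerivForm α β' t := e ▸ h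

/-- The induced map is multiplicative, so its derivative at the identity obeys the Leibniz rule; on
1-forms it is `A`. -/
theorem mapForm (A : Cov D →ₗ[ℝ] Cov D) (α : Form D) :
    HasDerivForm (fun t => mapForm (LinearMap.id + t • A) α) (derivation A α) 0 := by
  induction α using form_left_induction with
  | h0 r => simpa using HasDerivForm.const (form0 r) 0
  | ha α β hα hβ => simpa using hα.add hβ
  | hm ω α h =>
    have h1 : HasDerivForm (fun t : ℝ => MAG.mapForm (LinearMap.id + t • A) (form1 ω))
        (form1 (A ω)) 0 := by
      have := (const (form1 ω) 0).add (smul_const (hasDerivAt_id (0 : ℝ)) (form1 (A ω)))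
      simpa using this
    have h2 := h1.mul h
    have e : MAG.mapForm (LinearMap.id + (0 : ℝ) • A) = id := by
      ext β : 1
      rw [zero_smul, add_zero, MAG.mapForm, ExteriorAlgebra.map_id]; rfl
    simp only [← mapForm_mul] at h2
    refine h2.congr_deriv ?_
    rw [e, derivation_form1_mul]
    rfl

end HasDerivForm

/-! ### Coordinates on the space of geometries with a fixed metric -/

/-- The `p`-form with given coefficients. -/
def ofCoeff (p : ℕ) (τ : Finset (Fin D) → ℝ) : Form D :=
  ∑ I with I.card = p, τ I • dxBasis I

theorem deg_ofCoeff (p : ℕ) (τ : Finset (Fin D) → ℝ) : Deg p (ofCoeff p τ) := by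
  rw [ofCoeff, Finset.sum_filter]
  refine Deg.sum fun I => ?_
  split_ifs with h
  · exact Deg.smul _ (h ▸ deg_dxBasis I)
  · exact Deg.zero _

theorem ofCoeff_coeff {p : ℕ} {α : Form D} (h : Deg p α) : ofCoeff p (fun I => coeff I α) = α := by
  conv_rhs => rw [← sum_coeff α]
  rw [ofCoeff, Finset.sum_filter]
  refine Finset.sum_congr rfl fun I _ => ?_
  split_ifs with hI
  · rfl
  · rw [h.coeff_eq_zero (by exact_mod_cast hI), zero_smul]

/-- Coefficients of coframe, nonmetricity, torsion and curvature. -/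
abbrev Coords (D : ℕ) := (Fin D → Fin D → ℝ) × (Fin D → Fin D → Finset (Fin D) → ℝ) ×
  (Fin D → Finset (Fin D) → ℝ) × (Fin D → Fin D → Finset (Fin D) → ℝ)

/-- The geometry with given coefficients. -/
def Coords.geom (g : Matrix (Fin D) (Fin D) ℝ) (y : Coords D) : Geom D where
  g := g
  θ := y.1
  Q := fun a b => ofCoeff 1 fun I => (1 / 2 : ℝ) * (y.2.1 a b I + y.2.1 b a I)
  T := fun a => ofCoeff 2 (y.2.2.1 a)
  R := fun a b => ofCoeff 2 (y.2.2.2 a b)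

/-- The coefficients of a quadruple of fields. -/
def toCoords (θ : Fin D → Cov D) (Q : Fin D → Fin D → Form D) (T : Fin D → Form D)
    (R : Fin D → Fin D → Form D) : Coords D :=
  (θ, fun a b I => coeff I (Q a b), fun a I => coeff I (T a), fun a b I => coeff I (R a b))

theorem Geom.Regular.geom_toCoords {G : Geom D} (h : G.Regular) :
    (toCoords G.θ G.Q G.T G.R).geom G.g = G := by
  have hQ : ∀ a b, G.Q b a = G.Q a b := fun a b => congrFun₂ h.tpQ a b
  have e1 : ∀ a b, (ofCoeff 1 fun I => (1 / 2 : ℝ) * (coeff I (G.Q a b) + coeff I (G.Q b a)))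
      = G.Q a b := by
    intro a b
    rw [hQ a b]
    convert ofCoeff_coeff (p := 1) (α := G.Q a b) (by simpa using h.degQ a b) using 2
    ext I
    ring
  have e2 : ∀ a, (ofCoeff 2 fun I => coeff I (G.T a)) = G.T a :=
    fun a => ofCoeff_coeff (p := 2) (by simpa using h.degT a)
  have e3 : ∀ a b, (ofCoeff 2 fun I => coeff I (G.R a b)) = G.R a b :=
    fun a b => ofCoeff_coeff (p := 2) (by simpa using h.degR a b)
  cases G
  simp only [Coords.geom, toCoords, e1, e2, e3]

theorem Coords.smooth_θ (a μ : Fin D) : ContDiff ℝ (⊤ : ℕ∞) fun y : Coords D => y.1 a μ :=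
  contDiff_pi.1 (contDiff_pi.1 contDiff_fst a) μ

theorem Coords.smooth_Q (a b : Fin D) (I : Finset (Fin D)) :
    ContDiff ℝ (⊤ : ℕ∞) fun y : Coords D => y.2.1 a b I :=
  contDiff_pi.1 (contDiff_pi.1 (contDiff_pi.1 (contDiff_fst.comp contDiff_snd) a) b) I

theorem Coords.smooth_T (a : Fin D) (I : Finset (Fin D)) :
    ContDiff ℝ (⊤ : ℕ∞) fun y : Coords D => y.2.2.1 a I :=
  contDiff_pi.1 (contDiff_pi.1 (contDiff_fst.comp (contDiff_snd.comp contDiff_snd)) a) I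

theorem Coords.smooth_R (a b : Fin D) (I : Finset (Fin D)) :
    ContDiff ℝ (⊤ : ℕ∞) fun y : Coords D => y.2.2.2 a b I :=
  contDiff_pi.1 (contDiff_pi.1 (contDiff_pi.1
    (contDiff_snd.comp (contDiff_snd.comp contDiff_snd)) a) b) I

theorem SmoothForm.ofCoeff {E : Type} [NormedAddCommGroup E] [NormedSpace ℝ E] {s : Set E} {p : ℕ}
    {τ : E → Finset (Fin D) → ℝ} (h : ∀ I, ContDiffOn ℝ (⊤ : ℕ∞) (fun x => τ x I) s) :
    SmoothForm s fun x => ofCoeff p (τ x) :=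
  .sum fun I => .smul (h I) (.const _)

/-- The coordinates of `Q` are symmetrised in `Coords.geom` and each field is cut to its degree, so
nondegeneracy of the coframe is the only condition on a coordinate vector. Geometries with fixed
metric are thus parametrised by an open subset of a vector space. -/
theorem Coords.regular {g : Matrix (Fin D) (Fin D) ℝ} (hs : g.IsSymm) (h0 : g.det ≠ 0)
    {y : Coords D} (hy : Matrix.det (Matrix.of y.1) ≠ 0) : (y.geom g).Regular := by
  refine ⟨⟨hs, h0, hy⟩, ?_, fun a b => ?_, fun a => ?_, fun a b => ?_⟩
  · ext a b : 2
    simp only [Frame.tp_apply, Coords.geom, add_comm]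
  · exact (deg_ofCoeff 1 _).cast (by simp)
  · exact (deg_ofCoeff 2 _).cast (by simp)
  · exact (deg_ofCoeff 2 _).cast (by simp)

theorem Coords.smoothGeom {g : Matrix (Fin D) (Fin D) ℝ} (hs : g.IsSymm) (h0 : g.det ≠ 0) :
    SmoothGeom {y : Coords D | Matrix.det (Matrix.of y.1) ≠ 0} (Coords.geom g) where
  smooth_g _ _ := contDiffOn_const
  smooth_θ a μ := (Coords.smooth_θ a μ).contDiffOn
  regular _ hy := (Coords.regular hs h0 hy).toRegular
  smooth_Q a b := .ofCoeff fun I => contDiffOn_const.mul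
    ((Coords.smooth_Q a b I).contDiffOn.add (Coords.smooth_Q b a I).contDiffOn)
  smooth_T a := .ofCoeff fun I => (Coords.smooth_T a I).contDiffOn
  smooth_R a b := .ofCoeff fun I => (Coords.smooth_R a b I).contDiffOn
  geom_regular _ hy := Coords.regular hs h0 hy

/-- A curve of geometries through `G` with fixed metric and given velocity. -/
structure HasVelocity (X : ℝ → Geom D) (G : Geom D) (δθ : Fin D → Cov D)
    (δQ : Fin D → Fin D → Form D) (δT : Fin D → Form D) (δR : Fin D → Fin D → Form D) : Prop where
  zero : X 0 = G
  regular : ∀ᶠ t in 𝓝 0, (X t).Regular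
  metric : ∀ t, (X t).g = G.g
  deriv_θ : ∀ a μ, HasDerivAt (fun t => (X t).θ a μ) (δθ a μ) 0
  deriv_Q : ∀ a b, HasDerivForm (fun t => (X t).Q a b) (δQ a b) 0
  deriv_T : ∀ a, HasDerivForm (fun t => (X t).T a) (δT a) 0
  deriv_R : ∀ a b, HasDerivForm (fun t => (X t).R a b) (δR a b) 0

/-- In the coordinates the Lagrangian is smooth on an open set, so the derivative along a curve
depends linearly on its velocity and on nothing else. The same functional serves all curves, which
is what allows contributions to be separated. -/
theorem Concomitant.exists_differential {r : ℝ} {L : Geom D → Form D} (hL : Concomitant r L)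
    {G : Geom D} (hG : G.Regular) : ∃ f : Coords D →L[ℝ] ℝ, ∀ X δθ δQ δT δR,
      HasVelocity X G δθ δQ δT δR →
      HasDerivAt (fun t => top (L (X t))) (f (toCoords δθ δQ δT δR)) 0 := by
  have hs := Coords.smoothGeom hG.symm hG.det_g
  have hf := hL.smooth hs Finset.univ
  have ho : IsOpen {y : Coords D | Matrix.det (Matrix.of y.1) ≠ 0} := by
    refine isOpen_ne_fun ?_ continuous_const
    refine Continuous.matrix_det ?_
    fun_prop
  have hd := (hf.contDiffAt (ho.mem_nhds (x := toCoords G.θ G.Q G.T G.R) hG.det_θ)).differentiableAt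
    (by simp)
  refine ⟨fderiv ℝ (fun y => coeff Finset.univ (L (Coords.geom G.g y)))
    (toCoords G.θ G.Q G.T G.R), fun X δθ δQ δT δR hX => ?_⟩
  have hc : HasDerivAt (fun t => toCoords (X t).θ (X t).Q (X t).T (X t).R)
      (toCoords δθ δQ δT δR) 0 := by
    refine .prodMk ?_ (.prodMk ?_ (.prodMk ?_ ?_))
    · exact hasDerivAt_pi.2 fun a => hasDerivAt_pi.2 fun μ => hX.deriv_θ a μ
    · exact hasDerivAt_pi.2 fun a => hasDerivAt_pi.2 fun b => hasDerivAt_pi.2 fun I =>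
        hX.deriv_Q a b I
    · exact hasDerivAt_pi.2 fun a => hasDerivAt_pi.2 fun I => hX.deriv_T a I
    · exact hasDerivAt_pi.2 fun a => hasDerivAt_pi.2 fun b => hasDerivAt_pi.2 fun I =>
        hX.deriv_R a b I
  have h1 : HasFDerivAt (fun y => coeff Finset.univ (L (Coords.geom G.g y)))
      (fderiv ℝ (fun y => coeff Finset.univ (L (Coords.geom G.g y))) (toCoords G.θ G.Q G.T G.R))
      (toCoords (X 0).θ (X 0).Q (X 0).T (X 0).R) := by
    rw [hX.zero]; exact hd.hasFDerivAt
  refine (h1.comp_hasDerivAt 0 hc).congr_of_eventuallyEq ?_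
  filter_upwards [hX.regular] with t ht
  have := ht.geom_toCoords
  rw [hX.metric] at this
  simp only [Function.comp_apply, this]
  rfl

theorem HasVelocity.withQ {G : Geom D} (hG : G.Regular) {δQ : Fin D → Fin D → Form D}
    (hQ : TDeg 1 δQ) (hs : ∀ a b, δQ a b = δQ b a) :
    HasVelocity (fun t => { G with Q := G.Q + t • δQ }) G 0 δQ 0 0 where
  zero := by simp
  regular := .of_forall fun t =>
    hG.withQ (hG.degQ.add (hQ.smul t)) (by
      rw [map_add, map_smul, hG.tpQ, show Frame.tp δQ = δQ from funext₂ fun a b => hs b a])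
  metric _ := rfl
  deriv_θ a μ := hasDerivAt_const (0 : ℝ) (G.θ a μ)
  deriv_Q a b := by
    have := (HasDerivForm.const (G.Q a b) 0).add (.smul_const (hasDerivAt_id (0 : ℝ)) (δQ a b))
    simpa using this
  deriv_T a := .const _ _
  deriv_R a b := .const _ _

theorem HasVelocity.withT {G : Geom D} (hG : G.Regular) {δT : Fin D → Form D} (hT : VDeg 2 δT) :
    HasVelocity (fun t => { G with T := G.T + t • δT }) G 0 0 δT 0 where
  zero := by simp
  regular := .of_forall fun t => hG.withT (hG.degT.add (hT.smul t))
  metric _ := rfl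
  deriv_θ a μ := hasDerivAt_const (0 : ℝ) (G.θ a μ)
  deriv_Q a b := .const _ _
  deriv_T a := by
    have := (HasDerivForm.const (G.T a) 0).add (.smul_const (hasDerivAt_id (0 : ℝ)) (δT a))
    simpa using this
  deriv_R a b := .const _ _

theorem HasVelocity.withR {G : Geom D} (hG : G.Regular) {δR : Fin D → Fin D → Form D}
    (hR : TDeg 2 δR) : HasVelocity (fun t => { G with R := G.R + t • δR }) G 0 0 0 δR where
  zero := by simp
  regular := .of_forall fun t => hG.withR (hG.degR.add (hR.smul t))
  metric _ := rfl
  deriv_θ a μ := hasDerivAt_const (0 : ℝ) (G.θ a μ)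
  deriv_Q a b := .const _ _
  deriv_T a := .const _ _
  deriv_R a b := by
    have := (HasDerivForm.const (G.R a b) 0).add (.smul_const (hasDerivAt_id (0 : ℝ)) (δR a b))
    simpa using this

/-- The curve generated by the infinitesimal linear map `ϑ^a ↦ δϑ^a`. -/
theorem Geom.Regular.hasVelocity_map {G : Geom D} (hG : G.Regular) (Δ : Cov D →ₗ[ℝ] Cov D) :
    HasVelocity (fun t => G.map (LinearMap.id + t • Δ)) G (fun a => Δ (G.θ a))
      (fun a b => derivation Δ (G.Q a b)) (fun a => derivation Δ (G.T a))
      (fun a b => derivation Δ (G.R a b)) ∧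
    ∀ᶠ t in 𝓝 (0 : ℝ), ∃ A : Cov D ≃ₗ[ℝ] Cov D, A.toLinearMap = LinearMap.id + t • Δ := by
  have hA : ∀ᶠ t in 𝓝 (0 : ℝ), ∃ A : Cov D ≃ₗ[ℝ] Cov D, A.toLinearMap = LinearMap.id + t • Δ := by
    have h1 : Continuous fun t : ℝ => (1 + t • LinearMap.toMatrix' Δ).det :=
      Continuous.matrix_det (by fun_prop)
    have h2 : ∀ᶠ t in 𝓝 (0 : ℝ), (1 + t • LinearMap.toMatrix' Δ).det ≠ 0 :=
      h1.continuousAt.eventually_ne (by simp)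
    filter_upwards [h2] with t ht
    have e : LinearMap.det (LinearMap.id + t • Δ) ≠ 0 := by
      rw [← LinearMap.det_toMatrix', map_add, map_smul, LinearMap.toMatrix'_id]
      exact ht
    exact ⟨LinearMap.equivOfDetNeZero _ e, rfl⟩
  refine ⟨⟨?_, ?_, fun _ => rfl, fun a μ => ?_, fun a b => .mapForm Δ _, fun a => .mapForm Δ _,
    fun a b => .mapForm Δ _⟩, hA⟩
  · have e : ∀ β : Form D, MAG.mapForm LinearMap.id β = β := fun β => by
      rw [MAG.mapForm, ExteriorAlgebra.map_id]; rfl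
    simp only [Geom.map, Frame.map, zero_smul, add_zero, LinearMap.id_apply, e]
  · filter_upwards [hA] with t ⟨A, hAt⟩
    rw [← hAt]
    exact hG.map A
  · have := (hasDerivAt_const (0 : ℝ) (G.θ a μ)).fun_add
      ((hasDerivAt_id (0 : ℝ)).mul_const (Δ (G.θ a) μ))
    rw [zero_add, one_mul] at this
    exact this

/-- The partial derivative of a Lagrangian with respect to the coframe, as given by its
naturality. -/
def coframeDerivative (L : Geom D → Form D) (G : Geom D) (M : Fin D → Fin D → Form D)
    (H : Fin D → Form D) (HH : Fin D → Fin D → Form D) (a : Fin D) : Form D :=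
  G.ip a (L G) + (∑ b, ∑ c, G.ip a (G.Q b c) * (1 / 2 : ℝ) • M b c) + (∑ b, G.ip a (G.T b) * H b)
    + ∑ b, ∑ c, G.ip a (G.R b c) * HH b c

/-- The differential splits into four contributions, of which the momenta determine three. The
coframe contribution follows by evaluating the total in a second way along the curve on which all
fields are moved by one linear map. -/
theorem Concomitant.hasDerivAt {r : ℝ} {L : Geom D → Form D} (hL : Concomitant r L) {G : Geom D}
    (hG : G.Regular) {M : Fin D → Fin D → Form D} {H : Fin D → Form D}
    {HH : Fin D → Fin D → Form D} (hM : HasMomenta L G M H HH) {X : ℝ → Geom D}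
    {δθ : Fin D → Cov D} {δQ : Fin D → Fin D → Form D} {δT : Fin D → Form D}
    {δR : Fin D → Fin D → Form D} (hX : HasVelocity X G δθ δQ δT δR) (dQ : TDeg 1 δQ)
    (sQ : ∀ a b, δQ a b = δQ b a) (dT : VDeg 2 δT) (dR : TDeg 2 δR) :
    HasDerivAt (fun t => top (L (X t))) (top (∑ a, form1 (δθ a) * coframeDerivative L G M H HH a)
      + (top (∑ a, ∑ b, δQ a b * (-(1 / 2 : ℝ)) • M a b) + top (∑ a, δT a * -H a)
        + top (∑ a, ∑ b, δR a b * -HH a b))) 0 := by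
  obtain ⟨f, hf⟩ := hL.exists_differential hG
  have hsplit : ∀ δθ δQ δT δR, f (toCoords δθ δQ δT δR) = f (toCoords δθ 0 0 0)
      + (f (toCoords 0 δQ 0 0) + f (toCoords 0 0 δT 0) + f (toCoords 0 0 0 δR)) := by
    intro δθ δQ δT δR
    rw [← map_add, ← map_add, ← map_add]
    congr 1
    refine Prod.ext ?_ (Prod.ext ?_ (Prod.ext ?_ ?_))
    · simp [toCoords]
    · funext a b I; simp [toCoords]
    · funext a I; simp [toCoords]
    · funext a b I; simp [toCoords]
  have hQ : ∀ δQ, TDeg 1 δQ → (∀ a b, δQ a b = δQ b a) →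
      f (toCoords 0 δQ 0 0) = top (∑ a, ∑ b, δQ a b * (-(1 / 2 : ℝ)) • M a b) :=
    fun δQ d s => (hf _ _ _ _ _ (.withQ hG d s)).unique
      (hM.derivQ δQ (fun a b => isForm_iff_deg.2 ((d a b).cast (by simp))) s)
  have hT : ∀ δT, VDeg 2 δT → f (toCoords 0 0 δT 0) = top (∑ a, δT a * -H a) :=
    fun δT d => (hf _ _ _ _ _ (.withT hG d)).unique
      (hM.derivT δT (fun a => isForm_iff_deg.2 ((d a).cast (by simp))))
  have hR : ∀ δR, TDeg 2 δR → f (toCoords 0 0 0 δR) = top (∑ a, ∑ b, δR a b * -HH a b) :=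
    fun δR d => (hf _ _ _ _ _ (.withR hG d)).unique
      (hM.derivR δR (fun a b => isForm_iff_deg.2 ((d a b).cast (by simp))))
  have hθ : f (toCoords δθ 0 0 0)
      = top (∑ a, form1 (δθ a) * coframeDerivative L G M H HH a) := by
    -- The linear map with `ϑ^a ↦ δϑ^a`. Its derivation of the exterior algebra is `δϑ^a ∧ e_a ⌟`,
    -- so the total derivative of `L` produces `e_a ⌟ L`.
    set Δ := hG.basis.constr ℝ δθ with hΔ
    have hΔθ : ∀ a, Δ (G.θ a) = δθ a := fun a => by
      rw [← hG.basis_apply a, hΔ, Module.Basis.constr_basis]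
    have hder : ∀ α, derivation Δ α = ∑ a, form1 (δθ a) * G.ip a α := by
      intro α
      have := hG.sum_frame (ExteriorAlgebra.ι ℝ ∘ₗ Δ) α
      simp only [LinearMap.comp_apply, hΔθ] at this
      exact this.symm
    obtain ⟨hv, hA⟩ := hG.hasVelocity_map Δ
    have h1 := hf _ _ _ _ _ hv
    have h2 := (HasDerivForm.mapForm Δ (L G)).top
    -- Naturality is available only for isomorphisms; `id + tΔ` is one for small `t`.
    have h3 : (fun t : ℝ => top (L (G.map (LinearMap.id + t • Δ))))
        =ᶠ[𝓝 0] fun t => top (mapForm (LinearMap.id + t • Δ) (L G)) := by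
      filter_upwards [hA] with t ⟨A, hAt⟩
      rw [← hAt, hL.natural G hG]
    have h4 := h1.unique (h2.congr_of_eventuallyEq h3)
    have d1 : ∀ {r : ℝ} {α : Form D}, Deg r α → Deg r (derivation Δ α) := by
      intro r α h
      rw [hder]
      refine Deg.sum fun a => ?_
      exact ((Deg.form1 _).mul (h.interior _)).cast (by ring)
    -- The induced changes of `Q` and `R`, paired with their momenta, are regrouped so that `δϑ^a`
    -- stands in front; `s1` does this for `T`.
    have s2 : ∀ β μ : Fin D → Fin D → Form D, top (∑ b, ∑ c, derivation Δ (β b c) * -μ b c)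
        = -top (∑ a, form1 (δθ a) * ∑ b, ∑ c, G.ip a (β b c) * μ b c) := by
      intro β μ
      rw [← top_neg]
      congr 1
      simp only [hder, Finset.sum_mul, Finset.mul_sum, mul_neg, Finset.sum_neg_distrib, mul_assoc]
      congr 1
      rw [Finset.sum_comm]
      conv_rhs => rw [Finset.sum_comm' (t' := Finset.univ) (s' := fun _ => Finset.univ) (by simp)]
      rw [Finset.sum_comm]
      exact Finset.sum_congr rfl fun _ _ => Finset.sum_comm
    have s1 : ∀ β μ : Fin D → Form D, top (∑ b, derivation Δ (β b) * -μ b)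
        = -top (∑ a, form1 (δθ a) * ∑ b, G.ip a (β b) * μ b) := by
      intro β μ
      rw [← top_neg]
      congr 1
      simp only [hder, Finset.sum_mul, Finset.mul_sum, mul_neg, Finset.sum_neg_distrib, mul_assoc]
      rw [Finset.sum_comm]
    have hM' : ∀ b c, (-(1 / 2 : ℝ)) • M b c = -((1 / 2 : ℝ) • M b c) := fun b c => neg_smul _ _
    rw [hsplit, hQ _ (fun a b => d1 (hG.degQ a b)) (fun a b => by
      rw [show G.Q a b = G.Q b a from congrFun₂ hG.tpQ b a]), hT _ (fun a => d1 (hG.degT a)),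
      hR _ (fun a b => d1 (hG.degR a b))] at h4
    simp only [hΔθ, hM'] at h4
    rw [s2, s1, s2, hder] at h4
    simp only [coframeDerivative, mul_add, Finset.sum_add_distrib, top_add]
    linarith
  refine (hf _ _ _ _ _ hX).congr_deriv ?_
  rw [hsplit, hθ, hQ _ dQ sQ, hT _ dT, hR _ dR]

end MAG
end

/-! ### Exterior calculus in coordinates and Stokes' theorem. -/

noncomputable section

namespace MAG

variable {D : ℕ}

open Filter Topology

/-! ### The exterior derivative -/

theorem HasDerivForm.unique {α : ℝ → Form D} {α' β' : Form D} {t : ℝ} (h : HasDerivForm α α' t)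
    (h' : HasDerivForm α β' t) : α' = β' :=
  dxBasis.repr.injective (Finsupp.ext fun I => (h I).unique (h' I))

theorem coeff_pderiv (I : Finset (Fin D)) (μ : Fin D) (α : Pt D → Form D) (x : Pt D) :
    coeff I (pderiv μ α x) = fderiv ℝ (fun y => coeff I (α y)) x (Pi.single μ 1) := by
  simp [pderiv, coeff_sum, coeff_dxBasis]

/-- Coefficientwise differentiability of a field of forms at a point. -/
def DiffForm (α : Pt D → Form D) (x : Pt D) : Prop :=
  ∀ I, DifferentiableAt ℝ (fun y => coeff I (α y)) x

theorem SmoothForm.diffForm {U : Set (Pt D)} (hU : IsOpen U) {α : Pt D → Form D}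
    (h : SmoothForm U α) {x : Pt D} (hx : x ∈ U) : DiffForm α x := fun I =>
  ((h I).contDiffAt (hU.mem_nhds hx)).differentiableAt (by simp)

theorem DiffForm.hasDerivForm {α : Pt D → Form D} {x : Pt D} (h : DiffForm α x) (μ : Fin D) :
    HasDerivForm (fun t : ℝ => α (x + t • Pi.single μ 1)) (pderiv μ α x) 0 := fun I => by
  rw [coeff_pderiv]
  exact (h I).hasFDerivAt.hasLineDerivAt _

theorem DiffForm.add {α β : Pt D → Form D} {x : Pt D} (hα : DiffForm α x) (hβ : DiffForm β x) :
    DiffForm (fun x => α x + β x) x := fun I => by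
  simpa only [coeff_add] using (hα I).fun_add (hβ I)

theorem DiffForm.smul {f : Pt D → ℝ} {α : Pt D → Form D} {x : Pt D} (hf : DifferentiableAt ℝ f x)
    (hα : DiffForm α x) : DiffForm (fun x => f x • α x) x := fun I => by
  simpa only [coeff_smul] using hf.fun_mul (hα I)

theorem DiffForm.const (α : Form D) (x : Pt D) : DiffForm (fun _ => α) x := fun _ =>
  differentiableAt_const _

theorem DiffForm.sum {ι : Type*} {s : Finset ι} {α : ι → Pt D → Form D} {x : Pt D}
    (h : ∀ i, DiffForm (α i) x) : DiffForm (fun x => ∑ i ∈ s, α i x) x := fun I => by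
  simp only [coeff_sum]
  exact DifferentiableAt.fun_sum fun i _ => h i I

theorem DiffForm.map (L : Form D →ₗ[ℝ] Form D) {α : Pt D → Form D} {x : Pt D} (h : DiffForm α x) :
    DiffForm (fun x => L (α x)) x := by
  have : (fun x => L (α x)) = fun x => ∑ I, coeff I (α x) • L (dxBasis I) := by
    ext1 x
    conv_lhs => rw [← sum_coeff (α x)]
    simp
  rw [this]
  exact .sum fun I => .smul (h I) (.const _ _)

theorem DiffForm.mul {α β : Pt D → Form D} {x : Pt D} (hα : DiffForm α x) (hβ : DiffForm β x) :
    DiffForm (fun x => α x * β x) x := by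
  have : (fun x => α x * β x) = fun x => ∑ I, coeff I (α x) • (dxBasis I * β x) := by
    ext1 x
    conv_lhs => rw [← sum_coeff (α x)]
    simp [Finset.sum_mul]
  rw [this]
  exact .sum fun I => .smul (hα I) (hβ.map (LinearMap.mulLeft ℝ (dxBasis I)))

theorem DiffForm.form1 {ω : Pt D → Cov D} {x : Pt D} (h : DifferentiableAt ℝ ω x) :
    DiffForm (fun x => form1 (ω x)) x := by
  simp only [form1_eq_sum]
  exact .sum fun μ => .smul (differentiableAt_pi.1 h μ) (.const _ _)

theorem DiffForm.form0 {f : Pt D → ℝ} {x : Pt D} (h : DifferentiableAt ℝ f x) :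
    DiffForm (fun x => form0 (f x)) x := by
  simp only [form0_eq_smul]
  exact .smul h (.const _ _)

variable {α β : Pt D → Form D} {x : Pt D}

theorem extd_congr (h : α =ᶠ[𝓝 x] β) : extd α x = extd β x := by
  have : ∀ μ, pderiv μ α x = pderiv μ β x := fun μ =>
    Finset.sum_congr rfl fun I _ => by
      rw [EventuallyEq.fderiv_eq (h.mono fun y hy => by rw [hy])]
  simp only [extd, this]

theorem extd_add (hα : DiffForm α x) (hβ : DiffForm β x) :
    extd (fun y => α y + β y) x = extd α x + extd β x := by
  simp only [extd, ← Finset.sum_add_distrib, ← mul_add]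
  exact Finset.sum_congr rfl fun μ _ => congrArg _ <|
    ((hα.add hβ).hasDerivForm μ).unique ((hα.hasDerivForm μ).add (hβ.hasDerivForm μ))

/-- No differentiability is needed: a nonzero scalar preserves both differentiability and its
failure, where the derivative is zero by convention, and a zero scalar gives a constant. -/
theorem extd_const_smul (r : ℝ) (α : Pt D → Form D) (x : Pt D) :
    extd (fun y => r • α y) x = r • extd α x := by
  have : ∀ μ, pderiv μ (fun y => r • α y) x = r • pderiv μ α x := fun μ => by
    simp only [pderiv, coeff_smul, Finset.smul_sum, smul_smul]
    refine Finset.sum_congr rfl fun I _ => ?_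
    have := congrFun (fderiv_const_smul_field (𝕜 := ℝ) r (f := fun y => coeff I (α y))) x
    rw [show (fun y => r * coeff I (α y)) = r • fun y => coeff I (α y) from rfl, this]
    rfl
  simp only [extd, this, Finset.smul_sum, mul_smul_comm]

theorem extd_sum {ι : Type*} {s : Finset ι} {α : ι → Pt D → Form D} (h : ∀ i, DiffForm (α i) x) :
    extd (fun y => ∑ i ∈ s, α i y) x = ∑ i ∈ s, extd (α i) x := by
  have h1 : DiffForm (fun y => ∑ i ∈ s, α i y) x := .sum h
  have h2 : ∀ μ, pderiv μ (fun y => ∑ i ∈ s, α i y) x = ∑ i ∈ s, pderiv μ (α i) x := fun μ =>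
    (h1.hasDerivForm μ).unique
      (HasDerivForm.sum (α := fun i (t : ℝ) => α i (x + t • Pi.single μ 1))
        fun i => (h i).hasDerivForm μ)
  simp only [extd, h2, Finset.mul_sum]
  exact Finset.sum_comm

theorem extd_mul (hα : DiffForm α x) (hβ : DiffForm β x) :
    extd (fun y => α y * β y) x = extd α x * β x + inv (α x) * extd β x := by
  simp only [extd, Finset.sum_mul, Finset.mul_sum, ← Finset.sum_add_distrib]
  refine Finset.sum_congr rfl fun μ _ => ?_
  have := ((hα.mul hβ).hasDerivForm μ).unique ((hα.hasDerivForm μ).mul (hβ.hasDerivForm μ))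
  rw [this]
  simp only [zero_smul, add_zero, mul_add, ← mul_assoc, form1_mul_comm _ (α x)]

theorem extd_smul {f : Pt D → ℝ} (hf : DifferentiableAt ℝ f x) (hα : DiffForm α x) :
    extd (fun y => f y • α y) x = extd (fun y => form0 (f y)) x * α x + f x • extd α x := by
  have := extd_mul (.form0 hf) hα
  simpa [form0_eq_smul] using this

theorem extd_form0 {f : Pt D → ℝ} {f' : Cov D}
    (h : ∀ μ, HasDerivAt (fun t : ℝ => f (x + t • Pi.single μ 1)) (f' μ) 0)
    (hf : DifferentiableAt ℝ f x) : extd (fun y => form0 (f y)) x = form1 f' := by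
  rw [form1_eq_sum, extd]
  refine Finset.sum_congr rfl fun μ _ => ?_
  have h1 := HasDerivForm.smul_const (h μ) (1 : Form D)
  simp only [form0_eq_smul]
  rw [((DiffForm.smul hf (.const 1 x)).hasDerivForm μ).unique h1, mul_smul_comm, mul_one]
  rfl

/-- Coefficients of monomials in other degrees vanish near the point, hence so do their derivatives.
-/
theorem Deg.pderiv {r : ℝ} (h : ∀ᶠ y in 𝓝 x, Deg r (α y)) (μ : Fin D) :
    Deg r (pderiv μ α x) := by
  refine Deg.sum fun I => ?_
  by_cases hI : (I.card : ℝ) = r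
  · exact Deg.smul _ (hI ▸ deg_dxBasis I)
  · have : (fun y => coeff I (α y)) =ᶠ[𝓝 x] fun _ => 0 := h.mono fun y hy => hy.coeff_eq_zero hI
    rw [this.fderiv_eq]
    simpa using Deg.zero r

theorem Deg.extd {r : ℝ} (h : ∀ᶠ y in 𝓝 x, Deg r (α y)) : Deg (r + 1) (extd α x) :=
  Deg.sum fun μ => ((Deg.form1 _).mul (Deg.pderiv h μ)).cast (by ring)

theorem SmoothForm.extd {U : Set (Pt D)} (hU : IsOpen U) (h : SmoothForm U α) :
    SmoothForm U (extd α) := by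
  refine .sum fun μ => .mul (.const _) (.sum fun I => .smul ?_ (.const _))
  exact ((h I).fderiv_of_isOpen hU (m := (⊤ : ℕ∞)) (by exact_mod_cast le_top)).clm_apply contDiffOn_const

/-! ### Integration by parts -/

open MeasureTheory in
-- Integration by parts against the constant function `1`.
theorem integral_fderiv_eq_zero {f : Pt D → ℝ} (hf : ContDiff ℝ (⊤ : ℕ∞) f)
    (hs : HasCompactSupport f) (v : Pt D) : ∫ x, fderiv ℝ f x v = 0 := by
  have h1 : Continuous fun x => fderiv ℝ f x v :=
    (hf.continuous_fderiv (by simp)).clm_apply continuous_const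
  have := integral_mul_fderiv_eq_neg_fderiv_mul_of_integrable (μ := volume) (f := fun _ : Pt D => (1 : ℝ)) (g := f) (v := v)
    (by simp) (by simpa using h1.integrable_of_hasCompactSupport (hs.fderiv_apply ℝ v))
    (by simpa using hf.continuous.integrable_of_hasCompactSupport hs) (by simp)
    (fun x _ => hf.differentiable (by simp) x)
  simpa using this

theorem SmoothForm.contDiff {U : Set (Pt D)} (hU : IsOpen U) (hα : SmoothForm U α)
    (hs : tsupport α ⊆ U) (I : Finset (Fin D)) : ContDiff ℝ (⊤ : ℕ∞) fun x => coeff I (α x) := by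
  refine contDiff_iff_contDiffAt.2 fun x => ?_
  by_cases hx : x ∈ U
  · exact (hα I).contDiffAt (hU.mem_nhds hx)
  · have h0 := notMem_tsupport_iff_eventuallyEq.1 fun h => hx (hs h)
    refine contDiffAt_const (c := (0 : ℝ)) |>.congr_of_eventuallyEq (h0.mono fun y hy => ?_)
    simp only [hy, Pi.zero_apply, coeff_zero]

/-- The top coefficient of `dα` is a divergence, since `dx^μ` is constant and can be taken inside
the derivative. -/
theorem top_extd (hα : DiffForm α x) : top (extd α x)
    = ∑ μ, fderiv ℝ (fun y => coeff Finset.univ (dx μ * α y)) x (Pi.single μ 1) := by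
  rw [extd, top_sum]
  refine Finset.sum_congr rfl fun μ _ => ?_
  have h1 : DiffForm (fun y => dx μ * α y) x := hα.map (LinearMap.mulLeft ℝ (dx μ))
  rw [← coeff_pderiv, (h1.hasDerivForm μ).unique
    ((hα.hasDerivForm μ).map (LinearMap.mulLeft ℝ (dx μ)))]
  rfl

open MeasureTheory in
theorem SmoothForm.integrableOn {U K : Set (Pt D)} (hK : IsCompact K) (hKU : K ⊆ U)
    (hα : SmoothForm U α) : IntegrableOn (fun x => top (α x)) K :=
  ((hα Finset.univ).continuousOn.mono hKU).integrableOn_compact hK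

open MeasureTheory in
/-- Stokes' theorem for a form with compact support. -/
theorem integral_extd_eq_zero {U K : Set (Pt D)} (hU : IsOpen U) (hK : IsCompact K) (hKU : K ⊆ U)
    (hα : SmoothForm U α) (hs : tsupport α ⊆ K) : integral K (extd α) = 0 := by
  have h1 : ∀ μ, SmoothForm U fun y => dx μ * α y := fun μ => .mul (.const _) hα
  have h2 : ∀ μ, tsupport (fun y => dx μ * α y) ⊆ tsupport α := fun μ =>
    closure_mono fun y hy => by
      simp only [Function.mem_support] at hy ⊢
      exact fun h => hy (by rw [h, mul_zero])
  have h3 := fun μ => (h1 μ).contDiff hU ((h2 μ).trans (hs.trans hKU)) Finset.univ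
  have h4 : ∀ μ, tsupport (fun y => coeff Finset.univ (dx μ * α y)) ⊆ K := fun μ =>
    (closure_mono fun y hy => by
      simp only [Function.mem_support] at hy ⊢
      exact fun h => hy (by rw [h, coeff_zero])).trans ((h2 μ).trans hs)
  have h5 : ∀ μ, HasCompactSupport fun y => coeff Finset.univ (dx μ * α y) := fun μ =>
    hK.of_isClosed_subset (isClosed_tsupport _) (h4 μ)
  have h6 : ∀ μ, Continuous fun x =>
      fderiv ℝ (fun y => coeff Finset.univ (dx μ * α y)) x (Pi.single μ 1) := fun μ =>
    ((h3 μ).continuous_fderiv (by simp)).clm_apply continuous_const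
  calc integral K (extd α)
      = ∫ x in K, ∑ μ, fderiv ℝ (fun y => coeff Finset.univ (dx μ * α y)) x (Pi.single μ 1) :=
        setIntegral_congr_fun hK.measurableSet fun x hx => top_extd (hα.diffForm hU (hKU hx))
    _ = ∑ μ, ∫ x in K, fderiv ℝ (fun y => coeff Finset.univ (dx μ * α y)) x (Pi.single μ 1) :=
        integral_finsetSum _ fun μ _ => (h6 μ).continuousOn.integrableOn_compact hK
    _ = 0 := Finset.sum_eq_zero fun μ _ => by
        rw [setIntegral_eq_integral_of_forall_compl_eq_zero, integral_fderiv_eq_zero (h3 μ) (h5 μ)]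
        intro x hx
        have : fderiv ℝ (fun y => coeff Finset.univ (dx μ * α y)) x = 0 :=
          image_eq_zero_of_notMem_tsupport fun h => hx (h4 μ (tsupport_fderiv_subset ℝ h))
        rw [this]; rfl

open MeasureTheory in
-- Integrate `d(ω ∧ α) = dω ∧ α - ω ∧ dα`. Only `ω` is compactly supported, and that suffices for
-- the product.
theorem integral_extd_form1_mul {U K : Set (Pt D)} (hU : IsOpen U) (hK : IsCompact K)
    (hKU : K ⊆ U) {ω : Pt D → Cov D} (hω : ContDiff ℝ (⊤ : ℕ∞) ω) (hs : tsupport ω ⊆ K)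
    (hα : SmoothForm U α) : integral K (fun x => extd (fun y => form1 (ω y)) x * α x)
      = integral K fun x => form1 (ω x) * extd α x := by
  have h1 : SmoothForm U fun y => form1 (ω y) :=
    .form1 fun μ => (contDiff_pi.1 hω μ).contDiffOn
  have h2 : tsupport (fun y => form1 (ω y) * α y) ⊆ K :=
    (closure_mono fun y hy => by
      simp only [Function.mem_support] at hy ⊢
      exact fun h => hy (by rw [h, form1_zero, zero_mul])).trans hs
  have h3 := integral_extd_eq_zero hU hK hKU (h1.mul hα) h2
  have h4 : ∀ x ∈ K, top (extd (fun y => form1 (ω y) * α y) x)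
      = top (extd (fun y => form1 (ω y)) x * α x) - top (form1 (ω x) * extd α x) := by
    intro x hx
    rw [extd_mul (h1.diffForm hU (hKU hx)) (hα.diffForm hU (hKU hx)), inv_form1, neg_mul,
      top_add, top_neg, sub_eq_add_neg]
  rw [integral, setIntegral_congr_fun hK.measurableSet h4, integral_sub
    (((h1.extd hU).mul hα).integrableOn hK hKU) ((h1.mul (hα.extd hU)).integrableOn hK hKU)] at h3
  exact sub_eq_zero.1 h3

end MAG
end

/-! ### Jacobi's formula, and exterior derivatives of forms with constant coefficients in the
coframe. -/

noncomputable section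

namespace MAG

variable {D : ℕ}

open Filter Topology

/-! ### Derivatives of the determinant and of the inverse of a matrix -/

/-- The product rule in the Leibniz expansion differentiates one column at a time. Collecting the
terms of column `a` gives the determinant with that column replaced by its derivative, which is a
row of the adjugate times it. -/
theorem hasDerivAt_det {n : Type*} [Fintype n] [DecidableEq n] {A : ℝ → Matrix n n ℝ}
    {A' : Matrix n n ℝ} {t : ℝ} (h : ∀ a b, HasDerivAt (fun t => A t a b) (A' a b) t) :
    HasDerivAt (fun t => (A t).det) (∑ a, ∑ b, (A t).adjugate a b * A' b a) t := by
  have h1 : HasDerivAt (fun t => (A t).det)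
      (∑ σ : Equiv.Perm n, (Equiv.Perm.sign σ : ℝ) *
        ∑ i, (∏ j ∈ Finset.univ.erase i, A t (σ j) j) * A' (σ i) i) t := by
    simp only [Matrix.det_apply']
    refine HasDerivAt.fun_sum fun σ _ => HasDerivAt.const_mul _ ?_
    simpa only [smul_eq_mul] using HasDerivAt.fun_finsetProd fun i _ => h (σ i) i
  refine h1.congr_deriv ?_
  have h2 : ∀ a, ∑ b, (A t).adjugate a b * A' b a = ((A t).updateCol a fun b => A' b a).det := by
    intro a
    rw [← Matrix.cramer_apply, Matrix.cramer_eq_adjugate_mulVec]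
    rfl
  simp only [h2, Finset.mul_sum]
  rw [Finset.sum_comm]
  refine Finset.sum_congr rfl fun a _ => ?_
  rw [Matrix.det_apply']
  refine Finset.sum_congr rfl fun σ _ => ?_
  rw [← Finset.prod_erase_mul _ _ (Finset.mem_univ a), Matrix.updateCol_self]
  congr 2
  exact Finset.prod_congr rfl fun j hj => by rw [Matrix.updateCol_ne (Finset.ne_of_mem_erase hj)]

theorem hasDerivAt_sqrt_abs_det {A : ℝ → Matrix (Fin D) (Fin D) ℝ}
    {A' : Matrix (Fin D) (Fin D) ℝ} {t : ℝ} (h0 : (A t).det ≠ 0)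
    (h : ∀ a b, HasDerivAt (fun t => A t a b) (A' a b) t) :
    HasDerivAt (fun t => √|(A t).det|)
      (√|(A t).det| * (1 / 2 * ∑ a, ∑ b, (A t)⁻¹ a b * A' b a)) t := by
  have h1 : HasDerivAt (fun t => |(A t).det|)
      (SignType.sign (A t).det * ∑ a, ∑ b, (A t).adjugate a b * A' b a) t := by
    simpa [Function.comp_def] using (hasDerivAt_abs h0).comp t (hasDerivAt_det h)
  refine (h1.sqrt (abs_ne_zero.2 h0)).congr_deriv ?_
  have h2 : 0 < √|(A t).det| := Real.sqrt_pos.2 (abs_pos.2 h0)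
  have h3 : √|(A t).det| * √|(A t).det| = |(A t).det| := Real.mul_self_sqrt (abs_nonneg _)
  have h4 : ∀ a b, (A t).adjugate a b = (A t).det * (A t)⁻¹ a b := by
    intro a b
    rw [Matrix.inv_def, Matrix.smul_apply, Ring.inverse_eq_inv, smul_eq_mul,
      mul_inv_cancel_left₀ h0]
  simp only [h4, mul_assoc, ← Finset.mul_sum]
  rw [← mul_assoc (SignType.sign (A t).det : ℝ), sign_mul_self, div_eq_iff (by positivity)]
  linear_combination (-∑ a, ∑ b, (A t)⁻¹ a b * A' b a) * h3

/-- Differentiability of the inverse is known from smoothness, so its derivative may be found by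
differentiating `A⁻¹ A = 1`. -/
theorem hasDerivAt_matrix_inv {A : ℝ → Matrix (Fin D) (Fin D) ℝ}
    {A' B' : Matrix (Fin D) (Fin D) ℝ} {t : ℝ} (h0 : ∀ᶠ t in 𝓝 t, (A t).det ≠ 0)
    (h : ∀ a b, HasDerivAt (fun t => A t a b) (A' a b) t)
    (hB : ∀ a b, HasDerivAt (fun t => (A t)⁻¹ a b) (B' a b) t) :
    B' = -((A t)⁻¹ * A' * (A t)⁻¹) := by
  have h1 : (A t)⁻¹ * A' + B' * A t = 0 := by
    ext a b
    have h2 : HasDerivAt (fun t => ∑ c, (A t)⁻¹ a c * A t c b)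
        (∑ c, (B' a c * A t c b + (A t)⁻¹ a c * A' c b)) t :=
      HasDerivAt.fun_sum fun c _ => (hB a c).fun_mul (h c b)
    have h3 : (fun t => ∑ c, (A t)⁻¹ a c * A t c b) =ᶠ[𝓝 t] fun _ => (1 : Matrix _ _ ℝ) a b := by
      filter_upwards [h0] with t ht
      rw [← Matrix.mul_apply, Matrix.nonsing_inv_mul _ (isUnit_iff_ne_zero.2 ht)]
    have h4 := h2.unique ((hasDerivAt_const t ((1 : Matrix (Fin D) (Fin D) ℝ) a b)).congr_of_eventuallyEq h3)
    rw [Finset.sum_add_distrib] at h4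
    rw [Matrix.add_apply, Matrix.mul_apply, Matrix.mul_apply, Matrix.zero_apply, add_comm]
    exact h4
  have hu : IsUnit (A t).det := isUnit_iff_ne_zero.2 h0.self_of_nhds
  calc B' = B' * A t * (A t)⁻¹ := by rw [Matrix.mul_nonsing_inv_cancel_right _ _ hu]
    _ = -((A t)⁻¹ * A') * (A t)⁻¹ := by rw [eq_neg_of_add_eq_zero_right h1]
    _ = _ := Matrix.neg_mul _ _

/-! ### Exterior derivative of forms built from a smooth frame -/

variable {U : Set (Pt D)} {F : Pt D → Frame D} {x : Pt D}

/-- The linear map which maps the coordinate coframe to the given coframe. -/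
def Frame.fromCoord (F : Frame D) : Cov D →ₗ[ℝ] Cov D := Matrix.vecMulLinear F.θ

theorem Frame.form1_fromCoord (F : Frame D) (ω : Cov D) :
    form1 (F.fromCoord ω) = ∑ d, ω d • F.cof d := by
  have : F.fromCoord ω = ∑ d, ω d • F.θ d := by
    ext μ
    simp [fromCoord, Matrix.vecMul, dotProduct]
  simp [this, form1_sum, Frame.cof]

theorem SmoothFrame.mapForm (h : SmoothFrame U F) (β : Form D) :
    SmoothForm U fun x => mapForm (F x).fromCoord β := by
  induction β using form_left_induction with
  | h0 r => simpa using SmoothForm.const _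
  | ha α γ hα hγ => simpa using hα.add hγ
  | hm ω α hα =>
    simp only [mapForm_mul, mapForm_form1, Frame.form1_fromCoord]
    exact .mul (.sum fun d => .smul contDiffOn_const (h.cof d)) hα

/-- A form with constant coefficients in the coframe changes only through `dϑ^d`, and replacing one
factor `ϑ^d` at a time is `dϑ^d ∧ e_d ⌟`. The 2-forms `dϑ^d` commute with everything, so the two
antiderivations agree on products. -/
theorem SmoothFrame.extd_mapForm (hU : IsOpen U) (h : SmoothFrame U F) (hx : x ∈ U) (β : Form D) :
    extd (fun y => MAG.mapForm (F y).fromCoord β) x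
      = ∑ d, extd (fun y => (F y).cof d) x * (F x).ip d (MAG.mapForm (F x).fromCoord β) := by
  have hr := h.regular x hx
  induction β using form_left_induction with
  | h0 r =>
    have : ∀ d, (F x).ip d (form0 r) = 0 := fun d => interior_form0 _ r
    simp only [mapForm_form0, this, mul_zero, Finset.sum_const_zero]
    have := extd_const_smul 0 (fun _ => form0 r) x
    simp only [extd, pderiv, fderiv_fun_const, Pi.zero_apply, zero_smul, Finset.sum_const_zero, mul_zero, _root_.zero_apply]
  | ha α γ hα hγ =>
    simp only [mapForm_add, Frame.ip_add, mul_add, Finset.sum_add_distrib]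
    rw [extd_add ((h.mapForm α).diffForm hU hx) ((h.mapForm γ).diffForm hU hx), hα, hγ]
  | hm ω α hα =>
    have d1 : ∀ d, DiffForm (fun y => (F y).cof d) x := fun d => (h.cof d).diffForm hU hx
    have d2 : ∀ d, DiffForm (fun y => ω d • (F y).cof d) x := fun d =>
      .smul (differentiableAt_const _) (d1 d)
    have d3 : ∀ d, Deg 2 (extd (fun y => (F y).cof d) x) := fun d =>
      (Deg.extd (.of_forall fun y => (F y).deg_cof d)).cast (by norm_num)
    simp only [mapForm_mul, mapForm_form1, Frame.form1_fromCoord]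
    rw [extd_mul (.sum d2) ((h.mapForm α).diffForm hU hx), extd_sum d2, hα]
    simp only [extd_const_smul, inv_sum, inv_smul, Frame.cof, inv_form1, Frame.ip, interior_mul,
      interior_sum, interior_smul]
    have e1 : ∀ d b, interior ((F x).e d) (form1 ((F x).θ b)) = (if d = b then 1 else 0 : ℝ) • 1 := by
      intro d b
      simp [hr.e_θ]
    have e3 : ∀ (d : Fin D) (η : Cov D) (β : Form D), form1 η * (extd (fun y => form1 ((F y).θ d)) x * β)
        = extd (fun y => form1 ((F y).θ d)) x * (form1 η * β) := by
      intro d η β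
      have h2 : Deg 2 (extd (fun y => form1 ((F y).θ d)) x) := d3 d
      rw [← mul_assoc, ← h2.mul_form1_comm, mul_assoc]
    simp only [e1, mul_add, Finset.sum_add_distrib]
    congr 1
    · simp [Finset.sum_mul]
    · simp only [Finset.sum_mul, Finset.mul_sum, smul_mul_assoc, mul_smul_comm, neg_mul, mul_neg, e3, smul_neg, Finset.sum_neg_distrib]

end MAG
end

/-! ### Covariant derivatives of the metric, the volume form and the Einstein–Hilbert momentum. -/

noncomputable section

namespace MAG

variable {D : ℕ}

open Filter Topology

section SmoothFrame

variable {U : Set (Pt D)} {F : Pt D → Frame D} {x : Pt D}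

theorem hasDerivAt_coord {f : Pt D → ℝ} (hf : DifferentiableAt ℝ f x) (μ : Fin D) :
    HasDerivAt (fun t : ℝ => f (x + t • Pi.single μ 1)) (fderiv ℝ f x (Pi.single μ 1)) 0 :=
  hf.hasFDerivAt.hasLineDerivAt _

theorem extd_form0_eq {f : Pt D → ℝ} (hf : DifferentiableAt ℝ f x) :
    extd (fun y => form0 (f y)) x = form1 fun μ => fderiv ℝ f x (Pi.single μ 1) :=
  extd_form0 (hasDerivAt_coord hf) hf

theorem differentiableAt_of_contDiffOn {f : Pt D → ℝ} (hU : IsOpen U)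
    (hf : ContDiffOn ℝ (⊤ : ℕ∞) f U) (hx : x ∈ U) : DifferentiableAt ℝ f x :=
  (hf.contDiffAt (hU.mem_nhds hx)).differentiableAt (by simp)

theorem SmoothFrame.smooth_sqrt (h : SmoothFrame U F) :
    ContDiffOn ℝ (⊤ : ℕ∞) (fun x => √|(F x).g.det|) U :=
  h.smooth_abs_det.sqrt fun x hx => abs_ne_zero.2 (h.regular x hx).det_g

theorem SmoothFrame.extd_sqrt_det (hU : IsOpen U) (h : SmoothFrame U F) (hx : x ∈ U) :
    extd (fun y => form0 √|(F y).g.det|) x = (√|(F x).g.det| * (1 / 2)) •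
      ∑ a, ∑ b, (F x).gi a b • extd (fun y => form0 ((F y).g b a)) x := by
  have hg := fun a b => differentiableAt_of_contDiffOn hU (h.smooth_g a b) hx
  have h1 := differentiableAt_of_contDiffOn hU h.smooth_sqrt hx
  have h2 := fun μ => hasDerivAt_sqrt_abs_det (A := fun t : ℝ => (F (x + t • Pi.single μ 1)).g)
    (A' := fun a b => fderiv ℝ (fun y => (F y).g a b) x (Pi.single μ 1)) (t := 0)
    (by simpa using (h.regular x hx).det_g) fun a b => hasDerivAt_coord (hg a b) μ
  rw [extd_form0 h2 h1]
  simp only [extd_form0_eq (hg _ _), ← form1_smul, ← form1_sum]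
  congr 1
  ext μ
  simp only [zero_smul, add_zero, Pi.smul_apply, Finset.sum_apply, smul_eq_mul, Frame.gi, mul_assoc]

theorem SmoothFrame.extd_gi (hU : IsOpen U) (h : SmoothFrame U F) (hx : x ∈ U) (a b : Fin D) :
    extd (fun y => form0 ((F y).gi a b)) x = -∑ c, ∑ d, ((F x).gi a c * (F x).gi d b) •
      extd (fun y => form0 ((F y).g c d)) x := by
  have hg := fun a b => differentiableAt_of_contDiffOn hU (h.smooth_g a b) hx
  have hgi := fun a b => differentiableAt_of_contDiffOn hU (h.smooth_gi a b) hx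
  have h2 := fun μ => hasDerivAt_matrix_inv (A := fun t : ℝ => (F (x + t • Pi.single μ 1)).g)
    (A' := Matrix.of fun a b => fderiv ℝ (fun y => (F y).g a b) x (Pi.single μ 1))
    (B' := fun a b => fderiv ℝ (fun y => (F y).gi a b) x (Pi.single μ 1)) (t := 0)
    (by
      have : Tendsto (fun t : ℝ => x + t • (Pi.single μ 1 : Pt D)) (𝓝 0) (𝓝 x) := by
        have : Continuous fun t : ℝ => x + t • (Pi.single μ 1 : Pt D) := by fun_prop
        simpa using this.tendsto 0
      filter_upwards [this (hU.mem_nhds hx)] with t ht using (h.regular _ ht).det_g)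
    (fun a b => hasDerivAt_coord (hg a b) μ) fun a b => hasDerivAt_coord (hgi a b) μ
  rw [extd_form0_eq (hgi a b)]
  simp only [extd_form0_eq (hg _ _), ← form1_smul, ← form1_sum, ← form1_neg]
  congr 1
  ext μ
  refine (congrFun₂ (h2 μ) a b).trans ?_
  simp only [zero_smul, add_zero, Pi.neg_apply, Matrix.neg_apply, Pi.smul_apply, Finset.sum_apply,
    smul_eq_mul, Matrix.mul_apply, Finset.sum_mul, Matrix.of_apply]
  rw [Finset.sum_comm]
  congr 1
  exact Finset.sum_congr rfl fun c _ => Finset.sum_congr rfl fun d _ => mul_right_comm _ _ _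

/-- The form `dx^1 ∧ ⋯ ∧ dx^D`. -/
def coordVol (D : ℕ) : Form D := (List.ofFn fun a : Fin D => dx a).prod

theorem Frame.fromCoord_single (F : Frame D) (a : Fin D) :
    mapForm F.fromCoord (dx a) = F.cof a := by
  rw [dx, mapForm_form1, Frame.form1_fromCoord]
  simp [Pi.single_apply]

theorem Frame.vol_eq_mapForm (F : Frame D) :
    F.vol = √|F.g.det| • mapForm F.fromCoord (coordVol D) := by
  rw [vol, coordVol, mapForm, map_list_prod, List.map_ofFn]
  congr 3
  ext a : 1
  exact (F.fromCoord_single a).symm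

theorem Frame.Regular.ip_mapForm_fromCoord {F : Frame D} (h : F.Regular) (a : Fin D) (β : Form D) :
    F.ip a (mapForm F.fromCoord β) = mapForm F.fromCoord (interior (pd a) β) := by
  rw [Frame.ip, interior_mapForm]
  congr 2
  refine (Pi.basisFun ℝ (Fin D)).ext fun b => ?_
  have : F.fromCoord (Pi.single b 1) = F.θ b := by
    ext μ
    simp [fromCoord]
  rw [Pi.basisFun_apply, LinearMap.comp_apply, this, h.e_θ, pd_apply, Pi.single_apply]

theorem Frame.Regular.ip_ip_vol {F : Frame D} (h : F.Regular) (b c : Fin D) :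
    F.ip b (F.ip c F.vol) = √|F.g.det| •
      mapForm F.fromCoord (interior (pd b) (interior (pd c) (coordVol D))) := by
  rw [F.vol_eq_mapForm, ip_smul, ip_smul, h.ip_mapForm_fromCoord, h.ip_mapForm_fromCoord]

/-- The form is `√|det g|` times a form with constant coefficients in the coframe; Jacobi's formula
treats the first factor and the derivation by `dϑ^d` the second. -/
theorem SmoothFrame.extd_ip_ip_vol (hU : IsOpen U) (h : SmoothFrame U F) (hx : x ∈ U)
    (b c : Fin D) : extd (fun y => (F y).ip b ((F y).ip c (F y).vol)) x
      = ((1 / 2 : ℝ) • ∑ a, ∑ b, (F x).gi a b • extd (fun y => form0 ((F y).g b a)) x) *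
          (F x).ip b ((F x).ip c (F x).vol)
        + ∑ d, extd (fun y => (F y).cof d) x * (F x).ip d ((F x).ip b ((F x).ip c (F x).vol)) := by
  set β := interior (pd b) (interior (pd c) (coordVol D)) with hβ
  have e1 : extd (fun y => (F y).ip b ((F y).ip c (F y).vol)) x
      = extd (fun y => √|(F y).g.det| • MAG.mapForm (F y).fromCoord β) x :=
    extd_congr <| by
      filter_upwards [hU.mem_nhds hx] with y hy using (h.regular y hy).ip_ip_vol b c
  rw [e1, extd_smul (differentiableAt_of_contDiffOn hU h.smooth_sqrt hx)
    ((h.mapForm β).diffForm hU hx), h.extd_mapForm hU hx, h.extd_sqrt_det hU hx,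
    (h.regular x hx).ip_ip_vol b c, ← hβ, mul_smul, smul_mul_assoc, mul_smul_comm]
  simp only [Frame.ip_smul, mul_smul_comm, Finset.smul_sum]

/-- Since `ϑ ∧ vol = 0` by degree, moving `ϑ^e` inwards through the contractions leaves only
Kronecker terms. -/
theorem Frame.Regular.cof_mul_ip_ip_ip_vol {F : Frame D} (h : F.Regular) (e d b c : Fin D) :
    F.cof e * F.ip d (F.ip b (F.ip c F.vol)) = (if d = e then F.ip b (F.ip c F.vol) else 0)
      - (if b = e then F.ip d (F.ip c F.vol) else 0)
      - (if c = e then F.ip b (F.ip d F.vol) else 0) := by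
  have h0 : F.cof e * F.vol = 0 :=
    ((F.deg_cof e).mul F.deg_vol).eq_zero_of_gt (by linarith)
  rw [h.cof_mul_ip, h.cof_mul_ip, h.cof_mul_ip, h0]
  have : ∀ a : Fin D, F.ip a 0 = 0 := fun a => by simp
  rw [F.ip_ip_comm b d]
  split_ifs <;> simp <;> abel

end SmoothFrame

/-! ### Fields of geometries -/

namespace Config

variable {c : Config D} {U : Set (Pt D)} {x : Pt D}

theorem IsRegularOn.frame_regular (hc : c.IsRegularOn U) (hx : x ∈ U) :
    (c.geom x).toFrame.Regular where
  symm := hc.symm_g x hx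
  det_g := hc.nondeg_g x hx
  det_θ := ((Matrix.isUnit_iff_isUnit_det _).1
    (Matrix.linearIndependent_rows_iff_isUnit.1 (hc.coframe x hx))).ne_zero

theorem IsRegularOn.smoothFrame (hc : c.IsRegularOn U) :
    SmoothFrame U fun x => (c.geom x).toFrame where
  smooth_g := hc.smooth_g
  smooth_θ a μ := contDiffOn_pi.1 (hc.smooth_θ a) μ
  regular _ hx := hc.frame_regular hx

theorem IsRegularOn.smooth_conn (hc : c.IsRegularOn U) (a b : Fin D) : SmoothForm U (c.conn a b) :=
  .form1 fun μ => contDiffOn_pi.1 (hc.smooth_Γ a b) μ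

theorem IsRegularOn.smooth_metric (hc : c.IsRegularOn U) (a b : Fin D) :
    SmoothForm U fun x => (form0 (c.g x a b) : Form D) := by
  simp only [form0_eq_smul]
  exact .smul (hc.smooth_g a b) (.const _)

theorem IsRegularOn.smoothGeom (hU : IsOpen U) (hc : c.IsRegularOn U) : SmoothGeom U c.geom where
  toSmoothFrame := hc.smoothFrame
  smooth_Q a b := .neg (.sub (.sub ((hc.smooth_metric a b).extd hU)
    (.sum fun d => (hc.smooth_conn a d).mul (hc.smooth_metric d b)))
    (.sum fun d => (hc.smooth_conn b d).mul (hc.smooth_metric a d)))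
  smooth_T a := .add ((hc.smoothFrame.cof a).extd hU)
    (.sum fun d => (hc.smooth_conn d a).mul (hc.smoothFrame.cof d))
  smooth_R a b := .add ((hc.smooth_conn a b).extd hU)
    (.sum fun d => (hc.smooth_conn d b).mul (hc.smooth_conn a d))
  geom_regular x hx := by
    refine ⟨hc.frame_regular hx, ?_, fun a b => ?_, fun a => ?_, fun a b => ?_⟩
    · ext a b : 2
      have h1 : ∀ a b, c.g x a b = c.g x b a := fun a b => (hc.symm_g x hx).apply b a
      have h2 : extd (fun x => form0 (c.g x a b)) x = extd (fun x => form0 (c.g x b a)) x :=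
        extd_congr <| by
          filter_upwards [hU.mem_nhds hx] with y hy
          rw [(hc.symm_g y hy).apply]
      simp only [Frame.tp_apply, geom, nonmetricity, DLL, h2, h1 b, h1 a]
      abel
    · refine Deg.neg (Deg.sub (Deg.sub ?_ (Deg.sum fun d => ?_)) (Deg.sum fun d => ?_))
      · exact (Deg.extd (.of_forall fun y => Deg.form0 _)).cast (by norm_num)
      · exact ((Deg.form1 _).mul (Deg.form0 _)).cast (by norm_num)
      · exact ((Deg.form1 _).mul (Deg.form0 _)).cast (by norm_num)
    · refine Deg.add ?_ (Deg.sum fun d => ?_)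
      · exact (Deg.extd (.of_forall fun y => Deg.form1 _)).cast (by norm_num)
      · exact ((Deg.form1 _).mul (Deg.form1 _)).cast (by norm_num)
    · refine Deg.add ?_ (Deg.sum fun d => ?_)
      · exact (Deg.extd (.of_forall fun y => Deg.form1 _)).cast (by norm_num)
      · exact ((Deg.form1 _).mul (Deg.form1 _)).cast (by norm_num)

theorem extd_metric (a b : Fin D) : extd (fun y => form0 ((c.geom y).g a b)) x
    = -(c.geom x).Q a b + (∑ d, (c.geom x).g d b • c.conn a d x)
      + ∑ d, (c.geom x).g a d • c.conn b d x := by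
  simp only [geom, nonmetricity, DLL, form0_eq_smul, mul_smul_comm, mul_one]
  abel

theorem extd_coframe (a : Fin D) : extd (fun y => (c.geom y).cof a) x
    = (c.geom x).T a - ∑ d, c.conn d a x * (c.geom x).cof d := by
  simp only [geom, torsion, DU, Frame.cof]
  abel

theorem extd_gi (hU : IsOpen U) (hc : c.IsRegularOn U) (hx : x ∈ U) (a b : Fin D) :
    extd (fun y => form0 ((c.geom y).gi a b)) x = (c.geom x).up2 (c.geom x).Q a b
      - (∑ d, (c.geom x).gi a d • c.conn d b x) - ∑ d, (c.geom x).gi d b • c.conn d a x := by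
  have hr := hc.frame_regular hx
  rw [hc.smoothFrame.extd_gi hU hx]
  simp only [extd_metric, smul_add, smul_neg, Finset.sum_add_distrib, Finset.sum_neg_distrib,
    neg_add, neg_neg, Frame.up2, Finset.smul_sum, smul_smul]
  have e1 : ∑ i, ∑ j, ∑ k, ((c.geom x).gi a i * (c.geom x).gi j b * (c.geom x).g k j) • c.conn i k x
      = ∑ d, (c.geom x).gi a d • c.conn d b x := by
    refine Finset.sum_congr rfl fun i _ => ?_
    rw [Finset.sum_comm]
    have : ∀ k, ∑ j, (c.geom x).gi a i * (c.geom x).gi j b * (c.geom x).g k j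
        = if k = b then (c.geom x).gi a i else 0 := fun k => by
      have := congrArg ((c.geom x).gi a i * ·) (hr.g_mul_gi k b)
      simp only [Finset.mul_sum, mul_ite, mul_one, mul_zero] at this
      rw [← this]
      exact Finset.sum_congr rfl fun j _ => by ring
    simp only [← Finset.sum_smul, this, ite_smul, zero_smul]
    simp
  have e2 : ∑ i, ∑ j, ∑ k, ((c.geom x).gi a i * (c.geom x).gi j b * (c.geom x).g i k) • c.conn j k x
      = ∑ d, (c.geom x).gi d b • c.conn d a x := by
    rw [Finset.sum_comm]
    refine Finset.sum_congr rfl fun j _ => ?_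
    rw [Finset.sum_comm]
    have : ∀ k, ∑ i, (c.geom x).gi a i * (c.geom x).gi j b * (c.geom x).g i k
        = if a = k then (c.geom x).gi j b else 0 := fun k => by
      have := congrArg ((c.geom x).gi j b * ·) (hr.gi_mul_g a k)
      simp only [Finset.mul_sum, mul_ite, mul_one, mul_zero] at this
      rw [← this]
      exact Finset.sum_congr rfl fun j _ => by ring
    simp only [← Finset.sum_smul, this, ite_smul, zero_smul]
    simp
  rw [e1, e2, sub_eq_add_neg, sub_eq_add_neg]
  simp only [hr.gi_comm b]

/-- In each of the two connection terms of `dg`, the metric cancels its inverse and half of the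
trace `Γ_d{}^d` remains. -/
theorem sum_gi_extd_metric (hc : c.IsRegularOn U) (hx : x ∈ U) :
    (1 / 2 : ℝ) • ∑ a, ∑ b, (c.geom x).gi a b • extd (fun y => form0 ((c.geom y).g b a)) x
      = -(1 / 2 : ℝ) • (c.geom x).trace (c.geom x).Q + ∑ d, c.conn d d x := by
  have hr := hc.frame_regular hx
  simp only [extd_metric, smul_add, smul_neg, Finset.sum_add_distrib, Finset.sum_neg_distrib,
    Frame.trace, Finset.smul_sum, smul_smul]
  have e1 : ∑ i, ∑ j, ∑ k, ((1 / 2 : ℝ) * ((c.geom x).gi i j * (c.geom x).g k i)) • c.conn j k x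
      = (1 / 2 : ℝ) • ∑ d, c.conn d d x := by
    rw [Finset.sum_comm, Finset.smul_sum]
    refine Finset.sum_congr rfl fun j _ => ?_
    rw [Finset.sum_comm]
    have : ∀ k, ∑ i, (1 / 2 : ℝ) * ((c.geom x).gi i j * (c.geom x).g k i)
        = if k = j then 1 / 2 else 0 := fun k => by
      have := congrArg ((1 / 2 : ℝ) * ·) (hr.g_mul_gi k j)
      simp only [Finset.mul_sum, mul_ite, mul_one, mul_zero] at this
      rw [← this]
      exact Finset.sum_congr rfl fun j _ => by ring
    simp only [← Finset.sum_smul, this, ite_smul, zero_smul]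
    simp
  have e2 : ∑ i, ∑ j, ∑ k, ((1 / 2 : ℝ) * ((c.geom x).gi i j * (c.geom x).g j k)) • c.conn i k x
      = (1 / 2 : ℝ) • ∑ d, c.conn d d x := by
    rw [Finset.smul_sum]
    refine Finset.sum_congr rfl fun i _ => ?_
    rw [Finset.sum_comm]
    have : ∀ k, ∑ j, (1 / 2 : ℝ) * ((c.geom x).gi i j * (c.geom x).g j k)
        = if i = k then 1 / 2 else 0 := fun k => by
      have := congrArg ((1 / 2 : ℝ) * ·) (hr.gi_mul_g i k)
      simp only [Finset.mul_sum, mul_ite, mul_one, mul_zero] at this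
      rw [← this]
    simp only [← Finset.sum_smul, this, ite_smul, zero_smul]
    simp
  have e3 : ∑ i, ∑ j, ((1 / 2 : ℝ) * (c.geom x).gi i j) • (c.geom x).Q j i
      = ∑ i, ∑ j, ((1 / 2 : ℝ) * (c.geom x).gi i j) • (c.geom x).Q i j := by
    rw [Finset.sum_comm]
    simp only [hr.gi_comm]
  rw [e1, e2, add_assoc, ← add_smul]
  norm_num
  rw [e3]

/-- The trace of the connection coming from `√|det g|` cancels the one produced by `dϑ^d = T^d -
Γ_c{}^d ∧ ϑ^c`. The surviving connection terms are those of a tensor with two lower indices. -/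
theorem extd_ip_ip_vol (hU : IsOpen U) (hc : c.IsRegularOn U) (hx : x ∈ U) (a b : Fin D) :
    extd (fun y => (c.geom y).ip a ((c.geom y).ip b (c.geom y).vol)) x
      = -(1 / 2 : ℝ) • ((c.geom x).trace (c.geom x).Q * (c.geom x).ip a ((c.geom x).ip b (c.geom x).vol))
        + (∑ d, (c.geom x).T d * (c.geom x).ip d ((c.geom x).ip a ((c.geom x).ip b (c.geom x).vol)))
        + (∑ d, c.conn a d x * (c.geom x).ip d ((c.geom x).ip b (c.geom x).vol))
        + ∑ d, c.conn b d x * (c.geom x).ip a ((c.geom x).ip d (c.geom x).vol) := by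
  have hr := hc.frame_regular hx
  rw [hc.smoothFrame.extd_ip_ip_vol hU hx, sum_gi_extd_metric hc hx]
  simp only [extd_coframe, sub_mul, Finset.sum_sub_distrib, Finset.sum_mul, mul_assoc,
    hr.cof_mul_ip_ip_ip_vol, mul_sub, mul_ite, mul_zero, Finset.sum_ite_eq, Finset.mem_univ, if_true,
    add_mul, smul_mul_assoc]
  abel

/-- The covariant exterior derivative of `⋆(ϑ^a ∧ ϑ_b)`. -/
theorem DUL_star_cof_mul_cofL (hU : IsOpen U) (hc : c.IsRegularOn U) (hx : x ∈ U) (a b : Fin D) :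
    c.DUL (fun a b y => (c.geom y).star ((c.geom y).cof a * (c.geom y).cofL b)) a b x
      = (∑ d, (c.geom x).T d *
          (c.geom x).star ((c.geom x).cof a * (c.geom x).cofL b * (c.geom x).cofL d))
        + (∑ d, (c.geom x).up2 (c.geom x).Q a d *
            (c.geom x).star ((c.geom x).cofL d * (c.geom x).cofL b))
        - (1 / 2 : ℝ) • ((c.geom x).trace (c.geom x).Q *
            (c.geom x).star ((c.geom x).cof a * (c.geom x).cofL b)) := by
  have hr := hc.frame_regular hx
  -- The star is written as contractions of the volume form, with the inverse metric as the only
  -- other variable ingredient; its derivative brings in the term with `Q^{ad}`.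
  have e0 : ∀ (G : Geom D), G.toFrame.Regular → ∀ a b, G.star (G.cof a * G.cofL b)
      = ∑ d, G.gi a d • G.ip b (G.ip d G.vol) := fun G h a b => by
    rw [h.star_mul_cofL, ← one_mul (G.cof a), h.star_mul_cof, Frame.star_one, Frame.ipU,
      Frame.ip_sum]
    simp only [Frame.ip_smul]
  have e1 : ∀ d, (c.geom x).star ((c.geom x).cofL d * (c.geom x).cofL b)
      = (c.geom x).ip b ((c.geom x).ip d (c.geom x).vol) := fun d => by
    rw [hr.star_mul_cofL, ← one_mul ((c.geom x).cofL d), hr.star_mul_cofL, Frame.star_one]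
  have s1 : ∀ d, DiffForm (fun y => (c.geom y).ip b ((c.geom y).ip d (c.geom y).vol)) x := fun d =>
    (hc.smoothFrame.ip (hc.smoothFrame.ip hc.smoothFrame.vol d) b).diffForm hU hx
  have s2 := fun d => differentiableAt_of_contDiffOn hU (hc.smoothFrame.smooth_gi a d) hx
  have e2 : extd (fun y => (c.geom y).star ((c.geom y).cof a * (c.geom y).cofL b)) x
      = ∑ d, (extd (fun y => form0 ((c.geom y).gi a d)) x *
            (c.geom x).ip b ((c.geom x).ip d (c.geom x).vol)
          + (c.geom x).gi a d •
            extd (fun y => (c.geom y).ip b ((c.geom y).ip d (c.geom y).vol)) x) := by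
    rw [← Finset.sum_congr rfl fun d _ => extd_smul (s2 d) (s1 d),
      ← extd_sum fun d => .smul (s2 d) (s1 d)]
    exact extd_congr <| by
      filter_upwards [hU.mem_nhds hx] with y hy using e0 _ (hc.frame_regular hy) a b
  rw [DUL, e2]
  simp only [extd_gi hU hc hx, extd_ip_ip_vol hU hc hx, e1, e0 _ hr, hr.star_mul_cofL _ (_ * _)]
  -- Beyond this point only the array of twice contracted volume forms matters; the connection terms
  -- cancel by reordering finite sums.
  generalize hΨ : (fun a b => (c.geom x).ip a ((c.geom x).ip b (c.geom x).vol)) = Ψ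
  have hΨ' : ∀ a b, (c.geom x).ip a ((c.geom x).ip b (c.geom x).vol) = Ψ a b := fun a b => by
    rw [← hΨ]
  simp only [hΨ', sub_mul, smul_add, Finset.sum_add_distrib, Finset.sum_sub_distrib]
  have t1 : ∑ d, (∑ e, (c.geom x).gi a e • c.conn e d x) * Ψ b d
      = ∑ d, (c.geom x).gi a d • ∑ e, c.conn d e x * Ψ b e := by
    simp only [Finset.sum_mul, Finset.smul_sum, smul_mul_assoc]
    exact Finset.sum_comm
  have t2 : ∑ d, (∑ e, (c.geom x).gi e d • c.conn e a x) * Ψ b d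
      = ∑ e, c.conn e a x * ∑ d, (c.geom x).gi e d • Ψ b d := by
    simp only [Finset.sum_mul, Finset.mul_sum, smul_mul_assoc, mul_smul_comm]
    exact Finset.sum_comm
  have t3 : ∑ d, (c.geom x).gi a d • ∑ e, c.conn b e x * Ψ e d
      = ∑ e, c.conn b e x * ∑ d, (c.geom x).gi a d • Ψ e d := by
    simp only [Finset.smul_sum, Finset.mul_sum, mul_smul_comm]
    exact Finset.sum_comm
  have t4 : ∑ d, (c.geom x).gi a d • ∑ e, (c.geom x).T e * (c.geom x).ip e (Ψ b d)
      = ∑ e, (c.geom x).T e * (c.geom x).ip e (∑ d, (c.geom x).gi a d • Ψ b d) := by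
    simp only [Finset.smul_sum, Frame.ip_sum, Frame.ip_smul, Finset.mul_sum, mul_smul_comm]
    exact Finset.sum_comm
  have t5 : ∑ d, (c.geom x).gi a d • -(1 / 2 : ℝ) • ((c.geom x).trace (c.geom x).Q * Ψ b d)
      = -((1 / 2 : ℝ) • ((c.geom x).trace (c.geom x).Q * ∑ d, (c.geom x).gi a d • Ψ b d)) := by
    simp only [Finset.smul_sum, Finset.mul_sum, mul_smul_comm, neg_smul, smul_neg,
      Finset.sum_neg_distrib]
    congr 1
    exact Finset.sum_congr rfl fun d _ => smul_comm _ _ _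
  rw [t1, t2, t3, t4, t5]
  abel

end Config

end MAG
end

/-! ### The gravitational coframe derivative, and differentiation under the integral sign. -/

noncomputable section

namespace MAG

variable {D : ℕ}

open _root_.MAG.Frame

theorem Frame.Regular.up2_low2 {F : Frame D} (h : F.Regular) (A : TForm D) (b d : Fin D) :
    F.up2 (F.low2 A) b d = ∑ e, F.gi b e • A e d := by
  simp only [up2, low2, Finset.smul_sum, smul_smul]
  refine Finset.sum_congr rfl fun e _ => ?_
  rw [Finset.sum_comm]
  have : ∀ c, ∑ f, F.gi b e * F.gi d f * F.g c f = if d = c then F.gi b e else 0 := fun c => by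
    have := congrArg (F.gi b e * ·) (h.gi_mul_g d c)
    simp only [Finset.mul_sum, mul_ite, mul_one, mul_zero] at this
    rw [← this]
    exact Finset.sum_congr rfl fun f _ => by rw [h.g_comm c f]; ring
  simp only [← Finset.sum_smul, this, ite_smul, zero_smul, Finset.sum_ite_eq, Finset.mem_univ,
    if_true]

namespace Params

variable (p : Params) {G : Geom D}

theorem sum_ip_up2_Rlow (h : G.Regular) (a : Fin D) :
    ∑ b, ∑ d, G.ip a (G.up2 G.Rlow b d) * G.star (G.cofL b * G.cofL d)
      = ∑ b, ∑ d, G.ip a (G.R b d) * G.star (G.cof b * G.cofL d) := by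
  have h1 : ∀ b, G.cof b = ∑ e, G.gi e b • G.cofL e := fun b => by
    rw [← h.upV_cofL b, upV]
    simp only [h.gi_comm b]
  simp only [Geom.Rlow, h.up2_low2, Frame.ip_sum, Frame.ip_smul, h1, Finset.sum_mul,
    Frame.star_sum, Frame.star_smul, smul_mul_assoc, Finset.mul_sum, mul_smul_comm]
  rw [Finset.sum_comm]
  conv_rhs => rw [Finset.sum_comm]
  refine Finset.sum_congr rfl fun d _ => ?_
  exact Finset.sum_comm

/-- Graded Leibniz rule. The contraction of the curvature gives a term of the same form as the
curvature-momentum term, and the contraction of the star gives the Einstein form. -/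
theorem ip_LEH (h : G.Regular) (a : Fin D) : G.ip a (LEH G)
    = (∑ b, ∑ d, G.ip a (G.R b d) * G.star (G.cof b * G.cofL d))
      + ∑ b, ∑ d, G.up2 G.Rlow b d * G.star (G.cofL b * G.cofL d * G.cofL a) := by
  have h1 : ∀ b d, inv (G.up2 G.Rlow b d) = G.up2 G.Rlow b d := fun b d => by
    have : Deg (2 : ℕ) (G.up2 G.Rlow b d) :=
      ((Concomitant.up2 Concomitant.Rlow b d).deg G h).cast (by norm_num)
    rw [this.inv_eq]; simp
  rw [← sum_ip_up2_Rlow h, LEH]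
  simp only [Frame.ip_sum]
  simp only [← Finset.sum_add_distrib]
  refine Finset.sum_congr rfl fun b _ => Finset.sum_congr rfl fun d _ => ?_
  rw [Frame.ip, interior_mul, h1, h.star_mul_cofL a]
  rfl

/-- The Einstein–Hilbert part `-(a_0/2κ) ⋆(ϑ^a ∧ ϑ_b)` of the curvature momentum cancels the first
half of `e_a ⌟` of the Einstein–Hilbert term. What is left besides `q_a` is the Einstein form and
the cosmological term. -/
theorem smul_coframeDerivative (hκ : p.κ ≠ 0) (h : G.Regular) (a : Fin D) :
    p.κ • coframeDerivative p.LMAG G (fun a b => (2 / p.κ) • p.m G a b)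
      (fun a => (1 / p.κ) • p.h1 G a)
      (fun a b => (-(1 / (2 * p.κ)) * p.a0) • G.star (G.cof a * G.cofL b)
        + (1 / p.ρ) • p.h2 G a b) a
    = (p.a0 / 2) • (∑ b, ∑ d, G.up2 G.Rlow b d * G.star (G.cofL b * G.cofL d * G.cofL a))
      - p.lam • G.star (G.cofL a) + p.q G a := by
  have h1 : G.star (G.cofL a) = G.ip a G.vol := by
    rw [← one_mul (G.cofL a), h.star_mul_cofL, Frame.star_one]
  have h2 : p.κ • p.LMAG G = p.L2 G + (1 / 2 : ℝ) • (p.a0 • LEH G - (2 * p.lam) • G.vol) := by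
    rw [L2, smul_sub, smul_smul, show p.κ * (1 / (2 * p.κ)) = 1 / 2 by field_simp,
      sub_add_cancel]
  have h3 : p.κ • G.ip a (p.LMAG G) = G.ip a (p.L2 G)
      + (1 / 2 : ℝ) • (p.a0 • G.ip a (LEH G) - (2 * p.lam) • G.ip a G.vol) := by
    rw [← Frame.ip_smul, h2]
    simp only [Frame.ip_add, Frame.ip_sub, Frame.ip_smul]
  rw [coframeDerivative, smul_add, smul_add, smul_add, h3, ip_LEH h, h1, q]
  simp only [mul_add, Finset.sum_add_distrib, mul_smul_comm, ← Finset.smul_sum, smul_smul]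
  rw [show p.κ * (1 / 2 * (2 / p.κ)) = 1 by field_simp,
    show p.κ * (1 / p.κ) = 1 by field_simp]
  simp only [smul_add, smul_smul]
  rw [show p.κ * (-(1 / (2 * p.κ)) * p.a0) = -(p.a0 / 2) by field_simp,
    show p.κ * (1 / p.ρ) = p.κ / p.ρ by ring]
  module

end Params

/-! ### Differentiation under the integral sign -/

open MeasureTheory Filter Topology

/-- Differentiation under the integral over a compact set. -/
theorem hasDerivAt_integral_of_contDiffOn {s : Set (ℝ × Pt D)} (hs : IsOpen s) {K : Set (Pt D)}
    (hK : IsCompact K) (hsK : ∀ x ∈ K, ((0 : ℝ), x) ∈ s) {f : ℝ × Pt D → ℝ} {f' : Pt D → ℝ}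
    (hf : ContDiffOn ℝ (⊤ : ℕ∞) f s)
    (hf' : ∀ x ∈ K, HasDerivAt (fun t => f (t, x)) (f' x) 0) :
    HasDerivAt (fun t => ∫ x in K, f (t, x)) (∫ x in K, f' x) 0 := by
  -- The tube lemma gives a parameter interval valid for all of `K` at once. On a smaller closed
  -- interval times `K` the parameter derivative is bounded by compactness, and this constant
  -- dominates.
  obtain ⟨u, v, hu, hv, h0u, hKv, huv⟩ := generalized_tube_lemma (isCompact_singleton (x := (0 : ℝ)))
    hK hs (by rintro ⟨t, x⟩ ⟨rfl, hx⟩; exact hsK x hx)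
  obtain ⟨ε, hε, hεu⟩ := Metric.isOpen_iff.1 hu 0 (h0u rfl)
  have hsub : Metric.closedBall (0 : ℝ) (ε / 2) ×ˢ K ⊆ s := fun q hq =>
    huv ⟨hεu (Metric.closedBall_subset_ball (by linarith) hq.1), hKv hq.2⟩
  have hd : ∀ q ∈ s, HasDerivAt (fun t => f (t, q.2)) (fderiv ℝ f q (1, 0)) q.1 := by
    intro q hq
    have h1 := ((hf.contDiffAt (hs.mem_nhds hq)).differentiableAt (by simp)).hasFDerivAt
    exact h1.comp_hasDerivAt q.1 ((hasDerivAt_id q.1).prodMk (hasDerivAt_const q.1 q.2))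
  have hc : ContinuousOn (fun q => fderiv ℝ f q (1, 0)) s :=
    (hf.continuousOn_fderiv_of_isOpen hs (by simp)).clm_apply continuousOn_const
  obtain ⟨C, hC⟩ := ((isCompact_closedBall (0 : ℝ) (ε / 2)).prod hK).exists_bound_of_continuousOn
    (hc.mono hsub)
  have hball : Metric.ball (0 : ℝ) (ε / 2) ∈ 𝓝 (0 : ℝ) := Metric.ball_mem_nhds _ (by linarith)
  have hcont : ∀ t ∈ Metric.ball (0 : ℝ) (ε / 2), ContinuousOn (fun x => f (t, x)) K := fun t ht =>
    hf.continuousOn.comp (by fun_prop) fun x hx => hsub ⟨Metric.ball_subset_closedBall ht, hx⟩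
  have h0 : (0 : ℝ) ∈ Metric.ball (0 : ℝ) (ε / 2) := Metric.mem_ball_self (by linarith)
  have key := (hasDerivAt_integral_of_dominated_loc_of_deriv_le (μ := volume.restrict K)
    (F := fun t x => f (t, x)) (F' := fun t x => fderiv ℝ f (t, x) (1, 0)) (x₀ := (0 : ℝ))
    (bound := fun _ => C) hball
    (by
      filter_upwards [hball] with t ht
      exact (hcont t ht).aestronglyMeasurable hK.measurableSet)
    ((hcont 0 h0).integrableOn_compact hK)
    ((hc.comp (by fun_prop) fun x hx => hsK x hx).aestronglyMeasurable hK.measurableSet)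
    (by
      refine (ae_restrict_iff' hK.measurableSet).2 (.of_forall fun x hx t ht => ?_)
      exact hC _ ⟨Metric.ball_subset_closedBall ht, hx⟩)
    (integrableOn_const hK.measure_lt_top.ne)
    (by
      refine (ae_restrict_iff' hK.measurableSet).2 (.of_forall fun x hx t ht => ?_)
      exact hd (t, x) (hsub ⟨Metric.ball_subset_closedBall ht, hx⟩))).2
  refine key.congr_deriv (setIntegral_congr_fun hK.measurableSet fun x hx => ?_)
  exact (hd (0, x) (hsK x hx)).unique (hf' x hx)

end MAG
end

/-! ### The first variation with respect to the coframe. -/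

noncomputable section

namespace MAG

variable {D : ℕ}

open MeasureTheory Filter Topology

theorem SmoothForm.contForm {U : Set (Pt D)} {α : Pt D → Form D} (h : SmoothForm U α) :
    ContForm U α := fun I => (h I).continuousOn

theorem SmoothForm.comp_snd {U : Set (Pt D)} {s : Set (ℝ × Pt D)} {α : Pt D → Form D}
    (h : SmoothForm U α) (hs : ∀ q ∈ s, q.2 ∈ U) : SmoothForm s fun q => α q.2 := fun I =>
  (h I).comp contDiffOn_snd hs

theorem Concomitant.partialCoframe {L : Geom D → Form D} {M : Geom D → Fin D → Fin D → Form D}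
    {H : Geom D → Fin D → Form D} {HH : Geom D → Fin D → Fin D → Form D} (hL : Concomitant D L)
    (hM : ∀ a b, Concomitant (D - 1) fun G => M G a b) (hH : ∀ a, Concomitant (D - 2) fun G => H G a)
    (hHH : ∀ a b, Concomitant (D - 2) fun G => HH G a b) (a : Fin D) :
    Concomitant (D - 1) fun G => coframeDerivative L G (M G) (H G) (HH G) a :=
  .add (.add (.add (hL.ip a)
    (.sum fun b => .sum fun d => (((Concomitant.Q b d).ip a).mul ((hM b d).smul _)).cast))
    (.sum fun b => (((Concomitant.T b).ip a).mul (hH b)).cast))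
    (.sum fun b => .sum fun d => (((Concomitant.R b d).ip a).mul (hHH b d)).cast)

/-- Integration by parts for a finite family of compactly supported 1-forms. -/
theorem setIntegral_eq_of_by_parts {U K : Set (Pt D)} (hU : IsOpen U) (hK : IsCompact K)
    (hKU : K ⊆ U) {ι : Type*} [Fintype ι] {ω : ι → Pt D → Cov D} {α : ι → Pt D → Form D}
    {β : Pt D → Form D} {f : Pt D → ℝ} (hω : ∀ i, ContDiff ℝ (⊤ : ℕ∞) (ω i))
    (hs : ∀ i, tsupport (ω i) ⊆ K) (hα : ∀ i, SmoothForm U (α i)) (hβ : SmoothForm U β)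
    (hf : ∀ x ∈ K, f x = top (β x) - ∑ i, (top (extd (fun y => form1 (ω i y)) x * α i x)
      - top (form1 (ω i x) * extd (α i) x))) :
    ∫ x in K, f x = integral K β := by
  have h1 : ∀ i, SmoothForm U fun y => form1 (ω i y) := fun i =>
    .form1 fun μ => (contDiff_pi.1 (hω i) μ).contDiffOn
  have h2 := fun i => ((h1 i).extd hU |>.mul (hα i)).integrableOn hK hKU
  have h3 := fun i => ((h1 i).mul ((hα i).extd hU)).integrableOn hK hKU
  have h4 : ∀ i, IntegrableOn (fun x => top (extd (fun y => form1 (ω i y)) x * α i x)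
      - top (form1 (ω i x) * extd (α i) x)) K := fun i => (h2 i).sub (h3 i)
  rw [setIntegral_congr_fun hK.measurableSet hf, integral_sub (hβ.integrableOn hK hKU)
    (integrable_finsetSum _ fun i _ => h4 i),
    integral_finsetSum _ fun i _ => h4 i,
    Finset.sum_eq_zero fun i _ => ?_, sub_zero]
  · rfl
  · rw [integral_sub (h2 i) (h3 i)]
    exact sub_eq_zero.2 (integral_extd_form1_mul hU hK hKU (hω i) (hs i) (hα i))

/-- The first variation of the action of a concomitant Lagrangian along a smooth family of
geometries. -/
theorem Concomitant.hasDerivAt_integral {r : ℝ} {L : Geom D → Form D} (hL : Concomitant r L)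
    {M : Geom D → Fin D → Fin D → Form D} {H : Geom D → Fin D → Form D}
    {HH : Geom D → Fin D → Fin D → Form D}
    (hm : ∀ G : Geom D, G.Regular → HasMomenta L G (M G) (H G) (HH G))
    {s : Set (ℝ × Pt D)} (hs : IsOpen s) {K : Set (Pt D)} (hK : IsCompact K)
    (hsK : ∀ x ∈ K, ((0 : ℝ), x) ∈ s) {X : ℝ × Pt D → Geom D} (hX : SmoothGeom s X)
    {G : Pt D → Geom D} (hG : ∀ x ∈ K, (G x).Regular)
    {δθ : Fin D → Pt D → Cov D} {δQ : Fin D → Fin D → Pt D → Form D} {δT : Fin D → Pt D → Form D}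
    {δR : Fin D → Fin D → Pt D → Form D}
    (hv : ∀ x ∈ K, HasVelocity (fun t => X (t, x)) (G x) (fun a => δθ a x) (fun a b => δQ a b x)
      (fun a => δT a x) fun a b => δR a b x)
    (dQ : ∀ x ∈ K, ∀ a b, Deg 1 (δQ a b x)) (sQ : ∀ x ∈ K, ∀ a b, δQ a b x = δQ b a x)
    (dT : ∀ x ∈ K, ∀ a, Deg 2 (δT a x)) (dR : ∀ x ∈ K, ∀ a b, Deg 2 (δR a b x)) :
    HasDerivAt (fun t => integral K fun x => L (X (t, x))) (∫ x in K,
      (top (∑ a, form1 (δθ a x) * coframeDerivative L (G x) (M (G x)) (H (G x)) (HH (G x)) a)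
        + (top (∑ a, ∑ b, δQ a b x * (-(1 / 2 : ℝ)) • M (G x) a b)
          + top (∑ a, δT a x * -H (G x) a)
          + top (∑ a, ∑ b, δR a b x * -HH (G x) a b)))) 0 :=
  hasDerivAt_integral_of_contDiffOn hs hK hsK (hL.smooth hX Finset.univ) fun x hx =>
    hL.hasDerivAt (hG x hx) (hm _ (hG x hx)) (hv x hx) (dQ x hx) (sQ x hx) (dT x hx) (dR x hx)

namespace Config

variable {c : Config D} {U K : Set (Pt D)} {x : Pt D}

/-- At fixed connection the torsion is linear in the coframe, so the expansion in `t` is exact.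
Nonmetricity and curvature do not involve the coframe. -/
theorem torsion_add_coframe (hU : IsOpen U) (hc : c.IsRegularOn U) (hx : x ∈ U)
    {δθ : Fin D → Pt D → Cov D} (hδ : ∀ a, ContDiff ℝ (⊤ : ℕ∞) (δθ a)) (t : ℝ) (a : Fin D) :
    Config.torsion { c with θ := c.θ + t • δθ } a x
      = c.torsion a x + t • c.DU (fun a y => form1 (δθ a y)) a x := by
  have h1 : DiffForm (fun y => form1 (c.θ a y)) x := (hc.smoothFrame.cof a).diffForm hU hx
  have h2 : DiffForm (fun y => form1 (δθ a y)) x :=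
    .form1 ((hδ a).differentiable (by simp) x)
  have h3 : extd (fun y => form1 ((c.θ + t • δθ) a y)) x
      = extd (fun y => form1 (c.θ a y)) x + t • extd (fun y => form1 (δθ a y)) x := by
    rw [← extd_const_smul, ← extd_add h1 (.smul (differentiableAt_const t) h2)]
    simp only [Pi.add_apply, Pi.smul_apply, form1_add, form1_smul]
  simp only [torsion, DU, h3]
  simp only [conn, Pi.add_apply, Pi.smul_apply, form1_add, form1_smul, mul_add, mul_smul_comm,
    Finset.sum_add_distrib, Finset.smul_sum, smul_add]
  abel

/-- The parameters and points at which the varied coframe is nondegenerate. -/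
def coframeDomain (c : Config D) (U : Set (Pt D)) (δθ : Fin D → Pt D → Cov D) : Set (ℝ × Pt D) :=
  {q | q.2 ∈ U ∧ Matrix.det (Matrix.of fun a => c.θ a q.2 + q.1 • δθ a q.2) ≠ 0}

theorem IsRegularOn.smoothGeom_coframe (hU : IsOpen U) (hc : c.IsRegularOn U)
    {δθ : Fin D → Pt D → Cov D} (hδ : ∀ a, ContDiff ℝ (⊤ : ℕ∞) (δθ a)) :
    SmoothGeom (c.coframeDomain U δθ)
      fun q => Config.geom { c with θ := c.θ + q.1 • δθ } q.2 := by
  have hs : ∀ q ∈ c.coframeDomain U δθ, q.2 ∈ U := fun q hq => hq.1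
  have hg := hc.smoothGeom hU
  have hδ' : ∀ a, SmoothForm U fun y => form1 (δθ a y) := fun a =>
    .form1 fun μ => (contDiff_pi.1 (hδ a) μ).contDiffOn
  have hDU : ∀ a, SmoothForm U (c.DU (fun a y => form1 (δθ a y)) a) := fun a =>
    .add ((hδ' a).extd hU) (.sum fun d => (hc.smooth_conn d a).mul (hδ' d))
  have hdeg : ∀ x a, Deg 2 (c.DU (fun a y => form1 (δθ a y)) a x) := fun x a =>
    .add ((Deg.extd (.of_forall fun y => Deg.form1 _)).cast (by norm_num))
      (.sum fun d => ((Deg.form1 _).mul (Deg.form1 _)).cast (by norm_num))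
  have hT : ∀ q ∈ c.coframeDomain U δθ, ∀ a, Config.torsion { c with θ := c.θ + q.1 • δθ } a q.2
      = (c.geom q.2).T a + q.1 • c.DU (fun a y => form1 (δθ a y)) a q.2 := fun q hq a =>
    torsion_add_coframe hU hc hq.1 hδ q.1 a
  have hr : ∀ q ∈ c.coframeDomain U δθ,
      (Config.geom { c with θ := c.θ + q.1 • δθ } q.2).toFrame.Regular := fun q hq =>
    ⟨hc.symm_g _ hq.1, hc.nondeg_g _ hq.1, hq.2⟩
  refine ⟨⟨fun a b => (hc.smooth_g a b).comp contDiffOn_snd hs, fun a μ => ?_, hr⟩, fun a b => ?_,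
    fun a => ?_, fun a b => ?_, fun q hq => ⟨hr q hq, ?_, ?_, fun a => ?_, ?_⟩⟩
  · exact ((contDiffOn_pi.1 (hc.smooth_θ a) μ).comp contDiffOn_snd hs).add
      (contDiffOn_fst.mul ((contDiff_pi.1 (hδ a) μ).comp_contDiffOn contDiffOn_snd))
  · exact (hg.smooth_Q a b).comp_snd hs
  · exact (((hg.smooth_T a).comp_snd hs).add (.smul contDiffOn_fst ((hDU a).comp_snd hs))).congr
      fun q hq => hT q hq a
  · exact (hg.smooth_R a b).comp_snd hs
  · exact (hg.geom_regular _ hq.1).tpQ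
  · exact (hg.geom_regular _ hq.1).degQ
  · have := ((hg.geom_regular _ hq.1).degT a).add ((hdeg q.2 a).smul q.1)
    rw [← hT q hq a] at this
    exact this
  · exact (hg.geom_regular _ hq.1).degR

theorem isOpen_coframeDomain (hU : IsOpen U) (hc : c.IsRegularOn U) {δθ : Fin D → Pt D → Cov D}
    (hδ : ∀ a, ContDiff ℝ (⊤ : ℕ∞) (δθ a)) : IsOpen (c.coframeDomain U δθ) := by
  have h1 : ContinuousOn (fun q : ℝ × Pt D =>
      Matrix.det (Matrix.of fun a => c.θ a q.2 + q.1 • δθ a q.2)) {q | q.2 ∈ U} :=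
    (contDiffOn_det fun a μ => ((contDiffOn_pi.1 (hc.smooth_θ a) μ).comp contDiffOn_snd
      fun q hq => hq).add (contDiffOn_fst.mul
        ((contDiff_pi.1 (hδ a) μ).comp_contDiffOn contDiffOn_snd))).continuousOn
  exact h1.isOpen_inter_preimage (hU.preimage continuous_snd) isOpen_ne

theorem geom_coframe (hU : IsOpen U) (hc : c.IsRegularOn U) (hx : x ∈ U)
    {δθ : Fin D → Pt D → Cov D} (hδ : ∀ a, ContDiff ℝ (⊤ : ℕ∞) (δθ a)) (t : ℝ) :
    Config.geom { c with θ := c.θ + t • δθ } x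
      = { g := (c.geom x).g
          θ := fun a => c.θ a x + t • δθ a x
          Q := (c.geom x).Q
          T := fun a => (c.geom x).T a + t • c.DU (fun a y => form1 (δθ a y)) a x
          R := (c.geom x).R } := by
  rw [geom]
  simp only [torsion_add_coframe hU hc hx hδ]
  rfl

theorem hasVelocity_coframe (hU : IsOpen U) (hc : c.IsRegularOn U) (hx : x ∈ U)
    {δθ : Fin D → Pt D → Cov D} (hδ : ∀ a, ContDiff ℝ (⊤ : ℕ∞) (δθ a)) :
    HasVelocity (fun t => Config.geom { c with θ := c.θ + t • δθ } x) (c.geom x) (fun a => δθ a x)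
      0 (fun a => c.DU (fun a y => form1 (δθ a y)) a x) 0 := by
  have hsg := hc.smoothGeom_coframe hU hδ
  have ho := isOpen_coframeDomain hU hc hδ
  have h0 : ((0 : ℝ), x) ∈ c.coframeDomain U δθ := by
    refine ⟨hx, ?_⟩
    simp only [zero_smul, add_zero]
    exact (hc.frame_regular hx).det_θ
  have hreg : ∀ᶠ t in 𝓝 (0 : ℝ), (Config.geom { c with θ := c.θ + t • δθ } x).Regular := by
    have : Tendsto (fun t : ℝ => (t, x)) (𝓝 0) (𝓝 (0, x)) :=
      (Continuous.prodMk_left x).tendsto 0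
    filter_upwards [this (ho.mem_nhds h0)] with t ht using hsg.geom_regular _ ht
  simp only [geom_coframe hU hc hx hδ] at hreg ⊢
  refine ⟨?_, hreg, fun _ => rfl, fun a μ => ?_, fun a b => ?_, fun a => ?_, fun a b => ?_⟩
  · simp only [zero_smul, add_zero]
    rfl
  · have := (hasDerivAt_const (0 : ℝ) (c.θ a x μ)).fun_add
      ((hasDerivAt_id (0 : ℝ)).mul_const (δθ a x μ))
    rw [zero_add, one_mul] at this
    exact this
  · exact HasDerivForm.const ((c.geom x).Q a b) 0
  · have := (HasDerivForm.const ((c.geom x).T a) 0).add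
      (.smul_const (hasDerivAt_id (0 : ℝ)) (c.DU (fun a y => form1 (δθ a y)) a x))
    rw [zero_add, one_smul] at this
    exact this
  · exact HasDerivForm.const ((c.geom x).R a b) 0

end Config

/-- The variation has a direct part, given by `coframeDerivative`, and a part `-Dδϑ^a ∧ H_a` through
the torsion. Integration by parts turns the latter into `-δϑ^a ∧ DH_a`. -/
theorem Concomitant.hasCoframeVariation {L : Geom D → Form D}
    {M : Geom D → Fin D → Fin D → Form D} {H : Geom D → Fin D → Form D}
    {HH : Geom D → Fin D → Fin D → Form D} (hL : Concomitant D L)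
    (hM : ∀ a b, Concomitant (D - 1) fun G => M G a b) (hH : ∀ a, Concomitant (D - 2) fun G => H G a)
    (hHH : ∀ a b, Concomitant (D - 2) fun G => HH G a b)
    (hm : ∀ G : Geom D, G.Regular → HasMomenta L G (M G) (H G) (HH G)) (hD : 1 ≤ D)
    {U : Set (Pt D)} (hU : IsOpen U) {c : Config D} (hc : c.IsRegularOn U) :
    HasCoframeVariation U (fun K c' => integral K fun x => L (c'.geom x)) c fun a x =>
      coframeDerivative L (c.geom x) (M (c.geom x)) (H (c.geom x)) (HH (c.geom x)) a
        - c.DL (fun a x => H (c.geom x) a) a x := by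
  have hg := hc.smoothGeom hU
  have hN := Concomitant.partialCoframe hL hM hH hHH
  have hH' : ∀ a, SmoothForm U fun x => H (c.geom x) a := fun a => (hH a).smooth hg
  have hX : ∀ a, SmoothForm U fun x =>
      coframeDerivative L (c.geom x) (M (c.geom x)) (H (c.geom x)) (HH (c.geom x)) a
        - c.DL (fun a x => H (c.geom x) a) a x := fun a =>
    .sub ((hN a).smooth hg) (.sub ((hH' a).extd hU)
      (.sum fun d => (hc.smooth_conn a d).mul (hH' d)))
  refine ⟨fun a => (hX a).contForm, fun a x hx => isForm_iff_deg.2 ?_, ?_⟩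
  · have hr := hg.geom_regular
    refine Deg.cast (r := D - 1) (.sub ((hN a).deg _ (hr x hx)) (.sub ?_ (.sum fun d => ?_)))
      (by rw [Nat.cast_sub hD]; norm_num)
    · refine (Deg.extd (r := D - 2) ?_).cast (by ring)
      filter_upwards [hU.mem_nhds hx] with y hy using (hH a).deg _ (hr y hy)
    · exact ((Deg.form1 _).mul ((hH d).deg _ (hr x hx))).cast (by ring)
  · intro K hK hKU δθ hδ hsupp
    have hsg := hc.smoothGeom_coframe hU hδ
    have ho := Config.isOpen_coframeDomain hU hc hδ
    have h0 : ∀ x ∈ K, ((0 : ℝ), x) ∈ c.coframeDomain U δθ := fun x hx => by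
      refine ⟨hKU hx, ?_⟩
      simp only [zero_smul, add_zero]
      exact (hc.frame_regular (hKU hx)).det_θ
    refine (hL.hasDerivAt_integral hm ho hK h0 hsg (fun x hx => hg.geom_regular x (hKU hx))
      (δQ := 0) (δR := 0) (fun x hx => Config.hasVelocity_coframe hU hc (hKU hx) hδ)
      (fun _ _ _ _ => Deg.zero _) (fun _ _ _ _ => rfl) (fun x _ a => ?_)
      fun _ _ _ _ => Deg.zero _).congr_deriv ?_
    · exact .add ((Deg.extd (.of_forall fun y => Deg.form1 _)).cast (by norm_num))
        (.sum fun d => ((Deg.form1 _).mul (Deg.form1 _)).cast (by norm_num))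
    · refine setIntegral_eq_of_by_parts hU hK hKU hδ hsupp hH' (.sum fun a => .mul
        (.form1 fun μ => (contDiff_pi.1 (hδ a) μ).contDiffOn) (hX a)) fun x hx => ?_
      -- Moving `δϑ` in front of the connection form changes the sign, which turns the connection
      -- term for an upper index into the one for a lower index.
      have e1 : ∑ a, ∑ d, c.conn d a x * (form1 (δθ d x) * H (c.geom x) a)
          = -∑ a, ∑ d, form1 (δθ a x) * (c.conn a d x * H (c.geom x) d) := by
        rw [Finset.sum_comm]
        simp only [← Finset.sum_neg_distrib]
        exact Finset.sum_congr rfl fun a _ => Finset.sum_congr rfl fun d _ =>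
          form1_mul_form1_mul _ _ _
      have e2 := congrArg top e1
      simp only [Pi.zero_apply, zero_mul, Finset.sum_const_zero, top_zero, zero_add, Config.DU, Config.DL,
        mul_sub, add_mul, Finset.sum_mul, Finset.mul_sum, mul_neg, mul_assoc, top_sum, top_add, top_sub, top_neg,
        Finset.sum_add_distrib, Finset.sum_sub_distrib, Finset.sum_neg_distrib] at e2 ⊢
      linarith

end MAG
end

/-! ### The first variation with respect to the connection. -/

noncomputable section

namespace MAG

variable {D : ℕ}

open MeasureTheory Filter Topology

namespace Config

variable {c : Config D} {U K : Set (Pt D)} {x : Pt D} {δΓ : Fin D → Fin D → Pt D → Cov D}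

/-- The first variation of the nonmetricity with respect to the connection. -/
def varQ (c : Config D) (δΓ : Fin D → Fin D → Pt D → Cov D) (a b : Fin D) (x : Pt D) : Form D :=
  (∑ d, c.g x d b • form1 (δΓ a d x)) + ∑ d, c.g x a d • form1 (δΓ b d x)

/-- The first variation of the torsion with respect to the connection. -/
def varT (c : Config D) (δΓ : Fin D → Fin D → Pt D → Cov D) (a : Fin D) (x : Pt D) : Form D :=
  ∑ d, form1 (δΓ d a x) * form1 (c.θ d x)

/-- The first variation of the curvature with respect to the connection. -/
def varR (c : Config D) (δΓ : Fin D → Fin D → Pt D → Cov D) (a b : Fin D) (x : Pt D) : Form D :=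
  extd (fun y => form1 (δΓ a b y)) x
    + ∑ d, (form1 (δΓ d b x) * c.conn a d x + c.conn d b x * form1 (δΓ a d x))

theorem conn_add (t : ℝ) (a b : Fin D) (x : Pt D) :
    Config.conn { c with Γ := c.Γ + t • δΓ } a b x = c.conn a b x + t • form1 (δΓ a b x) := by
  simp only [conn, Pi.add_apply, Pi.smul_apply, form1_add, form1_smul]

/-- Nonmetricity and torsion are affine and the curvature is quadratic in the connection, so the
expansion stops at `t²`. The `t²` term does not contribute to the derivative at `0`. -/
theorem geom_connection (hU : IsOpen U) (hc : c.IsRegularOn U) (hx : x ∈ U)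
    (hδ : ∀ a b, ContDiff ℝ (⊤ : ℕ∞) (δΓ a b)) (t : ℝ) :
    Config.geom { c with Γ := c.Γ + t • δΓ } x
      = { g := (c.geom x).g
          θ := (c.geom x).θ
          Q := fun a b => (c.geom x).Q a b + t • c.varQ δΓ a b x
          T := fun a => (c.geom x).T a + t • c.varT δΓ a x
          R := fun a b => (c.geom x).R a b + t • c.varR δΓ a b x
            + t ^ 2 • ∑ d, form1 (δΓ d b x) * form1 (δΓ a d x) } := by
  have h1 : ∀ a b, DiffForm (c.conn a b) x := fun a b => (hc.smooth_conn a b).diffForm hU hx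
  have h2 : ∀ a b, DiffForm (fun y => form1 (δΓ a b y)) x := fun a b =>
    .form1 ((hδ a b).differentiable (by simp) x)
  have h3 : ∀ a b, extd (Config.conn { c with Γ := c.Γ + t • δΓ } a b) x
      = extd (c.conn a b) x + t • extd (fun y => form1 (δΓ a b y)) x := fun a b => by
    rw [← extd_const_smul, ← extd_add (h1 a b) (.smul (differentiableAt_const t) (h2 a b))]
    congr 1
    ext1 y
    exact conn_add t a b y
  have hQ : Config.nonmetricity { c with Γ := c.Γ + t • δΓ }
      = fun a b x => c.nonmetricity a b x + t • c.varQ δΓ a b x := by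
    ext a b x : 3
    simp only [nonmetricity, DLL, varQ, conn_add, form0_eq_smul, mul_smul_comm, mul_one, smul_add,
      Finset.sum_add_distrib, Finset.smul_sum, smul_smul, mul_comm t]
    abel
  have hT : Config.torsion { c with Γ := c.Γ + t • δΓ }
      = fun a x => c.torsion a x + t • c.varT δΓ a x := by
    ext a x : 2
    simp only [torsion, DU, varT, conn_add, add_mul, smul_mul_assoc,
      Finset.sum_add_distrib, Finset.smul_sum]
    abel
  have hR : ∀ a b, Config.curvature { c with Γ := c.Γ + t • δΓ } a b x = c.curvature a b x
      + t • c.varR δΓ a b x + t ^ 2 • ∑ d, form1 (δΓ d b x) * form1 (δΓ a d x) := by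
    intro a b
    rw [curvature, h3]
    simp only [curvature, varR, conn_add, add_mul, mul_add, smul_mul_assoc, mul_smul_comm,
      Finset.sum_add_distrib, Finset.smul_sum, smul_smul, smul_add, pow_two]
    abel
  rw [geom]
  simp only [hQ, hT, hR]
  rfl

theorem deg_varQ (a b : Fin D) (x : Pt D) : Deg 1 (c.varQ δΓ a b x) :=
  .add (.sum fun _ => (Deg.form1 _).smul _) (.sum fun _ => (Deg.form1 _).smul _)

theorem deg_varT (a : Fin D) (x : Pt D) : Deg 2 (c.varT δΓ a x) :=
  .sum fun _ => ((Deg.form1 _).mul (Deg.form1 _)).cast (by norm_num)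

theorem deg_varR (a b : Fin D) (x : Pt D) : Deg 2 (c.varR δΓ a b x) :=
  .add ((Deg.extd (.of_forall fun y => Deg.form1 _)).cast (by norm_num)) (.sum fun d =>
    .add (((Deg.form1 _).mul (Deg.form1 _)).cast (by norm_num))
      (((Deg.form1 _).mul (Deg.form1 _)).cast (by norm_num)))

theorem varQ_comm (hc : c.IsRegularOn U) (hx : x ∈ U) (a b : Fin D) :
    c.varQ δΓ a b x = c.varQ δΓ b a x := by
  have h1 : ∀ a b, c.g x a b = c.g x b a := fun a b => (hc.symm_g x hx).apply b a
  rw [varQ, varQ, add_comm]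
  simp only [h1 b, h1 a]

theorem regular_connection (hU : IsOpen U) (hc : c.IsRegularOn U) (hx : x ∈ U)
    (hδ : ∀ a b, ContDiff ℝ (⊤ : ℕ∞) (δΓ a b)) (t : ℝ) :
    (Config.geom { c with Γ := c.Γ + t • δΓ } x).Regular := by
  have hr := (hc.smoothGeom hU).geom_regular x hx
  rw [geom_connection hU hc hx hδ]
  refine ⟨hr.toRegular, ?_, fun a b => (hr.degQ a b).add ((deg_varQ a b x).smul t), fun a =>
    (hr.degT a).add ((deg_varT a x).smul t), fun a b => ((hr.degR a b).add
      ((deg_varR a b x).smul t)).add (.smul _ (.sum fun d =>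
        ((Deg.form1 _).mul (Deg.form1 _)).cast (by norm_num)))⟩
  ext a b : 2
  have : (c.geom x).Q b a = (c.geom x).Q a b := congrFun₂ hr.tpQ a b
  simp only [Frame.tp_apply, this, varQ_comm hc hx b a]

theorem IsRegularOn.smoothGeom_connection (hU : IsOpen U) (hc : c.IsRegularOn U)
    (hδ : ∀ a b, ContDiff ℝ (⊤ : ℕ∞) (δΓ a b)) :
    SmoothGeom {q : ℝ × Pt D | q.2 ∈ U}
      fun q => Config.geom { c with Γ := c.Γ + q.1 • δΓ } q.2 := by
  have hs : ∀ q ∈ {q : ℝ × Pt D | q.2 ∈ U}, q.2 ∈ U := fun q hq => hq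
  have hg := hc.smoothGeom hU
  have hδ' : ∀ a b, SmoothForm U fun y => form1 (δΓ a b y) := fun a b =>
    .form1 fun μ => (contDiff_pi.1 (hδ a b) μ).contDiffOn
  have hQ : ∀ a b, SmoothForm U (c.varQ δΓ a b) := fun a b =>
    .add (.sum fun d => .smul (hc.smooth_g d b) (hδ' a d))
      (.sum fun d => .smul (hc.smooth_g a d) (hδ' b d))
  have hT : ∀ a, SmoothForm U (c.varT δΓ a) := fun a =>
    .sum fun d => (hδ' d a).mul (hc.smoothFrame.cof d)
  have hR : ∀ a b, SmoothForm U (c.varR δΓ a b) := fun a b =>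
    .add ((hδ' a b).extd hU) (.sum fun d => .add ((hδ' d b).mul (hc.smooth_conn a d))
      ((hc.smooth_conn d b).mul (hδ' a d)))
  have hR' : ∀ a b, SmoothForm U fun x => ∑ d, form1 (δΓ d b x) * form1 (δΓ a d x) := fun a b =>
    .sum fun d => (hδ' d b).mul (hδ' a d)
  have e := fun (q : ℝ × Pt D) (hq : q.2 ∈ U) => geom_connection hU hc hq hδ q.1
  refine ⟨⟨fun a b => (hc.smooth_g a b).comp contDiffOn_snd hs, fun a μ =>
    (contDiffOn_pi.1 (hc.smooth_θ a) μ).comp contDiffOn_snd hs, fun q hq =>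
    (regular_connection hU hc hq hδ q.1).toRegular⟩, fun a b => ?_, fun a => ?_, fun a b => ?_,
    fun q hq => regular_connection hU hc hq hδ q.1⟩
  · exact (((hg.smooth_Q a b).comp_snd hs).add (.smul contDiffOn_fst ((hQ a b).comp_snd hs))).congr
      fun q hq => by rw [e q hq]
  · exact (((hg.smooth_T a).comp_snd hs).add (.smul contDiffOn_fst ((hT a).comp_snd hs))).congr
      fun q hq => by rw [e q hq]
  · exact ((((hg.smooth_R a b).comp_snd hs).add (.smul contDiffOn_fst ((hR a b).comp_snd hs))).add
      (.smul (contDiffOn_fst.pow 2) ((hR' a b).comp_snd hs))).congr fun q hq => by rw [e q hq]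

theorem hasVelocity_connection (hU : IsOpen U) (hc : c.IsRegularOn U) (hx : x ∈ U)
    (hδ : ∀ a b, ContDiff ℝ (⊤ : ℕ∞) (δΓ a b)) :
    HasVelocity (fun t => Config.geom { c with Γ := c.Γ + t • δΓ } x) (c.geom x) 0
      (fun a b => c.varQ δΓ a b x) (fun a => c.varT δΓ a x) fun a b => c.varR δΓ a b x := by
  have hreg := regular_connection hU hc hx hδ
  have h1 : ∀ α : Form D, HasDerivForm (fun t : ℝ => t • α) α 0 := fun α => by
    simpa using HasDerivForm.smul_const (hasDerivAt_id (0 : ℝ)) α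
  have h2 : ∀ α : Form D, HasDerivForm (fun t : ℝ => t ^ 2 • α) 0 0 := fun α => by
    simpa using HasDerivForm.smul_const (hasDerivAt_pow 2 (0 : ℝ)) α
  simp only [geom_connection hU hc hx hδ] at hreg ⊢
  refine ⟨?_, .of_forall hreg, fun _ => rfl, fun a μ => hasDerivAt_const _ _, fun a b => ?_,
    fun a => ?_, fun a b => ?_⟩
  · simp
  · simpa using (HasDerivForm.const ((c.geom x).Q a b) 0).add (h1 (c.varQ δΓ a b x))
  · simpa using (HasDerivForm.const ((c.geom x).T a) 0).add (h1 (c.varT δΓ a x))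
  · simpa using ((HasDerivForm.const ((c.geom x).R a b) 0).add (h1 (c.varR δΓ a b x))).add (h2 _)

end Config

/-- `δQ`, `δT` and `δR` are paired with `-½M`, `-H` and the curvature momentum with a minus sign.
The first two are algebraic in `δΓ`; the third is the covariant derivative of `δΓ` and is integrated
by parts. -/
theorem Concomitant.hasConnectionVariation {L : Geom D → Form D}
    {M : Geom D → Fin D → Fin D → Form D} {H : Geom D → Fin D → Form D}
    {HH : Geom D → Fin D → Fin D → Form D} (hL : Concomitant D L)
    (hM : ∀ a b, Concomitant (D - 1) fun G => M G a b) (hH : ∀ a, Concomitant (D - 2) fun G => H G a)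
    (hHH : ∀ a b, Concomitant (D - 2) fun G => HH G a b)
    (hm : ∀ G : Geom D, G.Regular → HasMomenta L G (M G) (H G) (HH G)) (hD : 1 ≤ D)
    {U : Set (Pt D)} (hU : IsOpen U) {c : Config D} (hc : c.IsRegularOn U) :
    HasConnectionVariation U (fun K c' => integral K fun x => L (c'.geom x)) c fun a b x =>
      -(c.geom x).low2 (M (c.geom x)) a b - (c.geom x).cof a * H (c.geom x) b
        - c.DUL (fun a b x => HH (c.geom x) a b) a b x := by
  have hg := hc.smoothGeom hU
  have hHH' : ∀ a b, SmoothForm U fun x => HH (c.geom x) a b := fun a b => (hHH a b).smooth hg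
  have hX : ∀ a b, SmoothForm U fun x =>
      -(c.geom x).low2 (M (c.geom x)) a b - (c.geom x).cof a * H (c.geom x) b
        - c.DUL (fun a b x => HH (c.geom x) a b) a b x := fun a b =>
    .sub (.sub (.neg ((Concomitant.low2 hM a b).smooth hg))
      ((hc.smoothFrame.cof a).mul ((hH b).smooth hg)))
      (.sub (.add ((hHH' a b).extd hU) (.sum fun d => (hc.smooth_conn d a).mul (hHH' d b)))
        (.sum fun d => (hc.smooth_conn b d).mul (hHH' a d)))
  refine ⟨fun a b => (hX a b).contForm, fun a b x hx => isForm_iff_deg.2 ?_, ?_⟩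
  · have hr := hg.geom_regular
    refine Deg.cast (r := D - 1) (.sub (.sub (.neg ((Concomitant.low2 hM a b).deg _ (hr x hx)))
      (((Frame.deg_cof _ a).mul ((hH b).deg _ (hr x hx))).cast (by ring)))
      (.sub (.add ?_ (.sum fun d => ?_)) (.sum fun d => ?_)))
      (by rw [Nat.cast_sub hD]; norm_num)
    · refine (Deg.extd (r := D - 2) ?_).cast (by ring)
      filter_upwards [hU.mem_nhds hx] with y hy using (hHH a b).deg _ (hr y hy)
    · exact ((Deg.form1 _).mul ((hHH d b).deg _ (hr x hx))).cast (by ring)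
    · exact ((Deg.form1 _).mul ((hHH a d).deg _ (hr x hx))).cast (by ring)
  · intro K hK hKU δΓ hδ hsupp
    refine (hL.hasDerivAt_integral hm (hU.preimage continuous_snd) hK (fun x hx => hKU hx)
      (hc.smoothGeom_connection hU hδ) (fun x hx => hg.geom_regular x (hKU hx))
      (δθ := 0) (fun x hx => Config.hasVelocity_connection hU hc (hKU hx) hδ)
      (fun x _ a b => Config.deg_varQ a b x) (fun x hx => Config.varQ_comm hc (hKU hx))
      (fun x _ a => Config.deg_varT a x) fun x _ a b => Config.deg_varR a b x).congr_deriv ?_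
    refine setIntegral_eq_of_by_parts hU hK hKU (ι := Fin D × Fin D) (ω := fun i => δΓ i.1 i.2)
      (α := fun i x => HH (c.geom x) i.1 i.2) (fun i => hδ i.1 i.2) (fun i => hsupp i.1 i.2)
      (fun i => hHH' i.1 i.2) (.sum fun a => .sum fun b => .mul
        (.form1 fun μ => (contDiff_pi.1 (hδ a b) μ).contDiffOn) (hX a b)) fun x hx => ?_
    have hs := (hm _ (hg.geom_regular x (hKU hx))).symmM
    -- The two terms of `δQ_{ab}` contribute equally because `M^{ab}` is symmetric, which removes
    -- the factor `½`.
    have e1 : ∑ a, ∑ b, c.varQ δΓ a b x * (-(1 / 2 : ℝ)) • M (c.geom x) a b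
        = -∑ a, ∑ b, form1 (δΓ a b x) * (c.geom x).low2 (M (c.geom x)) a b := by
      have t1 : ∑ a, ∑ b, (∑ d, c.g x d b • form1 (δΓ a d x)) * M (c.geom x) a b
          = ∑ a, ∑ b, form1 (δΓ a b x) * (c.geom x).low2 (M (c.geom x)) a b := by
        simp only [Frame.low2, Finset.sum_mul, Finset.mul_sum, smul_mul_assoc, mul_smul_comm]
        refine Finset.sum_congr rfl fun a _ => ?_
        rw [Finset.sum_comm]
        refine Finset.sum_congr rfl fun b _ => Finset.sum_congr rfl fun d _ => ?_
        rw [show c.g x b d = (c.geom x).g d b from (hc.symm_g x (hKU hx)).apply d b]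
      have t2 : ∑ a, ∑ b, (∑ d, c.g x a d • form1 (δΓ b d x)) * M (c.geom x) a b
          = ∑ a, ∑ b, form1 (δΓ a b x) * (c.geom x).low2 (M (c.geom x)) a b := by
        rw [← t1, Finset.sum_comm]
        refine Finset.sum_congr rfl fun a _ => Finset.sum_congr rfl fun b _ => ?_
        rw [hs b a]
        simp only [(hc.symm_g x (hKU hx)).apply b]
      simp only [Config.varQ, mul_smul_comm, add_mul, smul_add, Finset.sum_add_distrib,
        ← Finset.smul_sum, t1, t2]
      module
    have e2 : ∑ a, c.varT δΓ a x * -H (c.geom x) a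
        = -∑ a, ∑ b, form1 (δΓ a b x) * ((c.geom x).cof a * H (c.geom x) b) := by
      simp only [Config.varT, Finset.sum_mul, mul_neg, mul_assoc, Finset.sum_neg_distrib]
      congr 1
      exact Finset.sum_comm
    have e3 : ∑ a, ∑ b, (∑ d, form1 (δΓ d b x) * c.conn a d x) * HH (c.geom x) a b
        = ∑ a, ∑ b, form1 (δΓ a b x) * ∑ d, c.conn d a x * HH (c.geom x) d b := by
      simp only [Finset.sum_mul, Finset.mul_sum, mul_assoc]
      have : ∀ a, ∑ b, ∑ d, form1 (δΓ d b x) * (c.conn a d x * HH (c.geom x) a b)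
          = ∑ d, ∑ b, form1 (δΓ d b x) * (c.conn a d x * HH (c.geom x) a b) := fun a =>
        Finset.sum_comm
      simp only [this]
      rw [Finset.sum_comm]
      exact Finset.sum_congr rfl fun a _ => Finset.sum_comm
    -- In this half of `δR` the connection form stands first; exchanging it with `δΓ` gives the
    -- minus sign of the lower-index term in `Dα^a{}_b`. In the other half, `e3`, the order is
    -- already right.
    have e4 : ∑ a, ∑ b, (∑ d, c.conn d b x * form1 (δΓ a d x)) * HH (c.geom x) a b
        = -∑ a, ∑ b, form1 (δΓ a b x) * ∑ d, c.conn b d x * HH (c.geom x) a d := by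
      simp only [Finset.sum_mul, Finset.mul_sum, mul_assoc, ← Finset.sum_neg_distrib]
      refine Finset.sum_congr rfl fun a _ => ?_
      rw [Finset.sum_comm]
      exact Finset.sum_congr rfl fun b _ => Finset.sum_congr rfl fun d _ =>
        form1_mul_form1_mul _ _ _
    have e5 := congrArg top e3
    have e6 := congrArg top e4
    rw [e1, e2]
    simp only [Pi.zero_apply, form1_zero, zero_mul, Finset.sum_const_zero, top_zero, zero_add,
      Config.varR, Config.DUL, Fintype.sum_prod_type, mul_sub, mul_add, mul_neg, add_mul,
      Finset.sum_add_distrib, Finset.sum_sub_distrib, Finset.sum_neg_distrib,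
      top_add, top_sub, top_neg] at e5 e6 ⊢
    simp only [top_sum] at e5 e6 ⊢
    linarith

end MAG
end

/-! ### Existence and uniqueness of variational derivatives, and the gravitational action. -/

noncomputable section

namespace MAG

variable {D : ℕ}

open MeasureTheory Filter Topology

/-! ### Variational derivatives -/

section Variation

variable {U K : Set (Pt D)} {α β : Pt D → Form D}

theorem ContForm.add (hα : ContForm U α) (hβ : ContForm U β) : ContForm U fun x => α x + β x :=
  fun I => by simpa only [coeff_add] using (hα I).fun_add (hβ I)

theorem ContForm.congr (hα : ContForm U α) (h : ∀ x ∈ U, β x = α x) : ContForm U β :=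
  fun I => (hα I).congr fun x hx => by rw [h x hx]

/-- Continuity of coefficients is all that is assumed of matter currents; it suffices for
integrability over compact sets and for passing from almost everywhere to everywhere. -/
theorem ContForm.continuousOn_top_mul (hα : ContForm U α) {ω : Pt D → Cov D}
    (hω : Continuous ω) : ContinuousOn (fun x => top (form1 (ω x) * α x)) U := by
  have : (fun x => top (form1 (ω x) * α x))
      = fun x => ∑ μ, ∑ I, ω x μ * (coeff I (α x) * top (dx μ * dxBasis I)) := by
    ext1 x
    conv_lhs => rw [form1_eq_sum, ← sum_coeff (α x)]
    simp only [Finset.sum_mul, Finset.mul_sum, top_sum, smul_mul_assoc, mul_smul_comm, top_smul]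
    rw [Finset.sum_comm]
    simp only [mul_left_comm]
  rw [this]
  exact continuousOn_finsetSum _ fun μ _ => continuousOn_finsetSum _ fun I _ =>
    ((continuous_pi_iff.1 hω μ).continuousOn).mul ((hα I).mul continuousOn_const)

theorem integral_sum_form1_mul {ι : Type*} [Fintype ι] (hK : IsCompact K) (hKU : K ⊆ U)
    {ω : ι → Pt D → Cov D} {α : ι → Pt D → Form D} (hω : ∀ i, Continuous (ω i))
    (hα : ∀ i, ContForm U (α i)) : integral K (fun x => ∑ i, form1 (ω i x) * α i x)
      = ∑ i, ∫ x in K, top (form1 (ω i x) * α i x) := by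
  simp only [integral, top_sum]
  exact integral_finsetSum _ fun i _ =>
    (((hα i).continuousOn_top_mul (hω i)).mono hKU).integrableOn_compact hK

theorem integral_sum_form1_mul_add {ι : Type*} [Fintype ι] (hK : IsCompact K) (hKU : K ⊆ U)
    {ω : ι → Pt D → Cov D} {α β : ι → Pt D → Form D} (hω : ∀ i, Continuous (ω i))
    (hα : ∀ i, ContForm U (α i)) (hβ : ∀ i, ContForm U (β i)) :
    integral K (fun x => ∑ i, form1 (ω i x) * (α i x + β i x))
      = integral K (fun x => ∑ i, form1 (ω i x) * α i x)
        + integral K fun x => ∑ i, form1 (ω i x) * β i x := by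
  rw [integral_sum_form1_mul hK hKU hω hα, integral_sum_form1_mul hK hKU hω hβ,
    integral_sum_form1_mul hK hKU hω fun i => (hα i).add (hβ i), ← Finset.sum_add_distrib]
  refine Finset.sum_congr rfl fun i _ => ?_
  simp only [mul_add, top_add]
  exact integral_add ((((hα i).continuousOn_top_mul (hω i)).mono hKU).integrableOn_compact hK)
    ((((hβ i).continuousOn_top_mul (hω i)).mono hKU).integrableOn_compact hK)

/-- The exterior product with 1-forms separates `(D-1)`-forms. -/
theorem Deg.eq_zero_of_top_dx_mul {γ : Form D} (h : Deg (D - 1) γ)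
    (h0 : ∀ μ, top (dx μ * γ) = 0) : γ = 0 := by
  have h1 : ∀ μ, dx μ * γ = 0 := fun μ => by
    have : Deg D (dx μ * γ) := ((Deg.form1 _).mul h).cast (by ring)
    rw [this.smul_eq_top, h0, zero_smul]
  have h2 : ∑ μ, MAG.interior (pd μ) (dx μ * γ) = (D : ℝ) • γ - euler γ := by
    simp only [dx, interior_form1_mul, pd_apply, Pi.single_eq_same, one_smul,
      Finset.sum_sub_distrib, euler, derivation, LinearMap.id_apply]
    simp [← Nat.cast_smul_eq_nsmul ℝ]
  have h3 : euler γ = ((D : ℝ) - 1) • γ := h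
  simp only [h1, interior_zero, Finset.sum_const_zero, h3] at h2
  rw [← sub_smul, sub_sub_cancel, one_smul] at h2
  exact h2.symm

/-- The fundamental lemma of the calculus of variations. -/
theorem eq_of_integral_form1_mul_eq (hU : IsOpen U) {ι : Type*} [Fintype ι] [DecidableEq ι]
    {α β : ι → Pt D → Form D} (hα : ∀ i, ContForm U (α i)) (hβ : ∀ i, ContForm U (β i))
    (dα : ∀ i, ∀ x ∈ U, Deg (D - 1) (α i x)) (dβ : ∀ i, ∀ x ∈ U, Deg (D - 1) (β i x))
    (h : ∀ K, IsCompact K → K ⊆ U → ∀ ω : ι → Pt D → Cov D,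
      (∀ i, ContDiff ℝ (⊤ : ℕ∞) (ω i)) → (∀ i, tsupport (ω i) ⊆ K) →
      integral K (fun x => ∑ i, form1 (ω i x) * α i x)
        = integral K fun x => ∑ i, form1 (ω i x) * β i x) (i : ι) :
    ∀ x ∈ U, α i x = β i x := by
  have key : ∀ μ, Set.EqOn (fun x => top (dx μ * α i x)) (fun x => top (dx μ * β i x)) U := by
    intro μ
    have cα : ContinuousOn (fun x => top (dx μ * α i x)) U :=
      (hα i).continuousOn_top_mul continuous_const
    have cβ : ContinuousOn (fun x => top (dx μ * β i x)) U :=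
      (hβ i).continuousOn_top_mul continuous_const
    -- The scalar fundamental lemma gives equality almost everywhere, and continuity on the open set
    -- `U` then gives equality at every point.
    have hz := hU.ae_eq_zero_of_integral_contDiff_smul_eq_zero (μ := volume)
      ((cα.sub cβ).locallyIntegrableOn hU.measurableSet) ?_
    · refine Measure.eqOn_open_of_ae_eq ?_ hU cα cβ (μ := volume)
      refine (ae_restrict_iff' hU.measurableSet).2 ?_
      filter_upwards [hz] with x hx hxU using sub_eq_zero.1 (hx hxU)
    · intro φ hφ hφc hφU
      -- The test variation is `φ dx^μ` in the slot `i` alone, so it isolates one component of one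
      -- form; `tsupport φ` itself serves as the compact set.
      set ω : ι → Pt D → Cov D := Function.update 0 i fun x => φ x • Pi.single μ 1 with hω
      have ωi : ω i = fun x => φ x • Pi.single μ 1 := by simp [hω]
      have ωj : ∀ j, j ≠ i → ω j = 0 := fun j hj => by simp [hω, hj]
      have h1 : ∀ j, ContDiff ℝ (⊤ : ℕ∞) (ω j) := fun j => by
        by_cases hj : j = i
        · subst hj; rw [ωi]; exact hφ.smul (contDiff_const (c := (Pi.single μ 1 : Cov D)))
        · rw [ωj j hj]; exact contDiff_const
      have h2 : ∀ j, tsupport (ω j) ⊆ tsupport φ := fun j => by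
        by_cases hj : j = i
        · subst hj; rw [ωi]; exact tsupport_smul_subset_left φ fun _ => (Pi.single μ 1 : Cov D)
        · rw [ωj j hj, tsupport_zero]; exact Set.empty_subset _
      have h3 : ∀ γ : ι → Pt D → Form D, integral (tsupport φ)
          (fun x => ∑ j, form1 (ω j x) * γ j x) = ∫ x in tsupport φ, φ x * top (dx μ * γ i x) := by
        intro γ
        refine congrArg (fun f : Pt D → ℝ => ∫ x in tsupport φ, f x) (funext fun x => ?_)
        beta_reduce
        rw [Finset.sum_eq_single i (fun j _ hj => by simp [ωj j hj]) (by simp), ωi, form1_smul,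
          smul_mul_assoc, top_smul]
        rfl
      have h4 := h _ hφc hφU ω h1 h2
      rw [h3, h3] at h4
      have h5 : ∀ f : Pt D → ℝ, ContinuousOn f U → IntegrableOn (fun x => φ x * f x) (tsupport φ) :=
        fun f hf => (hφ.continuous.continuousOn.mul (hf.mono hφU)).integrableOn_compact hφc
      rw [← setIntegral_eq_integral_of_forall_compl_eq_zero (s := tsupport φ)
        fun x hx => by rw [image_eq_zero_of_notMem_tsupport hx, zero_smul]]
      simp only [smul_eq_mul, Pi.sub_apply, mul_sub]
      rw [integral_sub (h5 _ cα) (h5 _ cβ), h4, sub_self]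
  intro x hx
  refine sub_eq_zero.1 (((dα i x hx).sub (dβ i x hx)).eq_zero_of_top_dx_mul fun μ => ?_)
  rw [mul_sub, top_sub, sub_eq_zero]
  exact key μ hx

theorem deg_of_isForm (hD : 1 ≤ D) {γ : Form D} (h : IsForm (D - 1) γ) : Deg (D - 1) γ :=
  (isForm_iff_deg.1 h).cast (by rw [Nat.cast_sub hD]; norm_num)

end Variation

section Coframe

variable {U : Set (Pt D)} {S S' : Action D} {c : Config D} {X Y : Fin D → Pt D → Form D}

theorem HasCoframeVariation.add (hX : HasCoframeVariation U S c X)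
    (hY : HasCoframeVariation U S' c Y) :
    HasCoframeVariation U (fun K c' => S K c' + S' K c') c fun a x => X a x + Y a x where
  cont a := (hX.cont a).add (hY.cont a)
  deg a x hx := Submodule.add_mem _ (hX.deg a x hx) (hY.deg a x hx)
  deriv K hK hKU δθ hδ hs := by
    rw [integral_sum_form1_mul_add hK hKU (fun a => (hδ a).continuous) hX.cont hY.cont]
    exact (hX.deriv K hK hKU δθ hδ hs).fun_add (hY.deriv K hK hKU δθ hδ hs)

theorem HasCoframeVariation.congr (hX : HasCoframeVariation U S c X)
    (h : ∀ x ∈ U, ∀ a, Y a x = X a x) : HasCoframeVariation U S c Y where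
  cont a := (hX.cont a).congr fun x hx => h x hx a
  deg a x hx := by rw [h x hx]; exact hX.deg a x hx
  deriv K hK hKU δθ hδ hs := by
    refine (hX.deriv K hK hKU δθ hδ hs).congr_deriv
      (setIntegral_congr_fun hK.measurableSet fun x hx => ?_)
    simp only [h x (hKU hx)]

theorem HasCoframeVariation.unique (hD : 1 ≤ D) (hU : IsOpen U) (hX : HasCoframeVariation U S c X)
    (hY : HasCoframeVariation U S c Y) : ∀ x ∈ U, ∀ a, X a x = Y a x := fun x hx a =>
  eq_of_integral_form1_mul_eq hU hX.cont hY.cont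
    (fun a x hx => deg_of_isForm hD (hX.deg a x hx))
    (fun a x hx => deg_of_isForm hD (hY.deg a x hx))
    (fun K hK hKU ω hω hs => (hX.deriv K hK hKU ω hω hs).unique (hY.deriv K hK hKU ω hω hs)) a x hx

end Coframe

section Connection

variable {U : Set (Pt D)} {S S' : Action D} {c : Config D} {X Y : Fin D → Fin D → Pt D → Form D}

theorem HasConnectionVariation.add (hX : HasConnectionVariation U S c X)
    (hY : HasConnectionVariation U S' c Y) :
    HasConnectionVariation U (fun K c' => S K c' + S' K c') c fun a b x => X a b x + Y a b x where
  cont a b := (hX.cont a b).add (hY.cont a b)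
  deg a b x hx := Submodule.add_mem _ (hX.deg a b x hx) (hY.deg a b x hx)
  deriv K hK hKU δΓ hδ hs := by
    have h := integral_sum_form1_mul_add (ι := Fin D × Fin D) hK hKU
      (fun i => (hδ i.1 i.2).continuous) (fun i => hX.cont i.1 i.2) fun i => hY.cont i.1 i.2
    simp only [Fintype.sum_prod_type] at h
    rw [h]
    exact (hX.deriv K hK hKU δΓ hδ hs).fun_add (hY.deriv K hK hKU δΓ hδ hs)

theorem HasConnectionVariation.congr (hX : HasConnectionVariation U S c X)
    (h : ∀ x ∈ U, ∀ a b, Y a b x = X a b x) : HasConnectionVariation U S c Y where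
  cont a b := (hX.cont a b).congr fun x hx => h x hx a b
  deg a b x hx := by rw [h x hx]; exact hX.deg a b x hx
  deriv K hK hKU δΓ hδ hs := by
    refine (hX.deriv K hK hKU δΓ hδ hs).congr_deriv
      (setIntegral_congr_fun hK.measurableSet fun x hx => ?_)
    simp only [h x (hKU hx)]

theorem HasConnectionVariation.unique (hD : 1 ≤ D) (hU : IsOpen U)
    (hX : HasConnectionVariation U S c X) (hY : HasConnectionVariation U S c Y) :
    ∀ x ∈ U, ∀ a b, X a b x = Y a b x := fun x hx a b =>
  eq_of_integral_form1_mul_eq hU (ι := Fin D × Fin D) (α := fun i => X i.1 i.2)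
    (β := fun i => Y i.1 i.2) (fun i => hX.cont i.1 i.2) (fun i => hY.cont i.1 i.2)
    (fun i x hx => deg_of_isForm hD (hX.deg i.1 i.2 x hx))
    (fun i x hx => deg_of_isForm hD (hY.deg i.1 i.2 x hx))
    (fun K hK hKU ω hω hs => by
      simp only [Fintype.sum_prod_type]
      exact (hX.deriv K hK hKU (fun a b => ω (a, b)) (fun a b => hω (a, b))
        fun a b => hs (a, b)).unique (hY.deriv K hK hKU (fun a b => ω (a, b))
          (fun a b => hω (a, b)) fun a b => hs (a, b))) (a, b) x hx

end Connection

/-! ### The variations of the gravitational action -/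

namespace Params

variable (p : Params)

theorem hasMomenta_LMAG (hD : 3 ≤ D) {G : Geom D} (h : G.Regular) :
    HasMomenta p.LMAG G (fun a b => (2 / p.κ) • p.m G a b) (fun a => (1 / p.κ) • p.h1 G a)
      (fun a b => (-(1 / (2 * p.κ)) * p.a0) • G.star (G.cof a * G.cofL b)
        + (1 / p.ρ) • p.h2 G a b) :=
  p.hasMomenta h hD (fun a b => (Concomitant.m p a b).deg G h)
    (fun a => (Concomitant.h1 p a).deg G h) fun a b => (Concomitant.h2 p a b).deg G h

theorem concomitant_star_cof_mul_cofL (a b : Fin D) :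
    Concomitant (D - 2) fun G : Geom D => G.star (G.cof a * G.cofL b) :=
  (((Concomitant.cof a).mul (Concomitant.cofL b)).star).cast

variable {U : Set (Pt D)} {c : Config D}

theorem gravAction_coframe (hD : 3 ≤ D) (hκ : p.κ ≠ 0) (hU : IsOpen U)
    (hc : c.IsRegularOn U) :
    HasCoframeVariation U (gravAction p) c fun a x => (1 / p.κ) • coframeRHS p c a x := by
  refine (Concomitant.hasCoframeVariation (Concomitant.LMAG p)
    (fun a b => (Concomitant.m p a b).smul (2 / p.κ)) (fun a => (Concomitant.h1 p a).smul (1 / p.κ))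
    (fun a b => ((concomitant_star_cof_mul_cofL a b).smul (-(1 / (2 * p.κ)) * p.a0)).add
      ((Concomitant.h2 p a b).smul (1 / p.ρ)))
    (fun G h => p.hasMomenta_LMAG hD h) (by omega) hU hc).congr fun x hx a => ?_
  have h1 := p.smul_coframeDerivative hκ ((hc.smoothGeom hU).geom_regular x hx) a
  rw [coframeRHS, ← h1, smul_sub, smul_smul, one_div_mul_cancel hκ, one_smul]
  congr 1
  simp only [Config.DL, extd_const_smul, mul_smul_comm, ← Finset.smul_sum, ← smul_sub]

/-- The covariant derivative of the momentum splits into an Einstein–Hilbert part, evaluated by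
`DUL_star_cof_mul_cofL`, and the part with `h^a{}_b`. The minus in front of the derivative and the
coefficient `-a_0/2κ` produce the printed sign. -/
theorem gravAction_connection (hD : 3 ≤ D) (hκ : p.κ ≠ 0) (hρ : p.ρ ≠ 0) (hU : IsOpen U)
    (hc : c.IsRegularOn U) : HasConnectionVariation U (gravAction p) c fun a b x =>
      (1 / p.κ) • connectionRHS p c a b x := by
  refine (Concomitant.hasConnectionVariation (Concomitant.LMAG p)
    (fun a b => (Concomitant.m p a b).smul (2 / p.κ)) (fun a => (Concomitant.h1 p a).smul (1 / p.κ))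
    (fun a b => ((concomitant_star_cof_mul_cofL a b).smul (-(1 / (2 * p.κ)) * p.a0)).add
      ((Concomitant.h2 p a b).smul (1 / p.ρ)))
    (fun G h => p.hasMomenta_LMAG hD h) (by omega) hU hc).congr fun x hx a b => ?_
  have hg := hc.smoothGeom hU
  have d1 : DiffForm (fun y => (-(1 / (2 * p.κ)) * p.a0) •
      (c.geom y).star ((c.geom y).cof a * (c.geom y).cofL b)) x :=
    .smul (differentiableAt_const _)
      (((concomitant_star_cof_mul_cofL a b).smooth hg).diffForm hU hx)
  have d2 : DiffForm (fun y => (1 / p.ρ) • p.h2 (c.geom y) a b) x :=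
    .smul (differentiableAt_const _) (((Concomitant.h2 p a b).smooth hg).diffForm hU hx)
  have h1 : c.DUL (fun a b y => (-(1 / (2 * p.κ)) * p.a0) •
        (c.geom y).star ((c.geom y).cof a * (c.geom y).cofL b)
          + (1 / p.ρ) • p.h2 (c.geom y) a b) a b x
      = (-(1 / (2 * p.κ)) * p.a0) • c.DUL (fun a b y =>
          (c.geom y).star ((c.geom y).cof a * (c.geom y).cofL b)) a b x
        + (1 / p.ρ) • c.DUL (fun a b y => p.h2 (c.geom y) a b) a b x := by
    simp only [Config.DUL, extd_add d1 d2, extd_const_smul, mul_add, mul_smul_comm,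
      Finset.sum_add_distrib, ← Finset.smul_sum]
    module
  have h2 : (c.geom x).low2 (fun a b => (2 / p.κ) • p.m (c.geom x) a b) a b
      = (2 / p.κ) • (c.geom x).low2 (p.m (c.geom x)) a b := by
    simp only [Frame.low2, Finset.smul_sum]
    exact Finset.sum_congr rfl fun d _ => smul_comm _ _ _
  rw [h1, h2, Config.DUL_star_cof_mul_cofL hU hc hx, connectionRHS, mul_smul_comm]
  match_scalars <;> field_simp

end Params

end MAG
end

theorem theorem1 {D : ℕ} (hD : 3 ≤ D) (p : MAG.Params) (hκ : p.κ ≠ 0) (hρ : p.ρ ≠ 0)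
    {U : Set (MAG.Pt D)} (hU : IsOpen U) (c : MAG.Config D) (hc : c.IsRegularOn U)
    {Matter : Type*} (Ψ : Matter) (Smatt : Set (MAG.Pt D) → MAG.Config D → Matter → ℝ) :
    -- the gravitational momenta `M^{ab}`, `H_a`, `H^a_b` in terms of `m^{ab}`, `h_a`, `h^a_b`
    (∀ x ∈ U, MAG.HasMomenta p.LMAG (c.geom x)
      (fun a b => (2 / p.κ) • p.m (c.geom x) a b)
      (fun a => (1 / p.κ) • p.h1 (c.geom x) a)
      (fun a b => (-(1 / (2 * p.κ)) * p.a0) •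
          (c.geom x).star ((c.geom x).cof a * (c.geom x).cofL b)
        + (1 / p.ρ) • p.h2 (c.geom x) a b)) ∧
    -- the coframe variation; `EM` is the canonical energy-momentum current of the matter
    (∀ EM : Fin D → MAG.Pt D → MAG.Form D,
      MAG.HasCoframeVariation U (fun K c' => Smatt K c' Ψ) c EM →
      ∀ X : Fin D → MAG.Pt D → MAG.Form D,
        MAG.HasCoframeVariation U (fun K c' => MAG.gravAction p K c' + Smatt K c' Ψ) c X ↔
        ∀ x ∈ U, ∀ a, p.κ • X a x = MAG.coframeRHS p c a x + p.κ • EM a x) ∧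
    -- the connection variation; `HM` is the hypermomentum current of the matter
    (∀ HM : Fin D → Fin D → MAG.Pt D → MAG.Form D,
      MAG.HasConnectionVariation U (fun K c' => Smatt K c' Ψ) c HM →
      ∀ X : Fin D → Fin D → MAG.Pt D → MAG.Form D,
        MAG.HasConnectionVariation U (fun K c' => MAG.gravAction p K c' + Smatt K c' Ψ) c X ↔
        ∀ x ∈ U, ∀ a b, p.κ • X a b x = MAG.connectionRHS p c a b x + p.κ • HM a b x) := by
  refine ⟨fun x hx => p.hasMomenta_LMAG hD ((hc.smoothGeom hU).geom_regular x hx),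
    fun EM hEM X => ?_, fun HM hHM X => ?_⟩
  -- Additivity supplies one variational derivative of the total action. One direction of the
  -- equivalence is then uniqueness; the other holds because changing the form outside `U` is
  -- immaterial. Existence and uniqueness are thus both expressed by the equivalence.
  · have h1 := (p.gravAction_coframe hD hκ hU hc).add hEM
    have h2 : ∀ x ∈ U, ∀ a, X a x = (1 / p.κ) • MAG.coframeRHS p c a x + EM a x ↔
        p.κ • X a x = MAG.coframeRHS p c a x + p.κ • EM a x := fun x _ a => by
      rw [← smul_right_injective _ hκ |>.eq_iff, smul_add, smul_smul, mul_one_div_cancel hκ,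
        one_smul]
    exact ⟨fun hX x hx a => (h2 x hx a).1 (hX.unique (by omega) hU h1 x hx a),
      fun hX => h1.congr fun x hx a => (h2 x hx a).2 (hX x hx a)⟩
  · have h1 := (p.gravAction_connection hD hκ hρ hU hc).add hHM
    have h2 : ∀ x ∈ U, ∀ a b, X a b x = (1 / p.κ) • MAG.connectionRHS p c a b x + HM a b x ↔
        p.κ • X a b x = MAG.connectionRHS p c a b x + p.κ • HM a b x := fun x _ a b => by
      rw [← smul_right_injective _ hκ |>.eq_iff, smul_add, smul_smul, mul_one_div_cancel hκ,
        one_smul]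
    exact ⟨fun hX x hx a b => (h2 x hx a b).1 (hX.unique (by omega) hU h1 x hx a b),
      fun hX => h1.congr fun x hx a b => (h2 x hx a b).2 (hX x hx a b)⟩
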